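/- Let $N$ be a connected smooth $n$-manifold (Hausdorff, second countable, without boundary) with a smooth action of a compact Lie group $G$ whose orbit space $N/G$ is one-dimensional, i.e. $\dim N-\max_{x}\dim (G\cdot x)=1$ (a cohomogeneity one manifold), and let $N$ carry a $G$-invariant smooth Riemannian metric (not necessarily complete). An orbit $G\cdot x$ is principal if the isotropy group $G_x$ is conjugate to a subgroup of every isotropy group $G_y$, $y\in N$. For an open set $U\subseteq N$, a function $f$ is isoparametric on $U$ if it is smooth and non-constant on $U$ and $|\nabla f|^2=b(f)$, $\triangle f=a(f)$ on $U$ for a smooth function $b:\mathbb R\to\mathbb R$ and a continuous function $a:\mathbb R\to\mathbb R$; its regular level sets are called a family of isoparametric hypersurfaces. The focal varieties of $f$ form the set of points of $U$ where $f$ attains its maximum or its minimum over $U$; $f$ is proper if this set is, near each of its points, an embedded submanifold of codimension at least $2$ (possibly of different dimensions near different points; the set may be empty). Then: (1) Every principal orbit $P$ is an embedded hypersurface with constant principal curvatures: $P$ has a smooth unit normal field $\xi$ such that the eigenvalues, with multiplicities, of the shape operator $A v=-\nabla_v\xi$ on $T_pP$ do not depend on $p\in P$. (2) The principal orbits form a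 family of isoparametric hypersurfaces. Precisely: if $N/G$ is not homeomorphic to a circle, there is an isoparametric function $f:N\to\mathbb R$ whose level sets are exactly the $G$-orbits and such that $\nabla f(x)\neq 0$ if and only if $G\cdot x$ is principal. If $N/G$ is homeomorphic to a circle, then all orbits are principal, and for every $x\in N$ there is an isoparametric function on $N\setminus G\cdot x$, with nowhere vanishing gradient, whose level sets are exactly the orbits other than $G\cdot x$. (3) If every non-principal orbit has codimension at least $2$ in $N$, then the corresponding isoparametric functions are proper: whenever $U\subseteq N$ is open and $G$-invariant (in particular for $U=N$) and $f$ is an isoparametric function on $U$ whose level sets in $U$ are exactly the $G$-orbits contained in $U$, $f$ is proper. -/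

import Mathlib

open Set Filter Topology Bundle Manifold
open scoped ContDiff

noncomputable section

/-! ### Riemannian notions: gradient, Levi-Civita connection, Laplacian

`N` is a manifold modelled on `ℝⁿ` whose tangent spaces carry inner products. -/

section Riemannian

variable (n : ℕ) {N : Type*} [TopologicalSpace N] [ChartedSpace (EuclideanSpace ℝ (Fin n)) N]

instance tangentSpace_finiteDimensional (x : N) : FiniteDimensional ℝ (TangentSpace (𝓡 n) x) :=
  inferInstanceAs (FiniteDimensional ℝ (EuclideanSpace ℝ (Fin n)))

variable [IsManifold (𝓡 n) ∞ N] [RiemannianBundle (fun x : N ↦ TangentSpace (𝓡 n) x)]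

/-- The gradient `∇f`, i.e. the vector field with `⟨∇f, v⟩ = df(v)`, written in an orthonormal
basis `(eᵢ)` of the tangent space: `∇f = ∑ᵢ df(eᵢ) eᵢ`. -/
def gradientField (f : N → ℝ) (x : N) : TangentSpace (𝓡 n) x :=
  let e := stdOrthonormalBasis ℝ (TangentSpace (𝓡 n) x)
  ∑ i, mvfderiv (𝓡 n) f x (e i) • e i

/-- The right-hand side of the Koszul formula,
`X⟨Y,Z⟩ + Y⟨Z,X⟩ - Z⟨X,Y⟩ + ⟨[X,Y],Z⟩ - ⟨[Y,Z],X⟩ + ⟨[Z,X],Y⟩`,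
which equals `2⟨∇_X Y, Z⟩` for the Levi-Civita connection `∇`. -/
def koszul (X Y Z : Π x : N, TangentSpace (𝓡 n) x) (x : N) : ℝ :=
  mvfderiv (𝓡 n) (fun y ↦ inner ℝ (Y y) (Z y)) x (X x)
    + mvfderiv (𝓡 n) (fun y ↦ inner ℝ (Z y) (X y)) x (Y x)
    - mvfderiv (𝓡 n) (fun y ↦ inner ℝ (X y) (Y y)) x (Z x)
    + inner ℝ (VectorField.mlieBracket (𝓡 n) X Y x) (Z x)
    - inner ℝ (VectorField.mlieBracket (𝓡 n) Y Z x) (X x)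
    + inner ℝ (VectorField.mlieBracket (𝓡 n) Z X x) (Y x)

/-- The Levi-Civita covariant derivative `∇_v Y` of a vector field `Y` at `x` in the direction
`v ∈ T_x N`: the vector determined by `2⟨∇_v Y, w⟩ = koszul(V, Y, W)`, where `V`, `W` are vector
fields, smooth near `x`, that extend `v` and `w` (the value of the Koszul expression does not
depend on the extensions). -/
def leviCivita (Y : Π x : N, TangentSpace (𝓡 n) x) (x : N) (v : TangentSpace (𝓡 n) x) :
    TangentSpace (𝓡 n) x :=
  let e := stdOrthonormalBasis ℝ (TangentSpace (𝓡 n) x)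
  ∑ i, ((1 / 2 : ℝ) * koszul n (FiberBundle.extend (EuclideanSpace ℝ (Fin n)) v) Y
    (FiberBundle.extend (EuclideanSpace ℝ (Fin n)) (e i)) x) • e i

/-- The Laplacian `Δf`: the trace of the Hessian `H_f(v, w) = ⟨∇_v ∇f, w⟩`. -/
def laplacian (f : N → ℝ) (x : N) : ℝ :=
  let e := stdOrthonormalBasis ℝ (TangentSpace (𝓡 n) x)
  ∑ i, inner ℝ (leviCivita n (gradientField n f) x (e i)) (e i)

/-- `f` is a transnormal function on the open set `U`: smooth, non-constant, and
`|∇f|² = b(f)` for a smooth `b : ℝ → ℝ`. -/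
structure IsTransnormalOn (f : N → ℝ) (U : Set N) : Prop where
  contMDiffOn : ContMDiffOn (𝓡 n) 𝓘(ℝ, ℝ) ∞ f U
  nonconstant : ∃ x ∈ U, ∃ y ∈ U, f x ≠ f y
  exists_grad : ∃ b : ℝ → ℝ, ContDiff ℝ ∞ b ∧ ∀ x ∈ U, ‖gradientField n f x‖ ^ 2 = b (f x)

/-- `f` is an isoparametric function on the open set `U`: it is transnormal and
`Δf = a(f)` for a continuous `a : ℝ → ℝ`. -/
structure IsIsoparametricOn (f : N → ℝ) (U : Set N) : Prop extends IsTransnormalOn n f U where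
  exists_laplacian : ∃ a : ℝ → ℝ, Continuous a ∧ ∀ x ∈ U, laplacian n f x = a (f x)

end Riemannian

/-! ### Submanifolds -/

section Submanifold

variable (n : ℕ) {N : Type*} [TopologicalSpace N] [ChartedSpace (EuclideanSpace ℝ (Fin n)) N]

/-- Near its point `p`, the set `S` is an embedded smooth submanifold of dimension `d`: some
smooth chart `e` around `p` maps `S` onto a piece of the affine subspace `e p + W`, `dim W = d`. -/
def IsSubmanifoldAt (S : Set N) (p : N) (d : ℕ) : Prop :=
  ∃ e ∈ IsManifold.maximalAtlas (𝓡 n) ∞ N, p ∈ e.source ∧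
    ∃ W : Submodule ℝ (EuclideanSpace ℝ (Fin n)), Module.finrank ℝ W = d ∧
      ∀ q ∈ e.source, q ∈ S ↔ e q - e p ∈ W

/-- The velocities at `p` of smooth curves through `p` in `S`; for a submanifold `S` this is
the tangent space `T_p S`. -/
def tangentVectors (S : Set N) (p : N) : Set (TangentSpace (𝓡 n) p) :=
  {v | ∃ γ : ℝ → N, γ 0 = p ∧ ContMDiffAt 𝓘(ℝ, ℝ) (𝓡 n) ∞ γ 0 ∧ (∀ᶠ t in 𝓝 0, γ t ∈ S) ∧
    HasMFDerivAt 𝓘(ℝ, ℝ) (𝓡 n) γ 0 ((1 : ℝ →L[ℝ] ℝ).smulRight v)}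

/-- `P` is an embedded hypersurface. -/
def IsHypersurface (P : Set N) : Prop :=
  ∃ d : ℕ, d + 1 = n ∧ ∀ p ∈ P, IsSubmanifoldAt n P p d

/-- The focal varieties of a function `f` on `U`: the points at which `f` attains its global
maximum or its global minimum over `U`. -/
def focalVarieties (f : N → ℝ) (U : Set N) : Set N :=
  {p ∈ U | (∀ q ∈ U, f q ≤ f p) ∨ (∀ q ∈ U, f p ≤ f q)}

/-- The focal varieties of `f` on `U` have codimension at least two at each of their points
(different components may have different dimensions): this is properness of a transnormal
or isoparametric function. -/
def HasProperFocalVarieties (f : N → ℝ) (U : Set N) : Prop :=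
  ∀ p ∈ focalVarieties f U, ∃ d : ℕ, d + 2 ≤ n ∧ IsSubmanifoldAt n (focalVarieties f U) p d

variable [IsManifold (𝓡 n) ∞ N] [RiemannianBundle (fun x : N ↦ TangentSpace (𝓡 n) x)]

/-- The hypersurface `P` has constant principal curvatures: for some smooth unit normal field
`ξ` along `P` (given on an open neighbourhood `V` of `P`) the shape operator
`A v = -∇_v ξ` of `P` has, at all points of `P`, the same eigenvalues `κ i` with the same
multiplicities: there is an orthonormal basis `e` of `T_p P` with `A (e i) = κ i • e i`. -/
def HasConstantPrincipalCurvatures (P : Set N) : Prop :=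
  ∃ (V : Set N) (ξ : Π x : N, TangentSpace (𝓡 n) x), IsOpen V ∧ P ⊆ V ∧
    ContMDiffOn (𝓡 n) (𝓡 n).tangent ∞ (fun x ↦ (⟨x, ξ x⟩ : TangentBundle (𝓡 n) N)) V ∧
    (∀ p ∈ P, ‖ξ p‖ = 1 ∧ ∀ v ∈ tangentVectors n P p, inner ℝ v (ξ p) = 0) ∧
    ∃ (d : ℕ) (κ : Fin d → ℝ), ∀ p ∈ P, ∃ e : Fin d → TangentSpace (𝓡 n) p,
      Orthonormal ℝ e ∧
      (Submodule.span ℝ (range e) : Set (TangentSpace (𝓡 n) p)) = tangentVectors n P p ∧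
      ∀ i, -leviCivita n ξ p (e i) = κ i • e i

end Submanifold

/-! ### Group actions -/

section Action

/-- The orbit of `x` is principal: it has maximal orbit type, i.e. the isotropy group of `x` is
conjugate to a subgroup of every isotropy group (the isotropy groups of the points of the orbit
of `y` are the conjugates of the isotropy group of `y`). -/
def IsPrincipalPoint (G : Type*) [Group G] {N : Type*} [MulAction G N] (x : N) : Prop :=
  ∀ y : N, ∃ g : G, MulAction.stabilizer G x ≤ MulAction.stabilizer G (g • y)

/-- The level sets of `f` in the invariant set `U` are exactly the `G`-orbits in `U`. -/
def LevelSetsAreOrbits (G : Type*) [Group G] {N : Type*} [MulAction G N] (f : N → ℝ)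
    (U : Set N) : Prop :=
  ∀ x ∈ U, ∀ y ∈ U, f y = f x ↔ y ∈ MulAction.orbit G x

variable (m n : ℕ) (G : Type*) [TopologicalSpace G] [ChartedSpace (EuclideanSpace ℝ (Fin m)) G]
  [Group G] {N : Type*} [TopologicalSpace N] [ChartedSpace (EuclideanSpace ℝ (Fin n)) N]
  [MulAction G N]

/-- The dimension of the orbit `G • x`: the dimension of its tangent space at `x`, the image of
the differential at `1` of the orbit map `g ↦ g • x`. -/
def orbitDim (x : N) : ℕ :=
  Module.finrank ℝ (mfderiv (𝓡 m) (𝓡 n) (fun g : G ↦ g • x) 1).range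

variable (N) in
/-- The orbit space `N / G` is one-dimensional:
`dim (N / G) = dim N - max {dim (G • x) | x ∈ N} = 1`. -/
def IsCohomogeneityOne : Prop :=
  (∀ x : N, orbitDim m n G x + 1 ≤ n) ∧ ∃ x : N, orbitDim m n G x + 1 = n

variable (N) in
/-- The Riemannian metric of `N` is `G`-invariant: `G` acts by isometries. -/
def IsInvariantMetric [RiemannianBundle (fun x : N ↦ TangentSpace (𝓡 n) x)] : Prop :=
  ∀ (g : G) (x : N) (v w : TangentSpace (𝓡 n) x),
    inner ℝ (mfderiv (𝓡 n) (𝓡 n) (fun y : N ↦ g • y) x v)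
      (mfderiv (𝓡 n) (𝓡 n) (fun y : N ↦ g • y) x w) = inner ℝ v w

end Action

end

noncomputable section

open MulAction

/-! ### Parameter integrals over compact spaces -/

section ParameterIntegral

open MeasureTheory

variable {E : Type*} [NormedAddCommGroup E] [NormedSpace ℝ E] {X : Type*} [TopologicalSpace X]

/-- `f : E → X → F` is `n` times continuously differentiable in the first variable on `A`,
and all the partial derivatives are jointly continuous. -/
def IsContDiffFamily (A : Set E) : ℕ → ∀ (F : Type _) [NormedAddCommGroup F] [NormedSpace ℝ F],
    (E → X → F) → Prop
  | 0, _, _, _, f => ContinuousOn (Function.uncurry f) (A ×ˢ univ)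
  | k + 1, F, _, _, f => ContinuousOn (Function.uncurry f) (A ×ˢ univ) ∧
      ∃ f' : E → X → (E →L[ℝ] F), (∀ e ∈ A, ∀ x, HasFDerivAt (f · x) (f' e x) e) ∧
        IsContDiffFamily A k (E →L[ℝ] F) f'

variable {A : Set E}

theorem IsContDiffFamily.continuousOn {k : ℕ} {F : Type _} [NormedAddCommGroup F]
    [NormedSpace ℝ F] {f : E → X → F} (h : IsContDiffFamily A k F f) :
    ContinuousOn (Function.uncurry f) (A ×ˢ univ) := by
  cases k with
  | zero => exact h
  | succ k => exact h.1

variable [CompactSpace X] [MeasurableSpace X] [BorelSpace X] (μ : Measure X) [IsFiniteMeasure μ]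
  [FiniteDimensional ℝ E]

theorem continuousOn_integral_of_compactSpace {F : Type*} [NormedAddCommGroup F]
    [NormedSpace ℝ F] {f : E → X → F} (hf : ContinuousOn (Function.uncurry f) (A ×ˢ univ)) :
    ContinuousOn (fun e ↦ ∫ x, f e x ∂μ) A := by
  have := continuousOn_integral_of_compact_support (μ := μ) (s := A) (k := (univ : Set X))
    isCompact_univ (f := f) hf (by simp)
  exact this

theorem hasFDerivAt_integral_of_compactSpace (hA : IsOpen A) {F : Type*} [NormedAddCommGroup F]
    [NormedSpace ℝ F] {f : E → X → F} {f' : E → X → (E →L[ℝ] F)}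
    (hf : ContinuousOn (Function.uncurry f) (A ×ˢ univ))
    (hf' : ContinuousOn (Function.uncurry f') (A ×ˢ univ))
    (hd : ∀ e ∈ A, ∀ x, HasFDerivAt (f · x) (f' e x) e) {e : E} (he : e ∈ A) :
    HasFDerivAt (fun e ↦ ∫ x, f e x ∂μ) (∫ x, f' e x ∂μ) e := by
  obtain ⟨r, hr, hrA⟩ := Metric.nhds_basis_closedBall.mem_iff.1 (hA.mem_nhds he)
  have hsub : Metric.closedBall e r ×ˢ (univ : Set X) ⊆ A ×ˢ univ := prod_mono hrA subset_rfl
  obtain ⟨C, hC⟩ := ((isCompact_closedBall e r).prod (isCompact_univ (X := X))).exists_bound_of_continuousOn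
    (hf'.mono hsub)
  have cont' : ∀ {h : E → X → F},
      ContinuousOn (Function.uncurry h) (A ×ˢ univ) → ∀ e ∈ A, Continuous (h e) := by
    intro h hh e he
    have : Continuous fun x : X ↦ (e, x) := by fun_prop
    exact continuousOn_univ.1 (hh.comp this.continuousOn (fun x _ ↦ ⟨he, mem_univ x⟩))
  have cont : ∀ {h : E → X → E →L[ℝ] F},
      ContinuousOn (Function.uncurry h) (A ×ˢ univ) → ∀ e ∈ A, Continuous (h e) := by
    intro h hh e he
    have : Continuous fun x : X ↦ (e, x) := by fun_prop
    exact continuousOn_univ.1 (hh.comp this.continuousOn (fun x _ ↦ ⟨he, mem_univ x⟩))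
  refine hasFDerivAt_integral_of_dominated_of_fderiv_le (bound := fun _ ↦ C)
    (Metric.ball_mem_nhds e hr) ?_ ?_ ?_ ?_ (integrable_const C) ?_
  · filter_upwards [hA.mem_nhds he] with e' he'
    exact ((cont' hf e' he').integrable_of_hasCompactSupport
      (HasCompactSupport.of_compactSpace _)).aestronglyMeasurable
  · exact (cont' hf e he).integrable_of_hasCompactSupport (HasCompactSupport.of_compactSpace _)
  · exact ((cont hf' e he).integrable_of_hasCompactSupport
      (HasCompactSupport.of_compactSpace _)).aestronglyMeasurable
  · exact Eventually.of_forall fun x e' he' ↦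
      hC (e', x) ⟨Metric.ball_subset_closedBall he', mem_univ x⟩
  · exact Eventually.of_forall fun x e' he' ↦ hd e' (hrA (Metric.ball_subset_closedBall he')) x

theorem IsContDiffFamily.contDiffOn_integral (hA : IsOpen A) (k : ℕ) :
    ∀ {F : Type _} [NormedAddCommGroup F] [NormedSpace ℝ F] {f : E → X → F},
    IsContDiffFamily A k F f → ContDiffOn ℝ k (fun e ↦ ∫ x, f e x ∂μ) A := by
  induction k with
  | zero =>
    intro F _ _ f hf
    rw [Nat.cast_zero, contDiffOn_zero]
    exact continuousOn_integral_of_compactSpace μ hf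
  | succ k ih =>
    rintro F _ _ f ⟨hf, f', hd, hf'⟩
    have hder := fun e he ↦
      hasFDerivAt_integral_of_compactSpace μ hA hf hf'.continuousOn hd (e := e) he
    rw [Nat.cast_succ, contDiffOn_succ_iff_fderiv_of_isOpen hA]
    refine ⟨fun e he ↦ (hder e he).differentiableAt.differentiableWithinAt, by simp, ?_⟩
    exact (ih hf').congr fun e he ↦ (hder e he).fderiv

end ParameterIntegral

section ParameterIntegralManifold

variable {E : Type} [NormedAddCommGroup E] [NormedSpace ℝ E]
  {m : ℕ} {G : Type*} [TopologicalSpace G] [ChartedSpace (EuclideanSpace ℝ (Fin m)) G]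
  [IsManifold (𝓡 m) ∞ G]

theorem contMDiffOn_partial_fderiv {A : Set E} (hA : IsOpen A) {F : Type} [NormedAddCommGroup F]
    [NormedSpace ℝ F] {f : E → G → F}
    (hf : ContMDiffOn (𝓘(ℝ, E).prod (𝓡 m)) 𝓘(ℝ, F) ∞ (Function.uncurry f) (A ×ˢ univ)) :
    ContMDiffOn (𝓘(ℝ, E).prod (𝓡 m)) 𝓘(ℝ, E →L[ℝ] F) ∞
      (Function.uncurry fun e x ↦ fderiv ℝ (f · x) e) (A ×ˢ univ) := by
  rintro ⟨e, x⟩ ⟨he, -⟩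
  refine ContMDiffAt.contMDiffWithinAt ?_
  have h1 : ContMDiffAt ((𝓘(ℝ, E).prod (𝓡 m)).prod 𝓘(ℝ, E)) 𝓘(ℝ, F) ∞
      (Function.uncurry fun (p : E × G) (e' : E) ↦ f e' p.2) ((e, x), e) := by
    have h2 : ContMDiffAt (𝓘(ℝ, E).prod (𝓡 m)) 𝓘(ℝ, F) ∞ (Function.uncurry f) (e, x) :=
      hf.contMDiffAt ((hA.prod isOpen_univ).mem_nhds ⟨he, mem_univ _⟩)
    have h3 : ContMDiffAt ((𝓘(ℝ, E).prod (𝓡 m)).prod 𝓘(ℝ, E)) (𝓘(ℝ, E).prod (𝓡 m)) ∞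
        (fun q : (E × G) × E ↦ (q.2, q.1.2)) ((e, x), e) :=
      contMDiffAt_snd.prodMk (contMDiffAt_snd.comp _ contMDiffAt_fst)
    exact ContMDiffAt.comp (x := ((e, x), e)) (g := Function.uncurry f) h2 h3
  have h4 := ContMDiffAt.mfderiv (m := ∞) (fun (p : E × G) (e' : E) ↦ f e' p.2) (fun p ↦ p.1) h1
    contMDiffAt_fst (by simp)
  convert! h4 using 1
  ext1 p
  erw [inTangentCoordinates_model_space]
  simp [mfderiv_eq_fderiv, Function.uncurry]

theorem isContDiffFamily_of_contMDiffOn {A : Set E} (hA : IsOpen A) (k : ℕ) :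
    ∀ {F : Type} [NormedAddCommGroup F] [NormedSpace ℝ F] {f : E → G → F},
    ContMDiffOn (𝓘(ℝ, E).prod (𝓡 m)) 𝓘(ℝ, F) ∞ (Function.uncurry f) (A ×ˢ univ) →
    IsContDiffFamily A k F f := by
  induction k with
  | zero => intro F _ _ f hf; exact hf.continuousOn
  | succ k ih =>
    intro F _ _ f hf
    refine ⟨hf.continuousOn, _, fun e he x ↦ ?_, ih (contMDiffOn_partial_fderiv hA hf)⟩
    have h2 : ContMDiffAt (𝓘(ℝ, E).prod (𝓡 m)) 𝓘(ℝ, F) ∞ (Function.uncurry f) (e, x) :=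
      hf.contMDiffAt ((hA.prod isOpen_univ).mem_nhds ⟨he, mem_univ _⟩)
    have h3 : ContMDiffAt 𝓘(ℝ, E) (𝓘(ℝ, E).prod (𝓡 m)) ∞ (fun q : E ↦ (q, x)) e :=
      contMDiffAt_id.prodMk contMDiffAt_const
    have h4 : ContMDiffAt 𝓘(ℝ, E) 𝓘(ℝ, F) ∞ (fun q : E ↦ f q x) e :=
      ContMDiffAt.comp (x := e) (g := Function.uncurry f) h2 h3
    exact (h4.contDiffAt.differentiableAt (by simp)).hasFDerivAt

end ParameterIntegralManifold

/-! ### Hadamard's lemma and smooth even functions -/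

section Even

theorem isContDiffFamily_smul_comp_mul (k : ℕ) : ∀ {F : Type} [NormedAddCommGroup F]
    [NormedSpace ℝ F] {h : ℝ → F} {c : Icc (0 : ℝ) 1 → ℝ}, Continuous c → ContDiff ℝ k h →
    IsContDiffFamily univ k F (fun (t : ℝ) (s : Icc (0 : ℝ) 1) ↦ c s • h (t * s)) := by
  induction k with
  | zero =>
    intro F _ _ h c hc hh
    have := hh.continuous
    refine Continuous.continuousOn ?_
    simp only [Function.uncurry_def]
    fun_prop
  | succ k ih =>
    intro F _ _ h c hc hh
    have h0 := hh.continuous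
    refine ⟨Continuous.continuousOn (by simp only [Function.uncurry_def]; fun_prop),
      fun t s ↦ (c s * s) • (1 : ℝ →L[ℝ] ℝ).smulRight (deriv h (t * s)), fun t _ s ↦ ?_, ?_⟩
    · have h1 : HasDerivAt h (deriv h (t * s)) (t * s) :=
        (hh.differentiable (by simp) _).hasDerivAt
      have h2 : HasDerivAt (fun t : ℝ ↦ t * (s : ℝ)) (s : ℝ) t := by
        simpa using (hasDerivAt_id t).mul_const (s : ℝ)
      have h3 := ((h1.scomp t h2).const_smul (c s)).hasFDerivAt
      convert! h3 using 1
      ext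
      simp [smul_smul]
    · refine ih (h := fun t ↦ (1 : ℝ →L[ℝ] ℝ).smulRight (deriv h t)) (c := fun s ↦ c s * s)
        (by fun_prop) ?_
      have : ContDiff ℝ k (deriv h) := (contDiff_succ_iff_deriv.1 (by exact_mod_cast hh)).2.2
      exact contDiff_const.smulRight this

theorem contDiff_integral_comp_mul {h : ℝ → ℝ} (hh : ContDiff ℝ ∞ h) :
    ContDiff ℝ ∞ (fun t : ℝ ↦ ∫ s in (0 : ℝ)..1, h (t * s)) := by
  have key : ∀ t : ℝ, ∫ s in (0 : ℝ)..1, h (t * s) =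
      ∫ s : Icc (0 : ℝ) 1, (1 : ℝ) • h (t * s) := by
    intro t
    rw [intervalIntegral.integral_of_le zero_le_one, ← MeasureTheory.integral_Icc_eq_integral_Ioc]
    simp only [one_smul]
    exact MeasureTheory.integral_subtype measurableSet_Icc (fun s ↦ h (t * s)) |>.symm
  simp_rw [key]
  rw [contDiff_infty]
  intro k
  rw [← contDiffOn_univ]
  have : MeasureTheory.IsFiniteMeasure
      (MeasureTheory.Measure.comap ((↑) : Icc (0 : ℝ) 1 → ℝ) MeasureTheory.volume) := by
    refine ⟨?_⟩
    rw [(MeasurableEmbedding.subtype_coe measurableSet_Icc).comap_apply, image_univ,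
      Subtype.range_coe]
    simp
  exact IsContDiffFamily.contDiffOn_integral _ isOpen_univ k
    (isContDiffFamily_smul_comp_mul k (c := fun _ ↦ 1) continuous_const (contDiff_infty.1 hh k))

/-- Hadamard's lemma. -/
theorem exists_eq_mul_of_contDiff {f : ℝ → ℝ} (hf : ContDiff ℝ ∞ f) (h0 : f 0 = 0) :
    ∃ g : ℝ → ℝ, ContDiff ℝ ∞ g ∧ (∀ t, f t = t * g t) ∧ g 0 = deriv f 0 := by
  have hd : ContDiff ℝ ∞ (deriv f) := (contDiff_infty_iff_deriv.1 hf).2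
  refine ⟨_, contDiff_integral_comp_mul hd, fun t ↦ ?_, by simp⟩
  have h1 : ∀ s ∈ uIcc (0 : ℝ) 1, HasDerivAt (fun s ↦ f (t * s)) (t * deriv f (t * s)) s := by
    intro s _
    have h2 : HasDerivAt (fun s : ℝ ↦ t * s) t s := by
      simpa using (hasDerivAt_id s).const_mul t
    have := (hf.differentiable (by simp) (t * s)).hasDerivAt.comp s h2
    rw [mul_comm] at this
    exact this
  have h2 := intervalIntegral.integral_eq_sub_of_hasDerivAt h1
    (((continuous_const.mul ((hd.continuous).comp (by fun_prop)))).intervalIntegrable _ _)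
  rw [intervalIntegral.integral_const_mul] at h2
  simpa [h0] using h2.symm

theorem deriv_odd_of_even {f : ℝ → ℝ} (he : ∀ t, f (-t) = f t) (t : ℝ) :
    deriv f (-t) = -deriv f t := by
  have : (fun x ↦ f (-x)) = f := funext he
  have h := deriv_comp_neg f t
  rw [this] at h
  rw [h, neg_neg]

/-- Whitney: a smooth even function is a smooth function of the square. -/
theorem contDiffOn_comp_sqrt_of_even {f : ℝ → ℝ} (hf : ContDiff ℝ ∞ f)
    (he : ∀ t, f (-t) = f t) : ContDiffOn ℝ ∞ (fun x ↦ f (√x)) (Ici 0) := by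
  rw [contDiffOn_infty]
  intro k
  induction k generalizing f with
  | zero =>
    rw [Nat.cast_zero, contDiffOn_zero]
    exact (hf.continuous.comp Real.continuous_sqrt).continuousOn
  | succ k ih =>
    have hd : ContDiff ℝ ∞ (deriv f) := (contDiff_infty_iff_deriv.1 hf).2
    have hd0 : deriv f 0 = 0 := by
      have := deriv_odd_of_even he 0
      simp only [neg_zero] at this
      linarith
    obtain ⟨g, hg, hfg, -⟩ := exists_eq_mul_of_contDiff hd hd0
    have hge : ∀ t, g (-t) = g t := by
      intro t
      rcases eq_or_ne t 0 with rfl | ht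
      · simp
      · have h1 := hfg (-t)
        rw [deriv_odd_of_even he, hfg t] at h1
        have : t * (g (-t) - g t) = 0 := by linarith
        rcases mul_eq_zero.1 this with h | h
        · exact absurd h ht
        · linarith
    have hpos : ∀ x : ℝ, 0 < x → HasDerivAt (fun x ↦ f (√x)) (g (√x) / 2) x := by
      intro x hx
      have h1 := (hf.differentiable (by simp) (√x)).hasDerivAt.comp x (Real.hasDerivAt_sqrt hx.ne')
      convert! h1 using 1
      rw [hfg]
      have := (Real.sqrt_pos.2 hx).ne'
      field_simp
    have hcont : Continuous fun x ↦ f (√x) := hf.continuous.comp Real.continuous_sqrt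
    have hgc : Continuous fun x ↦ g (√x) / 2 := (hg.continuous.comp Real.continuous_sqrt).div_const _
    have hder : ∀ x ∈ Ici (0 : ℝ),
        HasDerivWithinAt (fun x ↦ f (√x)) (g (√x) / 2) (Ici 0) x := by
      intro x hx
      rcases eq_or_lt_of_le (show (0 : ℝ) ≤ x from hx) with rfl | hx
      · refine hasDerivWithinAt_Ici_of_tendsto_deriv (s := Ioi 0) ?_ hcont.continuousWithinAt
          self_mem_nhdsWithin ?_
        · exact fun x hx ↦ (hpos x hx).differentiableAt.differentiableWithinAt
        · refine (hgc.tendsto 0).mono_left nhdsWithin_le_nhds |>.congr' ?_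
          filter_upwards [self_mem_nhdsWithin] with x hx
          exact (hpos x hx).deriv.symm
      · exact (hpos x hx).hasDerivWithinAt
    rw [Nat.cast_succ, contDiffOn_succ_iff_derivWithin (uniqueDiffOn_Ici 0)]
    refine ⟨fun x hx ↦ (hder x hx).differentiableWithinAt, by simp, ?_⟩
    refine ((ih hg hge).div_const 2).congr fun x hx ↦ ?_
    exact (hder x hx).derivWithin (uniqueDiffOn_Ici 0 x hx)

end Even

/-! ### One-dimensional normal forms -/

section NormalForm

theorem exists_contDiff_eqOn_Ioo {f : ℝ → ℝ} {δ : ℝ} (hδ : 0 < δ)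
    (hf : ContDiffOn ℝ ∞ f (Ioo (-δ) δ)) :
    ∃ F : ℝ → ℝ, ContDiff ℝ ∞ F ∧ (∀ t ∈ Ioo (-(δ / 2)) (δ / 2), F t = f t) ∧
      ((∀ t ∈ Ioo (-δ) δ, f (-t) = f t) → ∀ t, F (-t) = F t) := by
  let χ : ContDiffBump (0 : ℝ) := ⟨δ / 2, 3 * δ / 4, by positivity, by linarith⟩
  have hχ0 : ∀ t, t ∉ Ioo (-(3 * δ / 4)) (3 * δ / 4) → χ t = 0 := by
    intro t ht
    refine χ.zero_of_le_dist ?_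
    rw [Real.dist_eq, sub_zero]
    by_contra! h
    exact ht (abs_lt.1 h)
  refine ⟨fun t ↦ χ t * f t, ?_, ?_, ?_⟩
  · rw [contDiff_iff_contDiffAt]
    intro t
    by_cases ht : t ∈ Ioo (-δ) δ
    · exact χ.contDiff.contDiffAt.mul (hf.contDiffAt (isOpen_Ioo.mem_nhds ht))
    · refine (contDiffAt_const (c := (0 : ℝ))).congr_of_eventuallyEq ?_
      have : (Icc (-(3 * δ / 4)) (3 * δ / 4))ᶜ ∈ 𝓝 t := by
        refine isClosed_Icc.isOpen_compl.mem_nhds fun h ↦ ht ?_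
        exact ⟨by linarith [h.1], by linarith [h.2]⟩
      filter_upwards [this] with y hy
      rw [hχ0 y fun h ↦ hy (Ioo_subset_Icc_self h), zero_mul]
  · intro t ht
    have : χ t = 1 := by
      refine χ.one_of_mem_closedBall ?_
      rw [Metric.mem_closedBall, Real.dist_eq, sub_zero]
      exact (abs_lt.2 ht).le
    simp [this]
  · intro he t
    have h1 : χ (-t) = χ t := χ.neg t
    simp only [h1]
    by_cases ht : t ∈ Ioo (-δ) δ
    · rw [he t ht]
    · rw [hχ0 t fun h ↦ ht ⟨by linarith [h.1], by linarith [h.2]⟩, zero_mul, zero_mul]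

theorem exists_eq_sq_mul {q : ℝ → ℝ} {δ κ : ℝ} (hδ : 0 < δ) (hκ : 0 < κ)
    (hq : ContDiffOn ℝ ∞ q (Ioo (-δ) δ)) (h0 : q 0 = 0)
    (hle : ∀ t ∈ Ioo (-δ) δ, κ * t ^ 2 ≤ q t) :
    ∃ η > 0, η ≤ δ ∧ ∃ w : ℝ → ℝ, ContDiff ℝ ∞ w ∧
      ∀ t ∈ Ioo (-η) η, q t = t ^ 2 * w t ∧ 0 < w t := by
  obtain ⟨Q, hQ, hQq, -⟩ := exists_contDiff_eqOn_Ioo hδ hq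
  have hQ0 : Q 0 = 0 := by rw [hQq 0 ⟨by linarith, by linarith⟩, h0]
  have hnhds : Ioo (-(δ / 2)) (δ / 2) ∈ 𝓝 (0 : ℝ) := Ioo_mem_nhds (by linarith) (by linarith)
  have hmin : IsLocalMin Q 0 := by
    filter_upwards [hnhds] with t ht
    rw [hQ0, hQq t ht]
    exact le_trans (by positivity) (hle t ⟨by linarith [ht.1], by linarith [ht.2]⟩)
  obtain ⟨g, hg, hQg, hg0⟩ := exists_eq_mul_of_contDiff hQ hQ0
  rw [hmin.deriv_eq_zero] at hg0
  obtain ⟨w, hw, hgw, -⟩ := exists_eq_mul_of_contDiff hg hg0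
  have hQw : ∀ t, Q t = t ^ 2 * w t := fun t ↦ by rw [hQg, hgw]; ring
  have hpos : ∀ t ∈ Ioo (-(δ / 2)) (δ / 2), t ≠ 0 → κ ≤ w t := by
    intro t ht h
    have h1 := hle t ⟨by linarith [ht.1], by linarith [ht.2]⟩
    rw [← hQq t ht, hQw, mul_comm] at h1
    exact le_of_mul_le_mul_left h1 (by positivity)
  have hw0 : κ ≤ w 0 := by
    have h1 : Tendsto w (𝓝[≠] 0) (𝓝 (w 0)) := hw.continuous.continuousAt.tendsto.mono_left
      nhdsWithin_le_nhds
    refine ge_of_tendsto h1 ?_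
    filter_upwards [self_mem_nhdsWithin, nhdsWithin_le_nhds hnhds] with t ht ht'
    exact hpos t ht' ht
  refine ⟨δ / 2, by linarith, by linarith, w, hw, fun t ht ↦ ⟨by rw [← hQq t ht, hQw], ?_⟩⟩
  rcases eq_or_ne t 0 with rfl | h
  · exact hκ.trans_le hw0
  · exact hκ.trans_le (hpos t ht h)

/-- A smooth function with a nondegenerate minimum becomes `t ↦ t ^ 2` in a suitable parameter. -/
theorem exists_reparam_sq {q : ℝ → ℝ} {δ κ : ℝ} (hδ : 0 < δ) (hκ : 0 < κ)
    (hq : ContDiffOn ℝ ∞ q (Ioo (-δ) δ)) (h0 : q 0 = 0)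
    (hle : ∀ t ∈ Ioo (-δ) δ, κ * t ^ 2 ≤ q t) :
    ∃ η > 0, ∃ φ : ℝ → ℝ, ContDiffOn ℝ ∞ φ (Ioo (-η) η) ∧ φ 0 = 0 ∧
      ∀ t ∈ Ioo (-η) η, φ t ∈ Ioo (-δ) δ ∧ q (φ t) = t ^ 2 := by
  obtain ⟨η, hη, hηδ, w, hw, hqw⟩ := exists_eq_sq_mul hδ hκ hq h0 hle
  have hw0 : 0 < w 0 := (hqw 0 ⟨by linarith, by linarith⟩).2
  set θ : ℝ → ℝ := fun t ↦ t * √(w t) with hθ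
  have hsq : ContDiffAt ℝ ∞ (fun t ↦ √(w t)) 0 := hw.contDiffAt.sqrt hw0.ne'
  have hθs : ContDiffAt ℝ ∞ θ 0 := contDiffAt_id.mul hsq
  have hθd : HasDerivAt θ (√(w 0)) 0 := by
    have := (hasDerivAt_id (0 : ℝ)).mul (hsq.differentiableAt (by simp)).hasDerivAt
    convert! this using 1
    simp
  have hne : √(w 0) ≠ 0 := (Real.sqrt_pos.2 hw0).ne'
  have hθf : HasFDerivAt θ
      ((ContinuousLinearEquiv.unitsEquivAut ℝ (Units.mk0 _ hne) : ℝ ≃L[ℝ] ℝ) : ℝ →L[ℝ] ℝ) 0 := by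
    have := hθd.hasFDerivAt
    convert! this using 1
  let e := hθs.toOpenPartialHomeomorph θ hθf (by simp)
  have he : ∀ x, e x = θ x := fun x ↦ rfl
  have h0s : (0 : ℝ) ∈ e.source := hθs.mem_toOpenPartialHomeomorph_source hθf (by simp)
  have hθ0 : θ 0 = 0 := by simp [hθ]
  have h0t : (0 : ℝ) ∈ e.target := by
    have := e.map_source h0s
    rwa [he, hθ0] at this
  have hes0 : e.symm 0 = 0 := by
    have := e.left_inv h0s
    rwa [he, hθ0] at this
  have hθon : ContDiffOn ℝ ∞ θ (Ioo (-η) η) :=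
    contDiffOn_id.mul (hw.contDiffOn.sqrt fun t ht ↦ (hqw t ht).2.ne')
  have hd0 : ∀ᶠ t in 𝓝 (0 : ℝ), deriv θ t ≠ 0 := by
    have h2 : ContinuousAt (deriv θ) 0 :=
      (hθon.continuousOn_deriv_of_isOpen isOpen_Ioo (by simp)).continuousAt
        (Ioo_mem_nhds (by linarith) hη)
    refine h2.eventually_ne ?_
    rw [hθd.deriv]
    exact hne
  have hc0 : Tendsto e.symm (𝓝 0) (𝓝 0) := by
    have := e.continuousAt_symm h0t
    rwa [ContinuousAt, hes0] at this
  have h1 : ∀ᶠ t in 𝓝 (0 : ℝ), t ∈ e.target ∧ e.symm t ∈ Ioo (-η) η ∧ deriv θ (e.symm t) ≠ 0 :=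
    Filter.Eventually.and (e.open_target.mem_nhds h0t)
      (Filter.Eventually.and (hc0 (Ioo_mem_nhds (by linarith) hη)) (hc0.eventually hd0))
  obtain ⟨r, hr, hr'⟩ := Metric.eventually_nhds_iff_ball.1 h1
  rw [Real.ball_eq_Ioo, zero_sub, zero_add] at hr'
  refine ⟨r, hr, e.symm, fun t ht ↦ ?_, hes0, fun t ht ↦ ?_⟩
  · obtain ⟨h2, h3, h4⟩ := hr' t ht
    have h5 : ContDiffAt ℝ ∞ θ (e.symm t) := hθon.contDiffAt (isOpen_Ioo.mem_nhds h3)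
    exact (e.contDiffAt_symm_deriv h4 h2 (h5.differentiableAt (by simp)).hasDerivAt
      h5).contDiffWithinAt
  obtain ⟨h2, h3, -⟩ := hr' t ht
  refine ⟨⟨by linarith [h3.1], by linarith [h3.2]⟩, ?_⟩
  rw [(hqw _ h3).1]
  have h4 := e.right_inv h2
  rw [he] at h4
  conv_rhs => rw [← h4]
  rw [hθ, mul_pow, Real.sq_sqrt (hqw _ h3).2.le]

theorem exists_primitive {a : ℝ → ℝ} {η : ℝ} (hη : 0 < η) (ha : ContDiffOn ℝ ∞ a (Ioo (-η) η))
    (hpos : ∀ t ∈ Ioo (-η) η, 0 < a t) :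
    ∃ Ω R : ℝ → ℝ, ContDiff ℝ ∞ Ω ∧ ContDiff ℝ ∞ R ∧ R 0 = 0 ∧ (∀ t, HasDerivAt R (Ω t) t) ∧
      (∀ t ∈ Ioo (-(η / 2)) (η / 2), 0 < Ω t ∧ Ω t ^ 2 * a t = 1) ∧
      ((∀ t ∈ Ioo (-η) η, a (-t) = a t) → ∀ t, R (-t) = -R t) := by
  obtain ⟨Ω, hΩ, hΩa, he⟩ := exists_contDiff_eqOn_Ioo (f := fun t ↦ (√(a t))⁻¹) hη
    ((ha.sqrt fun t ht ↦ (hpos t ht).ne').inv fun t ht ↦ (Real.sqrt_pos.2 (hpos t ht)).ne')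
  have hd : ∀ t, HasDerivAt (fun t ↦ ∫ s in (0 : ℝ)..t, Ω s) (Ω t) t := fun t ↦
    intervalIntegral.integral_hasDerivAt_right (hΩ.continuous.intervalIntegrable _ _)
      (hΩ.continuous.stronglyMeasurableAtFilter _ _) hΩ.continuous.continuousAt
  refine ⟨Ω, fun t ↦ ∫ s in (0 : ℝ)..t, Ω s, hΩ, ?_, by simp, hd, fun t ht ↦ ?_, fun h t ↦ ?_⟩
  · rw [contDiff_infty_iff_deriv]
    refine ⟨fun t ↦ (hd t).differentiableAt, ?_⟩
    have : deriv (fun t ↦ ∫ s in (0 : ℝ)..t, Ω s) = Ω := funext fun t ↦ (hd t).deriv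
    rw [this]
    exact hΩ
  · have hp := hpos t ⟨by linarith [ht.1], by linarith [ht.2]⟩
    rw [hΩa t ht]
    refine ⟨by positivity, ?_⟩
    rw [inv_pow, Real.sq_sqrt hp.le, inv_mul_cancel₀ hp.ne']
  · have he' := he fun t ht ↦ by simp only [h t ht]
    have := intervalIntegral.integral_comp_neg (a := 0) (b := -t) Ω
    simp only [he', neg_zero, neg_neg] at this
    exact this.trans (intervalIntegral.integral_symm _ _)

theorem exists_unit_speed_sq {a : ℝ → ℝ} {η : ℝ} (hη : 0 < η)
    (ha : ContDiffOn ℝ ∞ a (Ioo (-η) η)) (hpos : ∀ t ∈ Ioo (-η) η, 0 < a t)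
    (heven : ∀ t ∈ Ioo (-η) η, a (-t) = a t) :
    ∃ R : ℝ → ℝ, ContDiffOn ℝ ∞ (fun x ↦ R (√x) ^ 2) (Ici 0) ∧ R 0 = 0 ∧ ContDiff ℝ ∞ R ∧
      StrictMonoOn R (Ioo (-(η / 2)) (η / 2)) ∧
      ∀ x, 0 < x → √x < η / 2 → ∃ d, HasDerivAt (fun x ↦ R (√x) ^ 2) d x ∧
        d ^ 2 * (4 * x * a (√x)) = 4 * R (√x) ^ 2 := by
  obtain ⟨Ω, R, hΩ, hR, hR0, hd, hΩa, hodd⟩ := exists_primitive hη ha hpos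
  have hodd := hodd heven
  refine ⟨R, contDiffOn_comp_sqrt_of_even (f := fun t ↦ R t ^ 2) (hR.pow 2)
    fun t ↦ by simp only [hodd]; ring, hR0, hR, ?_, fun x hx hxη ↦ ?_⟩
  · refine strictMonoOn_of_deriv_pos (convex_Ioo _ _) hR.continuous.continuousOn fun t ht ↦ ?_
    rw [interior_Ioo] at ht
    rw [(hd t).deriv]
    exact (hΩa t ht).1
  · have h1 := ((hd (√x)).comp x (Real.hasDerivAt_sqrt hx.ne')).pow 2
    refine ⟨_, h1, ?_⟩
    have hs := Real.sqrt_pos.2 hx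
    have h2 := (hΩa (√x) ⟨by linarith, hxη⟩).2
    have h3 : x = √x ^ 2 := (Real.sq_sqrt hx.le).symm
    simp only [Function.comp_apply]
    rw [show (4 * x * a √x) = 4 * √x ^ 2 * a √x by rw [← h3]]
    field_simp
    simp only [Nat.add_one_sub_one, pow_one]
    linear_combination 4 * R √x ^ 2 * h2

end NormalForm

/-! ### Gradients, frames and the Levi-Civita connection -/

section RiemannianLemmas

variable {n : ℕ} {N : Type*} [TopologicalSpace N] [ChartedSpace (EuclideanSpace ℝ (Fin n)) N]

theorem contMDiffAt_mvfderiv_apply [IsManifold (𝓡 n) ∞ N] {f : N → ℝ} {x : N}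
    (hf : ContMDiffAt (𝓡 n) 𝓘(ℝ, ℝ) ∞ f x) {X : Π x : N, TangentSpace (𝓡 n) x}
    (hX : ContMDiffAt (𝓡 n) (𝓡 n).tangent ∞ (fun x ↦ (⟨x, X x⟩ : TangentBundle (𝓡 n) N)) x) :
    ContMDiffAt (𝓡 n) 𝓘(ℝ, ℝ) ∞ (fun y ↦ mvfderiv (𝓡 n) f y (X y)) x := by
  rw [contMDiffAt_infty]
  intro k
  obtain ⟨u, hu, hfu⟩ := (contMDiffAt_iff_contMDiffOn_nhds (n := ((k + 1 : ℕ) : ℕ∞ω))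
    (by simp)).1 (contMDiffAt_infty.1 hf (k + 1))
  obtain ⟨v, hvu, hv, hxv⟩ := mem_nhds_iff.1 hu
  have h1 := (hfu.mono hvu).contMDiffOn_tangentMapWithin (m := k) (by simp) hv.uniqueMDiffOn
  have h2 : ContMDiffAt (𝓡 n) 𝓘(ℝ, ℝ).tangent k
      (fun y ↦ tangentMapWithin (𝓡 n) 𝓘(ℝ, ℝ) f v (⟨y, X y⟩ : TangentBundle (𝓡 n) N)) x := by
    refine ContMDiffAt.comp x (h1.contMDiffAt ?_) (contMDiffAt_infty.1 hX k)
    exact (hv.preimage (FiberBundle.continuous_proj _ _)).mem_nhds hxv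
  have h3 := (contMDiff_snd_tangentBundle_modelSpace (n := k) ℝ 𝓘(ℝ, ℝ)).contMDiffAt.comp x h2
  refine h3.congr_of_eventuallyEq ?_
  filter_upwards [hv.mem_nhds hxv] with y hy
  simp only [Function.comp, tangentMapWithin, mfderivWithin_of_isOpen hv hy]
  rfl

theorem mvfderiv_congr {f g : N → ℝ} {x : N} (h : f =ᶠ[𝓝 x] g) :
    mvfderiv (𝓡 n) f x = mvfderiv (𝓡 n) g x := by
  ext v
  simp only [mvfderiv]
  have h1 := h.mfderiv_eq (I := 𝓡 n) (I' := 𝓘(ℝ, ℝ))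
  exact DFunLike.congr_fun h1 v

theorem mvfderiv_real_comp {f : N → ℝ} {x : N} (hf : MDifferentiableAt (𝓡 n) 𝓘(ℝ, ℝ) f x)
    {h : ℝ → ℝ} {d : ℝ} (hh : HasDerivAt h d (f x)) (v : TangentSpace (𝓡 n) x) :
    mvfderiv (𝓡 n) (fun y ↦ h (f y)) x v = d * mvfderiv (𝓡 n) f x v := by
  have h1 : MDifferentiableAt 𝓘(ℝ, ℝ) 𝓘(ℝ, ℝ) h (f x) := hh.differentiableAt.mdifferentiableAt
  have h2 := mvfderiv_comp_apply (I := 𝓘(ℝ, ℝ)) (I' := 𝓡 n) x h1 hf v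
  refine h2.trans ?_
  have h3 : ∀ w : ℝ, mvfderiv 𝓘(ℝ, ℝ) h (f x) w = d * w := by
    intro w
    have : mvfderiv 𝓘(ℝ, ℝ) h (f x) w = fderiv ℝ h (f x) w := by
      rw [← mfderiv_eq_fderiv]; rfl
    rw [this, hh.hasFDerivAt.fderiv]
    simp [mul_comm]
  exact h3 _

variable [RiemannianBundle (fun x : N ↦ TangentSpace (𝓡 n) x)]

theorem inner_gradientField (f : N → ℝ) (x : N) (v : TangentSpace (𝓡 n) x) :
    inner ℝ (gradientField n f x) v = mvfderiv (𝓡 n) f x v := by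
  simp only [gradientField]
  set e := stdOrthonormalBasis ℝ (TangentSpace (𝓡 n) x)
  rw [sum_inner]
  conv_rhs => rw [← e.sum_repr' v, map_sum]
  refine Finset.sum_congr rfl fun i _ ↦ ?_
  rw [real_inner_smul_left, map_smul, smul_eq_mul, mul_comm]

theorem gradientField_eq_iff {f : N → ℝ} {x : N} {w : TangentSpace (𝓡 n) x} :
    gradientField n f x = w ↔ ∀ v, inner ℝ w v = mvfderiv (𝓡 n) f x v := by
  constructor
  · rintro rfl v
    exact inner_gradientField f x v
  · intro h
    refine ext_inner_right ℝ fun v ↦ ?_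
    rw [inner_gradientField, h]

theorem gradientField_eq_zero_iff {f : N → ℝ} {x : N} :
    gradientField n f x = 0 ↔ mvfderiv (𝓡 n) f x = 0 := by
  rw [gradientField_eq_iff]
  simp only [inner_zero_left, ContinuousLinearMap.ext_iff, zero_apply]
  exact forall_congr' fun v ↦ eq_comm

theorem gradientField_congr {f g : N → ℝ} {x : N} (h : f =ᶠ[𝓝 x] g) :
    gradientField n f x = gradientField n g x := by
  simp only [gradientField, mvfderiv_congr h]

theorem gradientField_real_comp {f : N → ℝ} {x : N} (hf : MDifferentiableAt (𝓡 n) 𝓘(ℝ, ℝ) f x)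
    {h : ℝ → ℝ} {d : ℝ} (hh : HasDerivAt h d (f x)) :
    gradientField n (fun y ↦ h (f y)) x = d • gradientField n f x := by
  rw [gradientField_eq_iff]
  intro v
  rw [mvfderiv_real_comp hf hh, real_inner_smul_left, inner_gradientField]

theorem norm_gradientField_real_comp {f : N → ℝ} {x : N}
    (hf : MDifferentiableAt (𝓡 n) 𝓘(ℝ, ℝ) f x)
    {h : ℝ → ℝ} {d : ℝ} (hh : HasDerivAt h d (f x)) :
    ‖gradientField n (fun y ↦ h (f y)) x‖ ^ 2 = d ^ 2 * ‖gradientField n f x‖ ^ 2 := by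
  rw [gradientField_real_comp hf hh, norm_smul, mul_pow, Real.norm_eq_abs, sq_abs]

theorem gradientField_eq_zero_of_isLocalMin {f : N → ℝ} {x : N} (h : IsLocalMin f x) :
    gradientField n f x = 0 := by
  rw [gradientField_eq_zero_iff]
  by_cases hf : MDifferentiableAt (𝓡 n) 𝓘(ℝ, ℝ) f x
  · have h1 : IsLocalMin (writtenInExtChartAt (𝓡 n) 𝓘(ℝ, ℝ) x f) (extChartAt (𝓡 n) x x) := by
      have h2 : Tendsto (extChartAt (𝓡 n) x).symm (𝓝 (extChartAt (𝓡 n) x x)) (𝓝 x) := by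
        have := continuousAt_extChartAt_symm (I := 𝓡 n) x
        rwa [ContinuousAt, extChartAt_to_inv] at this
      filter_upwards [h2.eventually h] with y hy
      have h5 : writtenInExtChartAt (𝓡 n) 𝓘(ℝ, ℝ) x f (extChartAt (𝓡 n) x x) = f x := by
        change f ((extChartAt (𝓡 n) x).symm (extChartAt (𝓡 n) x x)) = f x
        rw [extChartAt_to_inv]
      rw [h5]
      exact hy
    have h3 := h1.fderiv_eq_zero
    ext v
    simp only [mvfderiv]
    have h4 : mfderiv (𝓡 n) 𝓘(ℝ, ℝ) f x = 0 := by
      rw [hf.mfderiv]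
      simp only [ModelWithCorners.range_eq_univ, fderivWithin_univ]
      exact h3
    rw [h4]
    rfl
  · ext v
    simp only [mvfderiv]
    rw [mfderiv_zero_of_not_mdifferentiableAt hf]
    rfl

end RiemannianLemmas

section Frame

variable {n : ℕ} {N : Type*} [TopologicalSpace N] [ChartedSpace (EuclideanSpace ℝ (Fin n)) N]
  [IsManifold (𝓡 n) ∞ N] [RiemannianBundle (fun x : N ↦ TangentSpace (𝓡 n) x)]
  [IsContMDiffRiemannianBundle (𝓡 n) ∞ (EuclideanSpace ℝ (Fin n))
    (fun x : N ↦ TangentSpace (𝓡 n) x)]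

theorem contMDiffAt_gramSchmidt {s : Fin n → Π x : N, TangentSpace (𝓡 n) x} {x : N}
    (hs : ∀ i, ContMDiffAt (𝓡 n) (𝓡 n).tangent ∞
      (fun x ↦ (⟨x, s i x⟩ : TangentBundle (𝓡 n) N)) x)
    (hli : LinearIndependent ℝ (s · x)) (i : Fin n) :
    ContMDiffAt (𝓡 n) (𝓡 n).tangent ∞
      (fun x ↦ (⟨x, InnerProductSpace.gramSchmidt ℝ (s · x) i⟩ : TangentBundle (𝓡 n) N)) x := by
  induction i using WellFoundedLT.induction with
  | _ i ih =>
    have h1 : ∀ j ∈ Finset.Iio i, ContMDiffAt (𝓡 n) (𝓡 n).tangent ∞ (fun y ↦ (⟨y,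
        (inner ℝ (InnerProductSpace.gramSchmidt ℝ (s · y) j) (s i y) /
          inner ℝ (InnerProductSpace.gramSchmidt ℝ (s · y) j)
            (InnerProductSpace.gramSchmidt ℝ (s · y) j)) •
          InnerProductSpace.gramSchmidt ℝ (s · y) j⟩ : TangentBundle (𝓡 n) N)) x := by
      intro j hj
      have hj := ih j (Finset.mem_Iio.1 hj)
      refine ContMDiffAt.smul_section (ContMDiffAt.div₀ (ContMDiffAt.inner_bundle hj (hs i))
        (ContMDiffAt.inner_bundle hj hj) ?_) hj
      exact inner_self_ne_zero.2 (InnerProductSpace.gramSchmidt_ne_zero (𝕜 := ℝ) j hli)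
    have h2 := (hs i).sub_section (ContMDiffAt.sum_section h1)
    refine h2.congr_of_eventuallyEq (Eventually.of_forall fun y ↦ ?_)
    have h3 := InnerProductSpace.gramSchmidt_def'' ℝ (s · y) i
    simp only [RCLike.ofReal_real_eq_id, id_eq, ← real_inner_self_eq_norm_sq] at h3
    simp only [Pi.sub_apply]
    congr 1
    exact eq_sub_of_add_eq h3.symm

/-- There are smooth local orthonormal frames. -/
theorem exists_orthonormal_frame (x : N) :
    ∃ E : Fin n → Π x : N, TangentSpace (𝓡 n) x,
      (∀ᶠ y in 𝓝 x, ∀ i, ContMDiffAt (𝓡 n) (𝓡 n).tangent ∞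
        (fun x ↦ (⟨x, E i x⟩ : TangentBundle (𝓡 n) N)) y) ∧
      ∀ᶠ y in 𝓝 x, Orthonormal ℝ (E · y) := by
  let t := trivializationAt (EuclideanSpace ℝ (Fin n)) (fun x : N ↦ TangentSpace (𝓡 n) x) x
  let b := (EuclideanSpace.basisFun (Fin n) ℝ).toBasis
  have hfr := t.isLocalFrameOn_localFrame_baseSet (𝓡 n) ∞ b
  have hx : ∀ᶠ y in 𝓝 x, y ∈ t.baseSet :=
    t.open_baseSet.mem_nhds (FiberBundle.mem_baseSet_trivializationAt' x)
  refine ⟨fun i y ↦ InnerProductSpace.gramSchmidtNormed ℝ (t.localFrame b · y) i, ?_, ?_⟩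
  · filter_upwards [hx] with y hy i
    have h1 := contMDiffAt_gramSchmidt (fun i ↦ hfr.contMDiffAt t.open_baseSet hy i)
      (hfr.linearIndependent hy) i
    have h2 : ContMDiffAt (𝓡 n) 𝓘(ℝ, ℝ) ∞
        (fun y ↦ (√(inner ℝ (InnerProductSpace.gramSchmidt ℝ (t.localFrame b · y) i)
          (InnerProductSpace.gramSchmidt ℝ (t.localFrame b · y) i)))⁻¹) y := by
      have h3 := ContMDiffAt.inner_bundle h1 h1
      have hne := InnerProductSpace.gramSchmidt_ne_zero (𝕜 := ℝ) i (hfr.linearIndependent hy)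
      have h5 := real_inner_self_pos.2 hne
      have h4 : ContDiffAt ℝ ∞ (fun t : ℝ ↦ (√t)⁻¹)
          (inner ℝ (InnerProductSpace.gramSchmidt ℝ (t.localFrame b · y) i)
          (InnerProductSpace.gramSchmidt ℝ (t.localFrame b · y) i)) :=
        (contDiffAt_id.sqrt h5.ne').inv (Real.sqrt_pos.2 h5).ne'
      exact ContMDiffAt.comp (g := fun t : ℝ ↦ (√t)⁻¹) y h4.contMDiffAt h3
    have h3 := h2.smul_section h1
    refine h3.congr_of_eventuallyEq (Eventually.of_forall fun z ↦ ?_)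
    simp only [InnerProductSpace.gramSchmidtNormed, norm_eq_sqrt_real_inner]
    rfl
  · filter_upwards [hx] with y hy
    exact InnerProductSpace.gramSchmidtNormed_orthonormal (hfr.linearIndependent hy)

end Frame

section Connection

variable {n : ℕ} {N : Type*} [TopologicalSpace N] [ChartedSpace (EuclideanSpace ℝ (Fin n)) N]
  [IsManifold (𝓡 n) ∞ N] [RiemannianBundle (fun x : N ↦ TangentSpace (𝓡 n) x)]
  [IsContMDiffRiemannianBundle (𝓡 n) ∞ (EuclideanSpace ℝ (Fin n))
    (fun x : N ↦ TangentSpace (𝓡 n) x)]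

/-- Smoothness at a point of a vector field. -/
abbrev SmoothFieldAt (X : Π x : N, TangentSpace (𝓡 n) x) (x : N) : Prop :=
  ContMDiffAt (𝓡 n) (𝓡 n).tangent ∞ (fun x ↦ (⟨x, X x⟩ : TangentBundle (𝓡 n) N)) x

/-- Differentiability at a point of a vector field. -/
abbrev DiffFieldAt (X : Π x : N, TangentSpace (𝓡 n) x) (x : N) : Prop :=
  MDifferentiableAt (𝓡 n) (𝓡 n).tangent (fun x ↦ (⟨x, X x⟩ : TangentBundle (𝓡 n) N)) x

omit [RiemannianBundle (fun x : N ↦ TangentSpace (𝓡 n) x)]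
  [IsContMDiffRiemannianBundle (𝓡 n) ∞ (EuclideanSpace ℝ (Fin n))
    (fun x : N ↦ TangentSpace (𝓡 n) x)] in
theorem SmoothFieldAt.diffFieldAt {X : Π x : N, TangentSpace (𝓡 n) x} {x : N}
    (h : SmoothFieldAt X x) : DiffFieldAt X x :=
  ContMDiffAt.mdifferentiableAt h (by simp)

omit [IsManifold (𝓡 n) ∞ N] [IsContMDiffRiemannianBundle (𝓡 n) ∞ (EuclideanSpace ℝ (Fin n))
    (fun x : N ↦ TangentSpace (𝓡 n) x)] in
/-- An orthonormal family of `n` vectors is an orthonormal basis of the tangent space. -/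
theorem exists_orthonormalBasis_tangentSpace {x : N} {e : Fin n → TangentSpace (𝓡 n) x}
    (he : Orthonormal ℝ e) :
    ∃ b : OrthonormalBasis (Fin n) ℝ (TangentSpace (𝓡 n) x), ⇑b = e := by
  have hcard : Fintype.card (Fin n) = Module.finrank ℝ (TangentSpace (𝓡 n) x) := by
    rw [Fintype.card_fin]
    exact (finrank_euclideanSpace_fin (𝕜 := ℝ) (n := n)).symm
  have h1 : ⊤ ≤ Submodule.span ℝ (range e) :=
    (he.linearIndependent.span_eq_top_of_card_eq_finrank' hcard).ge
  exact ⟨OrthonormalBasis.mk he h1, OrthonormalBasis.coe_mk he h1⟩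

/-- Every tangent vector extends to a vector field that is smooth near the point. -/
theorem exists_smooth_extension (x : N) (v : TangentSpace (𝓡 n) x) :
    ∃ X : Π x : N, TangentSpace (𝓡 n) x, (∀ᶠ y in 𝓝 x, SmoothFieldAt X y) ∧ X x = v := by
  obtain ⟨E, hE, hon⟩ := exists_orthonormal_frame (n := n) x
  obtain ⟨b, hb⟩ := exists_orthonormalBasis_tangentSpace hon.self_of_nhds
  refine ⟨fun y ↦ ∑ i, inner ℝ (b i) v • E i y, ?_, ?_⟩
  · filter_upwards [hE] with y hy
    exact ContMDiffAt.sum_section fun i _ ↦ ContMDiffAt.smul_section (f := fun _ ↦ inner ℝ (b i) v)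
      contMDiffAt_const (hy i)
  · have := b.sum_repr' v
    rw [hb] at this
    simpa [hb] using this

theorem DiffFieldAt.inner {X Y : Π x : N, TangentSpace (𝓡 n) x} {x : N} (hX : DiffFieldAt X x)
    (hY : DiffFieldAt Y x) : MDifferentiableAt (𝓡 n) 𝓘(ℝ, ℝ) (fun y ↦ inner ℝ (X y) (Y y)) x := by
  haveI : IsContMDiffRiemannianBundle (𝓡 n) 1 (EuclideanSpace ℝ (Fin n))
      (fun x : N ↦ TangentSpace (𝓡 n) x) := IsContMDiffRiemannianBundle.of_le (n := ∞) (by simp)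
  exact MDifferentiableAt.inner_bundle hX hY

theorem koszul_tensorial_left {Y Z : Π x : N, TangentSpace (𝓡 n) x} {x : N}
    (hY : DiffFieldAt Y x) (hZ : DiffFieldAt Z x) :
    TensorialAt (𝓡 n) (EuclideanSpace ℝ (Fin n)) (fun X ↦ koszul n X Y Z x) x where
  smul {f X} hf hX := by
    have h1 : mvfderiv (𝓡 n) (fun y ↦ inner ℝ (Z y) ((f • X) y)) x (Y x) =
        f x * mvfderiv (𝓡 n) (fun y ↦ inner ℝ (Z y) (X y)) x (Y x) +
          inner ℝ (Z x) (X x) * mvfderiv (𝓡 n) f x (Y x) := by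
      have : (fun y ↦ inner ℝ (Z y) ((f • X) y)) = f * (fun y ↦ inner ℝ (Z y) (X y)) := by
        ext y
        simp [real_inner_smul_right]
      rw [this, mvfderiv_mul hf (DiffFieldAt.inner hZ hX)]
      simp
    have h2 : mvfderiv (𝓡 n) (fun y ↦ inner ℝ ((f • X) y) (Y y)) x (Z x) =
        f x * mvfderiv (𝓡 n) (fun y ↦ inner ℝ (X y) (Y y)) x (Z x) +
          inner ℝ (X x) (Y x) * mvfderiv (𝓡 n) f x (Z x) := by
      have : (fun y ↦ inner ℝ ((f • X) y) (Y y)) = f * (fun y ↦ inner ℝ (X y) (Y y)) := by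
        ext y
        simp [real_inner_smul_left]
      rw [this, mvfderiv_mul hf (DiffFieldAt.inner hX hY)]
      simp
    have h3 := VectorField.mlieBracket_smul_left (W := Y) hf hX
    have h4 := VectorField.mlieBracket_smul_right (V := Z) hf hX
    simp only [koszul, h1, h2, h3, h4]
    simp only [Pi.smul_apply', map_smul, inner_add_left, real_inner_smul_left,
      real_inner_smul_right, smul_eq_mul, real_inner_comm (X x) (Z x)]
    ring
  add {X X'} hX hX' := by
    have h1 : mvfderiv (𝓡 n) (fun y ↦ inner ℝ (Z y) ((X + X') y)) x =
        mvfderiv (𝓡 n) (fun y ↦ inner ℝ (Z y) (X y)) x +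
          mvfderiv (𝓡 n) (fun y ↦ inner ℝ (Z y) (X' y)) x := by
      rw [← mvfderiv_add (DiffFieldAt.inner hZ hX)
        (DiffFieldAt.inner hZ hX')]
      congr 1
      ext y
      simp [inner_add_right]
    have h2 : mvfderiv (𝓡 n) (fun y ↦ inner ℝ ((X + X') y) (Y y)) x =
        mvfderiv (𝓡 n) (fun y ↦ inner ℝ (X y) (Y y)) x +
          mvfderiv (𝓡 n) (fun y ↦ inner ℝ (X' y) (Y y)) x := by
      rw [← mvfderiv_add (DiffFieldAt.inner hX hY)
        (DiffFieldAt.inner hX' hY)]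
      congr 1
      ext y
      simp [inner_add_left]
    have h3 := VectorField.mlieBracket_add_left (W := Y) hX hX'
    have h4 := VectorField.mlieBracket_add_right (V := Z) hX hX'
    simp only [koszul, h1, h2, h3, h4]
    simp only [Pi.add_apply, map_add, inner_add_left, inner_add_right, add_apply]
    ring

theorem koszul_tensorial_right {X Y : Π x : N, TangentSpace (𝓡 n) x} {x : N}
    (hX : DiffFieldAt X x) (hY : DiffFieldAt Y x) :
    TensorialAt (𝓡 n) (EuclideanSpace ℝ (Fin n)) (fun Z ↦ koszul n X Y Z x) x where
  smul {f Z} hf hZ := by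
    have h1 : mvfderiv (𝓡 n) (fun y ↦ inner ℝ (Y y) ((f • Z) y)) x (X x) =
        f x * mvfderiv (𝓡 n) (fun y ↦ inner ℝ (Y y) (Z y)) x (X x) +
          inner ℝ (Y x) (Z x) * mvfderiv (𝓡 n) f x (X x) := by
      have : (fun y ↦ inner ℝ (Y y) ((f • Z) y)) = f * (fun y ↦ inner ℝ (Y y) (Z y)) := by
        ext y
        simp [real_inner_smul_right]
      rw [this, mvfderiv_mul hf (DiffFieldAt.inner hY hZ)]
      simp
    have h2 : mvfderiv (𝓡 n) (fun y ↦ inner ℝ ((f • Z) y) (X y)) x (Y x) =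
        f x * mvfderiv (𝓡 n) (fun y ↦ inner ℝ (Z y) (X y)) x (Y x) +
          inner ℝ (Z x) (X x) * mvfderiv (𝓡 n) f x (Y x) := by
      have : (fun y ↦ inner ℝ ((f • Z) y) (X y)) = f * (fun y ↦ inner ℝ (Z y) (X y)) := by
        ext y
        simp [real_inner_smul_left]
      rw [this, mvfderiv_mul hf (DiffFieldAt.inner hZ hX)]
      simp
    have h3 := VectorField.mlieBracket_smul_left (W := X) hf hZ
    have h4 := VectorField.mlieBracket_smul_right (V := Y) hf hZ
    simp only [koszul, h1, h2, h3, h4]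
    simp only [Pi.smul_apply', map_smul, inner_add_left, real_inner_smul_left,
      real_inner_smul_right, smul_eq_mul, real_inner_comm (X x) (Z x),
      real_inner_comm (Z x) (Y x)]
    ring
  add {Z Z'} hZ hZ' := by
    have h1 : mvfderiv (𝓡 n) (fun y ↦ inner ℝ (Y y) ((Z + Z') y)) x =
        mvfderiv (𝓡 n) (fun y ↦ inner ℝ (Y y) (Z y)) x +
          mvfderiv (𝓡 n) (fun y ↦ inner ℝ (Y y) (Z' y)) x := by
      rw [← mvfderiv_add (DiffFieldAt.inner hY hZ)
        (DiffFieldAt.inner hY hZ')]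
      congr 1
      ext y
      simp [inner_add_right]
    have h2 : mvfderiv (𝓡 n) (fun y ↦ inner ℝ ((Z + Z') y) (X y)) x =
        mvfderiv (𝓡 n) (fun y ↦ inner ℝ (Z y) (X y)) x +
          mvfderiv (𝓡 n) (fun y ↦ inner ℝ (Z' y) (X y)) x := by
      rw [← mvfderiv_add (DiffFieldAt.inner hZ hX)
        (DiffFieldAt.inner hZ' hX)]
      congr 1
      ext y
      simp [inner_add_left]
    have h3 := VectorField.mlieBracket_add_left (W := X) hZ hZ'
    have h4 := VectorField.mlieBracket_add_right (V := Y) hZ hZ'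
    simp only [koszul, h1, h2, h3, h4]
    simp only [Pi.add_apply, map_add, inner_add_left, inner_add_right, add_apply]
    ring

/-- The Koszul expression as a bilinear form in its outer arguments. -/
def koszulHom {Y : Π x : N, TangentSpace (𝓡 n) x} {x : N} (hY : DiffFieldAt Y x) :
    TangentSpace (𝓡 n) x →L[ℝ] TangentSpace (𝓡 n) x →L[ℝ] ℝ :=
  TensorialAt.mkHom₂ (fun X Z ↦ koszul n X Y Z x) x
    (fun _ hZ ↦ koszul_tensorial_left hY hZ) (fun _ hX ↦ koszul_tensorial_right hX hY)

theorem koszulHom_apply {X Y Z : Π x : N, TangentSpace (𝓡 n) x} {x : N} (hX : DiffFieldAt X x)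
    (hY : DiffFieldAt Y x) (hZ : DiffFieldAt Z x) :
    koszulHom hY (X x) (Z x) = koszul n X Y Z x :=
  TensorialAt.mkHom₂_apply _ _ hX hZ

theorem inner_leviCivita_eq_koszulHom {Y : Π x : N, TangentSpace (𝓡 n) x} {x : N}
    (hY : DiffFieldAt Y x) (v w : TangentSpace (𝓡 n) x) :
    inner ℝ (leviCivita n Y x v) w = (1 / 2) * koszulHom hY v w := by
  simp only [leviCivita]
  set e := stdOrthonormalBasis ℝ (TangentSpace (𝓡 n) x)
  rw [sum_inner]
  conv_rhs => rw [← e.sum_repr' w, map_sum, Finset.mul_sum]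
  refine Finset.sum_congr rfl fun i _ ↦ ?_
  rw [real_inner_smul_left, map_smul, smul_eq_mul]
  have : koszulHom hY v (e i) = koszul n (FiberBundle.extend (EuclideanSpace ℝ (Fin n)) v) Y
    (FiberBundle.extend (EuclideanSpace ℝ (Fin n)) (e i)) x := rfl
  rw [this]
  ring

/-- The Koszul formula. -/
theorem inner_leviCivita {X Y Z : Π x : N, TangentSpace (𝓡 n) x} {x : N} (hX : DiffFieldAt X x)
    (hY : DiffFieldAt Y x) (hZ : DiffFieldAt Z x) :
    inner ℝ (leviCivita n Y x (X x)) (Z x) = (1 / 2) * koszul n X Y Z x := by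
  rw [inner_leviCivita_eq_koszulHom hY, koszulHom_apply hX hY hZ]

/-- The covariant derivative `v ↦ ∇_v Y` as a linear map. -/
def leviCivitaHom {Y : Π x : N, TangentSpace (𝓡 n) x} {x : N} (hY : DiffFieldAt Y x) :
    TangentSpace (𝓡 n) x →ₗ[ℝ] TangentSpace (𝓡 n) x where
  toFun := leviCivita n Y x
  map_add' v w := by
    refine ext_inner_right ℝ fun u ↦ ?_
    simp only [inner_add_left, inner_leviCivita_eq_koszulHom hY, map_add, add_apply]
    ring
  map_smul' c v := by
    refine ext_inner_right ℝ fun u ↦ ?_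
    simp only [real_inner_smul_left, inner_leviCivita_eq_koszulHom hY, map_smul, RingHom.id_apply,
      smul_apply, smul_eq_mul]
    ring

theorem laplacian_eq_sum {f : N → ℝ} {x : N} (hf : DiffFieldAt (gradientField n f) x)
    {ι : Type*} [Fintype ι] (b : OrthonormalBasis ι ℝ (TangentSpace (𝓡 n) x)) :
    laplacian n f x = ∑ i, inner ℝ (leviCivita n (gradientField n f) x (b i)) (b i) := by
  have key : ∀ {ι : Type _} [Fintype ι] (b : OrthonormalBasis ι ℝ (TangentSpace (𝓡 n) x)),
      ∑ i, inner ℝ (leviCivita n (gradientField n f) x (b i)) (b i) =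
        LinearMap.trace ℝ _ (leviCivitaHom hf) := by
    intro ι _ b
    rw [LinearMap.trace_eq_sum_inner _ b]
    exact Finset.sum_congr rfl fun i _ ↦ real_inner_comm _ _
  rw [key b]
  have key' : ∑ i, inner ℝ (leviCivita n (gradientField n f) x
      (stdOrthonormalBasis ℝ (TangentSpace (𝓡 n) x) i))
      (stdOrthonormalBasis ℝ (TangentSpace (𝓡 n) x) i) =
        LinearMap.trace ℝ _ (leviCivitaHom hf) := by
    rw [LinearMap.trace_eq_sum_inner _ (stdOrthonormalBasis ℝ (TangentSpace (𝓡 n) x))]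
    exact Finset.sum_congr rfl fun i _ ↦ real_inner_comm _ _
  exact key'

end Connection

section Hessian

variable {n : ℕ} {N : Type*} [TopologicalSpace N] [ChartedSpace (EuclideanSpace ℝ (Fin n)) N]
  [IsManifold (𝓡 n) ∞ N]

omit [TopologicalSpace N] [ChartedSpace (EuclideanSpace ℝ (Fin n)) N] [IsManifold (𝓡 n) ∞ N] in
theorem natCast_le_infty (k : ℕ) : (k : ℕ∞ω) ≤ ∞ := by
  exact_mod_cast (le_top : (k : ℕ∞) ≤ ⊤)

theorem SmoothFieldAt.eventually_diffFieldAt {X : Π x : N, TangentSpace (𝓡 n) x} {x : N}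
    (hX : SmoothFieldAt X x) : ∀ᶠ y in 𝓝 x, DiffFieldAt X y := by
  have := (contMDiffAt_iff_contMDiffAt_nhds (by simp)).1
    (ContMDiffAt.of_le hX (natCast_le_infty 1))
  exact this.mono fun y hy ↦ hy.mdifferentiableAt (by simp)

theorem SmoothFieldAt.mlieBracket {X Y : Π x : N, TangentSpace (𝓡 n) x} {x : N}
    (hX : SmoothFieldAt X x) (hY : SmoothFieldAt Y x) :
    SmoothFieldAt (VectorField.mlieBracket (𝓡 n) X Y) x := by
  have : IsManifold (𝓡 n) (((⊤ : ℕ∞) : ℕ∞ω) + 1) N := by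
    have : (((⊤ : ℕ∞) : ℕ∞ω) + 1) = ∞ := rfl
    rw [this]; infer_instance
  have : IsManifold (𝓡 n) (minSmoothness ℝ 2) N := by
    rw [minSmoothness_of_isRCLikeNormedField]; infer_instance
  exact ContMDiffAt.mlieBracket_vectorField (m := ⊤) (n := ⊤) hX hY (by simp)

/-- `[X, Z] f = X (Z f) - Z (X f)`. -/
theorem mvfderiv_mlieBracket {f : N → ℝ} {X Z : Π x : N, TangentSpace (𝓡 n) x} {x : N}
    (hf : ContMDiffAt (𝓡 n) 𝓘(ℝ, ℝ) ∞ f x) (hX : SmoothFieldAt X x) (hZ : SmoothFieldAt Z x)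
    {W : Π x : N, TangentSpace (𝓡 n) x} (hW : SmoothFieldAt W x) (hWx : W x ≠ 0) :
    mvfderiv (𝓡 n) f x (VectorField.mlieBracket (𝓡 n) X Z x) =
      mvfderiv (𝓡 n) (fun y ↦ mvfderiv (𝓡 n) f y (Z y)) x (X x) -
        mvfderiv (𝓡 n) (fun y ↦ mvfderiv (𝓡 n) f y (X y)) x (Z x) := by
  have : IsManifold (𝓡 n) (minSmoothness ℝ 3) N := by
    simp only [minSmoothness_of_isRCLikeNormedField]
    exact IsManifold.of_le (n := ∞) (natCast_le_infty 3)
  have h2 : minSmoothness ℝ 2 ≤ ∞ := by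
    simp only [minSmoothness_of_isRCLikeNormedField]
    exact natCast_le_infty 2
  have d1 : ∀ {g : N → ℝ}, ContMDiffAt (𝓡 n) 𝓘(ℝ, ℝ) ∞ g x → MDifferentiableAt (𝓡 n) 𝓘(ℝ, ℝ) g x :=
    fun h ↦ h.mdifferentiableAt (by simp)
  have key : ∀ {A : Π x : N, TangentSpace (𝓡 n) x}, SmoothFieldAt A x →
      VectorField.mlieBracket (𝓡 n) A (f • W) =ᶠ[𝓝 x]
        ((fun y ↦ mvfderiv (𝓡 n) f y (A y)) • W + f • VectorField.mlieBracket (𝓡 n) A W) := by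
    intro A hA
    have hf1 : ∀ᶠ y in 𝓝 x, ContMDiffAt (𝓡 n) 𝓘(ℝ, ℝ) 1 f y :=
      (contMDiffAt_iff_contMDiffAt_nhds (by simp)).1 (hf.of_le (natCast_le_infty 1))
    have hW1 : ∀ᶠ y in 𝓝 x, ContMDiffAt (𝓡 n) (𝓡 n).tangent 1
        (fun x ↦ (⟨x, W x⟩ : TangentBundle (𝓡 n) N)) y :=
      (contMDiffAt_iff_contMDiffAt_nhds (by simp)).1 (hW.of_le (natCast_le_infty 1))
    filter_upwards [hf1, hW1] with y hfy hWy
    exact VectorField.mlieBracket_smul_right (V := A) (hfy.mdifferentiableAt (by simp))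
      (hWy.mdifferentiableAt (by simp))
  have main : ∀ {A B : Π x : N, TangentSpace (𝓡 n) x}, SmoothFieldAt A x → SmoothFieldAt B x →
      VectorField.mlieBracket (𝓡 n) A (VectorField.mlieBracket (𝓡 n) B (f • W)) x =
        mvfderiv (𝓡 n) (fun y ↦ mvfderiv (𝓡 n) f y (B y)) x (A x) • W x +
        mvfderiv (𝓡 n) f x (B x) • VectorField.mlieBracket (𝓡 n) A W x +
        (mvfderiv (𝓡 n) f x (A x) • VectorField.mlieBracket (𝓡 n) B W x +
        f x • VectorField.mlieBracket (𝓡 n) A (VectorField.mlieBracket (𝓡 n) B W) x) := by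
    intro A B hA hB
    have hBf := contMDiffAt_mvfderiv_apply hf hB
    have hBW := hB.mlieBracket hW
    rw [(EventuallyEq.refl _ A).mlieBracket_vectorField_eq (key hB),
      VectorField.mlieBracket_add_right
        (SmoothFieldAt.diffFieldAt (X := (fun y ↦ mvfderiv (𝓡 n) f y (B y)) • W)
          (hBf.smul_section hW))
        (SmoothFieldAt.diffFieldAt (X := f • VectorField.mlieBracket (𝓡 n) B W)
          (hf.smul_section hBW)),
      VectorField.mlieBracket_smul_right (d1 hBf) hW.diffFieldAt,
      VectorField.mlieBracket_smul_right (d1 hf) hBW.diffFieldAt]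
  have hfW : SmoothFieldAt (f • W) x := hf.smul_section hW
  have hJ := VectorField.leibniz_identity_mlieBracket_apply (U := X) (V := Z) (W := f • W)
    (hX.of_le h2) (hZ.of_le h2) (hfW.of_le h2)
  have hJ' := VectorField.leibniz_identity_mlieBracket_apply (U := X) (V := Z) (W := W)
    (hX.of_le h2) (hZ.of_le h2) (hW.of_le h2)
  rw [main hX hZ, main hZ hX, hJ', VectorField.mlieBracket_smul_right (d1 hf) hW.diffFieldAt] at hJ
  have h3 : (mvfderiv (𝓡 n) f x (VectorField.mlieBracket (𝓡 n) X Z x) -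
      (mvfderiv (𝓡 n) (fun y ↦ mvfderiv (𝓡 n) f y (Z y)) x (X x) -
        mvfderiv (𝓡 n) (fun y ↦ mvfderiv (𝓡 n) f y (X y)) x (Z x))) • W x = 0 := by
    rw [sub_smul, sub_smul, sub_eq_zero]
    generalize VectorField.mlieBracket (𝓡 n) X (VectorField.mlieBracket (𝓡 n) Z W) x = p1 at hJ
    generalize VectorField.mlieBracket (𝓡 n) Z (VectorField.mlieBracket (𝓡 n) X W) x = p2 at hJ
    generalize VectorField.mlieBracket (𝓡 n) (VectorField.mlieBracket (𝓡 n) X Z) W x = p3 at hJ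
    generalize VectorField.mlieBracket (𝓡 n) X W x = p4 at hJ
    generalize VectorField.mlieBracket (𝓡 n) Z W x = p5 at hJ
    rw [smul_add] at hJ
    linear_combination (norm := module) (-1 : ℝ) • hJ
  have h4 := (smul_eq_zero.1 h3).resolve_right hWx
  linarith

variable [RiemannianBundle (fun x : N ↦ TangentSpace (𝓡 n) x)]
  [IsContMDiffRiemannianBundle (𝓡 n) ∞ (EuclideanSpace ℝ (Fin n))
    (fun x : N ↦ TangentSpace (𝓡 n) x)]

theorem SmoothFieldAt.inner {X Y : Π x : N, TangentSpace (𝓡 n) x} {x : N} (hX : SmoothFieldAt X x)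
    (hY : SmoothFieldAt Y x) : ContMDiffAt (𝓡 n) 𝓘(ℝ, ℝ) ∞ (fun y ↦ inner ℝ (X y) (Y y)) x :=
  ContMDiffAt.inner_bundle hX hY

theorem smoothFieldAt_gradientField {f : N → ℝ} {x : N}
    (hf : ContMDiffAt (𝓡 n) 𝓘(ℝ, ℝ) ∞ f x) : SmoothFieldAt (gradientField n f) x := by
  obtain ⟨E, hE, hon⟩ := exists_orthonormal_frame (n := n) x
  have h1 : SmoothFieldAt (fun y ↦ ∑ i, mvfderiv (𝓡 n) f y (E i y) • E i y) x :=
    ContMDiffAt.sum_section fun i _ ↦ ContMDiffAt.smul_section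
      (f := fun y ↦ mvfderiv (𝓡 n) f y (E i y))
      (contMDiffAt_mvfderiv_apply hf (hE.self_of_nhds i)) (hE.self_of_nhds i)
  refine h1.congr_of_eventuallyEq ?_
  filter_upwards [hon] with y hy
  congr 1
  obtain ⟨b, hb⟩ := exists_orthonormalBasis_tangentSpace hy
  rw [← b.sum_repr' (gradientField n f y), hb]
  refine Finset.sum_congr rfl fun i _ ↦ ?_
  rw [real_inner_comm, inner_gradientField]

theorem koszul_congr {X Y Y' Z : Π x : N, TangentSpace (𝓡 n) x} {x : N} (h : Y =ᶠ[𝓝 x] Y') :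
    koszul n X Y Z x = koszul n X Y' Z x := by
  simp only [koszul]
  rw [mvfderiv_congr (f := fun y ↦ inner ℝ (Y y) (Z y)) (g := fun y ↦ inner ℝ (Y' y) (Z y))
    (by filter_upwards [h] with y hy; rw [hy]),
    mvfderiv_congr (f := fun y ↦ inner ℝ (X y) (Y y)) (g := fun y ↦ inner ℝ (X y) (Y' y))
    (by filter_upwards [h] with y hy; rw [hy]),
    (EventuallyEq.refl _ X).mlieBracket_vectorField_eq h,
    h.mlieBracket_vectorField_eq (EventuallyEq.refl _ Z), h.self_of_nhds]

theorem leviCivita_congr {Y Y' : Π x : N, TangentSpace (𝓡 n) x} {x : N} (h : Y =ᶠ[𝓝 x] Y') :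
    leviCivita n Y x = leviCivita n Y' x := by
  ext1 v
  simp only [leviCivita, koszul_congr h]

/-- The Hessian of a function is symmetric. -/
theorem inner_leviCivita_gradientField_symm {f : N → ℝ} {x : N}
    (hf : ContMDiffAt (𝓡 n) 𝓘(ℝ, ℝ) ∞ f x) (v w : TangentSpace (𝓡 n) x) :
    inner ℝ (leviCivita n (gradientField n f) x v) w =
      inner ℝ (leviCivita n (gradientField n f) x w) v := by
  by_cases hw : w = 0
  · subst hw
    have := (leviCivitaHom (smoothFieldAt_gradientField hf).diffFieldAt).map_zero
    change leviCivita n (gradientField n f) x 0 = 0 at this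
    rw [this, inner_zero_left, inner_zero_right]
  obtain ⟨X, hX, rfl⟩ := exists_smooth_extension x v
  obtain ⟨Z, hZ, rfl⟩ := exists_smooth_extension x w
  have hY := smoothFieldAt_gradientField hf
  rw [inner_leviCivita hX.self_of_nhds.diffFieldAt hY.diffFieldAt hZ.self_of_nhds.diffFieldAt,
    inner_leviCivita hZ.self_of_nhds.diffFieldAt hY.diffFieldAt hX.self_of_nhds.diffFieldAt]
  have h1 := mvfderiv_mlieBracket hf hX.self_of_nhds hZ.self_of_nhds hZ.self_of_nhds hw
  simp only [koszul]
  rw [VectorField.mlieBracket_swap_apply (V := gradientField n f) (W := Z),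
    VectorField.mlieBracket_swap_apply (V := gradientField n f) (W := X),
    VectorField.mlieBracket_swap_apply (V := Z) (W := X)]
  simp only [inner_gradientField, real_inner_comm (gradientField n f _) _, real_inner_comm (X _) (Z _),
    inner_neg_left] at h1 ⊢
  rw [h1, map_neg, h1]
  ring

theorem inner_leviCivita_self {Y : Π x : N, TangentSpace (𝓡 n) x} {x : N}
    (hY : DiffFieldAt Y x) {c : ℝ} (hc : ∀ᶠ y in 𝓝 x, inner ℝ (Y y) (Y y) = c)
    (v : TangentSpace (𝓡 n) x) : inner ℝ (leviCivita n Y x v) (Y x) = 0 := by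
  obtain ⟨X, hX, rfl⟩ := exists_smooth_extension x v
  rw [inner_leviCivita hX.self_of_nhds.diffFieldAt hY hY]
  have h1 : mvfderiv (𝓡 n) (fun y ↦ inner ℝ (Y y) (Y y)) x (X x) = 0 := by
    rw [mvfderiv_congr (g := fun _ ↦ c) hc, mvfderiv, mfderiv_const]
    rfl
  have h2 : (fun y ↦ inner ℝ (Y y) (X y)) = fun y ↦ inner ℝ (X y) (Y y) :=
    funext fun y ↦ real_inner_comm _ _
  simp only [koszul, h1, h2]
  rw [VectorField.mlieBracket_swap_apply (V := X)]
  simp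

theorem continuousAt_laplacian {f : N → ℝ} {x : N} (hf : ContMDiffAt (𝓡 n) 𝓘(ℝ, ℝ) ∞ f x) :
    ContinuousAt (laplacian n f) x := by
  obtain ⟨E, hE, hon⟩ := exists_orthonormal_frame (n := n) x
  have hY := smoothFieldAt_gradientField hf
  have hE0 : ∀ i, SmoothFieldAt (E i) x := hE.self_of_nhds
  have h1 : ∀ i, ContinuousAt (koszul n (E i) (gradientField n f) (E i)) x := by
    intro i
    have a1 := contMDiffAt_mvfderiv_apply (SmoothFieldAt.inner hY (hE0 i)) (hE0 i)
    have a2 := contMDiffAt_mvfderiv_apply (SmoothFieldAt.inner (hE0 i) (hE0 i)) hY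
    have a3 := contMDiffAt_mvfderiv_apply (SmoothFieldAt.inner (hE0 i) hY) (hE0 i)
    have a4 := SmoothFieldAt.inner (SmoothFieldAt.mlieBracket (hE0 i) hY) (hE0 i)
    have a5 := SmoothFieldAt.inner (hY.mlieBracket (hE0 i)) (hE0 i)
    have a6 := SmoothFieldAt.inner (SmoothFieldAt.mlieBracket (hE0 i) (hE0 i)) hY
    change ContinuousAt (fun y ↦ koszul n (E i) (gradientField n f) (E i) y) x
    simp only [koszul]
    exact ((((a1.continuousAt.add a2.continuousAt).sub a3.continuousAt).add
      a4.continuousAt).sub a5.continuousAt).add a6.continuousAt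
  have h2 : ContinuousAt (fun y ↦ ∑ i, (1 / 2) * koszul n (E i) (gradientField n f) (E i) y) x :=
    tendsto_finsetSum _ fun i _ ↦ (h1 i).const_mul _
  have hY1 := hY.eventually_diffFieldAt
  refine h2.congr ?_
  filter_upwards [hE, hon, hY1] with y hEy hony hYy
  obtain ⟨b, hb⟩ := exists_orthonormalBasis_tangentSpace hony
  rw [laplacian_eq_sum hYy b]
  refine Finset.sum_congr rfl fun i _ ↦ ?_
  have h3 : SmoothFieldAt (E i) y := hEy i
  rw [hb]
  exact (inner_leviCivita h3.diffFieldAt hYy h3.diffFieldAt).symm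

end Hessian

section Isometry

variable {n : ℕ} {N : Type*} [TopologicalSpace N] [ChartedSpace (EuclideanSpace ℝ (Fin n)) N]
  [IsManifold (𝓡 n) ∞ N] [RiemannianBundle (fun x : N ↦ TangentSpace (𝓡 n) x)]
  [IsContMDiffRiemannianBundle (𝓡 n) ∞ (EuclideanSpace ℝ (Fin n))
    (fun x : N ↦ TangentSpace (𝓡 n) x)]

/-- The map `φ` preserves the metric. -/
def PreservesMetric (φ : N → N) : Prop :=
  ∀ (x : N) (v w : TangentSpace (𝓡 n) x),
    inner ℝ (mfderiv (𝓡 n) (𝓡 n) φ x v) (mfderiv (𝓡 n) (𝓡 n) φ x w) = inner ℝ v w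

theorem PreservesMetric.isInvertible {φ : N → N} (h : PreservesMetric (n := n) φ) (x : N) :
    (mfderiv (𝓡 n) (𝓡 n) φ x).IsInvertible := by
  have h1 : Function.Injective (mfderiv (𝓡 n) (𝓡 n) φ x) := by
    rw [injective_iff_map_eq_zero]
    intro v hv
    have := h x v v
    rw [hv, inner_zero_left] at this
    exact inner_self_eq_zero.1 this.symm
  have h2 : Function.Bijective (mfderiv (𝓡 n) (𝓡 n) φ x).toLinearMap :=
    ⟨h1, (LinearMap.injective_iff_surjective_of_finrank_eq_finrank (by rfl)).1 h1⟩
  exact ⟨(LinearEquiv.ofBijective _ h2).toContinuousLinearEquiv, by ext v; rfl⟩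

theorem PreservesMetric.mfderiv_mpullback {φ : N → N} (h : PreservesMetric (n := n) φ)
    (X : Π x : N, TangentSpace (𝓡 n) x) (x : N) :
    mfderiv (𝓡 n) (𝓡 n) φ x (VectorField.mpullback (𝓡 n) (𝓡 n) φ X x) = X (φ x) := by
  rw [VectorField.mpullback_apply]
  exact (h.isInvertible x).self_apply_inverse _

theorem PreservesMetric.eq_mpullback {φ : N → N} (h : PreservesMetric (n := n) φ)
    {X : Π x : N, TangentSpace (𝓡 n) x} {x : N} {v : TangentSpace (𝓡 n) x}
    (hv : mfderiv (𝓡 n) (𝓡 n) φ x v = X (φ x)) :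
    v = VectorField.mpullback (𝓡 n) (𝓡 n) φ X x := by
  rw [VectorField.mpullback_apply, ← hv, (h.isInvertible x).inverse_apply_self]

omit [IsManifold (𝓡 n) ∞ N] [RiemannianBundle (fun x : N ↦ TangentSpace (𝓡 n) x)]
  [IsContMDiffRiemannianBundle (𝓡 n) ∞ (EuclideanSpace ℝ (Fin n))
    (fun x : N ↦ TangentSpace (𝓡 n) x)] in
theorem mvfderiv_comp_map {φ : N → N} {x : N} (hφ : MDifferentiableAt (𝓡 n) (𝓡 n) φ x) {f : N → ℝ}
    (hf : MDifferentiableAt (𝓡 n) 𝓘(ℝ, ℝ) f (φ x)) (v : TangentSpace (𝓡 n) x) :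
    mvfderiv (𝓡 n) (fun y ↦ f (φ y)) x v =
      mvfderiv (𝓡 n) f (φ x) (mfderiv (𝓡 n) (𝓡 n) φ x v) :=
  mvfderiv_comp_apply (I := 𝓡 n) (I' := 𝓡 n) x hf hφ v

theorem PreservesMetric.koszul_mpullback {φ : N → N} (h : PreservesMetric (n := n) φ)
    (hφ : ContMDiff (𝓡 n) (𝓡 n) ∞ φ) {X Y Z : Π x : N, TangentSpace (𝓡 n) x} {x : N}
    (hX : DiffFieldAt X (φ x)) (hY : DiffFieldAt Y (φ x)) (hZ : DiffFieldAt Z (φ x)) :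
    koszul n (VectorField.mpullback (𝓡 n) (𝓡 n) φ X) (VectorField.mpullback (𝓡 n) (𝓡 n) φ Y)
      (VectorField.mpullback (𝓡 n) (𝓡 n) φ Z) x = koszul n X Y Z (φ x) := by
  have hd : MDifferentiableAt (𝓡 n) (𝓡 n) φ x := hφ.contMDiffAt.mdifferentiableAt (by simp)
  have h1 : ∀ {A B C : Π x : N, TangentSpace (𝓡 n) x}, DiffFieldAt A (φ x) → DiffFieldAt B (φ x) →
      mvfderiv (𝓡 n) (fun y ↦ inner ℝ (VectorField.mpullback (𝓡 n) (𝓡 n) φ A y)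
        (VectorField.mpullback (𝓡 n) (𝓡 n) φ B y)) x (VectorField.mpullback (𝓡 n) (𝓡 n) φ C x) =
      mvfderiv (𝓡 n) (fun y ↦ inner ℝ (A y) (B y)) (φ x) (C (φ x)) := by
    intro A B C hA hB
    have h2 : (fun y ↦ inner ℝ (VectorField.mpullback (𝓡 n) (𝓡 n) φ A y)
        (VectorField.mpullback (𝓡 n) (𝓡 n) φ B y)) = fun y ↦ inner ℝ (A (φ y)) (B (φ y)) := by
      ext y
      rw [← h y, h.mfderiv_mpullback, h.mfderiv_mpullback]
    rw [h2, mvfderiv_comp_map (f := fun y ↦ inner ℝ (A y) (B y)) hd (hA.inner hB),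
      h.mfderiv_mpullback]
  have h3 : ∀ {A B C : Π x : N, TangentSpace (𝓡 n) x}, DiffFieldAt A (φ x) → DiffFieldAt B (φ x) →
      inner ℝ (VectorField.mlieBracket (𝓡 n) (VectorField.mpullback (𝓡 n) (𝓡 n) φ A)
        (VectorField.mpullback (𝓡 n) (𝓡 n) φ B) x) (VectorField.mpullback (𝓡 n) (𝓡 n) φ C x) =
      inner ℝ (VectorField.mlieBracket (𝓡 n) A B (φ x)) (C (φ x)) := by
    intro A B C hA hB
    have : IsManifold (𝓡 n) (minSmoothness ℝ 2) N := by
      rw [minSmoothness_of_isRCLikeNormedField]; infer_instance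
    have h4 := VectorField.mpullback_mlieBracket (n := ∞) (f := φ) (x₀ := x) hA hB hφ.contMDiffAt
      (by rw [minSmoothness_of_isRCLikeNormedField]; exact natCast_le_infty 2)
    rw [← h4, ← h x, h.mfderiv_mpullback, h.mfderiv_mpullback]
  simp only [koszul]
  rw [h1 hY hZ, h1 hZ hX, h1 hX hY, h3 hX hY, h3 hY hZ, h3 hZ hX]

/-- Local isometries preserve the Levi-Civita connection. -/
theorem PreservesMetric.mfderiv_leviCivita {φ : N → N} (h : PreservesMetric (n := n) φ)
    (hφ : ContMDiff (𝓡 n) (𝓡 n) ∞ φ) {Y Y' : Π x : N, TangentSpace (𝓡 n) x} {x : N}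
    (hY' : DiffFieldAt Y' (φ x))
    (hYY' : ∀ᶠ y in 𝓝 x, mfderiv (𝓡 n) (𝓡 n) φ y (Y y) = Y' (φ y)) (v : TangentSpace (𝓡 n) x) :
    leviCivita n Y' (φ x) (mfderiv (𝓡 n) (𝓡 n) φ x v) =
      mfderiv (𝓡 n) (𝓡 n) φ x (leviCivita n Y x v) := by
  have h0 : Y =ᶠ[𝓝 x] VectorField.mpullback (𝓡 n) (𝓡 n) φ Y' := by
    filter_upwards [hYY'] with y hy using h.eq_mpullback hy
  have hpd : ∀ {A : Π x : N, TangentSpace (𝓡 n) x}, DiffFieldAt A (φ x) →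
      DiffFieldAt (VectorField.mpullback (𝓡 n) (𝓡 n) φ A) x := fun hA ↦
    MDifferentiableAt.mpullback_vectorField (n := ∞) hA hφ.contMDiffAt (h.isInvertible x)
      (natCast_le_infty 2)
  refine ext_inner_right ℝ fun u ↦ ?_
  obtain ⟨w, rfl⟩ : ∃ w, mfderiv (𝓡 n) (𝓡 n) φ x w = u :=
    ⟨_, (h.isInvertible x).self_apply_inverse u⟩
  obtain ⟨X, hX, hXv⟩ := exists_smooth_extension (φ x) (mfderiv (𝓡 n) (𝓡 n) φ x v)
  obtain ⟨Z, hZ, hZw⟩ := exists_smooth_extension (φ x) (mfderiv (𝓡 n) (𝓡 n) φ x w)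
  have hX := hX.self_of_nhds.diffFieldAt
  have hZ := hZ.self_of_nhds.diffFieldAt
  rw [h x, leviCivita_congr h0]
  conv_rhs => rw [h.eq_mpullback hXv.symm, h.eq_mpullback hZw.symm]
  rw [← hXv, ← hZw, inner_leviCivita hX hY' hZ, inner_leviCivita (hpd hX) (hpd hY') (hpd hZ),
    h.koszul_mpullback hφ hX hY' hZ]

theorem PreservesMetric.mfderiv_gradientField {φ : N → N} (h : PreservesMetric (n := n) φ)
    {x : N} (hφ : MDifferentiableAt (𝓡 n) (𝓡 n) φ x) {f : N → ℝ}
    (hf : MDifferentiableAt (𝓡 n) 𝓘(ℝ, ℝ) f (φ x)) (hfφ : ∀ᶠ y in 𝓝 x, f (φ y) = f y) :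
    mfderiv (𝓡 n) (𝓡 n) φ x (gradientField n f x) = gradientField n f (φ x) := by
  refine ext_inner_right ℝ fun u ↦ ?_
  obtain ⟨w, rfl⟩ : ∃ w, mfderiv (𝓡 n) (𝓡 n) φ x w = u :=
    ⟨_, (h.isInvertible x).self_apply_inverse u⟩
  rw [h x, inner_gradientField, inner_gradientField, ← mvfderiv_comp_map hφ hf,
    mvfderiv_congr hfφ]

theorem PreservesMetric.mfderiv_hessian {φ : N → N} (h : PreservesMetric (n := n) φ)
    (hφ : ContMDiff (𝓡 n) (𝓡 n) ∞ φ) {x : N} {f : N → ℝ}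
    (hf : ContMDiffAt (𝓡 n) 𝓘(ℝ, ℝ) ∞ f (φ x)) (hfφ : ∀ᶠ y in 𝓝 x, f (φ y) = f y)
    (v : TangentSpace (𝓡 n) x) :
    leviCivita n (gradientField n f) (φ x) (mfderiv (𝓡 n) (𝓡 n) φ x v) =
      mfderiv (𝓡 n) (𝓡 n) φ x (leviCivita n (gradientField n f) x v) := by
  refine h.mfderiv_leviCivita hφ (smoothFieldAt_gradientField hf).diffFieldAt ?_ v
  have h1 : ∀ᶠ y in 𝓝 (φ x), ContMDiffAt (𝓡 n) 𝓘(ℝ, ℝ) 1 f y :=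
    (contMDiffAt_iff_contMDiffAt_nhds (by simp)).1 (hf.of_le (natCast_le_infty 1))
  filter_upwards [hφ.continuous.continuousAt.eventually h1, hfφ.eventually_nhds] with y hy hy2
  exact h.mfderiv_gradientField (hφ.contMDiffAt.mdifferentiableAt (by simp))
    (hy.mdifferentiableAt (by simp)) hy2

/-- Local isometries preserve the Laplacian. -/
theorem PreservesMetric.laplacian_eq {φ : N → N} (h : PreservesMetric (n := n) φ)
    (hφ : ContMDiff (𝓡 n) (𝓡 n) ∞ φ) {x : N} {f : N → ℝ}
    (hf : ContMDiffAt (𝓡 n) 𝓘(ℝ, ℝ) ∞ f (φ x)) (hf' : ContMDiffAt (𝓡 n) 𝓘(ℝ, ℝ) ∞ f x)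
    (hfφ : ∀ᶠ y in 𝓝 x, f (φ y) = f y) : laplacian n f (φ x) = laplacian n f x := by
  let b := stdOrthonormalBasis ℝ (TangentSpace (𝓡 n) x)
  have hb : Orthonormal ℝ (fun i ↦ mfderiv (𝓡 n) (𝓡 n) φ x (b i)) := by
    rw [orthonormal_iff_ite]
    intro i j
    rw [h x, orthonormal_iff_ite.1 b.orthonormal]
  have hsp : ⊤ ≤ Submodule.span ℝ (range fun i ↦ mfderiv (𝓡 n) (𝓡 n) φ x (b i)) := by
    refine (hb.linearIndependent.span_eq_top_of_card_eq_finrank' ?_).ge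
    rw [Fintype.card_fin]
    rfl
  let b' := OrthonormalBasis.mk hb hsp
  rw [laplacian_eq_sum (smoothFieldAt_gradientField hf).diffFieldAt b',
    laplacian_eq_sum (smoothFieldAt_gradientField hf').diffFieldAt b]
  refine Finset.sum_congr rfl fun i _ ↦ ?_
  have : b' i = mfderiv (𝓡 n) (𝓡 n) φ x (b i) := by rw [OrthonormalBasis.coe_mk]
  rw [this, h.mfderiv_hessian hφ hf hfφ, h x]

end Isometry

section PrincipalCurvatures

variable {n : ℕ} {N : Type*} [TopologicalSpace N] [ChartedSpace (EuclideanSpace ℝ (Fin n)) N]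
  [IsManifold (𝓡 n) ∞ N] [RiemannianBundle (fun x : N ↦ TangentSpace (𝓡 n) x)]
  [IsContMDiffRiemannianBundle (𝓡 n) ∞ (EuclideanSpace ℝ (Fin n))
    (fun x : N ↦ TangentSpace (𝓡 n) x)]

/-- The Hessian of a function with unit gradient is diagonalizable on the orthogonal complement
of the gradient. -/
theorem exists_orthonormal_eigenvectors_hessian {r : N → ℝ} {x : N}
    (hr : ContMDiffAt (𝓡 n) 𝓘(ℝ, ℝ) ∞ r x) (h1 : ∀ᶠ y in 𝓝 x, ‖gradientField n r y‖ ^ 2 = 1) :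
    ∃ (d : ℕ) (κ : Fin d → ℝ) (e : Fin d → TangentSpace (𝓡 n) x), Orthonormal ℝ e ∧
      (∀ v, v ∈ Submodule.span ℝ (range e) ↔ mvfderiv (𝓡 n) r x v = 0) ∧
      ∀ i, -leviCivita n (gradientField n r) x (e i) = κ i • e i := by
  have hd := (smoothFieldAt_gradientField hr).diffFieldAt
  let A : TangentSpace (𝓡 n) x →ₗ[ℝ] TangentSpace (𝓡 n) x := -leviCivitaHom hd
  have hA : ∀ v, A v = -leviCivita n (gradientField n r) x v := fun v ↦ rfl
  let K : Submodule ℝ (TangentSpace (𝓡 n) x) := (mvfderiv (𝓡 n) r x).toLinearMap.ker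
  have hK : ∀ v, v ∈ K ↔ mvfderiv (𝓡 n) r x v = 0 := fun v ↦ Iff.rfl
  have hsym : A.IsSymmetric := by
    intro v w
    rw [hA, hA, inner_neg_left, inner_neg_right, inner_leviCivita_gradientField_symm hr v w,
      real_inner_comm]
  have hinv : ∀ v ∈ K, A v ∈ K := by
    intro v _
    rw [hK, ← inner_gradientField, hA, inner_neg_right, real_inner_comm,
      inner_leviCivita_self hd (c := 1) _ v, neg_zero]
    filter_upwards [h1] with y hy
    rw [real_inner_self_eq_norm_sq, hy]
  have hsymK := hsym.restrict_invariant hinv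
  let b := hsymK.eigenvectorBasis (n := Module.finrank ℝ K) rfl
  refine ⟨Module.finrank ℝ K, hsymK.eigenvalues rfl, fun i ↦ (b i : TangentSpace (𝓡 n) x), ?_, ?_,
    ?_⟩
  · exact b.orthonormal.comp_linearIsometry K.subtypeₗᵢ
  · intro v
    have h2 : (Submodule.span ℝ (range fun i ↦ (b i : TangentSpace (𝓡 n) x))) = K := by
      have h3 : range (fun i ↦ (b i : TangentSpace (𝓡 n) x)) = K.subtype '' range b := by
        rw [← range_comp]
        rfl
      rw [h3, Submodule.span_image, ← OrthonormalBasis.coe_toBasis, Module.Basis.span_eq,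
        Submodule.map_top, Submodule.range_subtype]
    rw [h2, hK]
  · intro i
    have h2 := hsymK.apply_eigenvectorBasis rfl i
    have h3 := congrArg (Subtype.val) h2
    exact h3

theorem hasConstantPrincipalCurvatures_orbit {G : Type*} [Group G] [MulAction G N]
    (hG : ∀ g : G, ContMDiff (𝓡 n) (𝓡 n) ∞ (fun y : N ↦ g • y))
    (hiso : ∀ g : G, PreservesMetric (n := n) (fun y : N ↦ g • y)) {U : Set N} (hU : IsOpen U)
    (hUG : ∀ (g : G), ∀ x ∈ U, g • x ∈ U) {r : N → ℝ} (hr : ContMDiffOn (𝓡 n) 𝓘(ℝ, ℝ) ∞ r U)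
    (hrG : ∀ (g : G), ∀ x ∈ U, r (g • x) = r x) (h1 : ∀ x ∈ U, ‖gradientField n r x‖ ^ 2 = 1)
    {p : N} (hp : p ∈ U)
    (ht : ∀ q ∈ orbit G p,
      tangentVectors n (orbit G p) q = {v | mvfderiv (𝓡 n) r q v = 0}) :
    HasConstantPrincipalCurvatures n (orbit G p) := by
  have hrU : ∀ x ∈ U, ContMDiffAt (𝓡 n) 𝓘(ℝ, ℝ) ∞ r x :=
    fun x hx ↦ hr.contMDiffAt (hU.mem_nhds hx)
  obtain ⟨d, κ, e, hon, hsp, hκ⟩ := exists_orthonormal_eigenvectors_hessian (hrU p hp)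
    (by filter_upwards [hU.mem_nhds hp] with y hy using h1 y hy)
  have hPU : orbit G p ⊆ U := by
    rintro _ ⟨g, rfl⟩
    exact hUG g p hp
  refine ⟨U, gradientField n r, hU, hPU, fun x hx ↦
    (smoothFieldAt_gradientField (hrU x hx)).contMDiffWithinAt, ?_, d, κ, ?_⟩
  · intro q hq
    refine ⟨(pow_eq_one_iff_of_nonneg (norm_nonneg _) two_ne_zero).1 (h1 q (hPU hq)), fun v hv ↦ ?_⟩
    rw [ht q hq] at hv
    rw [real_inner_comm, inner_gradientField]
    exact hv
  · rintro _ ⟨g, rfl⟩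
    have hg := hiso g
    have hfφ : ∀ᶠ y in 𝓝 p, r (g • y) = r y := by
      filter_upwards [hU.mem_nhds hp] with y hy using hrG g y hy
    have hrg := hrU _ (hUG g p hp)
    refine ⟨fun i ↦ mfderiv (𝓡 n) (𝓡 n) (fun y : N ↦ g • y) p (e i), ?_, ?_, ?_⟩
    · rw [orthonormal_iff_ite]
      intro i j
      exact (hg p _ _).trans (orthonormal_iff_ite.1 hon i j)
    · rw [ht _ ⟨g, rfl⟩]
      ext u
      obtain ⟨w, rfl⟩ : ∃ w, mfderiv (𝓡 n) (𝓡 n) (fun y : N ↦ g • y) p w = u :=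
        ⟨_, (hg.isInvertible p).self_apply_inverse u⟩
      have h3 : range (fun i ↦ mfderiv (𝓡 n) (𝓡 n) (fun y : N ↦ g • y) p (e i)) =
          (mfderiv (𝓡 n) (𝓡 n) (fun y : N ↦ g • y) p).toLinearMap '' range e := by
        rw [← range_comp]
        rfl
      have h4 : mvfderiv (𝓡 n) r (g • p) (mfderiv (𝓡 n) (𝓡 n) (fun y : N ↦ g • y) p w) =
          mvfderiv (𝓡 n) r p w := by
        rw [← mvfderiv_congr hfφ]
        exact (mvfderiv_comp_map ((hG g).contMDiffAt.mdifferentiableAt (by simp))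
          (hrg.mdifferentiableAt (by simp)) w).symm
      have h5 : Function.Injective (mfderiv (𝓡 n) (𝓡 n) (fun y : N ↦ g • y) p) := by
        obtain ⟨L, hL⟩ := hg.isInvertible p
        rw [← hL]
        exact L.injective
      have h6 := h5.mem_set_image (s := (Submodule.span ℝ (range e) : Set (TangentSpace (𝓡 n) p)))
        (a := w)
      rw [h3, Submodule.span_image]
      change _ ↔ mvfderiv (𝓡 n) r (g • p) (mfderiv (𝓡 n) (𝓡 n) (fun y : N ↦ g • y) p w) = 0
      rw [h4, ← hsp w]
      exact h6
    · intro i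
      have h3 := hg.mfderiv_hessian (hG g) hrg hfφ (e i)
      have h4 := congrArg (mfderiv (𝓡 n) (𝓡 n) (fun y : N ↦ g • y) p) (hκ i)
      rw [map_neg, map_smul] at h4
      rw [← h4, ← h3]

end PrincipalCurvatures

/-! ### Charts from parametrizations -/

section ParamChart

variable {n : ℕ} {N : Type*} [TopologicalSpace N] [ChartedSpace (EuclideanSpace ℝ (Fin n)) N]
  [IsManifold (𝓡 n) ∞ N]

/-- A smooth map `Ψ` into a manifold whose expression in a chart has the identity as its
derivative at `0` is locally the inverse of a chart. -/
theorem exists_chart_of_param {e : OpenPartialHomeomorph N (EuclideanSpace ℝ (Fin n))}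
    (he : e ∈ IsManifold.maximalAtlas (𝓡 n) ∞ N) {Ψ : EuclideanSpace ℝ (Fin n) → N}
    {s : Set (EuclideanSpace ℝ (Fin n))} (hs : s ∈ 𝓝 0)
    (hΨ : ContMDiffOn (𝓡 n) (𝓡 n) ∞ Ψ s) (h0 : Ψ 0 ∈ e.source)
    (hd : HasFDerivAt (fun x ↦ e (Ψ x)) (ContinuousLinearMap.id ℝ _) 0)
    {W : Set N} (hW : W ∈ 𝓝 (Ψ 0)) {B : Set (EuclideanSpace ℝ (Fin n))} (hB : B ∈ 𝓝 0) :
    ∃ (Φ : OpenPartialHomeomorph N (EuclideanSpace ℝ (Fin n))) (δ : ℝ),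
      Φ ∈ IsManifold.maximalAtlas (𝓡 n) ∞ N ∧ 0 < δ ∧ Φ.target = Metric.ball 0 δ ∧
      Metric.ball 0 δ ⊆ B ∧ Φ.source ⊆ W ∧ Ψ 0 ∈ Φ.source ∧ Φ (Ψ 0) = 0 ∧
      EqOn Φ.symm Ψ (Metric.ball 0 δ) := by
  have hΨ0 : ContMDiffAt (𝓡 n) (𝓡 n) ∞ Ψ 0 := hΨ.contMDiffAt hs
  have hc : ContDiffAt ℝ ∞ (fun x ↦ e (Ψ x)) 0 :=
    ((contMDiffAt_of_mem_maximalAtlas he h0).comp 0 hΨ0).contDiffAt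
  have hd' : HasFDerivAt (fun x ↦ e (Ψ x))
      ((ContinuousLinearEquiv.refl ℝ (EuclideanSpace ℝ (Fin n)) :
        EuclideanSpace ℝ (Fin n) ≃L[ℝ] EuclideanSpace ℝ (Fin n)) :
        EuclideanSpace ℝ (Fin n) →L[ℝ] EuclideanSpace ℝ (Fin n)) 0 := hd
  let h := hc.toOpenPartialHomeomorph (fun x ↦ e (Ψ x)) hd' (by simp)
  have hh : ∀ x, h x = e (Ψ x) := fun x ↦ rfl
  have h0s : (0 : EuclideanSpace ℝ (Fin n)) ∈ h.source :=
    hc.mem_toOpenPartialHomeomorph_source hd' (by simp)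
  have hinv : ∀ᶠ x in 𝓝 (0 : EuclideanSpace ℝ (Fin n)),
      fderiv ℝ (fun x ↦ e (Ψ x)) x ∈ range ((↑) : (EuclideanSpace ℝ (Fin n) ≃L[ℝ]
        EuclideanSpace ℝ (Fin n)) → _) := by
    have h1 : ContinuousAt (fderiv ℝ (fun x ↦ e (Ψ x))) 0 :=
      (hc.fderiv_right (m := 0) (by simp)).continuousAt
    refine h1 ?_
    rw [hd'.fderiv]
    exact ContinuousLinearEquiv.nhds (ContinuousLinearEquiv.refl ℝ (EuclideanSpace ℝ (Fin n)))
  have hS : ∀ᶠ x in 𝓝 (0 : EuclideanSpace ℝ (Fin n)), x ∈ h.source ∧ s ∈ 𝓝 x ∧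
      Ψ x ∈ e.source ∧ Ψ x ∈ interior W ∧ x ∈ B ∧ fderiv ℝ (fun x ↦ e (Ψ x)) x ∈
        range ((↑) : (EuclideanSpace ℝ (Fin n) ≃L[ℝ] EuclideanSpace ℝ (Fin n)) → _) := by
    filter_upwards [h.open_source.mem_nhds h0s, eventually_mem_nhds_iff.2 hs,
      hΨ0.continuousAt.eventually (e.open_source.mem_nhds h0),
      hΨ0.continuousAt.eventually (isOpen_interior.mem_nhds (mem_interior_iff_mem_nhds.2 hW)),
      hB, hinv] with x h1 h2 h3 h4 h5 h6 using ⟨h1, h2, h3, h4, h5, h6⟩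
  obtain ⟨δ, hδ, hball⟩ := Metric.eventually_nhds_iff_ball.1 hS
  let Φ := (((e.trans h.symm).symm).restrOpen (Metric.ball 0 δ) Metric.isOpen_ball).symm
  have htar : Φ.target = Metric.ball 0 δ := by
    ext x
    simp only [Φ, OpenPartialHomeomorph.symm_target, OpenPartialHomeomorph.restrOpen_source,
      OpenPartialHomeomorph.symm_source, OpenPartialHomeomorph.trans_target]
    constructor
    · exact fun h1 ↦ h1.2
    · intro hx
      refine ⟨⟨(hball x hx).1, ?_⟩, hx⟩
      exact e.map_source (hball x hx).2.2.1
  have hsymm : EqOn Φ.symm Ψ (Metric.ball 0 δ) := by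
    intro x hx
    change e.symm (h x) = Ψ x
    rw [hh, e.left_inv (hball x hx).2.2.1]
  have hap : ∀ y, Φ y = h.symm (e y) := fun y ↦ rfl
  have hsrc : ∀ y ∈ Φ.source, ∃ x ∈ Metric.ball (0 : EuclideanSpace ℝ (Fin n)) δ, Ψ x = y := by
    intro y hy
    have h1 := Φ.map_source hy
    rw [htar] at h1
    exact ⟨_, h1, by rw [← hsymm h1, Φ.left_inv hy]⟩
  have h0b : (0 : EuclideanSpace ℝ (Fin n)) ∈ Metric.ball (0 : EuclideanSpace ℝ (Fin n)) δ :=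
    Metric.mem_ball_self hδ
  refine ⟨Φ, δ, ?_, hδ, htar, fun x hx ↦ (hball x hx).2.2.2.2.1, ?_, ?_, ?_, hsymm⟩
  · rw [IsManifold.mem_maximalAtlas_iff_contMDiffOn]
    constructor
    · intro y hy
      obtain ⟨x, hx, rfl⟩ := hsrc y hy
      obtain ⟨h1, h2, h3, h4, h5, ⟨L, hL⟩⟩ := hball x hx
      have h6 : ContDiffAt ℝ ∞ (fun x ↦ e (Ψ x)) x :=
        ((contMDiffAt_of_mem_maximalAtlas he h3).comp x (hΨ.contMDiffAt h2)).contDiffAt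
      have h7 : HasFDerivAt h (L : EuclideanSpace ℝ (Fin n) →L[ℝ] EuclideanSpace ℝ (Fin n))
          (h.symm (h x)) := by
        rw [h.left_inv h1, hL]
        exact (h6.differentiableAt (by simp)).hasFDerivAt
      have h8 : ContDiffAt ℝ ∞ h.symm (h x) :=
        h.contDiffAt_symm (h.map_source h1) h7 (by rw [h.left_inv h1]; exact h6)
      exact (ContMDiffAt.comp (g := h.symm) (Ψ x) h8.contMDiffAt
        (contMDiffAt_of_mem_maximalAtlas he h3)).contMDiffWithinAt
    · rw [htar]
      exact (hΨ.mono fun x hx ↦ mem_of_mem_nhds (hball x hx).2.1).congr hsymm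
  · intro y hy
    obtain ⟨x, hx, rfl⟩ := hsrc y hy
    exact interior_subset (hball x hx).2.2.2.1
  · have := Φ.symm.map_source (x := 0) (by rw [Φ.symm_source, htar]; exact h0b)
    rwa [hsymm h0b] at this
  · rw [← hsymm h0b, Φ.right_inv (by rw [htar]; exact h0b)]

end ParamChart

/-! ### A constant rank theorem -/

section ConstantRank

variable {F E : Type*} [NormedAddCommGroup F] [InnerProductSpace ℝ F] [FiniteDimensional ℝ F]
  [NormedAddCommGroup E] [InnerProductSpace ℝ E] [FiniteDimensional ℝ E]

/-- A pseudo-inverse of a linear map. -/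
theorem exists_pseudoInverse (L : F →L[ℝ] E) :
    ∃ A : E →L[ℝ] F, (∀ x, A (L x) = L.kerᗮ.starProjection x) ∧ (∀ v ∈ L.rangeᗮ, A v = 0) ∧
      (∀ v, A v ∈ L.kerᗮ) ∧ ∀ v, L (A v) = L.range.starProjection v := by
  let S : L.kerᗮ →ₗ[ℝ] E := L.toLinearMap ∘ₗ L.kerᗮ.subtype
  have hS : S.ker = ⊥ := by
    rw [LinearMap.ker_eq_bot']
    intro x hx
    have h1 : (x : F) ∈ L.ker := hx
    have h2 : inner ℝ (x : F) (x : F) = 0 := Submodule.inner_right_of_mem_orthogonal h1 x.2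
    exact Subtype.ext (inner_self_eq_zero.1 h2)
  obtain ⟨g, hg⟩ := S.exists_leftInverse_of_injective hS
  have hLP : ∀ x, L (L.kerᗮ.starProjection x) = L x := by
    intro x
    have h1 : L.ker.starProjection x + L.kerᗮ.starProjection x = x :=
      Submodule.starProjection_add_starProjection_orthogonal (K := L.ker) x
    have h2 : L (L.ker.starProjection x) = 0 := Submodule.starProjection_apply_mem L.ker x
    conv_rhs => rw [← h1, map_add, h2, zero_add]
  have hgL : ∀ x, ((g (L x) : L.kerᗮ) : F) = L.kerᗮ.starProjection x := by
    intro x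
    have h1 : g (S ⟨L.kerᗮ.starProjection x, Submodule.starProjection_apply_mem _ _⟩) =
        ⟨L.kerᗮ.starProjection x, Submodule.starProjection_apply_mem _ _⟩ :=
      LinearMap.congr_fun hg _
    have h2 : S ⟨L.kerᗮ.starProjection x, Submodule.starProjection_apply_mem _ _⟩ = L x := hLP x
    rw [h2] at h1
    rw [h1]
  refine ⟨(L.kerᗮ.subtype ∘ₗ g).toContinuousLinearMap ∘L L.range.starProjection, ?_, ?_, ?_, ?_⟩
  · intro x
    have h1 : L.range.starProjection (L x) = L x :=
      Submodule.starProjection_eq_self_iff.2 (LinearMap.mem_range_self _ x)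
    simp only [ContinuousLinearMap.comp_apply, h1]
    exact hgL x
  · intro v hv
    have h1 : L.range.starProjection v = 0 := (Submodule.starProjection_apply_eq_zero_iff _).2 hv
    simp only [ContinuousLinearMap.comp_apply, h1, map_zero]
  · intro v
    exact (g (L.range.starProjection v)).2
  · intro v
    obtain ⟨x, hx⟩ := Submodule.starProjection_apply_mem L.range v
    have hx' : L x = L.range.starProjection v := hx
    simp only [ContinuousLinearMap.comp_apply, ← hx']
    exact (congrArg L (hgL x)).trans (hLP x)

/-- If the rank of a linear map `D` does not exceed that of `L` and `A D + P` is injective, where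
`P` is the projection onto the kernel of `L`, then `A D` and `D` have the same kernel. -/
theorem ker_comp_eq_of_rank_le {L D : F →L[ℝ] E} {A : E →L[ℝ] F}
    (hrank : Module.finrank ℝ D.range ≤ Module.finrank ℝ L.range)
    (hinj : Function.Injective fun v ↦ A (D v) + L.ker.starProjection v) {v : F}
    (hv : A (D v) = 0) : D v = 0 := by
  have h1 : D.ker ≤ (A ∘L D).ker := by
    intro w hw
    have : D w = 0 := hw
    change A (D w) = 0
    rw [this, map_zero]
  have h2 : Module.finrank ℝ (A ∘L D).ker ≤ Module.finrank ℝ L.ker := by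
    let R : (A ∘L D).ker →ₗ[ℝ] L.ker :=
      L.ker.orthogonalProjectionOnto.toLinearMap ∘ₗ (A ∘L D).ker.subtype
    refine LinearMap.finrank_le_finrank_of_injective (f := R) ?_
    intro a b hab
    have hab' : L.ker.starProjection (a : F) = L.ker.starProjection (b : F) :=
      congrArg Subtype.val hab
    have ha : A (D a) = 0 := a.2
    have hb : A (D b) = 0 := b.2
    refine Subtype.ext (hinj ?_)
    simp only [ha, hb, hab']
  have h3 := LinearMap.finrank_range_add_finrank_ker D.toLinearMap
  have h4 := LinearMap.finrank_range_add_finrank_ker L.toLinearMap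
  have h5 : D.ker = (A ∘L D).ker :=
    Submodule.eq_of_le_of_finrank_le h1 (by
      change Module.finrank ℝ D.range ≤ Module.finrank ℝ L.range at hrank
      change Module.finrank ℝ (A ∘L D).ker ≤ Module.finrank ℝ D.ker
      change Module.finrank ℝ D.range + Module.finrank ℝ D.ker = _ at h3
      change Module.finrank ℝ L.range + Module.finrank ℝ L.ker = _ at h4
      omega)
  have h6 : v ∈ (A ∘L D).ker := hv
  rw [← h5] at h6
  exact h6

/-- The constant rank theorem. -/
theorem exists_straightening {f : F → E} {x₀ : F} (hf : ContDiffAt ℝ ∞ f x₀) (h0 : f x₀ = 0)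
    {A : E →L[ℝ] F}
    (hAL : ∀ x, A (fderiv ℝ f x₀ x) = (fderiv ℝ f x₀).kerᗮ.starProjection x)
    (hA : ∀ v, A v ∈ (fderiv ℝ f x₀).kerᗮ)
    (hrank : ∀ᶠ x in 𝓝 x₀, Module.finrank ℝ (fderiv ℝ f x).range ≤
      Module.finrank ℝ (fderiv ℝ f x₀).range) :
    ∃ h : OpenPartialHomeomorph F F, x₀ ∈ h.source ∧
      (∀ x, h x = A (f x) + (fderiv ℝ f x₀).ker.starProjection (x - x₀)) ∧
      HasFDerivAt h.symm (ContinuousLinearMap.id ℝ F) 0 ∧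
      ∀ᶠ w in 𝓝 0, f (h.symm w) = f (h.symm ((fderiv ℝ f x₀).kerᗮ.starProjection w)) := by
  set L := fderiv ℝ f x₀ with hL
  let θ : F → F := fun x ↦ A (f x) + L.ker.starProjection (x - x₀)
  have hθ : ContDiffAt ℝ ∞ θ x₀ := by
    refine (A.contDiff.contDiffAt.comp x₀ hf).add
      (L.ker.starProjection.contDiff.contDiffAt.comp x₀ (contDiffAt_id.sub contDiffAt_const))
  have hθ' : ∀ {x}, DifferentiableAt ℝ f x →
      HasFDerivAt θ (A ∘L fderiv ℝ f x + L.ker.starProjection) x := by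
    intro x hx
    refine (A.hasFDerivAt.comp x hx.hasFDerivAt).add ?_
    have := L.ker.starProjection.hasFDerivAt.comp x ((hasFDerivAt_id x).sub_const x₀)
    rw [ContinuousLinearMap.comp_id] at this
    exact this
  have hdf : DifferentiableAt ℝ f x₀ := hf.differentiableAt (by simp)
  have hid : A ∘L L + L.ker.starProjection = ContinuousLinearMap.id ℝ F := by
    ext x
    simp only [add_apply, ContinuousLinearMap.comp_apply, hAL, ContinuousLinearMap.id_apply]
    rw [add_comm]
    exact Submodule.starProjection_add_starProjection_orthogonal (K := L.ker) x
  have hd0 : HasFDerivAt θ ((ContinuousLinearEquiv.refl ℝ F : F ≃L[ℝ] F) : F →L[ℝ] F) x₀ := by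
    have := hθ' hdf
    rw [← hL, hid] at this
    exact this
  let h := hθ.toOpenPartialHomeomorph θ hd0 (by simp)
  have hh : ∀ x, h x = θ x := fun x ↦ rfl
  have h0s : x₀ ∈ h.source := hθ.mem_toOpenPartialHomeomorph_source hd0 (by simp)
  have hθ0 : θ x₀ = 0 := by simp [θ, h0]
  have hsymm0 : h.symm 0 = x₀ := by rw [← hθ0, ← hh, h.left_inv h0s]
  have h0t : (0 : F) ∈ h.target := by rw [← hθ0, ← hh]; exact h.map_source h0s
  have hev : ∀ᶠ x in 𝓝 x₀, x ∈ h.source ∧ DifferentiableAt ℝ f x ∧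
      Module.finrank ℝ (fderiv ℝ f x).range ≤ Module.finrank ℝ L.range ∧
      fderiv ℝ θ x ∈ range ((↑) : (F ≃L[ℝ] F) → F →L[ℝ] F) := by
    have h1 : ContinuousAt (fderiv ℝ θ) x₀ := (hθ.fderiv_right (m := 0) (by simp)).continuousAt
    have h2 : ∀ᶠ x in 𝓝 x₀, fderiv ℝ θ x ∈ range ((↑) : (F ≃L[ℝ] F) → F →L[ℝ] F) := by
      refine h1 ?_
      rw [hd0.fderiv]
      exact ContinuousLinearEquiv.nhds (ContinuousLinearEquiv.refl ℝ F)
    have h3 : ∀ᶠ x in 𝓝 x₀, DifferentiableAt ℝ f x := by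
      have := (hf.of_le (natCast_le_infty 1)).eventually (by simp)
      exact this.mono fun y hy ↦ hy.differentiableAt (by simp)
    filter_upwards [h.open_source.mem_nhds h0s, h3, hrank, h2] with x a b c d using ⟨a, b, c, d⟩
  have hcont : Tendsto h.symm (𝓝 0) (𝓝 x₀) := by
    have := h.symm.continuousAt (x := 0) h0t
    rwa [ContinuousAt, hsymm0] at this
  have hev2 : ∀ᶠ w in 𝓝 (0 : F), w ∈ h.target ∧ DifferentiableAt ℝ f (h.symm w) ∧
      Module.finrank ℝ (fderiv ℝ f (h.symm w)).range ≤ Module.finrank ℝ L.range ∧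
      fderiv ℝ θ (h.symm w) ∈ range ((↑) : (F ≃L[ℝ] F) → F →L[ℝ] F) := by
    filter_upwards [h.open_target.mem_nhds h0t, hcont.eventually hev] with w a b
    exact ⟨a, b.2⟩
  have hsd : ∀ w, w ∈ h.target ∧ DifferentiableAt ℝ f (h.symm w) ∧
      Module.finrank ℝ (fderiv ℝ f (h.symm w)).range ≤ Module.finrank ℝ L.range ∧
      fderiv ℝ θ (h.symm w) ∈ range ((↑) : (F ≃L[ℝ] F) → F →L[ℝ] F) → ∀ u ∈ L.ker,
      HasFDerivAt (fun w ↦ f (h.symm w)) (fderiv ℝ (fun w ↦ f (h.symm w)) w) w ∧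
        fderiv ℝ (fun w ↦ f (h.symm w)) w u = 0 := by
    rintro w ⟨hw, hdw, hrw, ⟨M, hM⟩⟩ u hu
    have h1 := hθ' hdw
    have h2 : HasFDerivAt h (M : F →L[ℝ] F) (h.symm w) := by
      rw [hM]
      exact h1.differentiableAt.hasFDerivAt
    have h3 := h.hasFDerivAt_symm hw h2
    have h4 : HasFDerivAt (fun w ↦ f (h.symm w))
        (fderiv ℝ f (h.symm w) ∘L (M.symm : F →L[ℝ] F)) w := hdw.hasFDerivAt.comp w h3
    refine ⟨h4.differentiableAt.hasFDerivAt, ?_⟩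
    rw [h4.fderiv]
    have h5 : ∀ v, M v = A (fderiv ℝ f (h.symm w) v) + L.ker.starProjection v := by
      intro v
      have : (M : F →L[ℝ] F) = A ∘L fderiv ℝ f (h.symm w) + L.ker.starProjection := by
        rw [hM, h1.fderiv]
      exact DFunLike.congr_fun this v
    refine ker_comp_eq_of_rank_le (A := A) hrw ?_ ?_
    · intro a b hab
      exact M.injective ((h5 a).trans (hab.trans (h5 b).symm))
    · have h6 := h5 (M.symm u)
      rw [M.apply_symm_apply] at h6
      have h7 : A (fderiv ℝ f (h.symm w) (M.symm u)) ∈ L.ker := by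
        rw [← sub_eq_iff_eq_add] at h6
        rw [← h6]
        exact L.ker.sub_mem hu (Submodule.starProjection_apply_mem _ _)
      have h8 := Submodule.inner_right_of_mem_orthogonal h7 (hA (fderiv ℝ f (h.symm w) (M.symm u)))
      exact inner_self_eq_zero.1 h8
  refine ⟨h, h0s, fun x ↦ rfl, ?_, ?_⟩
  · have h1 : HasFDerivAt h ((ContinuousLinearEquiv.refl ℝ F : F ≃L[ℝ] F) : F →L[ℝ] F)
      (h.symm 0) := by rw [hsymm0]; exact hd0
    exact h.hasFDerivAt_symm h0t h1
  · obtain ⟨ε, hε, hball⟩ := Metric.eventually_nhds_iff_ball.1 hev2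
    filter_upwards [Metric.ball_mem_nhds 0 hε] with w hw
    set w' := L.kerᗮ.starProjection w with hw'
    have hw'b : w' ∈ Metric.ball (0 : F) ε := by
      rw [mem_ball_zero_iff] at hw ⊢
      exact (Submodule.norm_starProjection_apply_le _ _).trans_lt hw
    have hu : w - w' ∈ L.ker := by
      have := Submodule.starProjection_add_starProjection_orthogonal (K := L.ker) w
      rw [← hw'] at this
      rw [← this, add_sub_cancel_right]
      exact Submodule.starProjection_apply_mem _ _
    have hseg : ∀ τ ∈ Icc (0 : ℝ) 1, w' + τ • (w - w') ∈ Metric.ball (0 : F) ε := by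
      intro τ hτ
      exact (convex_ball (0 : F) ε).add_smul_sub_mem hw'b hw hτ
    have hder : ∀ τ ∈ Icc (0 : ℝ) 1,
        HasDerivAt (fun τ : ℝ ↦ f (h.symm (w' + τ • (w - w')))) 0 τ := by
      intro τ hτ
      obtain ⟨h1, h2⟩ := hsd _ (hball _ (hseg τ hτ)) _ hu
      have h3 : HasDerivAt (fun τ : ℝ ↦ w' + τ • (w - w')) (w - w') τ := by
        simpa using! ((hasDerivAt_id τ).smul_const (w - w')).const_add w'
      have h4 := h1.comp_hasDerivAt τ h3
      rwa [h2] at h4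
    have := constant_of_has_deriv_right_zero
      (fun τ hτ ↦ (hder τ hτ).continuousAt.continuousWithinAt)
      (fun τ hτ ↦ (hder τ (Ico_subset_Icc_self hτ)).hasDerivWithinAt) 1 (by simp)
    simpa using this

end ConstantRank

/-! ### Orbit maps and slices -/

/-- Points of an orbit near `p` are translates of `p` by elements near `1`. -/
theorem exists_nhds_orbit {G N : Type*} [TopologicalSpace G] [Group G] [ContinuousMul G]
    [CompactSpace G] [TopologicalSpace N] [T2Space N] [MulAction G N] [ContinuousSMul G N] (p : N)
    {O : Set G} (hO : O ∈ 𝓝 1) :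
    ∃ W ∈ 𝓝 p, ∀ y ∈ W, y ∈ orbit G p → ∃ g ∈ O, y = g • p := by
  have hc : Continuous fun g : G ↦ g • p := by fun_prop
  let K : Set G := {g | ∀ h ∈ stabilizer G p, g * h ∉ interior O}
  have hK : IsClosed K := by
    have : K = ⋂ h ∈ stabilizer G p, (fun g : G ↦ g * h) ⁻¹' (interior O)ᶜ := by
      ext g
      simp [K]
    rw [this]
    exact isClosed_biInter fun h _ ↦ isOpen_interior.isClosed_compl.preimage
      (continuous_mul_const h)
  have hKp : IsClosed ((fun g : G ↦ g • p) '' K) := (hK.isCompact.image hc).isClosed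
  have hp : p ∉ (fun g : G ↦ g • p) '' K := by
    rintro ⟨g, hg, hgp⟩
    have h1 : g⁻¹ ∈ stabilizer G p := by
      rw [inv_mem_iff]
      exact hgp
    have h2 := hg _ h1
    rw [mul_inv_cancel] at h2
    exact h2 (mem_interior_iff_mem_nhds.2 hO)
  refine ⟨((fun g : G ↦ g • p) '' K)ᶜ, hKp.isOpen_compl.mem_nhds hp, ?_⟩
  rintro y hy ⟨g, rfl⟩
  have h1 : g ∉ K := fun h ↦ hy ⟨g, h, rfl⟩
  simp only [K, mem_ofPred_eq, not_forall, not_not] at h1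
  obtain ⟨h, hh, h2⟩ := h1
  refine ⟨g * h, interior_subset h2, ?_⟩
  rw [mul_smul, mem_stabilizer_iff.1 hh]

section Orbit

variable {m n : ℕ} {G : Type*} [TopologicalSpace G] [ChartedSpace (EuclideanSpace ℝ (Fin m)) G]
  [Group G] [LieGroup (𝓡 m) ∞ G] {N : Type*} [TopologicalSpace N]
  [ChartedSpace (EuclideanSpace ℝ (Fin n)) N] [IsManifold (𝓡 n) ∞ N]
  [MulAction G N] [ContMDiffSMul (𝓡 m) (𝓡 n) ∞ G N]

omit [LieGroup (𝓡 m) ∞ G] [IsManifold (𝓡 n) ∞ N] in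
variable (m n G N) in
theorem contMDiff_smul_prod :
    ContMDiff ((𝓡 m).prod (𝓡 n)) (𝓡 n) ∞ (fun q : G × N ↦ q.1 • q.2) := contMDiff_smul

omit [LieGroup (𝓡 m) ∞ G] [IsManifold (𝓡 n) ∞ N] in
variable (m n G) in
theorem contMDiff_orbitMap (p : N) : ContMDiff (𝓡 m) (𝓡 n) ∞ (fun g : G ↦ g • p) :=
  (contMDiff_smul_prod m n G N).comp (contMDiff_id.prodMk contMDiff_const)

theorem contMDiff_smul_left (m n : ℕ) {G : Type*} [TopologicalSpace G]
    [ChartedSpace (EuclideanSpace ℝ (Fin m)) G] [Group G] {N : Type*} [TopologicalSpace N]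
    [ChartedSpace (EuclideanSpace ℝ (Fin n)) N] [MulAction G N]
    [ContMDiffSMul (𝓡 m) (𝓡 n) ∞ G N] (g : G) : ContMDiff (𝓡 n) (𝓡 n) ∞ (fun y : N ↦ g • y) :=
  (contMDiff_smul_prod m n G N).comp (contMDiff_const.prodMk contMDiff_id)

theorem finrank_range_comp_comp_le {V₁ V₂ V₃ V₄ : Type*} [AddCommGroup V₁] [Module ℝ V₁]
    [AddCommGroup V₂] [Module ℝ V₂] [AddCommGroup V₃] [Module ℝ V₃] [AddCommGroup V₄] [Module ℝ V₄]
    [FiniteDimensional ℝ V₃] [FiniteDimensional ℝ V₄]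
    (A : V₃ →ₗ[ℝ] V₄) (B : V₂ →ₗ[ℝ] V₃) (C : V₁ →ₗ[ℝ] V₂) :
    Module.finrank ℝ (A ∘ₗ B ∘ₗ C).range ≤ Module.finrank ℝ B.range := by
  have h1 : (A ∘ₗ B ∘ₗ C).range ≤ B.range.map A := by
    rintro _ ⟨x, rfl⟩
    exact ⟨B (C x), ⟨C x, rfl⟩, rfl⟩
  exact (Submodule.finrank_mono h1).trans (Submodule.finrank_map_le _ _)

variable (m n) in
theorem finrank_range_mfderiv_orbitMap_le (g : G) (p : N) :
    Module.finrank ℝ (mfderiv (𝓡 m) (𝓡 n) (fun h : G ↦ h • p) g).range ≤ orbitDim m n G p := by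
  have hα : MDifferentiable (𝓡 m) (𝓡 n) (fun h : G ↦ h • p) :=
    (contMDiff_orbitMap m n G p).mdifferentiable (by simp)
  have hφ : MDifferentiable (𝓡 n) (𝓡 n) (fun y : N ↦ g • y) :=
    (contMDiff_smul_left m n g).mdifferentiable (by simp)
  have hl : MDifferentiable (𝓡 m) (𝓡 m) (fun h : G ↦ g⁻¹ * h) :=
    (contMDiff_mul_left (I := 𝓡 m) (n := ∞)).mdifferentiable (by simp)
  have h1 : (fun h : G ↦ h • p) =
      (fun y : N ↦ g • y) ∘ (fun h : G ↦ h • p) ∘ (fun h : G ↦ g⁻¹ * h) := by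
    ext h
    simp [smul_smul]
  have h2 : mfderiv (𝓡 m) (𝓡 n) (fun h : G ↦ h • p) g =
      (mfderiv (𝓡 n) (𝓡 n) (fun y : N ↦ g • y) ((g⁻¹ * g) • p)).comp
        ((mfderiv (𝓡 m) (𝓡 n) (fun h : G ↦ h • p) (g⁻¹ * g)).comp
          (mfderiv (𝓡 m) (𝓡 m) (fun h : G ↦ g⁻¹ * h) g)) := by
    conv_lhs => rw [h1]
    rw [mfderiv_comp g (hφ _) ((hα _).comp g (hl g)), mfderiv_comp g (hα _) (hl g)]
    rfl
  rw [h2]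
  have h3 := finrank_range_comp_comp_le
    (mfderiv (𝓡 n) (𝓡 n) (fun y : N ↦ g • y) ((g⁻¹ * g) • p)).toLinearMap
    (mfderiv (𝓡 m) (𝓡 n) (fun h : G ↦ h • p) (g⁻¹ * g)).toLinearMap
    (mfderiv (𝓡 m) (𝓡 m) (fun h : G ↦ g⁻¹ * h) g).toLinearMap
  have h4 : ∀ k : G, k = 1 → Module.finrank ℝ
      (mfderiv (𝓡 m) (𝓡 n) (fun h : G ↦ h • p) k).range = orbitDim m n G p := by
    rintro _ rfl
    rfl
  exact h3.trans (h4 _ (inv_mul_cancel g)).le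

theorem orbitDim_smul (g : G) (p : N) : orbitDim m n G (g • p) = orbitDim m n G p := by
  have key : ∀ (g : G) (p : N), orbitDim m n G (g • p) ≤ orbitDim m n G p := by
    intro g p
    have hα : MDifferentiable (𝓡 m) (𝓡 n) (fun h : G ↦ h • p) :=
      (contMDiff_orbitMap m n G p).mdifferentiable (by simp)
    have hr : MDifferentiable (𝓡 m) (𝓡 m) (fun h : G ↦ h * g) :=
      (contMDiff_mul_right (I := 𝓡 m) (n := ∞)).mdifferentiable (by simp)
    have h1 : (fun h : G ↦ h • g • p) = (fun h : G ↦ h • p) ∘ (fun h : G ↦ h * g) := by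
      ext h
      simp [smul_smul]
    have h2 : mfderiv (𝓡 m) (𝓡 n) (fun h : G ↦ h • g • p) 1 =
        (mfderiv (𝓡 m) (𝓡 n) (fun h : G ↦ h • p) (1 * g)).comp
          (mfderiv (𝓡 m) (𝓡 m) (fun h : G ↦ h * g) 1) := by
      rw [h1, mfderiv_comp 1 (hα _) (hr _)]
    have h3 := finrank_range_comp_comp_le LinearMap.id
      (mfderiv (𝓡 m) (𝓡 n) (fun h : G ↦ h • p) (1 * g)).toLinearMap
      (mfderiv (𝓡 m) (𝓡 m) (fun h : G ↦ h * g) 1).toLinearMap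
    rw [orbitDim, h2]
    exact h3.trans (finrank_range_mfderiv_orbitMap_le m n (1 * g) p)
  refine le_antisymm (key g p) ?_
  have := key g⁻¹ (g • p)
  rwa [inv_smul_smul] at this

variable (m n G) in
/-- A chart around `p` adapted to the action of `G`. -/
structure IsSliceChart (p : N) (Φ : OpenPartialHomeomorph N (EuclideanSpace ℝ (Fin n)))
    (T : Submodule ℝ (EuclideanSpace ℝ (Fin n))) (δ : ℝ) : Prop where
  mem_maximalAtlas : Φ ∈ IsManifold.maximalAtlas (𝓡 n) ∞ N
  pos : 0 < δ
  target_eq : Φ.target = Metric.ball 0 δ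
  mem_source : p ∈ Φ.source
  map_base : Φ p = 0
  finrank_eq : Module.finrank ℝ T = orbitDim m n G p
  exists_smul : ∀ x ∈ Metric.ball (0 : EuclideanSpace ℝ (Fin n)) δ,
    ∃ g : G, Φ.symm x = g • Φ.symm (Tᗮ.starProjection x)
  mem_orbit_iff : ∀ y ∈ Φ.source, y ∈ orbit G p ↔ Φ y ∈ T

end Orbit

theorem mfderiv_eq_fderiv_chart {m n : ℕ} {M N : Type*} [TopologicalSpace M]
    [ChartedSpace (EuclideanSpace ℝ (Fin m)) M] [TopologicalSpace N]
    [ChartedSpace (EuclideanSpace ℝ (Fin n)) N] {f : M → N} {x : M}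
    (hf : MDifferentiableAt (𝓡 m) (𝓡 n) f x) :
    mfderiv (𝓡 m) (𝓡 n) f x =
      fderiv ℝ (fun z ↦ chartAt (EuclideanSpace ℝ (Fin n)) (f x)
        (f ((chartAt (EuclideanSpace ℝ (Fin m)) x).symm z)))
        (chartAt (EuclideanSpace ℝ (Fin m)) x x) := by
  rw [hf.mfderiv]
  simp only [ModelWithCorners.range_eq_univ, fderivWithin_univ]
  rfl

section Slice

variable {m n : ℕ} {G : Type*} [TopologicalSpace G] [ChartedSpace (EuclideanSpace ℝ (Fin m)) G]
  [Group G] [LieGroup (𝓡 m) ∞ G] [CompactSpace G] {N : Type*} [TopologicalSpace N] [T2Space N]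
  [ChartedSpace (EuclideanSpace ℝ (Fin n)) N] [IsManifold (𝓡 n) ∞ N]
  [MulAction G N] [ContMDiffSMul (𝓡 m) (𝓡 n) ∞ G N]

omit [CompactSpace G] [T2Space N] in
/-- The rank of an orbit map, read in charts, is at most the dimension of the orbit. -/
theorem finrank_range_fderiv_orbitMap_le (p : N)
    {Φ : OpenPartialHomeomorph N (EuclideanSpace ℝ (Fin n))}
    (hΦ : Φ ∈ IsManifold.maximalAtlas (𝓡 n) ∞ N)
    {c : OpenPartialHomeomorph G (EuclideanSpace ℝ (Fin m))}
    (hc : c ∈ IsManifold.maximalAtlas (𝓡 m) ∞ G) {x : EuclideanSpace ℝ (Fin m)}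
    (hx : x ∈ c.target) (hxp : c.symm x • p ∈ Φ.source) :
    Module.finrank ℝ (fderiv ℝ (fun x ↦ Φ (c.symm x • p)) x).range ≤ orbitDim m n G p := by
  have h1 : MDifferentiableAt (𝓡 m) (𝓡 m) c.symm x :=
    (contMDiffAt_symm_of_mem_maximalAtlas hc hx).mdifferentiableAt (by simp)
  have h2 : MDifferentiable (𝓡 m) (𝓡 n) (fun h : G ↦ h • p) :=
    (contMDiff_orbitMap m n G p).mdifferentiable (by simp)
  have h3 : MDifferentiableAt (𝓡 n) (𝓡 n) Φ (c.symm x • p) :=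
    (contMDiffAt_of_mem_maximalAtlas hΦ hxp).mdifferentiableAt (by simp)
  have h4 : fderiv ℝ (fun x ↦ Φ (c.symm x • p)) x =
      (mfderiv (𝓡 n) (𝓡 n) Φ (c.symm x • p)).comp
        ((mfderiv (𝓡 m) (𝓡 n) (fun h : G ↦ h • p) (c.symm x)).comp
          (mfderiv (𝓡 m) (𝓡 m) c.symm x)) := by
    rw [← mfderiv_eq_fderiv]
    have h5 : (fun x ↦ Φ (c.symm x • p)) = Φ ∘ (fun h : G ↦ h • p) ∘ c.symm := rfl
    rw [h5, mfderiv_comp x h3 ((h2 _).comp x h1), mfderiv_comp x (h2 _) h1]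
    rfl
  rw [h4]
  have h5 := finrank_range_comp_comp_le (mfderiv (𝓡 n) (𝓡 n) Φ (c.symm x • p)).toLinearMap
    (mfderiv (𝓡 m) (𝓡 n) (fun h : G ↦ h • p) (c.symm x)).toLinearMap
    (mfderiv (𝓡 m) (𝓡 m) c.symm x).toLinearMap
  exact h5.trans (finrank_range_mfderiv_orbitMap_le m n _ p)

/-- The derivative at the origin of the slice parametrization is the identity. -/
theorem hasFDerivAt_slice_param (p : N)
    {e : OpenPartialHomeomorph N (EuclideanSpace ℝ (Fin n))}
    (he : e ∈ IsManifold.maximalAtlas (𝓡 n) ∞ N) (hp : p ∈ e.source)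
    {c : OpenPartialHomeomorph G (EuclideanSpace ℝ (Fin m))}
    (hc : c ∈ IsManifold.maximalAtlas (𝓡 m) ∞ G) (h1 : (1 : G) ∈ c.source)
    {A : EuclideanSpace ℝ (Fin n) →L[ℝ] EuclideanSpace ℝ (Fin m)}
    {P : EuclideanSpace ℝ (Fin n) →L[ℝ] EuclideanSpace ℝ (Fin n)}
    (hAP : ∀ x, fderiv ℝ (fun x ↦ e (c.symm x • p)) (c 1) (A x) + P x = x) :
    HasFDerivAt (fun x ↦ e (c.symm (c 1 + A x) • e.symm (e p + P x)))
      (ContinuousLinearMap.id ℝ _) 0 := by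
  let H : EuclideanSpace ℝ (Fin m) × EuclideanSpace ℝ (Fin n) → EuclideanSpace ℝ (Fin n) :=
    fun q ↦ e (c.symm q.1 • e.symm q.2)
  have hH : DifferentiableAt ℝ H (c 1, e p) := by
    have h2 : ContMDiffAt (𝓘(ℝ, EuclideanSpace ℝ (Fin m) × EuclideanSpace ℝ (Fin n))) (𝓡 n) ∞ H
        (c 1, e p) := by
      have h3 : ContMDiffAt (𝓘(ℝ, EuclideanSpace ℝ (Fin m) × EuclideanSpace ℝ (Fin n))) (𝓡 m) ∞
          (fun q : EuclideanSpace ℝ (Fin m) × EuclideanSpace ℝ (Fin n) ↦ c.symm q.1)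
          (c 1, e p) :=
        ContMDiffAt.comp (g := c.symm) (c 1, e p)
          (contMDiffAt_symm_of_mem_maximalAtlas hc (c.map_source h1))
          contDiffAt_fst.contMDiffAt
      have h4 : ContMDiffAt (𝓘(ℝ, EuclideanSpace ℝ (Fin m) × EuclideanSpace ℝ (Fin n))) (𝓡 n) ∞
          (fun q : EuclideanSpace ℝ (Fin m) × EuclideanSpace ℝ (Fin n) ↦ e.symm q.2)
          (c 1, e p) :=
        ContMDiffAt.comp (g := e.symm) (c 1, e p)
          (contMDiffAt_symm_of_mem_maximalAtlas he (e.map_source hp))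
          contDiffAt_snd.contMDiffAt
      have h5 := (contMDiff_smul_prod m n G N).contMDiffAt.comp (c 1, e p) (h3.prodMk h4)
      refine ContMDiffAt.comp (g := e) (c 1, e p) ?_ h5
      refine contMDiffAt_of_mem_maximalAtlas he ?_
      simp only [c.left_inv h1, e.left_inv hp, one_smul, hp]
    exact h2.contDiffAt.differentiableAt (by simp)
  have hD := hH.hasFDerivAt
  set D := fderiv ℝ H (c 1, e p)
  have hD1 : ∀ v, D (v, 0) = fderiv ℝ (fun x ↦ e (c.symm x • p)) (c 1) v := by
    intro v
    have h2 : HasFDerivAt (fun x : EuclideanSpace ℝ (Fin m) ↦ (x, e p))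
      (ContinuousLinearMap.inl ℝ _ _) (c 1) := hasFDerivAt_prodMk_left _ _
    have h3 := hD.comp (c 1) h2
    have h4 : (H ∘ fun x : EuclideanSpace ℝ (Fin m) ↦ (x, e p)) = fun x ↦ e (c.symm x • p) := by
      ext1 x
      simp only [H, Function.comp, e.left_inv hp]
    rw [h4] at h3
    rw [h3.fderiv]
    rfl
  have hD2 : ∀ v, D (0, v) = v := by
    intro v
    have h2 : HasFDerivAt (fun x : EuclideanSpace ℝ (Fin n) ↦ (c 1, x))
      (ContinuousLinearMap.inr ℝ _ _) (e p) := hasFDerivAt_prodMk_right _ _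
    have h3 := hD.comp (e p) h2
    have h4 : (H ∘ fun x : EuclideanSpace ℝ (Fin n) ↦ (c 1, x)) =ᶠ[𝓝 (e p)] id := by
      filter_upwards [e.open_target.mem_nhds (e.map_source hp)] with x hx
      simp only [H, Function.comp, c.left_inv h1, one_smul, e.right_inv hx, id]
    have h5 := h3.unique ((hasFDerivAt_id (𝕜 := ℝ) (e p)).congr_of_eventuallyEq h4)
    have h6 := DFunLike.congr_fun h5 v
    exact h6
  have h2 : HasFDerivAt (fun x ↦ (c 1 + A x, e p + P x)) (A.prod P) 0 :=
    (A.hasFDerivAt.const_add _).prodMk (P.hasFDerivAt.const_add _)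
  have h3 : HasFDerivAt H D ((fun x ↦ (c 1 + A x, e p + P x)) 0) := by simpa using hD
  have h4 := h3.comp (0 : EuclideanSpace ℝ (Fin n)) h2
  have h5 : D ∘L (A.prod P) = ContinuousLinearMap.id ℝ _ := by
    ext1 x
    change D (A x, P x) = x
    have : (A x, P x) = (A x, (0 : EuclideanSpace ℝ (Fin n))) + (0, P x) := by simp
    rw [this, map_add, hD1, hD2, hAP]
  rw [h5] at h4
  exact h4

variable (m n G) in
theorem exists_isSliceChart_and_curves (p : N) {W : Set N} (hW : W ∈ 𝓝 p) :
    (∃ Φ T δ, IsSliceChart m n G p Φ T δ ∧ Φ.source ⊆ W) ∧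
    ∀ ξ : TangentSpace (𝓡 m) (1 : G), mfderiv (𝓡 m) (𝓡 n) (fun g : G ↦ g • p) 1 ξ = 0 →
      ∃ γ : ℝ → G, γ 0 = 1 ∧
        HasMFDerivAt 𝓘(ℝ, ℝ) (𝓡 m) γ 0 ((1 : ℝ →L[ℝ] ℝ).smulRight ξ) ∧
        ∀ᶠ t in 𝓝 0, γ t ∈ stabilizer G p := by
  have : IsTopologicalGroup G := topologicalGroup_of_lieGroup (𝓡 m) ∞
  have : ContinuousSMul G N := ContMDiffSMul.continuousSMul (I := 𝓡 m) (I' := 𝓡 n) ∞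
  let e := chartAt (EuclideanSpace ℝ (Fin n)) ((1 : G) • p)
  let c := chartAt (EuclideanSpace ℝ (Fin m)) (1 : G)
  have he : e ∈ IsManifold.maximalAtlas (𝓡 n) ∞ N := IsManifold.chart_mem_maximalAtlas _
  have hc : c ∈ IsManifold.maximalAtlas (𝓡 m) ∞ G := IsManifold.chart_mem_maximalAtlas _
  have hp : p ∈ e.source := by
    have h : (1 : G) • p ∈ e.source := mem_chart_source _ _
    rwa [one_smul] at h
  have h1 : (1 : G) ∈ c.source := mem_chart_source _ _
  have hct : c 1 ∈ c.target := c.map_source h1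
  let L := fderiv ℝ (fun x ↦ e (c.symm x • p)) (c 1)
  have hL : mfderiv (𝓡 m) (𝓡 n) (fun g : G ↦ g • p) 1 = L :=
    mfderiv_eq_fderiv_chart ((contMDiff_orbitMap m n G p).mdifferentiable (by simp) _)
  have hdim : Module.finrank ℝ L.range = orbitDim m n G p := by
    rw [orbitDim, hL]
    rfl
  obtain ⟨A, hAL, hA0, hAK, hLA⟩ := exists_pseudoInverse L
  let T := L.range
  let P := Tᗮ.starProjection
  have hTP : ∀ x, T.starProjection x + P x = x :=
    fun x ↦ Submodule.starProjection_add_starProjection_orthogonal (K := T) x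
  let Ψ : EuclideanSpace ℝ (Fin n) → N := fun x ↦ c.symm (c 1 + A x) • e.symm (e p + P x)
  have hΨ0 : Ψ 0 = p := by
    simp only [Ψ, map_zero, add_zero, c.left_inv h1, one_smul, e.left_inv hp]
  let s : Set (EuclideanSpace ℝ (Fin n)) := {x | c 1 + A x ∈ c.target ∧ e p + P x ∈ e.target}
  have hs : s ∈ 𝓝 0 := by
    have a1 : ContinuousAt (fun x ↦ c 1 + A x) 0 := by fun_prop
    have a2 : ContinuousAt (fun x ↦ e p + P x) 0 := by fun_prop
    refine Filter.inter_mem (a1 ?_) (a2 ?_)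
    · beta_reduce
      rw [map_zero, add_zero]
      exact c.open_target.mem_nhds hct
    · beta_reduce
      rw [map_zero, add_zero]
      exact e.open_target.mem_nhds (e.map_source hp)
  have hΨ : ContMDiffOn (𝓡 n) (𝓡 n) ∞ Ψ s := by
    have a1 : ContMDiff (𝓡 n) (𝓡 m) ∞ (fun x ↦ c 1 + A x) :=
      (contDiff_const.add A.contDiff).contMDiff
    have a2 : ContMDiff (𝓡 n) (𝓡 n) ∞ (fun x ↦ e p + P x) :=
      (contDiff_const.add P.contDiff).contMDiff
    have a3 := (contMDiffOn_symm_of_mem_maximalAtlas hc).comp (a1.contMDiffOn (s := s))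
      fun x hx ↦ hx.1
    have a4 := (contMDiffOn_symm_of_mem_maximalAtlas he).comp (a2.contMDiffOn (s := s))
      fun x hx ↦ hx.2
    exact (contMDiff_smul_prod m n G N).comp_contMDiffOn (a3.prodMk a4)
  have hd : HasFDerivAt (fun x ↦ e (Ψ x)) (ContinuousLinearMap.id ℝ _) 0 := by
    refine hasFDerivAt_slice_param p he hp hc h1 fun x ↦ ?_
    change L (A x) + P x = x
    rw [hLA]
    exact hTP x
  have hAP : ∀ x, A (P x) = 0 := fun x ↦ hA0 _ (Submodule.starProjection_apply_mem _ x)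
  have hPP : ∀ x, P (P x) = P x := fun x ↦
    Submodule.starProjection_eq_self_iff.2 (Submodule.starProjection_apply_mem _ x)
  -- for every small chart the orbit map takes values in `T`
  have key : ∀ (Φ : OpenPartialHomeomorph N (EuclideanSpace ℝ (Fin n))) (δ : ℝ),
      Φ ∈ IsManifold.maximalAtlas (𝓡 n) ∞ N → 0 < δ → Φ.target = Metric.ball 0 δ →
      p ∈ Φ.source → Φ p = 0 → EqOn Φ.symm Ψ (Metric.ball 0 δ) →
      (∀ᶠ x in 𝓝 (c 1), Φ (c.symm x • p) ∈ T) ∧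
      ∀ ξ, L ξ = 0 → ∃ γ : ℝ → EuclideanSpace ℝ (Fin m), γ 0 = c 1 ∧ HasDerivAt γ ξ 0 ∧
        ∀ᶠ t in 𝓝 0, c.symm (γ t) • p = p := by
    intro Φ δ hΦ hδ htar hpΦ hΦp hsymm
    let f : EuclideanSpace ℝ (Fin m) → EuclideanSpace ℝ (Fin n) := fun x ↦ Φ (c.symm x • p)
    have hf0 : f (c 1) = 0 := by simp only [f, c.left_inv h1, one_smul, hΦp]
    have hcs : ContinuousAt (fun x ↦ c.symm x • p) (c 1) :=
      (c.symm.continuousAt hct).smul continuousAt_const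
    have hcs1 : c.symm (c 1) • p = p := by rw [c.left_inv h1, one_smul]
    have hsrc : ∀ᶠ x in 𝓝 (c 1), c.symm x • p ∈ Φ.source :=
      hcs (by beta_reduce; rw [hcs1]; exact Φ.open_source.mem_nhds hpΦ)
    have hf : ContDiffAt ℝ ∞ f (c 1) := by
      have a1 : ContMDiffAt (𝓡 m) (𝓡 n) ∞ (fun x ↦ c.symm x • p) (c 1) :=
        (contMDiff_orbitMap m n G p).contMDiffAt.comp (c 1)
          (contMDiffAt_symm_of_mem_maximalAtlas hc hct)
      exact (ContMDiffAt.comp (g := Φ) (c 1) (contMDiffAt_of_mem_maximalAtlas hΦ hsrc.self_of_nhds)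
        a1).contDiffAt
    have hfL : fderiv ℝ f (c 1) = L := by
      have a1 : (fun x ↦ e (c.symm x • p)) =ᶠ[𝓝 (c 1)] (fun x ↦ e (Ψ x)) ∘ f := by
        filter_upwards [hsrc] with x hx
        have a2 := Φ.map_source hx
        rw [htar] at a2
        change _ = e (Ψ (Φ (c.symm x • p)))
        rw [← hsymm a2, Φ.left_inv hx]
      have a2 : HasFDerivAt ((fun x ↦ e (Ψ x)) ∘ f)
          ((ContinuousLinearMap.id ℝ _).comp (fderiv ℝ f (c 1))) (c 1) := by
        refine HasFDerivAt.comp (c 1) ?_ (hf.differentiableAt (by simp)).hasFDerivAt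
        rw [hf0]
        exact hd
      have a3 := (a2.congr_of_eventuallyEq a1).fderiv
      rw [ContinuousLinearMap.id_comp] at a3
      exact a3.symm
    have hrank : ∀ᶠ x in 𝓝 (c 1), Module.finrank ℝ (fderiv ℝ f x).range ≤
        Module.finrank ℝ (fderiv ℝ f (c 1)).range := by
      rw [hfL, hdim]
      filter_upwards [hsrc, c.open_target.mem_nhds hct] with x hx hxt
      exact finrank_range_fderiv_orbitMap_le p hΦ hc hxt hx
    obtain ⟨h, h0s, hh, hhd, hstr⟩ := exists_straightening hf hf0 (A := A)
      (by rw [hfL]; exact hAL) (by rw [hfL]; exact hAK) hrank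
    rw [hfL] at hh hstr
    have hh0 : h (c 1) = 0 := by rw [hh, hf0, sub_self, map_zero, map_zero, add_zero]
    have hsymm0 : h.symm 0 = c 1 := by rw [← hh0, h.left_inv h0s]
    constructor
    · have hΨt : ∀ᶠ u in 𝓝 (0 : EuclideanSpace ℝ (Fin m)), c 1 + A (L u) ∈ h.source ∧
          L u ∈ Metric.ball (0 : EuclideanSpace ℝ (Fin n)) δ := by
        have a1 : ContinuousAt (fun u ↦ c 1 + A (L u)) 0 := by fun_prop
        have a2 : ContinuousAt (fun u ↦ L u) 0 := by fun_prop
        refine (a1.eventually (p := (· ∈ h.source)) ?_).and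
          (a2.eventually (p := (· ∈ Metric.ball (0 : EuclideanSpace ℝ (Fin n)) δ)) ?_)
        · beta_reduce
          rw [map_zero, map_zero, add_zero]
          exact h.open_source.mem_nhds h0s
        · beta_reduce
          rw [map_zero]
          exact Metric.ball_mem_nhds 0 hδ
      have hP0 : Tendsto (fun w ↦ L.kerᗮ.starProjection w) (𝓝 0) (𝓝 0) := by
        have : ContinuousAt (fun w ↦ L.kerᗮ.starProjection w) 0 := by fun_prop
        simpa [ContinuousAt] using this
      have a3 : ∀ᶠ w in 𝓝 (0 : EuclideanSpace ℝ (Fin m)), f (h.symm w) ∈ T := by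
        filter_upwards [hstr, hP0.eventually hΨt] with w hw ⟨b1, b2⟩
        rw [hw]
        set u := L.kerᗮ.starProjection w
        have hu : u ∈ L.kerᗮ := Submodule.starProjection_apply_mem _ w
        have hALu : A (L u) = u := by rw [hAL, Submodule.starProjection_eq_self_iff.2 hu]
        have hLu : P (L u) = 0 := by
          refine (Submodule.starProjection_apply_eq_zero_iff _).2 ?_
          exact Submodule.le_orthogonal_orthogonal _ (LinearMap.mem_range_self _ u)
        have hfu : f (c 1 + A (L u)) = L u := by
          have : Ψ (L u) = c.symm (c 1 + A (L u)) • p := by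
            simp only [Ψ, hLu, add_zero, e.left_inv hp]
          simp only [f]
          rw [← this, ← hsymm b2, Φ.right_inv (by rw [htar]; exact b2)]
        have hhu : h (c 1 + A (L u)) = u := by
          rw [hh, hfu, add_sub_cancel_left, hALu]
          have : L.ker.starProjection u = 0 := (Submodule.starProjection_apply_eq_zero_iff _).2 hu
          rw [this, add_zero]
        rw [← hhu, h.left_inv b1, hfu]
        exact LinearMap.mem_range_self _ u
      have a4 : ContinuousAt h (c 1) := h.continuousAt h0s
      filter_upwards [a4.eventually (by rw [hh0]; exact a3), h.open_source.mem_nhds h0s] with x b1 b2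
      rw [h.left_inv b2] at b1
      exact b1
    · intro ξ hξ
      refine ⟨fun t ↦ h.symm (t • ξ), by beta_reduce; rw [zero_smul, hsymm0], ?_, ?_⟩
      · have a1 : HasDerivAt (fun t : ℝ ↦ t • ξ) ξ 0 := by
          simpa using! (hasDerivAt_id (0 : ℝ)).smul_const ξ
        have a2 : HasFDerivAt h.symm (ContinuousLinearMap.id ℝ _) ((0 : ℝ) • ξ) := by
          rw [zero_smul]
          exact hhd
        exact a2.comp_hasDerivAt (0 : ℝ) a1
      · have a1 : Tendsto (fun t : ℝ ↦ t • ξ) (𝓝 0) (𝓝 0) := by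
          have : ContinuousAt (fun t : ℝ ↦ t • ξ) 0 := by fun_prop
          simpa [ContinuousAt] using this
        have a2 : Tendsto (fun t : ℝ ↦ h.symm (t • ξ)) (𝓝 0) (𝓝 (c 1)) := by
          have b1 : ContinuousAt h.symm 0 := hhd.continuousAt
          have := b1.tendsto.comp a1
          rwa [hsymm0] at this
        filter_upwards [a1.eventually hstr, a2.eventually hsrc] with t ht hts
        have b1 : L.kerᗮ.starProjection (t • ξ) = 0 := by
          refine (Submodule.starProjection_apply_eq_zero_iff _).2 ?_
          refine Submodule.le_orthogonal_orthogonal _ (Submodule.smul_mem _ _ ?_)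
          exact hξ
        rw [b1, hsymm0, hf0] at ht
        refine Φ.injOn hts hpΦ ?_
        rw [hΦp]
        exact ht
  constructor
  · -- choose the chart so small that it meets the orbit only near `p`
    obtain ⟨Φ, δ, hΦ, hδ, htar, -, hsW, hpΦ, hΦp, hsymm⟩ :=
      exists_chart_of_param he hs hΨ (by rw [hΨ0]; exact hp) hd (W := W) (by rw [hΨ0]; exact hW)
        (B := univ) Filter.univ_mem
    rw [hΨ0] at hpΦ hΦp
    obtain ⟨hk1, -⟩ := key Φ δ hΦ hδ htar hpΦ hΦp hsymm
    have hO : {g : G | g ∈ c.source ∧ Φ (g • p) ∈ T} ∈ 𝓝 (1 : G) := by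
      have a1 : ContinuousAt c 1 := c.continuousAt h1
      filter_upwards [a1.eventually hk1, c.open_source.mem_nhds h1] with g b1 b2
      rw [c.left_inv b2] at b1
      exact ⟨b2, b1⟩
    obtain ⟨W', hW', horb⟩ := exists_nhds_orbit p hO
    obtain ⟨Φ', δ', hΦ', hδ', htar', hsub, hsW', hpΦ', hΦp', hsymm'⟩ :=
      exists_chart_of_param he hs hΨ (by rw [hΨ0]; exact hp) hd (W := W ∩ W' ∩ Φ.source)
        (by rw [hΨ0]; exact inter_mem (inter_mem hW hW') (Φ.open_source.mem_nhds hpΦ))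
        (B := Metric.ball 0 δ) (Metric.ball_mem_nhds 0 hδ)
    rw [hΨ0] at hpΦ' hΦp'
    have hball : ∀ x ∈ Metric.ball (0 : EuclideanSpace ℝ (Fin n)) δ',
        P x ∈ Metric.ball (0 : EuclideanSpace ℝ (Fin n)) δ' := by
      intro x hx
      rw [mem_ball_zero_iff] at hx ⊢
      exact (Submodule.norm_starProjection_apply_le _ _).trans_lt hx
    have hagree : ∀ y ∈ Φ'.source, Φ' y = Φ y := by
      intro y hy
      have b1 := Φ'.map_source hy
      rw [htar'] at b1
      have b2 : Φ.symm (Φ' y) = Φ'.symm (Φ' y) := by rw [hsymm' b1, hsymm (hsub b1)]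
      rw [Φ'.left_inv hy] at b2
      conv_rhs => rw [← b2]
      rw [Φ.right_inv (by rw [htar]; exact hsub b1)]
    have hsm : ∀ x ∈ Metric.ball (0 : EuclideanSpace ℝ (Fin n)) δ',
        ∃ g : G, Φ'.symm x = g • Φ'.symm (P x) := by
      intro x hx
      refine ⟨c.symm (c 1 + A x), ?_⟩
      rw [hsymm' hx, hsymm' (hball x hx)]
      simp only [Ψ, hAP, hPP, add_zero, c.left_inv h1, one_smul]
    refine ⟨Φ', T, δ', ⟨hΦ', hδ', htar', hpΦ', hΦp', hdim, hsm, ?_⟩, fun y hy ↦ (hsW' hy).1.1⟩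
    intro y hy
    constructor
    · intro hyo
      obtain ⟨g, hg, rfl⟩ := horb y (hsW' hy).1.2 hyo
      rw [hagree _ hy]
      exact hg.2
    · intro hyT
      have b1 := Φ'.map_source hy
      rw [htar'] at b1
      obtain ⟨g, hg⟩ := hsm _ b1
      have b2 : P (Φ' y) = 0 := by
        refine (Submodule.starProjection_apply_eq_zero_iff _).2 ?_
        exact Submodule.le_orthogonal_orthogonal _ hyT
      rw [b2, Φ'.left_inv hy] at hg
      have b3 : Φ'.symm 0 = p := by rw [← hΦp', Φ'.left_inv hpΦ']
      rw [b3] at hg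
      exact ⟨g, hg.symm⟩
  · intro ξ hξ
    obtain ⟨Φ, δ, hΦ, hδ, htar, -, -, hpΦ, hΦp, hsymm⟩ :=
      exists_chart_of_param he hs hΨ (by rw [hΨ0]; exact hp) hd (W := W) (by rw [hΨ0]; exact hW)
        (B := univ) Filter.univ_mem
    rw [hΨ0] at hpΦ hΦp
    obtain ⟨-, hk2⟩ := key Φ δ hΦ hδ htar hpΦ hΦp hsymm
    rw [hL] at hξ
    obtain ⟨γ, hγ0, hγ, hst⟩ := hk2 ξ hξ
    refine ⟨fun t ↦ c.symm (γ t), by beta_reduce; rw [hγ0, c.left_inv h1], ⟨?_, ?_⟩, hst⟩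
    · refine ContinuousAt.comp (g := c.symm) ?_ hγ.continuousAt
      rw [hγ0]
      exact c.symm.continuousAt hct
    · have a0 : c.symm (γ 0) = 1 := by rw [hγ0, c.left_inv h1]
      have a1 : ∀ᶠ t in 𝓝 (0 : ℝ), c (c.symm (γ t)) = γ t := by
        have := hγ.continuousAt.eventually (by rw [hγ0]; exact c.open_target.mem_nhds hct)
        exact this.mono fun t ht ↦ c.right_inv ht
      have a2 : HasDerivAt (fun t ↦ c (c.symm (γ t))) ξ 0 :=
        hγ.congr_of_eventuallyEq a1
      have a3 : chartAt (EuclideanSpace ℝ (Fin m)) (c.symm (γ 0)) = c := by rw [a0]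
      have a4 : writtenInExtChartAt 𝓘(ℝ, ℝ) (𝓡 m) 0 (fun t ↦ c.symm (γ t)) =
          fun t ↦ c (c.symm (γ t)) := by
        ext1 t
        simp only [writtenInExtChartAt, extChartAt, a3]
        rfl
      rw [a4]
      exact a2.hasFDerivAt.hasFDerivWithinAt

end Slice

section OrbitDim

variable {m n : ℕ} {G : Type*} [TopologicalSpace G] [ChartedSpace (EuclideanSpace ℝ (Fin m)) G]
  [Group G] [LieGroup (𝓡 m) ∞ G] [CompactSpace G] {N : Type*} [TopologicalSpace N] [T2Space N]
  [ChartedSpace (EuclideanSpace ℝ (Fin n)) N] [IsManifold (𝓡 n) ∞ N]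
  [MulAction G N] [ContMDiffSMul (𝓡 m) (𝓡 n) ∞ G N]

variable (m n G) in
theorem exists_isSliceChart (p : N) {W : Set N} (hW : W ∈ 𝓝 p) :
    ∃ Φ T δ, IsSliceChart m n G p Φ T δ ∧ Φ.source ⊆ W :=
  (exists_isSliceChart_and_curves m n G p hW).1

/-- Orbits are embedded submanifolds. -/
theorem isSubmanifoldAt_orbit (p : N) :
    IsSubmanifoldAt n (orbit G p) p (orbitDim m n G p) := by
  obtain ⟨Φ, T, δ, h, -⟩ := exists_isSliceChart m n G p (W := univ) Filter.univ_mem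
  refine ⟨Φ, h.mem_maximalAtlas, h.mem_source, T, h.finrank_eq, fun q hq ↦ ?_⟩
  rw [h.map_base, sub_zero, h.mem_orbit_iff q hq]

/-- If the isotropy group of `p` is contained in that of `q`, then the orbit of `p` has at least
the dimension of the orbit of `q`. -/
theorem orbitDim_le_of_stabilizer_le {p q : N}
    (h : stabilizer G p ≤ stabilizer G q) :
    orbitDim m n G q ≤ orbitDim m n G p := by
  have hα : ∀ q : N, MDifferentiable (𝓡 m) (𝓡 n) (fun h : G ↦ h • q) := fun q ↦
    (contMDiff_orbitMap m n G q).mdifferentiable (by simp)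
  let Lp : EuclideanSpace ℝ (Fin m) →ₗ[ℝ] EuclideanSpace ℝ (Fin n) :=
    (mfderiv (𝓡 m) (𝓡 n) (fun g : G ↦ g • p) 1).toLinearMap
  let Lq : EuclideanSpace ℝ (Fin m) →ₗ[ℝ] EuclideanSpace ℝ (Fin n) :=
    (mfderiv (𝓡 m) (𝓡 n) (fun g : G ↦ g • q) 1).toLinearMap
  have h1 : Lp.ker ≤ Lq.ker := by
    intro ξ hξ
    obtain ⟨γ, hγ0, hγ, hst⟩ := (exists_isSliceChart_and_curves m n G p
      (W := univ) Filter.univ_mem).2 ξ hξ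
    have h2 : HasMFDerivAt (𝓡 m) (𝓡 n) (fun g : G ↦ g • q) (γ 0)
        (mfderiv (𝓡 m) (𝓡 n) (fun g : G ↦ g • q) (γ 0)) := (hα q _).hasMFDerivAt
    have h3 := h2.comp (0 : ℝ) hγ
    have h4 : ((fun g : G ↦ g • q) ∘ γ) =ᶠ[𝓝 0] fun _ ↦ q := by
      filter_upwards [hst] with t ht
      exact mem_stabilizer_iff.1 (h ht)
    have h5 : HasMFDerivAt 𝓘(ℝ, ℝ) (𝓡 n) ((fun g : G ↦ g • q) ∘ γ) 0 0 :=
      (hasMFDerivAt_const q (0 : ℝ)).congr_of_eventuallyEq h4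
    have h6 := hasMFDerivAt_unique h3 h5
    have h7 := DFunLike.congr_fun h6 (1 : ℝ)
    rw [hγ0] at h7
    change mfderiv (𝓡 m) (𝓡 n) (fun g : G ↦ g • q) 1 ((1 : ℝ) • ξ) = 0 at h7
    rw [one_smul ℝ ξ] at h7
    exact h7
  have h2 := LinearMap.finrank_range_add_finrank_ker Lp
  have h3 := LinearMap.finrank_range_add_finrank_ker Lq
  have h4 := Submodule.finrank_mono h1
  change Module.finrank ℝ Lq.range ≤ Module.finrank ℝ Lp.range
  omega

omit [CompactSpace G] [T2Space N] in
/-- The dimension of orbits is lower semicontinuous. -/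
theorem eventually_orbitDim_le (p : N) : ∀ᶠ y in 𝓝 p, orbitDim m n G p ≤ orbitDim m n G y := by
  have : ContinuousSMul G N := ContMDiffSMul.continuousSMul (I := 𝓡 m) (I' := 𝓡 n) ∞
  let e := chartAt (EuclideanSpace ℝ (Fin n)) ((1 : G) • p)
  let c := chartAt (EuclideanSpace ℝ (Fin m)) (1 : G)
  have he : e ∈ IsManifold.maximalAtlas (𝓡 n) ∞ N := IsManifold.chart_mem_maximalAtlas _
  have hc : c ∈ IsManifold.maximalAtlas (𝓡 m) ∞ G := IsManifold.chart_mem_maximalAtlas _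
  have hp : p ∈ e.source := by
    have h : (1 : G) • p ∈ e.source := mem_chart_source _ _
    rwa [one_smul] at h
  have h1 : (1 : G) ∈ c.source := mem_chart_source _ _
  have hct : c 1 ∈ c.target := c.map_source h1
  have hL : mfderiv (𝓡 m) (𝓡 n) (fun g : G ↦ g • p) 1 =
      fderiv ℝ (fun x ↦ e (c.symm x • p)) (c 1) :=
    mfderiv_eq_fderiv_chart ((contMDiff_orbitMap m n G p).mdifferentiable (by simp) _)
  let L := fderiv ℝ (fun x ↦ e (c.symm x • p)) (c 1)
  have hdim : Module.finrank ℝ L.range = orbitDim m n G p := by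
    rw [orbitDim, hL]
    rfl
  let H : EuclideanSpace ℝ (Fin m) × EuclideanSpace ℝ (Fin n) → EuclideanSpace ℝ (Fin n) :=
    fun q ↦ e (c.symm q.1 • e.symm q.2)
  have hH : ContDiffAt ℝ ∞ H (c 1, e p) := by
    have h3 : ContMDiffAt (𝓘(ℝ, EuclideanSpace ℝ (Fin m) × EuclideanSpace ℝ (Fin n))) (𝓡 m) ∞
        (fun q : EuclideanSpace ℝ (Fin m) × EuclideanSpace ℝ (Fin n) ↦ c.symm q.1)
        (c 1, e p) :=
      ContMDiffAt.comp (g := c.symm) (c 1, e p)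
        (contMDiffAt_symm_of_mem_maximalAtlas hc (c.map_source h1))
        contDiffAt_fst.contMDiffAt
    have h4 : ContMDiffAt (𝓘(ℝ, EuclideanSpace ℝ (Fin m) × EuclideanSpace ℝ (Fin n))) (𝓡 n) ∞
        (fun q : EuclideanSpace ℝ (Fin m) × EuclideanSpace ℝ (Fin n) ↦ e.symm q.2)
        (c 1, e p) :=
      ContMDiffAt.comp (g := e.symm) (c 1, e p)
        (contMDiffAt_symm_of_mem_maximalAtlas he (e.map_source hp))
        contDiffAt_snd.contMDiffAt
    have h5 := (contMDiff_smul_prod m n G N).contMDiffAt.comp (c 1, e p) (h3.prodMk h4)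
    have h6 : ContMDiffAt (𝓘(ℝ, EuclideanSpace ℝ (Fin m) × EuclideanSpace ℝ (Fin n))) (𝓡 n) ∞ H
        (c 1, e p) := by
      refine ContMDiffAt.comp (g := e) (c 1, e p) ?_ h5
      refine contMDiffAt_of_mem_maximalAtlas he ?_
      simp only [c.left_inv h1, e.left_inv hp, one_smul, hp]
    exact h6.contDiffAt
  have hev : ∀ᶠ q in 𝓝 (c 1, e p), DifferentiableAt ℝ H q := by
    have := (hH.of_le (natCast_le_infty 1)).eventually (by simp)
    exact this.mono fun y hy ↦ hy.differentiableAt (by simp)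
  have hcont : ContinuousAt (fun y : N ↦ (c 1, e y)) p :=
    continuousAt_const.prodMk (e.continuousAt hp)
  have hD : ∀ᶠ y in 𝓝 p, ∀ v,
      fderiv ℝ (fun x ↦ e (c.symm x • y)) (c 1) v = fderiv ℝ H (c 1, e y) (v, 0) := by
    filter_upwards [hcont.eventually hev, e.open_source.mem_nhds hp] with y hy hye v
    have h3 := hy.hasFDerivAt.comp (c 1) (hasFDerivAt_prodMk_left (𝕜 := ℝ) (c 1) (e y))
    have h4 : (H ∘ fun x : EuclideanSpace ℝ (Fin m) ↦ (x, e y)) = fun x ↦ e (c.symm x • y) := by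
      ext1 x
      simp only [H, Function.comp, e.left_inv hye]
    rw [h4] at h3
    rw [h3.fderiv]
    rfl
  have hDc : ∀ v, ContinuousAt (fun y : N ↦ fderiv ℝ H (c 1, e y) (v, 0)) p := by
    intro v
    have h3 : ContinuousAt (fderiv ℝ H) (c 1, e p) :=
      (hH.fderiv_right (m := 0) (by simp)).continuousAt
    have h4 : ContinuousAt (fun y : N ↦ fderiv ℝ H (c 1, e y)) p :=
      ContinuousAt.comp (f := fun y : N ↦ (c 1, e y)) h3 hcont
    exact h4.clm_apply continuousAt_const
  let b := Module.finBasis ℝ L.range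
  choose w hw using fun i ↦ (b i).2
  have hli : LinearIndependent ℝ (fun i ↦ fderiv ℝ H (c 1, e p) (w i, 0)) := by
    have h3 : (fun i ↦ fderiv ℝ H (c 1, e p) (w i, 0)) = fun i ↦ (b i : EuclideanSpace ℝ (Fin n)) := by
      ext1 i
      rw [← hD.self_of_nhds]
      exact hw i
    rw [h3]
    exact b.linearIndependent.map' L.range.subtype (Submodule.ker_subtype _)
  have hev2 : ∀ᶠ y in 𝓝 p, LinearIndependent ℝ (fun i ↦ fderiv ℝ H (c 1, e y) (w i, 0)) := by
    have h3 : ContinuousAt (fun y : N ↦ fun i ↦ fderiv ℝ H (c 1, e y) (w i, 0)) p :=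
      continuousAt_pi.2 fun i ↦ hDc (w i)
    exact h3.eventually (isOpen_setOfPred_linearIndependent.mem_nhds hli)
  have hsrc : ∀ᶠ y in 𝓝 p, c.symm (c 1) • y ∈ e.source := by
    have h3 : ContinuousAt (fun y : N ↦ c.symm (c 1) • y) p := by fun_prop
    refine h3.eventually (e.open_source.mem_nhds ?_)
    beta_reduce
    rwa [c.left_inv h1, one_smul]
  filter_upwards [hD, hev2, hsrc] with y hy hy2 hy3
  refine le_trans ?_ (finrank_range_fderiv_orbitMap_le y he hc hct hy3)
  have h3 : LinearIndependent ℝ (fun i ↦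
      (⟨fderiv ℝ (fun x ↦ e (c.symm x • y)) (c 1) (w i), LinearMap.mem_range_self _ _⟩ :
        (fderiv ℝ (fun x ↦ e (c.symm x • y)) (c 1)).range)) := by
    refine LinearIndependent.of_comp (Submodule.subtype _) ?_
    have h4 : (Submodule.subtype _ ∘ fun i ↦
      (⟨fderiv ℝ (fun x ↦ e (c.symm x • y)) (c 1) (w i), LinearMap.mem_range_self _ _⟩ :
        (fderiv ℝ (fun x ↦ e (c.symm x • y)) (c 1)).range)) =
        fun i ↦ fderiv ℝ H (c 1, e y) (w i, 0) := by
      ext1 i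
      exact hy (w i)
    rw [h4]
    exact hy2
  have h4 := h3.fintype_card_le_finrank
  rw [Fintype.card_fin, hdim] at h4
  exact h4

end OrbitDim

/-! ### Averaging over a compact group -/

section Average

open MeasureTheory

variable {m n : ℕ} {G : Type*} [TopologicalSpace G] [ChartedSpace (EuclideanSpace ℝ (Fin m)) G]
  [Group G] [LieGroup (𝓡 m) ∞ G] [CompactSpace G] {N : Type*} [TopologicalSpace N]
  [ChartedSpace (EuclideanSpace ℝ (Fin n)) N] [IsManifold (𝓡 n) ∞ N]
  [MulAction G N] [ContMDiffSMul (𝓡 m) (𝓡 n) ∞ G N]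

omit [CompactSpace G] [IsManifold (𝓡 n) ∞ N] in
variable (m n G) in
theorem contMDiff_inv_smul : ContMDiff ((𝓡 n).prod (𝓡 m)) (𝓡 n) ∞
    (fun q : N × G ↦ q.2⁻¹ • q.1) :=
  (contMDiff_smul_prod m n G N).comp (contMDiff_snd.inv.prodMk contMDiff_fst)

theorem contMDiff_integral_smul
    (hG : ContMDiff ((𝓡 n).prod (𝓡 m)) (𝓡 n) ∞ (fun q : N × G ↦ q.2⁻¹ • q.1)) [MeasurableSpace G] [BorelSpace G] (μ : Measure G)
    [IsFiniteMeasure μ] {ψ : N → ℝ} (hψ : ContMDiff (𝓡 n) 𝓘(ℝ, ℝ) ∞ ψ) :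
    ContMDiff (𝓡 n) 𝓘(ℝ, ℝ) ∞ (fun y ↦ ∫ g : G, ψ (g⁻¹ • y) ∂μ) := by
  intro y₀
  let e := chartAt (EuclideanSpace ℝ (Fin n)) y₀
  have he : e ∈ IsManifold.maximalAtlas (𝓡 n) ∞ N := IsManifold.chart_mem_maximalAtlas _
  have hy : y₀ ∈ e.source := mem_chart_source _ _
  let f : EuclideanSpace ℝ (Fin n) → G → ℝ := fun x g ↦ ψ (g⁻¹ • e.symm x)
  have hf : ContMDiffOn (𝓘(ℝ, EuclideanSpace ℝ (Fin n)).prod (𝓡 m)) 𝓘(ℝ, ℝ) ∞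
      (Function.uncurry f) (e.target ×ˢ univ) := by
    have h1 : ContMDiffOn (𝓘(ℝ, EuclideanSpace ℝ (Fin n)).prod (𝓡 m)) (𝓡 n) ∞
        (fun q : EuclideanSpace ℝ (Fin n) × G ↦ e.symm q.1) (e.target ×ˢ univ) :=
      (contMDiffOn_symm_of_mem_maximalAtlas he).comp contMDiffOn_fst fun q hq ↦ hq.1
    have h2 := hG.comp_contMDiffOn (h1.prodMk contMDiffOn_snd)
    exact hψ.comp_contMDiffOn h2
  have h1 : ContDiffOn ℝ ∞ (fun x ↦ ∫ g, f x g ∂μ) e.target := by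
    rw [contDiffOn_infty]
    intro k
    exact IsContDiffFamily.contDiffOn_integral μ e.open_target k
      (isContDiffFamily_of_contMDiffOn e.open_target k hf)
  have h2 : ContMDiffAt (𝓡 n) 𝓘(ℝ, ℝ) ∞ (fun y ↦ ∫ g, f (e y) g ∂μ) y₀ :=
    ContMDiffAt.comp (g := fun x ↦ ∫ g, f x g ∂μ) y₀
      (h1.contDiffAt (e.open_target.mem_nhds (e.map_source hy))).contMDiffAt
      (contMDiffAt_of_mem_maximalAtlas he hy)
  refine h2.congr_of_eventuallyEq ?_
  filter_upwards [e.open_source.mem_nhds hy] with y hy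
  simp only [f, e.left_inv hy]

omit [CompactSpace G] [TopologicalSpace N] [LieGroup (𝓡 m) ∞ G]
  [ChartedSpace (EuclideanSpace ℝ (Fin m)) G] in
theorem integral_smul_smul [IsTopologicalGroup G] [MeasurableSpace G] [BorelSpace G]
    (μ : Measure G) [μ.IsMulLeftInvariant] (ψ : N → ℝ) (h : G) (y : N) :
    ∫ g : G, ψ (g⁻¹ • h • y) ∂μ = ∫ g : G, ψ (g⁻¹ • y) ∂μ := by
  rw [← integral_mul_left_eq_self (μ := μ) (fun g ↦ ψ (g⁻¹ • h • y)) h]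
  refine integral_congr_ae (Eventually.of_forall fun g ↦ ?_)
  simp [smul_smul, mul_assoc]

/-- Near a point of a slice chart, the component of the chart transverse to the orbit extends to
a smooth map on the whole manifold which vanishes on the orbit. -/
theorem IsSliceChart.exists_transverse_map [T2Space N] {p : N}
    {Φ : OpenPartialHomeomorph N (EuclideanSpace ℝ (Fin n))}
    {T : Submodule ℝ (EuclideanSpace ℝ (Fin n))} {δ : ℝ} (h : IsSliceChart m n G p Φ T δ) :
    ∃ w : N → EuclideanSpace ℝ (Fin n), ContMDiff (𝓡 n) (𝓡 n) ∞ w ∧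
      (∀ᶠ y in 𝓝 p, w y = Tᗮ.starProjection (Φ y)) ∧ ∀ g : G, w (g • p) = 0 := by
  obtain ⟨χ, -, hχ⟩ := (SmoothBumpFunction.nhds_basis_tsupport (I := 𝓡 n) p).mem_iff.1
    (Φ.open_source.mem_nhds h.mem_source)
  refine ⟨fun y ↦ χ y • Tᗮ.starProjection (Φ y), ?_, ?_, ?_⟩
  · refine contMDiff_of_tsupport fun y hy ↦ ?_
    have h1 : y ∈ Φ.source := by
      refine hχ (closure_mono ?_ hy)
      intro z hz hz0
      rw [Function.mem_support] at hz
      exact hz (by simp [hz0])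
    have h2 : ContMDiffAt (𝓡 n) (𝓡 n) ∞ (fun y ↦ Tᗮ.starProjection (Φ y)) y :=
      ContMDiffAt.comp (g := fun x ↦ Tᗮ.starProjection x) y
        Tᗮ.starProjection.contDiff.contDiffAt.contMDiffAt
        (contMDiffAt_of_mem_maximalAtlas h.mem_maximalAtlas h1)
    exact χ.contMDiffAt.smul h2
  · filter_upwards [χ.eventuallyEq_one] with y hy
    rw [hy]
    simp
  · intro g
    by_cases hg : g • p ∈ Φ.source
    · have h1 : Φ (g • p) ∈ T := (h.mem_orbit_iff _ hg).1 ⟨g, rfl⟩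
      have h2 : Tᗮ.starProjection (Φ (g • p)) = 0 :=
        (Submodule.starProjection_apply_eq_zero_iff _).2 (Submodule.le_orthogonal_orthogonal _ h1)
      simp [h2]
    · have h1 : χ (g • p) = 0 := by
        by_contra h2
        exact hg (hχ (subset_tsupport _ h2))
      simp [h1]

end Average

section Radial

variable {E : Type*} [NormedAddCommGroup E] [NormedSpace ℝ E]

/-- A function which grows quadratically in the directions of a subspace has positive radial
derivatives in these directions. -/
theorem exists_radial_deriv_pos {f : E → ℝ} (hf : ContDiffAt ℝ ∞ f 0) (h0 : f 0 = 0)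
    {V : Submodule ℝ E} {κ : ℝ} (hκ : 0 < κ) (hle : ∀ᶠ v in 𝓝 0, v ∈ V → κ * ‖v‖ ^ 2 ≤ f v) :
    ∃ ε > 0, ∀ v ∈ V, v ≠ 0 → ‖v‖ < ε → 0 < fderiv ℝ f v v := by
  have hf1 : ∀ᶠ v in 𝓝 (0 : E), DifferentiableAt ℝ f v := by
    have := (hf.of_le (natCast_le_infty 1)).eventually (by simp)
    exact this.mono fun y hy ↦ hy.differentiableAt (by simp)
  have hD : HasFDerivAt (fderiv ℝ f) (fderiv ℝ (fderiv ℝ f) 0) 0 :=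
    ((hf.fderiv_right (m := 1) (one_add_one_eq_two.trans_le (natCast_le_infty 2))).differentiableAt
      (by simp)).hasFDerivAt
  set B := fderiv ℝ (fderiv ℝ f) 0
  -- the restriction of `f` to a line
  have hline : ∀ v : E, ∀ᶠ t in 𝓝 (0 : ℝ), HasDerivAt (fun t : ℝ ↦ f (t • v)) (fderiv ℝ f (t • v) v) t := by
    intro v
    have h1 : Tendsto (fun t : ℝ ↦ t • v) (𝓝 0) (𝓝 0) := by
      have : ContinuousAt (fun t : ℝ ↦ t • v) 0 := by fun_prop
      simpa [ContinuousAt] using this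
    filter_upwards [h1.eventually hf1] with t ht
    have h2 : HasDerivAt (fun t : ℝ ↦ t • v) v t := by
      simpa using! (hasDerivAt_id t).smul_const v
    exact ht.hasFDerivAt.comp_hasDerivAt t h2
  have hlow : ∀ v ∈ V, ∀ᶠ t in 𝓝 (0 : ℝ), κ * ‖v‖ ^ 2 * t ^ 2 ≤ f (t • v) := by
    intro v hv
    have h1 : Tendsto (fun t : ℝ ↦ t • v) (𝓝 0) (𝓝 0) := by
      have : ContinuousAt (fun t : ℝ ↦ t • v) 0 := by fun_prop
      simpa [ContinuousAt] using this
    filter_upwards [h1.eventually hle] with t ht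
    have := ht (V.smul_mem t hv)
    rw [norm_smul, mul_pow, Real.norm_eq_abs, sq_abs] at this
    linarith
  have hd0 : ∀ v ∈ V, fderiv ℝ f 0 v = 0 := by
    intro v hv
    have h1 : IsLocalMin (fun t : ℝ ↦ f (t • v)) 0 := by
      filter_upwards [hlow v hv] with t ht
      rw [zero_smul, h0]
      exact le_trans (by positivity) ht
    have h2 := (hline v).self_of_nhds
    rw [zero_smul] at h2
    exact h1.hasDerivAt_eq_zero h2
  have hB : ∀ v ∈ V, κ * ‖v‖ ^ 2 ≤ B v v := by
    intro v hv
    by_contra! hlt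
    have hg : HasDerivAt (fun t : ℝ ↦ fderiv ℝ f (t • v) v) (B v v) 0 := by
      have h1 : HasDerivAt (fun t : ℝ ↦ t • v) v 0 := by
        simpa using! (hasDerivAt_id (0 : ℝ)).smul_const v
      have h2 : HasFDerivAt (fderiv ℝ f) B ((0 : ℝ) • v) := by rwa [zero_smul]
      have h3 := h2.comp_hasDerivAt (0 : ℝ) h1
      exact (ContinuousLinearMap.apply ℝ ℝ v).hasFDerivAt.comp_hasDerivAt (0 : ℝ) h3
    -- on a right neighbourhood of `0` the function `f (t • v) - κ |v|² t² / 2` is decreasing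
    have hslope : ∀ᶠ t in 𝓝[>] (0 : ℝ), fderiv ℝ f (t • v) v < κ * ‖v‖ ^ 2 * t := by
      have h1 := hasDerivAt_iff_tendsto_slope.1 hg
      have h2 : ∀ᶠ t in 𝓝[≠] (0 : ℝ), slope (fun t : ℝ ↦ fderiv ℝ f (t • v) v) 0 t < κ * ‖v‖ ^ 2 :=
        h1.eventually (gt_mem_nhds hlt)
      have h3 := h2.filter_mono (nhdsWithin_mono (0 : ℝ) (fun t (ht : 0 < t) ↦ ht.ne'))
      filter_upwards [h3, self_mem_nhdsWithin] with t ht ht0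
      have ht0 : 0 < t := ht0
      rw [slope_def_field, zero_smul, hd0 v hv, sub_zero, sub_zero, div_lt_iff₀ ht0] at ht
      exact ht
    obtain ⟨ε, hε, h1⟩ := Metric.eventually_nhds_iff_ball.1 ((hline v).and (hlow v hv))
    obtain ⟨b, hb, h2⟩ := mem_nhdsGT_iff_exists_Ioo_subset.1 hslope
    have hb : 0 < b := hb
    let c := min b ε / 2
    have hc : 0 < c := by positivity
    have hcb : c < b := by
      have := min_le_left b ε
      have : 0 < min b ε := by positivity
      change min b ε / 2 < b
      linarith
    have hcε : c < ε := by
      have := min_le_right b ε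
      have : 0 < min b ε := by positivity
      change min b ε / 2 < ε
      linarith
    have hmem : ∀ t ∈ Icc 0 c, t ∈ Metric.ball (0 : ℝ) ε := by
      intro t ht
      rw [mem_ball_zero_iff, Real.norm_eq_abs, abs_of_nonneg ht.1]
      linarith [ht.2]
    have hder : ∀ t ∈ Icc 0 c, HasDerivAt (fun t : ℝ ↦ f (t • v) - κ * ‖v‖ ^ 2 * t ^ 2 / 2)
        (fderiv ℝ f (t • v) v - κ * ‖v‖ ^ 2 * t) t := by
      intro t ht
      have h3 := ((hasDerivAt_pow 2 t).const_mul (κ * ‖v‖ ^ 2)).div_const 2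
      convert! (h1 t (hmem t ht)).1.sub h3 using 1
      simp
      ring
    have hanti : StrictAntiOn (fun t : ℝ ↦ f (t • v) - κ * ‖v‖ ^ 2 * t ^ 2 / 2) (Icc 0 c) := by
      refine strictAntiOn_of_deriv_neg (convex_Icc _ _)
        (fun t ht ↦ (hder t ht).continuousAt.continuousWithinAt) fun t ht ↦ ?_
      rw [interior_Icc] at ht
      rw [(hder t (Ioo_subset_Icc_self ht)).deriv, sub_neg]
      exact h2 ⟨ht.1, by linarith [ht.2]⟩
    have h3 := hanti (left_mem_Icc.2 hc.le) (right_mem_Icc.2 hc.le) hc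
    simp only [zero_smul, h0] at h3
    have h4 := (h1 c (hmem c (right_mem_Icc.2 hc.le))).2
    have h5 : 0 ≤ κ * ‖v‖ ^ 2 * c ^ 2 := by positivity
    linarith
  have hlit := hD.isLittleO.def (show 0 < κ / 2 by positivity)
  obtain ⟨ε, hε, h1⟩ := Metric.eventually_nhds_iff_ball.1 hlit
  refine ⟨ε, hε, fun v hv hv0 hvε ↦ ?_⟩
  have h2 := h1 v (by rwa [mem_ball_zero_iff])
  rw [sub_zero] at h2
  have h3 := ((fderiv ℝ f v - fderiv ℝ f 0 - B v).le_opNorm v).trans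
    (mul_le_mul_of_nonneg_right h2 (norm_nonneg v))
  rw [Real.norm_eq_abs] at h3
  have h4 := (abs_le.1 h3).1
  have h5 : (fderiv ℝ f v - fderiv ℝ f 0 - B v) v = fderiv ℝ f v v - B v v := by
    simp only [sub_apply, hd0 v hv, sub_zero]
  rw [h5] at h4
  have h6 := hB v hv
  have h7 : 0 < ‖v‖ := norm_pos_iff.2 hv0
  have h8 : 0 < κ * ‖v‖ ^ 2 := by positivity
  nlinarith

end Radial

section SliceFunction

open MeasureTheory

variable {m n : ℕ} {G : Type*} [TopologicalSpace G] [ChartedSpace (EuclideanSpace ℝ (Fin m)) G]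
  [Group G] [LieGroup (𝓡 m) ∞ G] [CompactSpace G] {N : Type*} [TopologicalSpace N] [T2Space N]
  [ChartedSpace (EuclideanSpace ℝ (Fin n)) N] [IsManifold (𝓡 n) ∞ N]
  [MulAction G N] [ContMDiffSMul (𝓡 m) (𝓡 n) ∞ G N]

/-- An invariant function which behaves like the squared distance from an orbit. -/
theorem IsSliceChart.exists_invariant_function {p : N}
    {Φ : OpenPartialHomeomorph N (EuclideanSpace ℝ (Fin n))}
    {T : Submodule ℝ (EuclideanSpace ℝ (Fin n))} {δ : ℝ} (h : IsSliceChart m n G p Φ T δ) :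
    ∃ (s : N → ℝ) (κ ε : ℝ), ContMDiff (𝓡 n) 𝓘(ℝ, ℝ) ∞ s ∧ (∀ (g : G) y, s (g • y) = s y) ∧
      (∀ y, 0 ≤ s y) ∧ s p = 0 ∧ 0 < κ ∧ 0 < ε ∧ ε ≤ δ ∧
      (∀ v ∈ Tᗮ, ‖v‖ < ε → κ * ‖v‖ ^ 2 ≤ s (Φ.symm v)) ∧
      ∀ v ∈ Tᗮ, v ≠ 0 → ‖v‖ < ε → 0 < fderiv ℝ (fun v ↦ s (Φ.symm v)) v v := by
  have : IsTopologicalGroup G := topologicalGroup_of_lieGroup (𝓡 m) ∞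
  have : ContinuousSMul G N := ContMDiffSMul.continuousSMul (I := 𝓡 m) (I' := 𝓡 n) ∞
  obtain ⟨w, hw, hwp, hw0⟩ := h.exists_transverse_map
  let _ : MeasurableSpace G := borel G
  have : BorelSpace G := ⟨rfl⟩
  let μ : Measure G := Measure.haar
  let ψ : N → ℝ := fun y ↦ ‖w y‖ ^ 2
  have hψ : ContMDiff (𝓡 n) 𝓘(ℝ, ℝ) ∞ ψ :=
    ContDiff.comp_contMDiff (g := fun x ↦ ‖x‖ ^ 2) (contDiff_norm_sq ℝ) hw
  let s : N → ℝ := fun y ↦ ∫ g : G, ψ (g⁻¹ • y) ∂μ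
  have hs : ContMDiff (𝓡 n) 𝓘(ℝ, ℝ) ∞ s :=
    contMDiff_integral_smul (contMDiff_inv_smul m n G) μ hψ
  have hsp : s p = 0 := by
    simp only [s, ψ, hw0]
    simp
  have htar0 : (0 : EuclideanSpace ℝ (Fin n)) ∈ Φ.target := by
    rw [h.target_eq]; exact Metric.mem_ball_self h.pos
  have hsymm0 : Φ.symm 0 = p := by rw [← h.map_base, Φ.left_inv h.mem_source]
  let P := Tᗮ.starProjection
  let f : EuclideanSpace ℝ (Fin n) → G → EuclideanSpace ℝ (Fin n) := fun v g ↦ w (g⁻¹ • Φ.symm v)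
  have hf : ContMDiffOn (𝓘(ℝ, EuclideanSpace ℝ (Fin n)).prod (𝓡 m))
      𝓘(ℝ, EuclideanSpace ℝ (Fin n)) ∞ (Function.uncurry f) (Φ.target ×ˢ univ) := by
    have h1 : ContMDiffOn (𝓘(ℝ, EuclideanSpace ℝ (Fin n)).prod (𝓡 m)) (𝓡 n) ∞
        (fun q : EuclideanSpace ℝ (Fin n) × G ↦ Φ.symm q.1) (Φ.target ×ˢ univ) :=
      (contMDiffOn_symm_of_mem_maximalAtlas h.mem_maximalAtlas).comp contMDiffOn_fst
        fun q hq ↦ hq.1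
    have h2 := (contMDiff_inv_smul m n G (N := N)).comp_contMDiffOn (h1.prodMk contMDiffOn_snd)
    exact hw.comp_contMDiffOn h2
  have hf0 : ∀ g, f 0 g = 0 := fun g ↦ by simp only [f, hsymm0, hw0]
  have hfd : ∀ v ∈ Φ.target, ∀ g, DifferentiableAt ℝ (f · g) v := by
    intro v hv g
    have h1 : ContMDiffAt 𝓘(ℝ, EuclideanSpace ℝ (Fin n)) 𝓘(ℝ, EuclideanSpace ℝ (Fin n)) ∞
        (f · g) v :=
      (hf.contMDiffAt ((Φ.open_target.prod isOpen_univ).mem_nhds ⟨hv, mem_univ _⟩)).comp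
        (f := fun v ↦ (v, g)) v (contMDiffAt_id.prodMk contMDiffAt_const)
    exact h1.contDiffAt.differentiableAt (by simp)
  have hf1 : fderiv ℝ (f · 1) 0 = P := by
    have h1 : (f · (1 : G)) =ᶠ[𝓝 0] P := by
      have h2 : ContinuousAt Φ.symm 0 := Φ.symm.continuousAt htar0
      filter_upwards [h2.eventually (by rw [hsymm0]; exact hwp), Φ.open_target.mem_nhds htar0]
        with v hv hvt
      simp only [f, inv_one, one_smul, hv, Φ.right_inv hvt]
      rfl
    rw [h1.fderiv_eq]
    exact P.fderiv
  have hfc : ContinuousOn (Function.uncurry fun v g ↦ fderiv ℝ (f · g) v) (Φ.target ×ˢ univ) :=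
    (contMDiffOn_partial_fderiv Φ.open_target hf).continuousOn
  have hnear : ∀ᶠ q in 𝓝 ((0 : EuclideanSpace ℝ (Fin n)), (1 : G)),
      ‖fderiv ℝ (f · q.2) q.1 - P‖ < 1 / 2 := by
    have h1 : ContinuousAt (Function.uncurry fun v g ↦ fderiv ℝ (f · g) v)
        ((0 : EuclideanSpace ℝ (Fin n)), (1 : G)) :=
      hfc.continuousAt ((Φ.open_target.prod isOpen_univ).mem_nhds ⟨htar0, mem_univ _⟩)
    have h2 := (h1.sub (continuousAt_const (y := P))).norm
    refine h2.eventually (gt_mem_nhds ?_)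
    change ‖fderiv ℝ (f · (1 : G)) 0 - P‖ < 1 / 2
    rw [hf1, sub_self, norm_zero]
    norm_num
  rw [nhds_prod_eq, Filter.eventually_prod_iff] at hnear
  obtain ⟨pa, hpa, pb, hpb, hab⟩ := hnear
  obtain ⟨ε₁, hε₁, hball⟩ := Metric.eventually_nhds_iff_ball.1 (hpa.and
    (Φ.open_target.mem_nhds htar0))
  have hlow : ∀ v ∈ Tᗮ, ‖v‖ < ε₁ → ∀ g : G, pb g → (1 / 4 : ℝ) * ‖v‖ ^ 2 ≤ ψ (g⁻¹ • Φ.symm v) := by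
    intro v hv hvε g hg
    have h1 : ‖(f v g - P v) - (f 0 g - P 0)‖ ≤ 1 / 2 * ‖v - 0‖ := by
      refine (convex_ball (0 : EuclideanSpace ℝ (Fin n)) ε₁).norm_image_sub_le_of_norm_fderiv_le
        (𝕜 := ℝ) (f := fun v ↦ f v g - P v) (fun x hx ↦ ?_) (fun x hx ↦ ?_)
        (Metric.mem_ball_self hε₁) (by rwa [mem_ball_zero_iff])
      · exact (hfd x (hball x hx).2 g).sub P.differentiableAt
      · rw [fderiv_fun_sub (hfd x (hball x hx).2 g) P.differentiableAt, P.fderiv]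
        exact (hab (hball x hx).1 hg).le
    have hPv : P v = v := Submodule.starProjection_eq_self_iff.2 hv
    rw [hf0, map_zero, sub_zero, sub_zero, sub_zero, hPv] at h1
    have h2 : ‖v‖ - ‖f v g‖ ≤ ‖f v g - v‖ := by
      rw [norm_sub_rev]
      exact norm_sub_norm_le _ _
    have h3 : 1 / 2 * ‖v‖ ≤ ‖f v g‖ := by linarith
    have h4 := pow_le_pow_left₀ (by positivity) h3 2
    calc (1 / 4 : ℝ) * ‖v‖ ^ 2 = (1 / 2 * ‖v‖) ^ 2 := by ring
      _ ≤ ‖f v g‖ ^ 2 := h4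
  obtain ⟨O, hOpb, hO, h1O⟩ := mem_nhds_iff.1 hpb
  have hμO : 0 < μ.real O := by
    refine ENNReal.toReal_pos (hO.measure_pos μ ⟨1, h1O⟩).ne' (measure_ne_top μ O)
  have hint : ∀ y : N, Integrable (fun g : G ↦ ψ (g⁻¹ • y)) μ := by
    intro y
    have : Continuous (fun g : G ↦ ψ (g⁻¹ • y)) :=
      hψ.continuous.comp (by fun_prop)
    exact this.integrable_of_hasCompactSupport (HasCompactSupport.of_compactSpace _)
  have hlow2 : ∀ v ∈ Tᗮ, ‖v‖ < ε₁ → μ.real O / 4 * ‖v‖ ^ 2 ≤ s (Φ.symm v) := by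
    intro v hv hvε
    have h1 : ∫ g in O, (1 / 4 : ℝ) * ‖v‖ ^ 2 ∂μ ≤ ∫ g in O, ψ (g⁻¹ • Φ.symm v) ∂μ := by
      refine setIntegral_mono_on (integrable_const _).integrableOn (hint _).integrableOn hO.measurableSet fun g hg ↦ ?_
      exact hlow v hv hvε g (hOpb hg)
    have h2 : ∫ g in O, ψ (g⁻¹ • Φ.symm v) ∂μ ≤ s (Φ.symm v) :=
      setIntegral_le_integral (hint _) (Eventually.of_forall fun g ↦ by positivity)
    rw [setIntegral_const, smul_eq_mul] at h1
    linarith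
  have hsΦ : ContDiffAt ℝ ∞ (fun v ↦ s (Φ.symm v)) 0 :=
    (hs.contMDiffAt.comp (0 : EuclideanSpace ℝ (Fin n))
      (contMDiffAt_symm_of_mem_maximalAtlas h.mem_maximalAtlas htar0)).contDiffAt
  obtain ⟨ε₂, hε₂, hrad⟩ := exists_radial_deriv_pos hsΦ (by rw [hsymm0, hsp]) (V := Tᗮ)
    (κ := μ.real O / 4) (by positivity) (by
      filter_upwards [Metric.ball_mem_nhds 0 hε₁] with v hv hvT
      exact hlow2 v hvT (by rwa [mem_ball_zero_iff] at hv))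
  refine ⟨s, μ.real O / 4, min δ (min ε₁ ε₂), hs, fun g y ↦ integral_smul_smul μ ψ g y,
    fun y ↦ integral_nonneg fun g ↦ by positivity, hsp, by positivity,
    lt_min h.pos (lt_min hε₁ hε₂), min_le_left _ _, ?_, ?_⟩
  · intro v hv hvε
    exact hlow2 v hv (lt_of_lt_of_le hvε ((min_le_right _ _).trans (min_le_left _ _)))
  · intro v hv hv0 hvε
    exact hrad v hv hv0 (lt_of_lt_of_le hvε ((min_le_right _ _).trans (min_le_right _ _)))

end SliceFunction

section Curves

variable {n : ℕ} {N : Type*} [TopologicalSpace N] [ChartedSpace (EuclideanSpace ℝ (Fin n)) N]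

theorem hasFDerivAt_comp_param {F : Type*} [NormedAddCommGroup F] [NormedSpace ℝ F] {f : N → ℝ}
    {j : F → N} {v : F} (hf : MDifferentiableAt (𝓡 n) 𝓘(ℝ, ℝ) f (j v))
    (hj : MDifferentiableAt 𝓘(ℝ, F) (𝓡 n) j v) :
    HasFDerivAt (fun v ↦ f (j v))
      ((mvfderiv (𝓡 n) f (j v)).comp (mfderiv 𝓘(ℝ, F) (𝓡 n) j v) : F →L[ℝ] ℝ) v := by
  have h := hf.hasMFDerivAt.comp v hj.hasMFDerivAt
  exact hasMFDerivAt_iff_hasFDerivAt.1 h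

theorem hasDerivAt_comp_curve {f : N → ℝ} {γ : ℝ → N} {t : ℝ}
    (hf : MDifferentiableAt (𝓡 n) 𝓘(ℝ, ℝ) f (γ t)) {v : TangentSpace (𝓡 n) (γ t)}
    (hγ : HasMFDerivAt 𝓘(ℝ, ℝ) (𝓡 n) γ t ((1 : ℝ →L[ℝ] ℝ).smulRight v)) :
    HasDerivAt (fun t ↦ f (γ t)) (mvfderiv (𝓡 n) f (γ t) v) t := by
  have h := hasMFDerivAt_iff_hasFDerivAt.1 (hf.hasMFDerivAt.comp t hγ)
  rw [hasDerivAt_iff_hasFDerivAt]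
  refine HasFDerivAt.congr_fderiv h ?_
  ext
  change mvfderiv (𝓡 n) f (γ t) ((1 : ℝ) • v) = (1 : ℝ) • mvfderiv (𝓡 n) f (γ t) v
  rw [map_smul]

theorem exists_local_inverse {q : ℝ → ℝ} {a : ℝ} (hq : ContDiffAt ℝ ∞ q a) (hd : deriv q a ≠ 0) :
    ∃ ψ : ℝ → ℝ, ContDiffAt ℝ ∞ ψ (q a) ∧ ψ (q a) = a ∧ (∀ᶠ t in 𝓝 (q a), q (ψ t) = t) ∧
      ∀ᶠ t in 𝓝 a, ψ (q t) = t := by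
  have hf : HasFDerivAt q
      ((ContinuousLinearEquiv.unitsEquivAut ℝ (Units.mk0 _ hd) : ℝ ≃L[ℝ] ℝ) : ℝ →L[ℝ] ℝ) a := by
    have := (hq.differentiableAt (by simp)).hasDerivAt.hasFDerivAt
    convert! this using 1
  exact ⟨hq.localInverse hf (by simp), hq.to_localInverse hf (by simp),
    hq.localInverse_apply_image hf (by simp),
    (hq.hasStrictFDerivAt' hf (by simp)).eventually_right_inverse,
    (hq.hasStrictFDerivAt' hf (by simp)).eventually_left_inverse⟩

theorem hasFDerivAt_comp_chart_symm [IsManifold (𝓡 n) ∞ N] {f : N → ℝ} {x : N}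
    (hf : MDifferentiableAt (𝓡 n) 𝓘(ℝ, ℝ) f x) :
    HasFDerivAt (fun z ↦ f ((chartAt (EuclideanSpace ℝ (Fin n)) x).symm z))
      (mvfderiv (𝓡 n) f x : EuclideanSpace ℝ (Fin n) →L[ℝ] ℝ)
      (chartAt (EuclideanSpace ℝ (Fin n)) x x) := by
  have h := hf.hasMFDerivAt.2
  simp only [ModelWithCorners.range_eq_univ] at h
  exact hasFDerivWithinAt_univ.1 h

/-- A submersion to the line has local sections. -/
theorem exists_local_section [IsManifold (𝓡 n) ∞ N] {f : N → ℝ} {x : N}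
    (hf : ContMDiffAt (𝓡 n) 𝓘(ℝ, ℝ) ∞ f x) (hd : mvfderiv (𝓡 n) f x ≠ 0) :
    ∃ c : ℝ → N, ContMDiffAt 𝓘(ℝ, ℝ) (𝓡 n) ∞ c (f x) ∧ c (f x) = x ∧
      ∀ᶠ t in 𝓝 (f x), f (c t) = t := by
  obtain ⟨w, hw⟩ : ∃ w : EuclideanSpace ℝ (Fin n), mvfderiv (𝓡 n) f x w ≠ 0 := by
    by_contra! h
    exact hd (ContinuousLinearMap.ext h)
  let e := chartAt (EuclideanSpace ℝ (Fin n)) x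
  have he : e ∈ IsManifold.maximalAtlas (𝓡 n) ∞ N := IsManifold.chart_mem_maximalAtlas x
  let γ : ℝ → N := fun t ↦ e.symm (e x + t • w)
  have hx0 : e x + (0 : ℝ) • w = e x := by rw [zero_smul, add_zero]
  have hγ0 : γ 0 = x := by
    simp only [γ, hx0]
    exact e.left_inv (mem_chart_source _ x)
  have hγ : ContMDiffAt 𝓘(ℝ, ℝ) (𝓡 n) ∞ γ 0 := by
    refine ContMDiffAt.comp (g := e.symm) (f := fun t : ℝ ↦ e x + t • w)
      (I' := 𝓘(ℝ, EuclideanSpace ℝ (Fin n))) (0 : ℝ) ?_ ?_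
    · rw [hx0]
      exact contMDiffAt_symm_of_mem_maximalAtlas he (mem_chart_target _ x)
    · exact ContDiff.contDiffAt (by fun_prop) |>.contMDiffAt
  have hq : ContDiffAt ℝ ∞ (fun t ↦ f (γ t)) 0 := by
    refine (ContMDiffAt.comp (g := f) (f := γ) (0 : ℝ) ?_ hγ).contDiffAt
    rwa [hγ0]
  have hqd : HasDerivAt (fun t ↦ f (γ t)) (mvfderiv (𝓡 n) f x w) 0 := by
    have h1 := hasFDerivAt_comp_chart_symm (hf.mdifferentiableAt (by simp))
    have h2 : HasDerivAt (fun t : ℝ ↦ e x + t • w) w 0 := by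
      simpa using! ((hasDerivAt_id (0 : ℝ)).smul_const w).const_add (e x)
    rw [← hx0] at h1
    exact h1.comp_hasDerivAt (0 : ℝ) h2
  obtain ⟨ψ, hψ, hψ0, hψr, -⟩ := exists_local_inverse hq (by rw [hqd.deriv]; exact hw)
  rw [hγ0] at hψ hψ0 hψr
  refine ⟨fun t ↦ γ (ψ t), ?_, ?_, hψr⟩
  · refine ContMDiffAt.comp (g := γ) (f := ψ) (I' := 𝓘(ℝ, ℝ)) (f x) ?_ hψ.contMDiffAt
    rwa [hψ0]
  · beta_reduce
    rw [hψ0, hγ0]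

end Curves

section Polar

variable {E : Type*} [NormedAddCommGroup E] [NormedSpace ℝ E]

/-- Polar coordinates for a radially increasing function. -/
theorem exists_polar {σ : E → ℝ} {δ κ : ℝ} (hδ : 0 < δ)
    (hσ : ContDiffOn ℝ ∞ σ (Metric.ball 0 δ)) (h0 : σ 0 = 0) (hκ : 0 < κ)
    (hle : ∀ v, ‖v‖ < δ → κ * ‖v‖ ^ 2 ≤ σ v)
    (hrad : ∀ v, v ≠ 0 → ‖v‖ < δ → 0 < fderiv ℝ σ v v) :
    ∃ c₀ > 0, ∃ ρ : E → ℝ → ℝ,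
      (∀ e c, ‖e‖ = 1 → c ∈ Ioo 0 c₀ → ρ e c ∈ Ioo 0 δ ∧ σ (ρ e c • e) = c) ∧
      (∀ e t, ‖e‖ = 1 → t ∈ Ioo 0 δ → ρ e (σ (t • e)) = t ∨ c₀ ≤ σ (t • e)) ∧
      ContinuousOn (Function.uncurry ρ) (Metric.sphere 0 1 ×ˢ Ioo 0 c₀) := by
  have hdiff : ∀ v, ‖v‖ < δ → DifferentiableAt ℝ σ v := fun v hv ↦
    (hσ.contDiffAt (Metric.isOpen_ball.mem_nhds (by rwa [mem_ball_zero_iff]))).differentiableAt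
      (by simp)
  have hnorm : ∀ e : E, ‖e‖ = 1 → ∀ t ∈ Ico 0 δ, ‖t • e‖ < δ := by
    intro e he t ht
    rw [norm_smul, he, mul_one, Real.norm_eq_abs, abs_of_nonneg ht.1]
    exact ht.2
  have hmono : ∀ e : E, ‖e‖ = 1 → StrictMonoOn (fun t : ℝ ↦ σ (t • e)) (Ico 0 δ) := by
    intro e he
    have hd : ∀ t ∈ Ico 0 δ, HasDerivAt (fun t : ℝ ↦ σ (t • e)) (fderiv ℝ σ (t • e) e) t := by
      intro t ht
      have h2 : HasDerivAt (fun t : ℝ ↦ t • e) e t := by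
        simpa using! (hasDerivAt_id t).smul_const e
      exact (hdiff _ (hnorm e he t ht)).hasFDerivAt.comp_hasDerivAt t h2
    refine strictMonoOn_of_deriv_pos (convex_Ico _ _)
      (fun t ht ↦ (hd t ht).continuousAt.continuousWithinAt) fun t ht ↦ ?_
    rw [interior_Ico] at ht
    rw [(hd t (Ioo_subset_Ico_self ht)).deriv]
    have h1 : t • e ≠ 0 := by
      refine smul_ne_zero ht.1.ne' fun h ↦ ?_
      rw [h, norm_zero] at he
      exact zero_ne_one he
    have h2 := hrad _ h1 (hnorm e he t (Ioo_subset_Ico_self ht))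
    rw [map_smul, smul_eq_mul] at h2
    exact pos_of_mul_pos_right h2 ht.1.le
  have hcont : ∀ e : E, ‖e‖ = 1 → ∀ t ∈ Ico 0 δ, ContinuousAt σ (t • e) := fun e he t ht ↦
    (hdiff _ (hnorm e he t ht)).continuousAt
  have hex : ∀ e c, ‖e‖ = 1 → c ∈ Ioo 0 (κ * (δ / 2) ^ 2) → ∃ t ∈ Ioo 0 δ, σ (t • e) = c := by
    intro e c he hc
    have h1 : ContinuousOn (fun t : ℝ ↦ σ (t • e)) (Icc 0 (δ / 2)) := fun t ht ↦
      ContinuousAt.continuousWithinAt <| ContinuousAt.comp (g := σ) (f := fun t : ℝ ↦ t • e)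
        (hcont e he t ⟨ht.1, by linarith [ht.2]⟩) (by fun_prop)
    have h2 := intermediate_value_Icc (by linarith) h1
    have h3 := hle _ (hnorm e he (δ / 2) ⟨by linarith, by linarith⟩)
    rw [norm_smul, he, mul_one, Real.norm_eq_abs, abs_of_pos (by linarith)] at h3
    obtain ⟨t, ht, hte⟩ := h2 (show c ∈ _ from ⟨by
      beta_reduce
      rw [zero_smul, h0]
      exact hc.1.le, hc.2.le.trans h3⟩)
    beta_reduce at hte
    refine ⟨t, ⟨lt_of_le_of_ne ht.1 ?_, by linarith [ht.2]⟩, hte⟩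
    rintro rfl
    rw [zero_smul, h0] at hte
    exact hc.1.ne hte
  choose! ρ hρ hσρ using hex
  have huniq : ∀ e t, ‖e‖ = 1 → t ∈ Ioo 0 δ → σ (t • e) < κ * (δ / 2) ^ 2 → ρ e (σ (t • e)) = t := by
    intro e t he ht hlt
    have hpos : 0 < σ (t • e) := by
      have := hmono e he (left_mem_Ico.2 hδ) (Ioo_subset_Ico_self ht) ht.1
      beta_reduce at this
      rwa [zero_smul, h0] at this
    exact (hmono e he).injOn (Ioo_subset_Ico_self (hρ e _ he ⟨hpos, hlt⟩)) (Ioo_subset_Ico_self ht)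
      (hσρ e _ he ⟨hpos, hlt⟩)
  refine ⟨κ * (δ / 2) ^ 2, by positivity, ρ, fun e c he hc ↦ ⟨hρ e c he hc, hσρ e c he hc⟩,
    fun e t he ht ↦ ?_, ?_⟩
  · rcases lt_or_ge (σ (t • e)) (κ * (δ / 2) ^ 2) with h | h
    · exact Or.inl (huniq e t he ht h)
    · exact Or.inr h
  rintro ⟨e, c⟩ ⟨he, hc⟩
  have he : ‖e‖ = 1 := by simpa using he
  have hev : ∀ t ∈ Ioo 0 δ, ∀ᶠ q in 𝓝[Metric.sphere 0 1 ×ˢ Ioo 0 (κ * (δ / 2) ^ 2)] (e, c),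
      (t < ρ e c → t < ρ q.1 q.2) ∧ (ρ e c < t → ρ q.1 q.2 < t) := by
    intro t ht
    have h1 : ContinuousAt (fun q : E × ℝ ↦ σ (t • q.1) - q.2) (e, c) := by
      refine ContinuousAt.sub ?_ continuousAt_snd
      exact ContinuousAt.comp (g := σ) (f := fun q : E × ℝ ↦ t • q.1)
        (hcont e he t (Ioo_subset_Ico_self ht)) (by fun_prop)
    have h2 : (t < ρ e c → ∀ᶠ q in 𝓝 (e, c), σ (t • q.1) - q.2 < 0) ∧
        (ρ e c < t → ∀ᶠ q in 𝓝 (e, c), 0 < σ (t • q.1) - q.2) := by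
      refine ⟨fun hlt ↦ h1.eventually (gt_mem_nhds ?_), fun hlt ↦ h1.eventually (lt_mem_nhds ?_)⟩
      · have := hmono e he (Ioo_subset_Ico_self ht) (Ioo_subset_Ico_self (hρ e c he hc)) hlt
        beta_reduce at this ⊢
        rw [hσρ e c he hc] at this
        linarith
      · have := hmono e he (Ioo_subset_Ico_self (hρ e c he hc)) (Ioo_subset_Ico_self ht) hlt
        beta_reduce at this ⊢
        rw [hσρ e c he hc] at this
        linarith
    refine Filter.Eventually.and ?_ ?_
    · by_cases hlt : t < ρ e c
      · filter_upwards [nhdsWithin_le_nhds (h2.1 hlt), self_mem_nhdsWithin] with q hq hqm _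
        have hq1 : ‖q.1‖ = 1 := by simpa using hqm.1
        refine ((hmono _ hq1).lt_iff_lt (Ioo_subset_Ico_self ht)
          (Ioo_subset_Ico_self (hρ _ _ hq1 hqm.2))).1 ?_
        beta_reduce
        rw [hσρ _ _ hq1 hqm.2]
        linarith
      · exact Eventually.of_forall fun q h ↦ absurd h hlt
    · by_cases hlt : ρ e c < t
      · filter_upwards [nhdsWithin_le_nhds (h2.2 hlt), self_mem_nhdsWithin] with q hq hqm _
        have hq1 : ‖q.1‖ = 1 := by simpa using hqm.1
        refine ((hmono _ hq1).lt_iff_lt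
          (Ioo_subset_Ico_self (hρ _ _ hq1 hqm.2)) (Ioo_subset_Ico_self ht)).1 ?_
        beta_reduce
        rw [hσρ _ _ hq1 hqm.2]
        linarith
      · exact Eventually.of_forall fun q h ↦ absurd h hlt
  have hm := hρ e c he hc
  refine tendsto_order.2 ⟨fun a ha ↦ ?_, fun a ha ↦ ?_⟩
  · have h1 : max a (ρ e c / 2) ∈ Ioo 0 δ :=
      ⟨lt_max_of_lt_right (by linarith [hm.1]), max_lt (lt_trans ha hm.2) (by linarith [hm.1, hm.2])⟩
    filter_upwards [hev _ h1] with q hq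
    exact (le_max_left _ _).trans_lt (hq.1 (max_lt ha (by
      change ρ e c / 2 < ρ e c
      linarith [hm.1])))
  · have h1 : min a ((ρ e c + δ) / 2) ∈ Ioo 0 δ :=
      ⟨lt_min (lt_trans hm.1 ha) (by linarith [hm.1]), min_lt_of_right_lt (by linarith [hm.2])⟩
    filter_upwards [hev _ h1] with q hq
    exact (hq.2 (lt_min ha (by
      change ρ e c < _
      linarith [hm.2]))).trans_le (min_le_left _ _)

end Polar

section Slice

variable (m n : ℕ) (G : Type*) [TopologicalSpace G] [ChartedSpace (EuclideanSpace ℝ (Fin m)) G]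
  [Group G] {N : Type*} [TopologicalSpace N]
  [ChartedSpace (EuclideanSpace ℝ (Fin n)) N] [MulAction G N]

/-- `j` parametrizes a submanifold through `p` transverse to the orbit of `p`, every orbit near
`p` meets it, and `τ` is a retraction onto it along the orbits. -/
structure IsSlice (p : N) (k : ℕ) (j : EuclideanSpace ℝ (Fin k) → N)
    (τ : N → EuclideanSpace ℝ (Fin k)) (O : Set N) (δ : ℝ) : Prop where
  dim_eq : orbitDim m n G p + k = n
  pos : 0 < δ
  isOpen : IsOpen O
  mem : p ∈ O
  base : j 0 = p
  contMDiffOn_param : ContMDiffOn 𝓘(ℝ, EuclideanSpace ℝ (Fin k)) (𝓡 n) ∞ j (Metric.ball 0 δ)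
  contMDiffOn_retract : ContMDiffOn (𝓡 n) 𝓘(ℝ, EuclideanSpace ℝ (Fin k)) ∞ τ O
  param_mem : ∀ v, ‖v‖ < δ → j v ∈ O
  retract_param : ∀ v, ‖v‖ < δ → τ (j v) = v
  norm_retract_lt : ∀ y ∈ O, ‖τ y‖ < δ
  exists_smul : ∀ y ∈ O, ∃ g : G, y = g • j (τ y)
  mem_orbit_iff : ∀ y ∈ O, y ∈ orbit G p ↔ τ y = 0

variable {m n G}

theorem IsSliceChart.exists_isSlice {p : N}
    {Φ : OpenPartialHomeomorph N (EuclideanSpace ℝ (Fin n))}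
    {T : Submodule ℝ (EuclideanSpace ℝ (Fin n))} {δ : ℝ} (h : IsSliceChart m n G p Φ T δ)
    {ε : ℝ} (hε : 0 < ε) (hεδ : ε ≤ δ) :
    ∃ (k : ℕ) (ι : EuclideanSpace ℝ (Fin k) →L[ℝ] EuclideanSpace ℝ (Fin n))
      (τ : N → EuclideanSpace ℝ (Fin k)) (O : Set N),
      IsSlice m n G p k (fun v ↦ Φ.symm (ι v)) τ O ε ∧ (∀ v, ‖ι v‖ = ‖v‖) ∧ (∀ v, ι v ∈ Tᗮ) ∧
      O ⊆ Φ.source := by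
  let b := stdOrthonormalBasis ℝ Tᗮ
  let L := b.repr
  let ι : EuclideanSpace ℝ (Fin (Module.finrank ℝ Tᗮ)) →L[ℝ] EuclideanSpace ℝ (Fin n) :=
    Tᗮ.subtypeL.comp (L.symm.toContinuousLinearEquiv : _ →L[ℝ] Tᗮ)
  let pr : EuclideanSpace ℝ (Fin n) →L[ℝ] EuclideanSpace ℝ (Fin (Module.finrank ℝ Tᗮ)) :=
    (L.toContinuousLinearEquiv : Tᗮ →L[ℝ] _).comp Tᗮ.orthogonalProjection
  have hι : ∀ v, ‖ι v‖ = ‖v‖ := fun v ↦ by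
    change ‖L.symm v‖ = ‖v‖
    exact L.symm.norm_map v
  have hιT : ∀ v, ι v ∈ Tᗮ := fun v ↦ (L.symm v).2
  have hpr_ι : ∀ v, pr (ι v) = v := fun v ↦ by
    change L (Tᗮ.orthogonalProjection (L.symm v : EuclideanSpace ℝ (Fin n))) = v
    rw [Submodule.orthogonalProjection_mem_subspace_eq_self, L.apply_symm_apply]
  have hι_pr : ∀ x, ι (pr x) = Tᗮ.starProjection x := fun x ↦ by
    change ((L.symm (L (Tᗮ.orthogonalProjection x)) : Tᗮ) : EuclideanSpace ℝ (Fin n)) = _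
    rw [L.symm_apply_apply]
    rfl
  have hsrc : ∀ v, ‖v‖ < ε → ι v ∈ Φ.target := fun v hv ↦ by
    rw [h.target_eq, mem_ball_zero_iff, hι]
    exact hv.trans_le hεδ
  have hτ : ContMDiffOn (𝓡 n) 𝓘(ℝ, EuclideanSpace ℝ (Fin (Module.finrank ℝ Tᗮ))) ∞
      (fun y ↦ pr (Φ y)) Φ.source := by
    refine pr.contDiff.contMDiff.comp_contMDiffOn ?_
    exact contMDiffOn_of_mem_maximalAtlas h.mem_maximalAtlas
  refine ⟨_, ι, fun y ↦ pr (Φ y), Φ.source ∩ (fun y ↦ pr (Φ y)) ⁻¹' Metric.ball 0 ε,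
    ?_, hι, hιT, inter_subset_left⟩
  refine ⟨?_, hε, ?_, ?_, ?_, ?_, hτ.mono inter_subset_left, ?_, ?_, ?_, ?_, ?_⟩
  · rw [← h.finrank_eq, Submodule.finrank_add_finrank_orthogonal, finrank_euclideanSpace,
      Fintype.card_fin]
  · exact hτ.continuousOn.isOpen_inter_preimage Φ.open_source Metric.isOpen_ball
  · exact ⟨h.mem_source, by simp [h.map_base, hε]⟩
  · rw [map_zero, ← h.map_base, Φ.left_inv h.mem_source]
  · refine (contMDiffOn_symm_of_mem_maximalAtlas h.mem_maximalAtlas).comp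
      ι.contDiff.contMDiff.contMDiffOn fun v hv ↦ hsrc v (by rwa [mem_ball_zero_iff] at hv)
  · intro v hv
    refine ⟨Φ.map_target (hsrc v hv), ?_⟩
    rwa [mem_preimage, Φ.right_inv (hsrc v hv), hpr_ι, mem_ball_zero_iff]
  · intro v hv
    rw [Φ.right_inv (hsrc v hv), hpr_ι]
  · intro y hy
    simpa using hy.2
  · intro y hy
    obtain ⟨g, hg⟩ := h.exists_smul (Φ y) (by rw [← h.target_eq]; exact Φ.map_source hy.1)
    refine ⟨g, ?_⟩
    rw [Φ.left_inv hy.1] at hg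
    rw [hι_pr]
    exact hg
  · intro y hy
    rw [h.mem_orbit_iff y hy.1]
    constructor
    · intro hT
      have h1 : Tᗮ.starProjection (Φ y) = 0 := by
        rw [Submodule.starProjection_apply_eq_zero_iff, Submodule.orthogonal_orthogonal]
        exact hT
      have h2 := hpr_ι (pr (Φ y))
      rw [hι_pr, h1, map_zero] at h2
      exact h2.symm
    · intro h0
      have h1 := hι_pr (Φ y)
      beta_reduce at h0
      rw [h0, map_zero, eq_comm, Submodule.starProjection_apply_eq_zero_iff,
        Submodule.orthogonal_orthogonal] at h1
      exact h1

variable [LieGroup (𝓡 m) ∞ G] [CompactSpace G] [T2Space N] [IsManifold (𝓡 n) ∞ N]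
  [ContMDiffSMul (𝓡 m) (𝓡 n) ∞ G N]

variable (m n G) in
theorem exists_isSlice_and_function (p : N) {W : Set N} (hW : W ∈ 𝓝 p) :
    ∃ k j τ O δ, IsSlice m n G p k j τ O δ ∧ O ⊆ W ∧
    ∃ (s : N → ℝ) (κ : ℝ), ContMDiff (𝓡 n) 𝓘(ℝ, ℝ) ∞ s ∧ (∀ (g : G) y, s (g • y) = s y) ∧
      s p = 0 ∧ 0 < κ ∧ (∀ v, ‖v‖ < δ → κ * ‖v‖ ^ 2 ≤ s (j v)) ∧
      ∀ v, v ≠ 0 → ‖v‖ < δ → 0 < fderiv ℝ (fun v ↦ s (j v)) v v := by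
  obtain ⟨Φ, T, δ, h, hΦW⟩ := exists_isSliceChart m n G p hW
  obtain ⟨s, κ, ε, hs, hsG, -, hsp, hκ, hε, hεδ, hle, hrad⟩ := h.exists_invariant_function
  obtain ⟨k, ι, τ, O, hS, hι, hιT, hO⟩ := h.exists_isSlice hε hεδ
  refine ⟨k, _, τ, O, ε, hS, hO.trans hΦW, s, κ, hs, hsG, hsp, hκ, fun v hv ↦ ?_, fun v hv0 hv ↦ ?_⟩
  · have := hle (ι v) (hιT v) (by rwa [hι])
    rwa [hι] at this
  · have h1 := hrad (ι v) (hιT v) (by rwa [← norm_ne_zero_iff, hι, norm_ne_zero_iff]) (by rwa [hι])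
    have h2 : DifferentiableAt ℝ (fun v ↦ s (Φ.symm v)) (ι v) := by
      refine (ContMDiffAt.comp (g := s) (f := Φ.symm) (ι v) hs.contMDiffAt
        (contMDiffAt_symm_of_mem_maximalAtlas h.mem_maximalAtlas ?_)).contDiffAt.differentiableAt
          (by simp)
      rw [h.target_eq, mem_ball_zero_iff, hι]
      exact hv.trans_le hεδ
    have h3 := (h2.hasFDerivAt.comp v ι.hasFDerivAt).fderiv
    change 0 < fderiv ℝ ((fun v ↦ s (Φ.symm v)) ∘ ι) v v
    rw [h3]
    exact h1

theorem IsSlice.continuousAt_param {p : N} {k : ℕ} {j : EuclideanSpace ℝ (Fin k) → N}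
    {τ : N → EuclideanSpace ℝ (Fin k)} {O : Set N} {δ : ℝ} (h : IsSlice m n G p k j τ O δ)
    {v : EuclideanSpace ℝ (Fin k)} (hv : ‖v‖ < δ) : ContinuousAt j v :=
  h.contMDiffOn_param.continuousOn.continuousAt
    (Metric.isOpen_ball.mem_nhds (by rwa [mem_ball_zero_iff]))

theorem IsSlice.contMDiffAt_param {p : N} {k : ℕ} {j : EuclideanSpace ℝ (Fin k) → N}
    {τ : N → EuclideanSpace ℝ (Fin k)} {O : Set N} {δ : ℝ} (h : IsSlice m n G p k j τ O δ)
    {v : EuclideanSpace ℝ (Fin k)} (hv : ‖v‖ < δ) :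
    ContMDiffAt 𝓘(ℝ, EuclideanSpace ℝ (Fin k)) (𝓡 n) ∞ j v :=
  h.contMDiffOn_param.contMDiffAt (Metric.isOpen_ball.mem_nhds (by rwa [mem_ball_zero_iff]))

theorem IsSlice.contMDiffAt_retract {p : N} {k : ℕ} {j : EuclideanSpace ℝ (Fin k) → N}
    {τ : N → EuclideanSpace ℝ (Fin k)} {O : Set N} {δ : ℝ} (h : IsSlice m n G p k j τ O δ)
    {y : N} (hy : y ∈ O) : ContMDiffAt (𝓡 n) 𝓘(ℝ, EuclideanSpace ℝ (Fin k)) ∞ τ y :=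
  h.contMDiffOn_retract.contMDiffAt (h.isOpen.mem_nhds hy)

/-- An invariant function with non-zero differential at `p` has non-zero differential along a
slice. -/
theorem IsSlice.fderiv_comp_ne_zero {p : N} {k : ℕ} {j : EuclideanSpace ℝ (Fin k) → N}
    {τ : N → EuclideanSpace ℝ (Fin k)} {O : Set N} {δ : ℝ} (h : IsSlice m n G p k j τ O δ)
    {f : N → ℝ} (hf : ContMDiffAt (𝓡 n) 𝓘(ℝ, ℝ) ∞ f p)
    (hfG : ∀ᶠ y in 𝓝 p, ∀ z ∈ orbit G y, f z = f y)
    (hd : mvfderiv (𝓡 n) f p ≠ 0) : fderiv ℝ (fun v ↦ f (j v)) 0 ≠ 0 := by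
  intro h0
  apply hd
  have h1 : f =ᶠ[𝓝 p] fun y ↦ f (j (τ y)) := by
    filter_upwards [hfG, h.isOpen.mem_nhds h.mem] with y hy hyO
    obtain ⟨g, hg⟩ := h.exists_smul y hyO
    refine (hy _ ⟨g⁻¹, ?_⟩).symm
    change g⁻¹ • y = _
    conv_lhs => rw [hg]
    rw [inv_smul_smul]
  have hτp : τ p = 0 := (h.mem_orbit_iff p h.mem).1 (mem_orbit_self p)
  rw [mvfderiv_congr h1]
  have h2 : ContDiffAt ℝ ∞ (fun v ↦ f (j v)) (τ p) := by
    rw [hτp]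
    refine (ContMDiffAt.comp (g := f) (f := j) (0 : EuclideanSpace ℝ (Fin k)) ?_
      (h.contMDiffAt_param (by simpa using h.pos))).contDiffAt
    rwa [h.base]
  have h3 := (h2.contMDiffAt.mdifferentiableAt (by simp)).hasMFDerivAt.comp p
    ((h.contMDiffAt_retract h.mem).mdifferentiableAt (by simp)).hasMFDerivAt
  ext v
  have h4 := DFunLike.congr_fun h3.mfderiv v
  refine h4.trans ?_
  change mfderiv 𝓘(ℝ, EuclideanSpace ℝ (Fin k)) 𝓘(ℝ, ℝ) (fun v ↦ f (j v)) (τ p) _ = (0 : ℝ)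
  rw [mfderiv_eq_fderiv, hτp, h0]
  rfl

theorem tendsto_smul_zero {E : Type*} [NormedAddCommGroup E] [NormedSpace ℝ E] (w : E) :
    Tendsto (fun t : ℝ ↦ t • w) (𝓝 0) (𝓝 0) := by
  have : ContinuousAt (fun t : ℝ ↦ t • w) 0 := by fun_prop
  simpa [ContinuousAt] using this

theorem hasDerivAt_smul_comp {E : Type*} [NormedAddCommGroup E] [NormedSpace ℝ E] {f : E → ℝ} {t : ℝ} {w : E}
    (hf : DifferentiableAt ℝ f (t • w)) :
    HasDerivAt (fun t : ℝ ↦ f (t • w)) (fderiv ℝ f (t • w) w) t := by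
  have h2 : HasDerivAt (fun t : ℝ ↦ t • w) w t := by
    simpa using! (hasDerivAt_id t).smul_const w
  exact hf.hasFDerivAt.comp_hasDerivAt t h2

/-- Near an orbit of codimension one, the orbits are the levels of any invariant function with
non-zero differential. -/
theorem exists_nhds_mem_orbit_of_eq {p : N} (hp : orbitDim m n G p + 1 = n) {f : N → ℝ}
    (hf : ContMDiffAt (𝓡 n) 𝓘(ℝ, ℝ) ∞ f p)
    (hfG : ∀ᶠ y in 𝓝 p, ∀ z ∈ orbit G y, f z = f y) (hd : mvfderiv (𝓡 n) f p ≠ 0) :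
    ∃ W ∈ 𝓝 p, ∀ y ∈ W, ∀ z ∈ W, f y = f z → y ∈ orbit G z := by
  obtain ⟨k, j, τ, O, δ, h, -, -⟩ := exists_isSlice_and_function m n G p (W := univ) Filter.univ_mem
  obtain rfl : k = 1 := by have := h.dim_eq; omega
  have h0 := h.fderiv_comp_ne_zero hf hfG hd
  let e₁ : EuclideanSpace ℝ (Fin 1) := EuclideanSpace.single 0 1
  have hspan : ∀ v : EuclideanSpace ℝ (Fin 1), v = v 0 • e₁ := by
    intro v
    ext i
    fin_cases i
    simp [e₁]
  have h1 : fderiv ℝ (fun v ↦ f (j v)) 0 e₁ ≠ 0 := by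
    intro h2
    apply h0
    ext v
    rw [hspan v, map_smul, h2]
    simp
  have hτp : τ p = 0 := (h.mem_orbit_iff p h.mem).1 (mem_orbit_self p)
  have hfj : ContDiffAt ℝ ∞ (fun v ↦ f (j v)) 0 := by
    refine (ContMDiffAt.comp (g := f) (f := j) (0 : EuclideanSpace ℝ (Fin 1)) ?_
      (h.contMDiffAt_param (by simpa using h.pos))).contDiffAt
    rwa [h.base]
  have hq : ContDiffAt ℝ ∞ (fun t : ℝ ↦ f (j (t • e₁))) 0 := by
    refine ContDiffAt.comp (g := fun v ↦ f (j v)) (f := fun t : ℝ ↦ t • e₁) (0 : ℝ) ?_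
      (by fun_prop)
    rwa [zero_smul]
  have hqd : deriv (fun t : ℝ ↦ f (j (t • e₁))) 0 ≠ 0 := by
    have h2 := hasDerivAt_smul_comp (f := fun v ↦ f (j v)) (t := 0) (w := e₁)
      (by rw [zero_smul]; exact hfj.differentiableAt (by simp))
    rw [h2.deriv, zero_smul]
    exact h1
  obtain ⟨ψ, -, -, -, hψ⟩ := exists_local_inverse hq hqd
  have hτ0 : Tendsto (fun y ↦ τ y 0) (𝓝 p) (𝓝 0) := by
    have h2 : ContinuousAt (fun y ↦ τ y 0) p := by
      have h3 := (h.contMDiffAt_retract h.mem).continuousAt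
      fun_prop
    have h3 : τ p 0 = 0 := by rw [hτp]; rfl
    rwa [ContinuousAt, h3] at h2
  refine ⟨_, (h.isOpen.mem_nhds h.mem |> fun h2 ↦ Filter.Eventually.and h2
    (hfG.and (hτ0.eventually hψ))), fun y hy z hz hyz ↦ ?_⟩
  obtain ⟨hyO, hyG, hyψ⟩ := hy
  obtain ⟨hzO, hzG, hzψ⟩ := hz
  have key : ∀ y ∈ O, j (τ y) ∈ orbit G y := fun y hy ↦ by
    obtain ⟨g, hg⟩ := h.exists_smul y hy
    refine ⟨g⁻¹, ?_⟩
    change g⁻¹ • y = _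
    conv_lhs => rw [hg]
    rw [inv_smul_smul]
  rw [← hspan, hyG _ (key y hyO)] at hyψ
  rw [← hspan, hzG _ (key z hzO)] at hzψ
  have h2 : τ y = τ z := by rw [hspan (τ y), hspan (τ z), ← hyψ, ← hzψ, hyz]
  have h3 := key y hyO
  rw [h2] at h3
  have h4 := key z hzO
  rw [← orbit_eq_iff] at h3 h4 ⊢
  rw [← h3, h4]

/-- Near an orbit of codimension at least two, an invariant function whose level through `p` is
the orbit has a critical point at `p`. -/
theorem mvfderiv_eq_zero_of_codim {p : N} (hp : orbitDim m n G p + 2 ≤ n) {f : N → ℝ}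
    (hf : ContMDiffAt (𝓡 n) 𝓘(ℝ, ℝ) ∞ f p)
    (hfG : ∀ᶠ y in 𝓝 p, ∀ z ∈ orbit G y, f z = f y)
    (hlev : ∀ᶠ y in 𝓝 p, f y = f p → y ∈ orbit G p) : mvfderiv (𝓡 n) f p = 0 := by
  by_contra hd
  obtain ⟨k, j, τ, O, δ, h, -, -⟩ := exists_isSlice_and_function m n G p (W := univ) Filter.univ_mem
  have hk : 2 ≤ k := by have := h.dim_eq; omega
  have h0 := h.fderiv_comp_ne_zero hf hfG hd
  obtain ⟨w, hw⟩ : ∃ w, fderiv ℝ (fun v ↦ f (j v)) 0 w ≠ 0 := by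
    by_contra! h1
    exact h0 (ContinuousLinearMap.ext h1)
  have hw0 : w ≠ 0 := by rintro rfl; exact hw (map_zero _)
  have hfj : ContDiffAt ℝ ∞ (fun v ↦ f (j v)) 0 := by
    refine (ContMDiffAt.comp (g := f) (f := j) (0 : EuclideanSpace ℝ (Fin k)) ?_
      (h.contMDiffAt_param (by simpa using h.pos))).contDiffAt
    rwa [h.base]
  have hcont : ∀ᶠ v in 𝓝 (0 : EuclideanSpace ℝ (Fin k)), ContinuousAt (fun v ↦ f (j v)) v := by
    have := (hfj.of_le (natCast_le_infty 1)).eventually (by simp)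
    exact this.mono fun y hy ↦ hy.continuousAt
  have hj0 : Tendsto j (𝓝 0) (𝓝 p) := by
    have := h.continuousAt_param (v := 0) (by simpa using h.pos)
    rwa [ContinuousAt, h.base] at this
  obtain ⟨r, hr, hball⟩ := Metric.eventually_nhds_iff_ball.1
    (hcont.and ((hj0.eventually hlev).and (Metric.ball_mem_nhds 0 h.pos)))
  have hne : ∀ v ∈ Metric.ball 0 r, v ≠ 0 → f (j v) ≠ f p := by
    intro v hv hv0 hfv
    obtain ⟨-, h1, h2⟩ := hball v hv
    have h2 : ‖v‖ < δ := by simpa using h2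
    have h3 := (h.mem_orbit_iff _ (h.param_mem v h2)).1 (h1 hfv)
    rw [h.retract_param v h2] at h3
    exact hv0 h3
  have hder : HasDerivAt (fun t : ℝ ↦ f (j (t • w))) (fderiv ℝ (fun v ↦ f (j v)) 0 w) 0 := by
    have h2 := hasDerivAt_smul_comp (f := fun v ↦ f (j v)) (t := 0) (w := w)
      (by rw [zero_smul]; exact hfj.differentiableAt (by simp))
    rwa [zero_smul] at h2
  have hslope := hasDerivAt_iff_tendsto_slope.1 hder
  have hsl : ∀ᶠ t in 𝓝[≠] (0 : ℝ), 0 < slope (fun t : ℝ ↦ f (j (t • w))) 0 t *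
      fderiv ℝ (fun v ↦ f (j v)) 0 w := by
    refine (hslope.mul_const (fderiv ℝ (fun v ↦ f (j v)) 0 w)).eventually (lt_mem_nhds ?_)
    exact mul_self_pos.2 hw
  rw [eventually_nhdsWithin_iff] at hsl
  have hsw : ∀ᶠ t in 𝓝 (0 : ℝ), t • w ∈ Metric.ball 0 r :=
    (tendsto_smul_zero w).eventually (Metric.ball_mem_nhds 0 hr)
  obtain ⟨a, ha, hab⟩ := Metric.eventually_nhds_iff_ball.1 (hsl.and hsw)
  have ha2 : a / 2 ∈ Metric.ball (0 : ℝ) a := by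
    rw [mem_ball_zero_iff, Real.norm_eq_abs, abs_of_pos (by positivity)]; linarith
  have ha3 : -(a / 2) ∈ Metric.ball (0 : ℝ) a := by
    rw [mem_ball_zero_iff, norm_neg, Real.norm_eq_abs, abs_of_pos (by positivity)]; linarith
  obtain ⟨h2, h3⟩ := hab _ ha2
  obtain ⟨h4, h5⟩ := hab _ ha3
  have h2 := h2 (by simp; positivity)
  have h4 := h4 (by simp; positivity)
  rw [slope_def_field, zero_smul, h.base, sub_zero, div_mul_eq_mul_div] at h2 h4
  have h2 : 0 < (f (j ((a / 2) • w)) - f p) * fderiv ℝ (fun v ↦ f (j v)) 0 w := by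
    have := mul_pos h2 (half_pos ha)
    rwa [div_mul_cancel₀ _ (by positivity)] at this
  have h4 : (f (j (-(a / 2) • w)) - f p) * fderiv ℝ (fun v ↦ f (j v)) 0 w < 0 := by
    rw [div_neg] at h4
    have := mul_pos h4 (half_pos ha)
    rw [neg_mul, div_mul_cancel₀ _ (by positivity)] at this
    linarith
  have hrk : 1 < Module.rank ℝ (EuclideanSpace ℝ (Fin k)) := by
    rw [← Module.finrank_eq_rank, finrank_euclideanSpace, Fintype.card_fin]
    exact_mod_cast hk
  have hconn := isPreconnected_sphere hrk 0 ‖(a / 2) • w‖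
  have hsub : ∀ v ∈ Metric.sphere (0 : EuclideanSpace ℝ (Fin k)) ‖(a / 2) • w‖,
      v ∈ Metric.ball 0 r ∧ v ≠ 0 := by
    intro v hv
    rw [mem_sphere_zero_iff_norm] at hv
    refine ⟨by rw [mem_ball_zero_iff, hv]; simpa using h3, ?_⟩
    rw [← norm_ne_zero_iff, hv, norm_ne_zero_iff]
    exact smul_ne_zero (by positivity) hw0
  have hsg : ContinuousOn (fun v ↦ (f (j v) - f p) * fderiv ℝ (fun v ↦ f (j v)) 0 w)
      (Metric.sphere (0 : EuclideanSpace ℝ (Fin k)) ‖(a / 2) • w‖) := by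
    refine ContinuousOn.mul (ContinuousOn.sub (fun v hv ↦ ?_) continuousOn_const) continuousOn_const
    exact (hball v (hsub v hv).1).1.continuousWithinAt
  have hivt := hconn.intermediate_value (a := -(a / 2) • w) (b := (a / 2) • w) (by simp [norm_smul])
    (by simp) hsg
  obtain ⟨v, hv, hv0⟩ := hivt ⟨h4.le, h2.le⟩
  rcases mul_eq_zero.1 hv0 with h6 | h6
  · exact hne v (hsub v hv).1 (hsub v hv).2 (sub_eq_zero.1 h6)
  · exact hw h6

end Slice

section OrbitRelation

theorem IsPreconnected.forall_of_isClopen {α : Type*} [TopologicalSpace α] {s : Set α}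
    (hs : IsPreconnected s) {P : α → Prop} (hopen : ∀ x ∈ s, P x → ∀ᶠ y in 𝓝[s] x, P y)
    (hclosed : ∀ x ∈ s, (∃ᶠ y in 𝓝[s] x, P y) → P x) {x₀ : α} (hx₀ : x₀ ∈ s) (h₀ : P x₀)
    {x : α} (hx : x ∈ s) : P x := by
  refine (hs.induction₂ (fun x y ↦ P x ↔ P y) (fun x hx ↦ ?_) (fun x y z _ _ _ h h' ↦ h.trans h')
    (fun x y _ _ h ↦ h.symm) hx₀ hx).1 h₀
  by_cases h : P x
  · exact (hopen x hx h).mono fun y hy ↦ iff_of_true h hy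
  · have h1 := not_frequently.1 (mt (hclosed x hx) h)
    exact h1.mono fun y hy ↦ iff_of_false h hy

theorem isClosed_orbitRel (G : Type*) [TopologicalSpace G] [Group G] [CompactSpace G] {N : Type*}
    [TopologicalSpace N] [T2Space N] [MulAction G N] [ContinuousSMul G N] :
    IsClosed {q : N × N | q.1 ∈ orbit G q.2} := by
  have h1 : IsClosed {x : G × (N × N) | x.1 • x.2.2 = x.2.1} :=
    isClosed_eq (by fun_prop) (by fun_prop)
  have h2 := isClosedMap_snd_of_compactSpace _ h1
  convert! h2 using 1
  ext q
  constructor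
  · rintro ⟨g, hg⟩
    exact ⟨(g, q), hg, rfl⟩
  · rintro ⟨⟨g, q'⟩, hg, rfl⟩
    exact ⟨g, hg⟩

end OrbitRelation

section Dichotomy

variable {m n : ℕ} {G : Type*} [TopologicalSpace G] [ChartedSpace (EuclideanSpace ℝ (Fin m)) G]
  [Group G] [LieGroup (𝓡 m) ∞ G] [CompactSpace G] {N : Type*} [TopologicalSpace N] [T2Space N]
  [ChartedSpace (EuclideanSpace ℝ (Fin n)) N] [IsManifold (𝓡 n) ∞ N]
  [MulAction G N] [ContMDiffSMul (𝓡 m) (𝓡 n) ∞ G N]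

/-- In a slice at a limit of orbits of codimension one, the levels of the squared distance from
the orbit either lie in a single orbit, or the slice is a curve which meets every orbit once. -/
theorem exists_slice_dichotomy (hcoh : ∀ x : N, orbitDim m n G x + 1 ≤ n) {p : N}
    (hp : p ∈ closure {x : N | orbitDim m n G x + 1 = n}) :
    ∃ k j τ O δ, IsSlice m n G p k j τ O δ ∧
    ∃ (s : N → ℝ) (κ c₀ : ℝ), ContMDiff (𝓡 n) 𝓘(ℝ, ℝ) ∞ s ∧ (∀ (g : G) y, s (g • y) = s y) ∧
      s p = 0 ∧ 0 < κ ∧ 0 < c₀ ∧ 0 < k ∧ (∀ v, ‖v‖ < δ → κ * ‖v‖ ^ 2 ≤ s (j v)) ∧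
      (((∀ v w, ‖v‖ < δ → ‖w‖ < δ → s (j v) = s (j w) → s (j v) < c₀ →
          j v ∈ orbit G (j w)) ∧
        ∀ e, ‖e‖ = 1 → ∀ ε > 0, ∃ t ∈ Ioo (0 : ℝ) ε, ∃ t' ∈ Ioo (0 : ℝ) ε,
          j (t • e) ∈ orbit G (j (-t' • e))) ∨
      (k = 1 ∧ ∀ v w, ‖v‖ < δ → ‖w‖ < δ → s (j v) < c₀ →
        j v ∈ orbit G (j w) → v = w)) := by
  have : IsTopologicalGroup G := topologicalGroup_of_lieGroup (𝓡 m) ∞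
  have : ContinuousSMul G N := ContMDiffSMul.continuousSMul (I := 𝓡 m) (I' := 𝓡 n) ∞
  let M := {x : N | orbitDim m n G x + 1 = n}
  have hM : IsOpen M := by
    refine isOpen_iff_mem_nhds.2 fun x hx ↦ ?_
    filter_upwards [eventually_orbitDim_le (m := m) (n := n) (G := G) x] with y hy
    have h1 := hcoh y
    have h2 : orbitDim m n G x + 1 = n := hx
    change orbitDim m n G y + 1 = n
    omega
  have hMG : ∀ (g : G) (x : N), x ∈ M → g • x ∈ M := fun g x hx ↦ by
    change orbitDim m n G (g • x) + 1 = n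
    rw [orbitDim_smul]
    exact hx
  have hMo : ∀ x y : N, x ∈ M → y ∈ orbit G x → y ∈ M := by
    rintro x _ hx ⟨g, rfl⟩
    exact hMG g x hx
  obtain ⟨k, j, τ, O, δ, h, hOW, s, κ, hs, hsG, hsp, hκ, hle, hrad⟩ :=
    exists_isSlice_and_function m n G p (W := {x | p ∈ M → x ∈ M}) (by
      by_cases hpM : p ∈ M
      · filter_upwards [hM.mem_nhds hpM] with x hx _ using hx
      · exact Eventually.of_forall fun x h ↦ absurd h hpM)
  have hk0 : 0 < k := by have := h.dim_eq; have := hcoh p; omega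
  have hj0 : s (j 0) = 0 := by rw [h.base, hsp]
  have hσ : ContDiffOn ℝ ∞ (fun v ↦ s (j v)) (Metric.ball 0 δ) :=
    (hs.comp_contMDiffOn h.contMDiffOn_param).contDiffOn
  obtain ⟨c₀, hc₀, ρ, hρ, hρu, hρc⟩ := exists_polar h.pos hσ hj0 hκ hle hrad
  have ha : ∀ e c, ‖e‖ = 1 → c ∈ Ioo 0 c₀ → ‖ρ e c • e‖ < δ ∧ s (j (ρ e c • e)) = c := by
    intro e c he hc
    obtain ⟨h1, h2⟩ := hρ e c he hc
    refine ⟨?_, h2⟩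
    rw [norm_smul, he, mul_one, Real.norm_eq_abs, abs_of_pos h1.1]
    exact h1.2
  have hpos : ∀ v, v ≠ 0 → ‖v‖ < δ → 0 < s (j v) := fun v hv0 hv ↦
    lt_of_lt_of_le (mul_pos hκ (pow_pos (norm_pos_iff.2 hv0) 2)) (hle v hv)
  have hpolar : ∀ v, v ≠ 0 → ‖v‖ < δ → s (j v) < c₀ → ∃ e, ‖e‖ = 1 ∧ v = ρ e (s (j v)) • e := by
    intro v hv0 hv hc
    have h1 : 0 < ‖v‖ := norm_pos_iff.2 hv0
    have h2 : ‖(‖v‖⁻¹ • v)‖ = 1 := norm_smul_inv_norm (𝕜 := ℝ) hv0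
    have h3 : ‖v‖ • (‖v‖⁻¹ • v) = v := by rw [smul_smul, mul_inv_cancel₀ h1.ne', one_smul]
    refine ⟨_, h2, ?_⟩
    rcases hρu _ ‖v‖ h2 ⟨h1, hv⟩ with h4 | h4
    · rw [h3] at h4
      rw [h4, h3]
    · rw [h3] at h4
      exact absurd hc h4.not_gt
  have hds : ∀ v, v ≠ 0 → ‖v‖ < δ → mvfderiv (𝓡 n) s (j v) ≠ 0 := by
    intro v hv0 hv h0
    have h1 := hasFDerivAt_comp_param (hs.contMDiffAt.mdifferentiableAt (x := j v) (by simp))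
      ((h.contMDiffAt_param hv).mdifferentiableAt (by simp))
    have h2 := hrad v hv0 hv
    rw [h1.fderiv, h0] at h2
    exact lt_irrefl _ h2
  have hsGe : ∀ x : N, ∀ᶠ y in 𝓝 x, ∀ z ∈ orbit G y, s z = s y := fun x ↦
    Eventually.of_forall fun y z ⟨g, hg⟩ ↦ by rw [← hg]; exact hsG g y
  have hρj : ContinuousOn (fun q : EuclideanSpace ℝ (Fin k) × ℝ ↦ j (ρ q.1 q.2 • q.1))
      (Metric.sphere 0 1 ×ˢ Ioo 0 c₀) := by
    intro q hq
    have hq1 : ‖q.1‖ = 1 := by simpa using hq.1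
    refine ContinuousAt.comp_continuousWithinAt
      (h.continuousAt_param (ha q.1 q.2 hq1 hq.2).1) ?_
    exact (hρc q hq).smul continuousWithinAt_fst
  have hje : ∀ e, ‖e‖ = 1 → ContinuousOn (fun c ↦ j (ρ e c • e)) (Ioo 0 c₀) := fun e he ↦
    hρj.comp (f := fun c ↦ (e, c)) (by fun_prop) fun c hc ↦ ⟨by simpa using he, hc⟩
  have hjc : ∀ c ∈ Ioo 0 c₀, ContinuousOn (fun e ↦ j (ρ e c • e)) (Metric.sphere 0 1) :=
    fun c hc ↦ hρj.comp (f := fun e ↦ (e, c)) (by fun_prop) fun e he ↦ ⟨he, hc⟩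
  have ha0 : ∀ e c, ‖e‖ = 1 → c ∈ Ioo 0 c₀ → ρ e c • e ≠ 0 := by
    intro e c he hc h0
    have := (ha e c he hc).2
    rw [h0, hj0] at this
    exact hc.1.ne this
  have hrelc : ∀ e e', ‖e‖ = 1 → ‖e'‖ = 1 → ∀ c ∈ Ioo 0 c₀,
      (∃ᶠ c' in 𝓝[Ioo 0 c₀] c, j (ρ e c' • e) ∈ orbit G (j (ρ e' c' • e'))) →
      j (ρ e c • e) ∈ orbit G (j (ρ e' c • e')) := by
    intro e e' he he' c hc hf
    have h1 : Tendsto (fun c ↦ (j (ρ e c • e), j (ρ e' c • e'))) (𝓝[Ioo 0 c₀] c)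
        (𝓝 (j (ρ e c • e), j (ρ e' c • e'))) := (hje e he c hc).prodMk_nhds (hje e' he' c hc)
    exact (isClosed_orbitRel G (N := N)).mem_of_frequently_of_tendsto hf h1
  -- the conclusion, if each level lies in an orbit
  have hBd : (∀ e e', ‖e‖ = 1 → ‖e'‖ = 1 → ∀ c ∈ Ioo 0 c₀,
      j (ρ e c • e) ∈ orbit G (j (ρ e' c • e'))) →
      ((∀ v w, ‖v‖ < δ → ‖w‖ < δ → s (j v) = s (j w) → s (j v) < c₀ →
          j v ∈ orbit G (j w)) ∧
        ∀ e, ‖e‖ = 1 → ∀ ε > 0, ∃ t ∈ Ioo (0 : ℝ) ε, ∃ t' ∈ Ioo (0 : ℝ) ε,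
          j (t • e) ∈ orbit G (j (-t' • e))) := by
    intro hall
    constructor
    · intro v w hv hw hvw hc
      by_cases hv0 : v = 0
      · by_cases hw0 : w = 0
        · rw [hv0, hw0]
          exact mem_orbit_self _
        · have := hpos w hw0 hw
          rw [← hvw, hv0, hj0] at this
          exact absurd this (lt_irrefl _)
      have hw0 : w ≠ 0 := by
        rintro rfl
        have := hpos v hv0 hv
        rw [hvw, hj0] at this
        exact lt_irrefl _ this
      obtain ⟨e, he, hve⟩ := hpolar v hv0 hv hc
      obtain ⟨e', he', hwe⟩ := hpolar w hw0 hw (hvw ▸ hc)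
      rw [hve, hwe, ← hvw]
      exact hall e e' he he' _ ⟨hpos v hv0 hv, hc⟩
    · intro e he ε hε
      let c := min (c₀ / 2) (κ * (ε / 2) ^ 2)
      have hc : c ∈ Ioo 0 c₀ := ⟨by positivity, (min_le_left _ _).trans_lt (by linarith)⟩
      have hlt : ∀ e, ‖e‖ = 1 → ρ e c ∈ Ioo 0 ε := by
        intro e he
        have h1 := hle _ (ha e c he hc).1
        rw [(ha e c he hc).2, norm_smul, he, mul_one, Real.norm_eq_abs, sq_abs] at h1
        have h2 : κ * ρ e c ^ 2 ≤ κ * (ε / 2) ^ 2 := h1.trans (min_le_right _ _)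
        have h3 := le_of_mul_le_mul_left h2 hκ
        have h4 := (pow_le_pow_iff_left₀ (hρ e c he hc).1.1.le (by positivity) two_ne_zero).1 h3
        exact ⟨(hρ e c he hc).1.1, by linarith⟩
      have hne : ‖-e‖ = 1 := by rwa [norm_neg]
      refine ⟨ρ e c, hlt e he, ρ (-e) c, hlt (-e) hne, ?_⟩
      rw [neg_smul, ← smul_neg]
      exact hall e (-e) he hne c hc
  refine ⟨k, j, τ, O, δ, h, s, κ, c₀, hs, hsG, hsp, hκ, hc₀, hk0, hle, ?_⟩
  obtain hk | hk : k = 1 ∨ 2 ≤ k := by omega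
  · subst hk
    have hpM : p ∈ M := h.dim_eq
    have hOM : ∀ x ∈ O, x ∈ M := fun x hx ↦ hOW hx hpM
    let e₁ : EuclideanSpace ℝ (Fin 1) := EuclideanSpace.single 0 1
    have he₁ : ‖e₁‖ = 1 := by simp [e₁]
    have he₁' : ‖-e₁‖ = 1 := by rwa [norm_neg]
    have hunit : ∀ e : EuclideanSpace ℝ (Fin 1), ‖e‖ = 1 → e = e₁ ∨ e = -e₁ := by
      intro e he
      have h1 : e 0 = 1 ∨ e 0 = -1 := by simpa [EuclideanSpace.norm_eq] using he
      rcases h1 with h2 | h2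
      · left
        ext i
        fin_cases i
        simpa [e₁] using h2
      · right
        ext i
        fin_cases i
        simpa [e₁] using h2
    by_cases hR : ∃ c ∈ Ioo 0 c₀, j (ρ e₁ c • e₁) ∈ orbit G (j (ρ (-e₁) c • -e₁))
    · left
      obtain ⟨c₁, hc₁, hR⟩ := hR
      have hall : ∀ c ∈ Ioo 0 c₀,
          j (ρ e₁ c • e₁) ∈ orbit G (j (ρ (-e₁) c • -e₁)) := by
        intro c hc
        refine isPreconnected_Ioo.forall_of_isClopen (s := Ioo 0 c₀) (P := fun c ↦
          j (ρ e₁ c • e₁) ∈ orbit G (j (ρ (-e₁) c • -e₁))) ?_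
          (hrelc _ _ he₁ he₁') hc₁ hR hc
        intro c hc hcR
        obtain ⟨g, hg⟩ := hcR
        have hg : g • j (ρ (-e₁) c • -e₁) = j (ρ e₁ c • e₁) := hg
        obtain ⟨W, hW, hWo⟩ := exists_nhds_mem_orbit_of_eq (m := m) (G := G)
          (p := j (ρ e₁ c • e₁)) (hOM _ (h.param_mem _ (ha _ _ he₁ hc).1)) hs.contMDiffAt
          (hsGe _) (hds _ (ha0 _ _ he₁ hc) (ha _ _ he₁ hc).1)
        have h1 := (hje e₁ he₁ c hc).eventually hW
        have h2 : ∀ᶠ c' in 𝓝[Ioo 0 c₀] c, g • j (ρ (-e₁) c' • -e₁) ∈ W := by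
          have h3 : Tendsto (fun c' ↦ g • j (ρ (-e₁) c' • -e₁)) (𝓝[Ioo 0 c₀] c)
              (𝓝 (g • j (ρ (-e₁) c • -e₁))) :=
            (continuous_const_smul g).continuousAt.tendsto.comp (hje (-e₁) he₁' c hc)
          rw [hg] at h3
          exact h3.eventually hW
        filter_upwards [h1, h2, self_mem_nhdsWithin] with c' hc1 hc2 hc'
        have h3 := hWo _ hc1 _ hc2 (by
          rw [hsG, (ha _ _ he₁ hc').2, (ha _ _ he₁' hc').2])
        rwa [orbit_smul] at h3
      refine hBd fun e e' he he' c hc ↦ ?_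
      rcases hunit e he with rfl | rfl <;> rcases hunit e' he' with rfl | rfl
      · exact mem_orbit_self _
      · exact hall c hc
      · exact mem_orbit_symm.1 (hall c hc)
      · exact mem_orbit_self _
    · right
      refine ⟨rfl, fun v w hv hw hc hvw ↦ ?_⟩
      have hsvw : s (j v) = s (j w) := by
        obtain ⟨g, hg⟩ := hvw
        rw [← hg]
        exact hsG g _
      by_cases hv0 : v = 0
      · by_contra hne
        have := hpos w (fun hw0 ↦ hne (by rw [hv0, hw0])) hw
        rw [← hsvw, hv0, hj0] at this
        exact lt_irrefl _ this
      have hw0 : w ≠ 0 := by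
        rintro rfl
        have := hpos v hv0 hv
        rw [hsvw, hj0] at this
        exact lt_irrefl _ this
      obtain ⟨e, he, hve⟩ := hpolar v hv0 hv hc
      obtain ⟨e', he', hwe⟩ := hpolar w hw0 hw (hsvw ▸ hc)
      have hcm : s (j v) ∈ Ioo 0 c₀ := ⟨hpos v hv0 hv, hc⟩
      generalize s (j v) = c at hve hwe hsvw hcm
      rw [← hsvw] at hwe
      rw [hve, hwe] at hvw ⊢
      rcases hunit e he with rfl | rfl <;> rcases hunit e' he' with rfl | rfl
      · rfl
      · exact absurd ⟨c, hcm, hvw⟩ hR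
      · exact absurd ⟨c, hcm, mem_orbit_symm.1 hvw⟩ hR
      · rfl
  · left
    have hrk : 1 < Module.rank ℝ (EuclideanSpace ℝ (Fin k)) := by
      rw [← Module.finrank_eq_rank, finrank_euclideanSpace, Fintype.card_fin]
      exact_mod_cast hk
    have hsphere := isPreconnected_sphere hrk 0 1
    let C : ℝ → Prop := fun c ↦ ∃ e, ‖e‖ = 1 ∧ j (ρ e c • e) ∈ M
    have hC : ∀ c ∈ Ioo 0 c₀, C c → ∀ e e', ‖e‖ = 1 → ‖e'‖ = 1 →
        j (ρ e c • e) ∈ orbit G (j (ρ e' c • e')) := by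
      rintro c hc ⟨e₀, he₀, hM₀⟩
      have key : ∀ e, ‖e‖ = 1 → j (ρ e c • e) ∈ orbit G (j (ρ e₀ c • e₀)) := by
        intro e he
        refine hsphere.forall_of_isClopen (P := fun e ↦
          j (ρ e c • e) ∈ orbit G (j (ρ e₀ c • e₀))) ?_ ?_ (x₀ := e₀) (by simpa using he₀)
          (mem_orbit_self _) (by simpa using he)
        · intro e he hP
          have he' : ‖e‖ = 1 := by simpa using he
          obtain ⟨W, hW, hWo⟩ := exists_nhds_mem_orbit_of_eq (m := m) (G := G)
            (p := j (ρ e c • e)) (hMo _ _ hM₀ hP) hs.contMDiffAt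
            (hsGe _) (hds _ (ha0 _ _ he' hc) (ha _ _ he' hc).1)
          filter_upwards [(hjc c hc e he).eventually hW, self_mem_nhdsWithin] with e' h1 h2
          have h2 : ‖e'‖ = 1 := by simpa using h2
          have h3 := hWo _ h1 _ (mem_of_mem_nhds hW) (by
            rw [(ha _ _ h2 hc).2, (ha _ _ he' hc).2])
          rw [orbit_eq_iff.2 hP] at h3
          exact h3
        · intro e he hP
          have h1 : Tendsto (fun e ↦ (j (ρ e c • e), j (ρ e₀ c • e₀)))
              (𝓝[Metric.sphere 0 1] e) (𝓝 (j (ρ e c • e), j (ρ e₀ c • e₀))) :=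
            (hjc c hc e he).prodMk_nhds continuousWithinAt_const
          exact (isClosed_orbitRel G (N := N)).mem_of_frequently_of_tendsto hP h1
      intro e e' he he'
      have h1 := key e he
      rwa [← orbit_eq_iff.2 (key e' he')] at h1
    have hCall : ∀ c ∈ Ioo 0 c₀, C c := by
      have hpM : p ∉ M := fun hpM ↦ by
        have h1 := h.dim_eq
        have h2 : orbitDim m n G p + 1 = n := hpM
        omega
      have hτ0 : Tendsto (fun y ↦ s (j (τ y))) (𝓝 p) (𝓝 0) := by
        have hτp : τ p = 0 := (h.mem_orbit_iff p h.mem).1 (mem_orbit_self p)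
        have h1 : ContinuousAt (fun y ↦ s (j (τ y))) p := by
          refine ContinuousAt.comp (g := fun v ↦ s (j v)) (f := τ) ?_
            (h.contMDiffAt_retract h.mem).continuousAt
          rw [hτp]
          exact hσ.continuousOn.continuousAt (Metric.ball_mem_nhds 0 h.pos)
        rwa [ContinuousAt, hτp, hj0] at h1
      obtain ⟨y, hyM, hyO, hyc⟩ := ((mem_closure_iff_frequently.1 hp).and_eventually
        (Filter.Eventually.and (h.isOpen.mem_nhds h.mem) (hτ0.eventually (gt_mem_nhds hc₀)))).exists
      obtain ⟨g, hg⟩ := h.exists_smul y hyO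
      have hjM : j (τ y) ∈ M := by
        refine hMo y _ hyM ⟨g⁻¹, ?_⟩
        change g⁻¹ • y = _
        conv_lhs => rw [hg]
        rw [inv_smul_smul]
      have hτy := h.norm_retract_lt y hyO
      have hτ0 : τ y ≠ 0 := fun h0 ↦ by
        rw [h0, h.base] at hjM
        exact hpM hjM
      obtain ⟨e, he, hve⟩ := hpolar _ hτ0 hτy hyc
      intro c hc
      refine isPreconnected_Ioo.forall_of_isClopen (s := Ioo 0 c₀) (P := C) ?_ ?_
        (x₀ := s (j (τ y))) ⟨hpos _ hτ0 hτy, hyc⟩ ⟨e, he, hve ▸ hjM⟩ hc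
      · rintro c hc ⟨e, he, hM₀⟩
        filter_upwards [(hje e he c hc).eventually (hM.mem_nhds hM₀)] with c' hc'
        exact ⟨e, he, hc'⟩
      · intro c hc hfr
        refine ⟨e, he, ?_⟩
        by_contra hzM
        have hz2 : orbitDim m n G (j (ρ e c • e)) + 2 ≤ n := by
          have h1 := hcoh (j (ρ e c • e))
          have h2 : ¬ orbitDim m n G (j (ρ e c • e)) + 1 = n := hzM
          omega
        refine hds _ (ha0 _ _ he hc) (ha _ _ he hc).1
          (mvfderiv_eq_zero_of_codim hz2 hs.contMDiffAt (hsGe _) ?_)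
        filter_upwards [h.isOpen.mem_nhds (h.param_mem _ (ha _ _ he hc).1)] with x hx hsx
        rw [(ha _ _ he hc).2] at hsx
        obtain ⟨g, hg⟩ := h.exists_smul x hx
        have hsx' : s (j (τ x)) = c := by
          rw [← hsx]
          conv_rhs => rw [hg, hsG]
        have hτx := h.norm_retract_lt x hx
        have hτx0 : τ x ≠ 0 := fun h0 ↦ by
          rw [h0, hj0] at hsx'
          exact hc.1.ne hsx'
        obtain ⟨e', he', hve'⟩ := hpolar _ hτx0 hτx (hsx' ▸ hc.2)
        rw [hsx'] at hve'
        have h1 : j (ρ e' c • e') ∈ orbit G (j (ρ e c • e)) := by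
          refine hrelc e' e he' he c hc ?_
          have h2 : ∀ᶠ c' in 𝓝[Ioo 0 c₀] c, c' ∈ Ioo 0 c₀ := self_mem_nhdsWithin
          exact (hfr.and_eventually h2).mono fun c' hc' ↦ hC c' hc'.2 hc'.1 e' e he' he
        rw [hg, hve']
        obtain ⟨g', hg'⟩ := h1
        exact ⟨g * g', by rw [← hg']; exact mul_smul _ _ _⟩
    exact hBd fun e e' he he' c hc ↦ hC c hc (hCall c hc) e e' he he'

end Dichotomy

section GradientBounds

variable {n : ℕ} {N : Type*} [TopologicalSpace N] [ChartedSpace (EuclideanSpace ℝ (Fin n)) N]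
  [IsManifold (𝓡 n) ∞ N] [RiemannianBundle (fun x : N ↦ TangentSpace (𝓡 n) x)]
  [IsContMDiffRiemannianBundle (𝓡 n) ∞ (EuclideanSpace ℝ (Fin n))
    (fun x : N ↦ TangentSpace (𝓡 n) x)]

theorem contMDiffAt_norm_gradientField_sq {f : N → ℝ} {x : N}
    (hf : ContMDiffAt (𝓡 n) 𝓘(ℝ, ℝ) ∞ f x) :
    ContMDiffAt (𝓡 n) 𝓘(ℝ, ℝ) ∞ (fun y ↦ ‖gradientField n f y‖ ^ 2) x := by
  have h := (smoothFieldAt_gradientField hf).inner (smoothFieldAt_gradientField hf)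
  simpa only [real_inner_self_eq_norm_sq] using h

theorem PreservesMetric.norm_mfderiv {φ : N → N} (h : PreservesMetric (n := n) φ) (x : N)
    (v : TangentSpace (𝓡 n) x) : ‖mfderiv (𝓡 n) (𝓡 n) φ x v‖ = ‖v‖ := by
  have h1 := h x v v
  rw [real_inner_self_eq_norm_sq, real_inner_self_eq_norm_sq] at h1
  exact (pow_left_inj₀ (norm_nonneg _) (norm_nonneg _) two_ne_zero).1 h1

theorem PreservesMetric.norm_gradientField {φ : N → N} (h : PreservesMetric (n := n) φ)
    {x : N} (hφ : MDifferentiableAt (𝓡 n) (𝓡 n) φ x) {f : N → ℝ}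
    (hf : MDifferentiableAt (𝓡 n) 𝓘(ℝ, ℝ) f (φ x)) (hfφ : ∀ᶠ y in 𝓝 x, f (φ y) = f y) :
    ‖gradientField n f (φ x)‖ = ‖gradientField n f x‖ := by
  rw [← h.mfderiv_gradientField hφ hf hfφ, h.norm_mfderiv]

theorem abs_mvfderiv_le (f : N → ℝ) (x : N) (v : TangentSpace (𝓡 n) x) :
    |mvfderiv (𝓡 n) f x v| ≤ ‖gradientField n f x‖ * ‖v‖ := by
  rw [← inner_gradientField]
  exact abs_real_inner_le_norm _ _

theorem norm_apply_le_of_opNorm_le {E F : Type*} {_ : SeminormedAddCommGroup E}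
    {_ : SeminormedAddCommGroup F} {_ : NormedSpace ℝ E} {_ : NormedSpace ℝ F} {f : E →L[ℝ] F}
    {C : ℝ} (h : ‖f‖ ≤ C) (w : E) : ‖f w‖ ≤ C * ‖w‖ :=
  f.le_of_opNorm_le h w

theorem exists_norm_mfderiv_chart_symm_le (p : N) :
    ∃ C > 0, ∀ᶠ z in 𝓝 (chartAt (EuclideanSpace ℝ (Fin n)) p p), ∀ w : EuclideanSpace ℝ (Fin n),
      ‖(mfderiv 𝓘(ℝ, EuclideanSpace ℝ (Fin n)) (𝓡 n) (chartAt (EuclideanSpace ℝ (Fin n)) p).symm z w :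
        TangentSpace (𝓡 n) ((chartAt (EuclideanSpace ℝ (Fin n)) p).symm z))‖ ≤ C * ‖w‖ := by
  have : IsContinuousRiemannianBundle (EuclideanSpace ℝ (Fin n))
      (fun x : N ↦ TangentSpace (𝓡 n) x) := by
    obtain ⟨g, hg⟩ := ‹IsContMDiffRiemannianBundle (𝓡 n) ∞ (EuclideanSpace ℝ (Fin n))
      (fun x : N ↦ TangentSpace (𝓡 n) x)›
    exact ⟨g, hg.1.continuous, hg.2⟩
  obtain ⟨C, hC, hbound⟩ := eventually_norm_mfderivWithin_symm_extChartAt_lt (𝓡 n) p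
  rw [ModelWithCorners.range_eq_univ, nhdsWithin_univ] at hbound
  refine ⟨C, hC, hbound.mono fun z hz w ↦ ?_⟩
  rw [mfderivWithin_univ] at hz
  exact norm_apply_le_of_opNorm_le hz.le w

/-- The gradient of a function that grows quadratically along a curve grows at least linearly. -/
theorem exists_le_norm_gradientField_sq {s : N → ℝ} (hs : ContMDiff (𝓡 n) 𝓘(ℝ, ℝ) ∞ s) {c : ℝ → N}
    (hc : ContMDiffAt 𝓘(ℝ, ℝ) (𝓡 n) ∞ c 0) (hsc : ∀ᶠ t in 𝓝 0, s (c t) = t ^ 2) :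
    ∃ κ > 0, ∀ᶠ t in 𝓝 0, κ * t ^ 2 ≤ ‖gradientField n s (c t)‖ ^ 2 := by
  let e := chartAt (EuclideanSpace ℝ (Fin n)) (c 0)
  have he : e ∈ IsManifold.maximalAtlas (𝓡 n) ∞ N := IsManifold.chart_mem_maximalAtlas _
  have h0 : c 0 ∈ e.source := mem_chart_source _ _
  obtain ⟨C, hC, hbound⟩ := exists_norm_mfderiv_chart_symm_le (n := n) (c 0)
  let a : ℝ → EuclideanSpace ℝ (Fin n) := fun t ↦ e (c t)
  have ha : ContDiffAt ℝ ∞ a 0 :=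
    ((contMDiffAt_of_mem_maximalAtlas he h0).comp (0 : ℝ) hc).contDiffAt
  have ha1 : ∀ᶠ t in 𝓝 0, DifferentiableAt ℝ a t := by
    have := (ha.of_le (natCast_le_infty 1)).eventually (by simp)
    exact this.mono fun y hy ↦ hy.differentiableAt (by simp)
  have ha2 : ContinuousAt (deriv a) 0 := by
    have := (ha.fderiv_right (m := 0) (by simp)).continuousAt
    have h2 := this.clm_apply (continuousAt_const (y := (1 : ℝ)))
    exact h2
  have ha3 : ∀ᶠ t in 𝓝 0, ‖deriv a t‖ < ‖deriv a 0‖ + 1 :=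
    ha2.norm.eventually (gt_mem_nhds (by linarith))
  have hcs : ∀ᶠ t in 𝓝 0, c t ∈ e.source := hc.continuousAt.eventually (e.open_source.mem_nhds h0)
  have hab := ha.continuousAt.eventually hbound
  let K := C * (‖deriv a 0‖ + 1)
  have hK : 0 < K := by positivity
  refine ⟨(2 / K) ^ 2, by positivity, ?_⟩
  filter_upwards [ha1, ha3, hcs, hab, hsc.eventually_nhds, hcs.eventually_nhds] with t h1 h3 h4 h5 h6 h6s
  have hat : a t ∈ e.target := e.map_source h4
  have hsymm : MDifferentiableAt 𝓘(ℝ, EuclideanSpace ℝ (Fin n)) (𝓡 n) e.symm (a t) :=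
    (contMDiffAt_symm_of_mem_maximalAtlas he hat).mdifferentiableAt (by simp)
  have h7 := hasFDerivAt_comp_param (f := s) (hs.contMDiffAt.mdifferentiableAt (by simp)) hsymm
  have h8 := h7.comp_hasDerivAt t h1.hasDerivAt
  have h9 : (fun t ↦ s (e.symm (a t))) =ᶠ[𝓝 t] fun t ↦ t ^ 2 := by
    filter_upwards [h6, h6s] with t' h10 h11
    rw [← h10]
    exact congrArg s (e.left_inv h11)
  have h10 : HasDerivAt (fun t : ℝ ↦ t ^ 2) (2 * t) t := by
    simpa using hasDerivAt_pow 2 t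
  have h11 := h8.unique (h10.congr_of_eventuallyEq h9)
  have h12 : |2 * t| ≤ ‖gradientField n s (c t)‖ * K := by
    rw [← h11]
    have h13 : e.symm (a t) = c t := e.left_inv h4
    have h14 := abs_mvfderiv_le s (e.symm (a t))
      (mfderiv 𝓘(ℝ, EuclideanSpace ℝ (Fin n)) (𝓡 n) e.symm (a t) (deriv a t))
    have h15 : ‖gradientField n s (e.symm (a t))‖ = ‖gradientField n s (c t)‖ := by rw [h13]
    rw [← h15]
    refine h14.trans (mul_le_mul_of_nonneg_left ((h5 _).trans ?_) (norm_nonneg _))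
    exact mul_le_mul_of_nonneg_left h3.le hC.le
  have h13 := pow_le_pow_left₀ (abs_nonneg _) h12 2
  rw [sq_abs] at h13
  rw [div_pow, div_mul_eq_mul_div, div_le_iff₀ (by positivity), ← mul_pow, ← mul_pow]
  exact h13

end GradientBounds

section Coordinates

variable (n : ℕ) (G : Type*) [Group G] {N : Type*} [TopologicalSpace N]
  [ChartedSpace (EuclideanSpace ℝ (Fin n)) N] [MulAction G N]
  [RiemannianBundle (fun x : N ↦ TangentSpace (𝓡 n) x)]

/-- A unit speed coordinate transverse to the orbits in the invariant open set `U`. -/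
structure IsRegularCoord (U : Set N) (r : N → ℝ) : Prop where
  isOpen : IsOpen U
  smul_mem : ∀ (g : G), ∀ x ∈ U, g • x ∈ U
  contMDiffOn : ContMDiffOn (𝓡 n) 𝓘(ℝ, ℝ) ∞ r U
  norm_gradient : ∀ x ∈ U, ‖gradientField n r x‖ ^ 2 = 1
  levelSets : LevelSetsAreOrbits G r U
  ordConnected : (r '' U).OrdConnected

/-- The squared distance from the orbit of `p` in the invariant open set `U`. -/
structure IsBoundaryCoord (p : N) (U : Set N) (u : N → ℝ) (ε : ℝ) : Prop where
  isOpen : IsOpen U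
  smul_mem : ∀ (g : G), ∀ x ∈ U, g • x ∈ U
  mem : p ∈ U
  apply_base : u p = 0
  contMDiffOn : ContMDiffOn (𝓡 n) 𝓘(ℝ, ℝ) ∞ u U
  norm_gradient : ∀ x ∈ U, ‖gradientField n u x‖ ^ 2 = 4 * u x
  levelSets : LevelSetsAreOrbits G u U
  pos : 0 < ε
  image : u '' U = Ico 0 (ε ^ 2)

variable {n G}

theorem LevelSetsAreOrbits.apply_smul {f : N → ℝ} {U : Set N} (h : LevelSetsAreOrbits G f U)
    (hU : ∀ (g : G), ∀ x ∈ U, g • x ∈ U) (g : G) {x : N} (hx : x ∈ U) : f (g • x) = f x :=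
  (h x hx (g • x) (hU g x hx)).2 (mem_orbit x g)

end Coordinates

section CoordinatesExist

variable {m n : ℕ} {G : Type*} [TopologicalSpace G] [ChartedSpace (EuclideanSpace ℝ (Fin m)) G]
  [Group G] [LieGroup (𝓡 m) ∞ G] [CompactSpace G] {N : Type*} [TopologicalSpace N] [T2Space N]
  [ChartedSpace (EuclideanSpace ℝ (Fin n)) N] [IsManifold (𝓡 n) ∞ N]
  [RiemannianBundle (fun x : N ↦ TangentSpace (𝓡 n) x)]
  [IsContMDiffRiemannianBundle (𝓡 n) ∞ (EuclideanSpace ℝ (Fin n))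
    (fun x : N ↦ TangentSpace (𝓡 n) x)]
  [MulAction G N] [ContMDiffSMul (𝓡 m) (𝓡 n) ∞ G N]

theorem norm_gradientField_smul (hG : ∀ g : G, ContMDiff (𝓡 n) (𝓡 n) ∞ (fun y : N ↦ g • y))
    (hiso : ∀ g : G, PreservesMetric (n := n) (fun y : N ↦ g • y)) {U : Set N} (hU : IsOpen U)
    (hUG : ∀ (g : G), ∀ x ∈ U, g • x ∈ U) {f : N → ℝ} (hf : ContMDiffOn (𝓡 n) 𝓘(ℝ, ℝ) ∞ f U)
    (hfG : ∀ (g : G), ∀ x ∈ U, f (g • x) = f x) {x y : N} (hx : x ∈ U)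
    (hy : y ∈ orbit G x) : ‖gradientField n f y‖ = ‖gradientField n f x‖ := by
  obtain ⟨g, rfl⟩ := hy
  exact (hiso g).norm_gradientField ((hG g).contMDiffAt.mdifferentiableAt (by simp))
    ((hf.contMDiffAt (hU.mem_nhds (hUG g x hx))).mdifferentiableAt (by simp))
    (by filter_upwards [hU.mem_nhds hx] with y hy using hfG g y hy)

theorem IsSlice.param_mem_orbit {p : N} {k : ℕ} {j : EuclideanSpace ℝ (Fin k) → N}
    {τ : N → EuclideanSpace ℝ (Fin k)} {O : Set N} {δ : ℝ} (h : IsSlice m n G p k j τ O δ)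
    {y : N} (hy : y ∈ O) : j (τ y) ∈ orbit G y := by
  obtain ⟨g, hg⟩ := h.exists_smul y hy
  refine ⟨g⁻¹, ?_⟩
  change g⁻¹ • y = _
  conv_lhs => rw [hg]
  rw [inv_smul_smul]

/-- If the levels of the squared distance in a slice lie in orbits, then there is a smooth squared
distance in the invariant metric. -/
theorem IsSlice.exists_isBoundaryCoord
    (hiso : ∀ g : G, PreservesMetric (n := n) (fun y : N ↦ g • y)) {p : N} {k : ℕ}
    {j : EuclideanSpace ℝ (Fin k) → N} {τ : N → EuclideanSpace ℝ (Fin k)} {O : Set N} {δ : ℝ}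
    (h : IsSlice m n G p k j τ O δ) {s : N → ℝ} {κ c₀ : ℝ} (hs : ContMDiff (𝓡 n) 𝓘(ℝ, ℝ) ∞ s)
    (hsG : ∀ (g : G) y, s (g • y) = s y) (hsp : s p = 0) (hκ : 0 < κ) (hc₀ : 0 < c₀) (hk : 0 < k)
    (hle : ∀ v, ‖v‖ < δ → κ * ‖v‖ ^ 2 ≤ s (j v))
    (hB : ∀ v w, ‖v‖ < δ → ‖w‖ < δ → s (j v) = s (j w) → s (j v) < c₀ →
      j v ∈ orbit G (j w)) :
    ∃ U u ε, IsBoundaryCoord n G p U u ε := by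
  have : ContinuousSMul G N := ContMDiffSMul.continuousSMul (I := 𝓡 m) (I' := 𝓡 n) ∞
  have hG : ∀ g : G, ContMDiff (𝓡 n) (𝓡 n) ∞ (fun y : N ↦ g • y) := contMDiff_smul_left m n
  let e : EuclideanSpace ℝ (Fin k) := EuclideanSpace.single ⟨0, hk⟩ 1
  have he : ‖e‖ = 1 := by simp [e]
  have hte : ∀ t : ℝ, ‖t • e‖ = |t| := fun t ↦ by rw [norm_smul, he, mul_one, Real.norm_eq_abs]
  have hte' : ∀ t ∈ Ioo (-δ) δ, ‖t • e‖ < δ := fun t ht ↦ by rw [hte]; exact abs_lt.2 ht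
  have hj0 : s (j 0) = 0 := by rw [h.base, hsp]
  have hjte : ContMDiffOn 𝓘(ℝ, ℝ) (𝓡 n) ∞ (fun t : ℝ ↦ j (t • e)) (Ioo (-δ) δ) := by
    refine h.contMDiffOn_param.comp (t := Metric.ball 0 δ) (f := fun t : ℝ ↦ t • e) ?_ fun t ht ↦ ?_
    · exact (contDiff_id.smul contDiff_const).contMDiff.contMDiffOn
    · simpa using hte' t ht
  obtain ⟨η₀, hη₀, φ, hφ, hφ0, hφs⟩ := exists_reparam_sq (q := fun t ↦ s (j (t • e))) (κ := κ) h.pos hκ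
    (hs.comp_contMDiffOn hjte).contDiffOn (by rw [zero_smul, hj0]) (fun t ht ↦ by
      have := hle _ (hte' t ht)
      rwa [hte, sq_abs] at this)
  let c : ℝ → N := fun t ↦ j (φ t • e)
  have hc : ContMDiffOn 𝓘(ℝ, ℝ) (𝓡 n) ∞ c (Ioo (-η₀) η₀) :=
    hjte.comp hφ.contMDiffOn fun t ht ↦ (hφs t ht).1
  have hsc : ∀ t ∈ Ioo (-η₀) η₀, s (c t) = t ^ 2 := fun t ht ↦ (hφs t ht).2
  have hcn : ∀ t ∈ Ioo (-η₀) η₀, ‖φ t • e‖ < δ := fun t ht ↦ hte' _ (hφs t ht).1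
  have hc0 : c 0 = p := by simp only [c, hφ0, zero_smul, h.base]
  have hη₀m : (0 : ℝ) ∈ Ioo (-η₀) η₀ := ⟨by linarith, hη₀⟩
  have hiG : ∀ {y z : N}, z ∈ orbit G y → s z = s y := by
    rintro y _ ⟨g, rfl⟩
    exact hsG g y
  have hgrad : ∀ {y z : N}, z ∈ orbit G y →
      ‖gradientField n s z‖ = ‖gradientField n s y‖ := fun {y z} hz ↦
    norm_gradientField_smul hG hiso isOpen_univ (fun _ _ _ ↦ mem_univ _) hs.contMDiffOn
      (fun g x _ ↦ hsG g x) (mem_univ _) hz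
  obtain ⟨κ', hκ', hβle⟩ := exists_le_norm_gradientField_sq hs
    (hc.contMDiffAt (Ioo_mem_nhds hη₀m.1 hη₀m.2))
    (by filter_upwards [Ioo_mem_nhds hη₀m.1 hη₀m.2] with t ht using hsc t ht)
  obtain ⟨η₂, hη₂, hβle⟩ := Metric.eventually_nhds_iff_ball.1 hβle
  let β : ℝ → ℝ := fun t ↦ ‖gradientField n s (c t)‖ ^ 2
  let η₁ := min (min η₀ η₂) (√c₀)
  have hη₁ : 0 < η₁ := lt_min (lt_min hη₀ hη₂) (Real.sqrt_pos.2 hc₀)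
  have hη₁₀ : η₁ ≤ η₀ := (min_le_left _ _).trans (min_le_left _ _)
  have hsub : ∀ t ∈ Ioo (-η₁) η₁, t ∈ Ioo (-η₀) η₀ := fun t ht ↦
    ⟨by linarith [ht.1], by linarith [ht.2]⟩
  have hsqlt : ∀ t ∈ Ioo (-η₁) η₁, t ^ 2 < c₀ := by
    intro t ht
    have h1 : |t| < √c₀ := (abs_lt.2 ht).trans_le (min_le_right _ _)
    rw [← sq_abs]
    exact (Real.lt_sqrt (abs_nonneg t)).1 h1
  have hβs : ContDiffOn ℝ ∞ β (Ioo (-η₁) η₁) := fun t ht ↦ by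
    refine ContDiffAt.contDiffWithinAt (ContMDiffAt.contDiffAt ?_)
    exact ContMDiffAt.comp (g := fun y ↦ ‖gradientField n s y‖ ^ 2) (f := c) t
      (contMDiffAt_norm_gradientField_sq hs.contMDiffAt)
      (hc.contMDiffAt (Ioo_mem_nhds (hsub t ht).1 (hsub t ht).2))
  have hcc : ∀ t ∈ Ioo (-η₁) η₁, ∀ t' ∈ Ioo (-η₁) η₁, t ^ 2 = t' ^ 2 →
      c t ∈ orbit G (c t') := fun t ht t' ht' htt ↦ by
    have h1 := hsc t (hsub t ht)
    have h2 := hsc t' (hsub t' ht')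
    exact hB _ _ (hcn t (hsub t ht)) (hcn t' (hsub t' ht')) (h1.trans (htt.trans h2.symm))
      (h1.trans_lt (hsqlt t ht))
  have hneg : ∀ {a t : ℝ}, t ∈ Ioo (-a) a → -t ∈ Ioo (-a) a := fun {a t} ht ↦
    ⟨by linarith [ht.2], by linarith [ht.1]⟩
  have hβe : ∀ t ∈ Ioo (-η₁) η₁, β (-t) = β t := fun t ht ↦ by
    have h1 := hgrad (hcc (-t) (hneg ht) t ht (by ring))
    exact congrArg (· ^ 2) h1
  have hsmin : IsLocalMin s p := by
    filter_upwards [h.isOpen.mem_nhds h.mem] with y hy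
    rw [hsp, ← hiG (h.param_mem_orbit hy)]
    exact le_trans (by positivity) (hle _ (h.norm_retract_lt y hy))
  have hβ0 : β 0 = 0 := by
    have h1 : ‖gradientField n s (c 0)‖ = ‖gradientField n s p‖ := by rw [hc0]
    change ‖gradientField n s (c 0)‖ ^ 2 = 0
    rw [h1, gradientField_eq_zero_of_isLocalMin hsmin, norm_zero, zero_pow two_ne_zero]
  obtain ⟨η, hη, hηη₁, w, hw, hβw⟩ := exists_eq_sq_mul hη₁ hκ' hβs hβ0 fun t ht ↦ by
    refine hβle t ?_
    rw [mem_ball_zero_iff, Real.norm_eq_abs]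
    exact (abs_lt.2 ht).trans_le ((min_le_left _ _).trans (min_le_right _ _))
  have hsub' : ∀ t ∈ Ioo (-η) η, t ∈ Ioo (-η₁) η₁ := fun t ht ↦
    ⟨by linarith [ht.1], by linarith [ht.2]⟩
  have hwe : ∀ t ∈ Ioo (-η) η, w (-t) = w t := by
    intro t ht
    by_cases ht0 : t = 0
    · rw [ht0, neg_zero]
    have h1 := (hβw t ht).1
    have h2 := (hβw (-t) (hneg ht)).1
    rw [hβe t (hsub' t ht), h1, neg_sq] at h2
    exact (mul_left_cancel₀ (pow_ne_zero 2 ht0) h2).symm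
  obtain ⟨R, hE, hR0, hR, hRm, hRd⟩ := exists_unit_speed_sq (a := fun t ↦ w t / 4) hη
    (hw.div_const 4).contDiffOn (fun t ht ↦ by have := (hβw t ht).2; positivity)
    (fun t ht ↦ by rw [hwe t ht])
  let ζ := η / 4
  have hζ : 0 < ζ := by positivity
  have hζη : ζ < η / 2 := by change η / 4 < η / 2; linarith
  have hζm : ∀ t ∈ Ico 0 ζ, t ∈ Ioo (-(η / 2)) (η / 2) := fun t ht ↦
    ⟨by linarith [ht.1], by linarith [ht.2]⟩
  have hζm' : ∀ t ∈ Ico 0 ζ, t ∈ Ioo (-η) η := fun t ht ↦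
    ⟨by linarith [ht.1], by linarith [ht.2]⟩
  let U : Set N := {y | s y < ζ ^ 2} ∩ {y | ∃ g : G, g • y ∈ O}
  -- every orbit in `U` meets the curve `c`
  have hU : ∀ y ∈ U, 0 ≤ s y ∧ √(s y) ∈ Ico 0 ζ ∧ y ∈ orbit G (c (√(s y))) := by
    rintro y ⟨hy, g, hg⟩
    have h1 := h.param_mem_orbit hg
    rw [orbit_smul] at h1
    have h2 := hle _ (h.norm_retract_lt _ hg)
    rw [hiG h1] at h2
    have h3 : 0 ≤ s y := le_trans (by positivity) h2
    have h4 : √(s y) ∈ Ico 0 ζ := ⟨Real.sqrt_nonneg _, (Real.sqrt_lt' hζ).2 hy⟩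
    refine ⟨h3, h4, ?_⟩
    have h5 := hsub' _ (hζm' _ h4)
    have h6 : s (c √(s y)) = s y := by rw [hsc _ (hsub _ h5), Real.sq_sqrt h3]
    have h7 := hB (τ (g • y)) (φ √(s y) • e) (h.norm_retract_lt _ hg) (hcn _ (hsub _ h5))
      ((hiG h1).trans h6.symm) (by
        rw [hiG h1, ← Real.sq_sqrt h3]
        exact hsqlt _ h5)
    rw [← orbit_eq_iff] at h1 h7 ⊢
    rw [← h1, h7]
  have hUo : IsOpen U := by
    refine (isOpen_lt hs.continuous continuous_const).inter ?_
    have : {y : N | ∃ g : G, g • y ∈ O} = ⋃ g : G, (fun y ↦ g • y) ⁻¹' O := by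
      ext y; simp
    rw [this]
    exact isOpen_iUnion fun g ↦ h.isOpen.preimage (continuous_const_smul g)
  have hUG : ∀ (g : G), ∀ x ∈ U, g • x ∈ U := by
    rintro g x ⟨hx, g', hg'⟩
    refine ⟨by change s (g • x) < _; rw [hsG]; exact hx, g' * g⁻¹, ?_⟩
    rwa [smul_smul, inv_mul_cancel_right]
  let u : N → ℝ := fun y ↦ R (√(s y)) ^ 2
  have hpU : p ∈ U := ⟨by change s p < _; rw [hsp]; positivity, 1, by rw [one_smul]; exact h.mem⟩
  have hus : ContMDiffOn (𝓡 n) 𝓘(ℝ, ℝ) ∞ u U := by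
    refine ContMDiffOn.comp (g := fun x ↦ R (√x) ^ 2) (t := Ici 0) hE.contMDiffOn hs.contMDiffOn ?_
    exact fun y hy ↦ (hU y hy).1
  have huG : ∀ (g : G), ∀ x ∈ U, u (g • x) = u x := fun g x _ ↦ by simp only [u, hsG]
  have hRnn : ∀ t ∈ Ico 0 ζ, 0 ≤ R t := fun t ht ↦ by
    have := hRm.monotoneOn (hζm 0 ⟨le_rfl, hζ⟩) (hζm t ht) ht.1
    rwa [hR0] at this
  have hζ' : ζ ∈ Ioo (-(η / 2)) (η / 2) := ⟨by linarith, hζη⟩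
  have hRζ : ∀ t ∈ Ico 0 ζ, R t < R ζ := fun t ht ↦ hRm (hζm t ht) hζ' ht.2
  refine ⟨U, u, R ζ, hUo, hUG, hpU, ?_, hus, ?_, ?_, ?_, ?_⟩
  · simp only [u, hsp, Real.sqrt_zero, hR0]
    ring
  · intro y hy
    obtain ⟨h1, h2, h3⟩ := hU y hy
    rcases h1.eq_or_lt with h4 | h4
    · have h5 : IsLocalMin u y := Eventually.of_forall fun z ↦ by
        simp only [u, ← h4, Real.sqrt_zero, hR0, zero_pow two_ne_zero]
        exact sq_nonneg _
      rw [gradientField_eq_zero_of_isLocalMin h5]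
      simp only [u, ← h4, Real.sqrt_zero, hR0, norm_zero]
      ring
    · obtain ⟨d, hd, hd2⟩ := hRd (s y) h4 (h2.2.trans hζη)
      have h5 := norm_gradientField_real_comp (hs.contMDiffAt.mdifferentiableAt (x := y) (by simp)) hd
      have h6 : ‖gradientField n s y‖ ^ 2 = s y * w (√(s y)) := by
        rw [hgrad h3, ← Real.sq_sqrt h1, Real.sqrt_sq (Real.sqrt_nonneg _)]
        exact (hβw _ (hζm' _ h2)).1
      refine h5.trans ?_
      rw [h6]
      change _ = 4 * R √(s y) ^ 2
      rw [← hd2]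
      ring
  · intro x hx y hy
    constructor
    · intro hxy
      obtain ⟨h1, h2, h3⟩ := hU x hx
      obtain ⟨h4, h5, h6⟩ := hU y hy
      have h7 := (pow_left_inj₀ (hRnn _ h5) (hRnn _ h2) two_ne_zero).1 hxy
      have h8 := hRm.injOn (hζm _ h5) (hζm _ h2) h7
      rw [h8] at h6
      rw [← orbit_eq_iff] at h3 h6 ⊢
      rw [h6, h3]
    · rintro ⟨g, rfl⟩
      exact huG g x hx
  · have := hRζ 0 ⟨le_rfl, hζ⟩
    rwa [hR0] at this
  · ext x
    constructor
    · rintro ⟨y, hy, rfl⟩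
      obtain ⟨h1, h2, h3⟩ := hU y hy
      exact ⟨sq_nonneg _, pow_lt_pow_left₀ (hRζ _ h2) (hRnn _ h2) two_ne_zero⟩
    · intro hx
      have hR0' : 0 < R ζ := by
        have := hRζ 0 ⟨le_rfl, hζ⟩
        rwa [hR0] at this
      have h1 : ContinuousOn (fun t ↦ R t ^ 2) (Icc 0 ζ) := (hR.continuous.pow 2).continuousOn
      obtain ⟨t, ht, htx⟩ := intermediate_value_Ico hζ.le h1 (show x ∈ _ by
        beta_reduce
        rw [hR0, zero_pow two_ne_zero]
        exact hx)
      have h5 := hsub' _ (hζm' _ ht)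
      have h6 : s (c t) = t ^ 2 := hsc _ (hsub _ h5)
      refine ⟨c t, ⟨?_, 1, ?_⟩, ?_⟩
      · change s (c t) < ζ ^ 2
        rw [h6]
        exact pow_lt_pow_left₀ ht.2 ht.1 two_ne_zero
      · rw [one_smul]
        exact h.param_mem _ (hcn _ (hsub _ h5))
      · simp only [u, h6, Real.sqrt_sq ht.1]
        exact htx

/-- If a slice is a curve which meets every orbit once, then there is a unit speed coordinate. -/
theorem IsSlice.exists_isRegularCoord
    (hiso : ∀ g : G, PreservesMetric (n := n) (fun y : N ↦ g • y)) {p : N}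
    {j : EuclideanSpace ℝ (Fin 1) → N} {τ : N → EuclideanSpace ℝ (Fin 1)} {O : Set N} {δ : ℝ}
    (h : IsSlice m n G p 1 j τ O δ) {s : N → ℝ} {c₀ : ℝ} (hs : ContMDiff (𝓡 n) 𝓘(ℝ, ℝ) ∞ s)
    (hsG : ∀ (g : G) y, s (g • y) = s y) (hsp : s p = 0) (hc₀ : 0 < c₀)
    (hR : ∀ v w, ‖v‖ < δ → ‖w‖ < δ → s (j v) < c₀ → j v ∈ orbit G (j w) → v = w) :
    ∃ U r, p ∈ U ∧ IsRegularCoord n G U r := by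
  have : ContinuousSMul G N := ContMDiffSMul.continuousSMul (I := 𝓡 m) (I' := 𝓡 n) ∞
  have hG : ∀ g : G, ContMDiff (𝓡 n) (𝓡 n) ∞ (fun y : N ↦ g • y) := contMDiff_smul_left m n
  let e : EuclideanSpace ℝ (Fin 1) := EuclideanSpace.single 0 1
  have he : ‖e‖ = 1 := by simp [e]
  have hte : ∀ t : ℝ, ‖t • e‖ = |t| := fun t ↦ by rw [norm_smul, he, mul_one, Real.norm_eq_abs]
  have hspan : ∀ v : EuclideanSpace ℝ (Fin 1), v = v 0 • e := by
    intro v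
    ext i
    fin_cases i
    simp [e]
  have hj0 : s (j 0) = 0 := by rw [h.base, hsp]
  let U₀ : Set N := {y | s y < c₀} ∩ {y | ∃ g : G, g • y ∈ O}
  have hU₀ : IsOpen U₀ := by
    refine (isOpen_lt hs.continuous continuous_const).inter ?_
    have : {y : N | ∃ g : G, g • y ∈ O} = ⋃ g : G, (fun y ↦ g • y) ⁻¹' O := by
      ext y; simp
    rw [this]
    exact isOpen_iUnion fun g ↦ h.isOpen.preimage (continuous_const_smul g)
  have hU₀G : ∀ (g : G), ∀ x ∈ U₀, g • x ∈ U₀ := by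
    rintro g x ⟨hx, g', hg'⟩
    refine ⟨by change s (g • x) < _; rw [hsG]; exact hx, g' * g⁻¹, ?_⟩
    rwa [smul_smul, inv_mul_cancel_right]
  have hiG : ∀ {y z : N}, z ∈ orbit G y → s z = s y := by
    rintro y _ ⟨g, rfl⟩
    exact hsG g y
  have hex : ∀ y, ∃ t : ℝ, y ∈ U₀ → ∀ g : G, g • y ∈ O → τ (g • y) 0 = t := by
    intro y
    by_cases hy : y ∈ U₀
    · obtain ⟨hyc, g₀, hg₀⟩ := id hy
      refine ⟨τ (g₀ • y) 0, fun _ g hg ↦ ?_⟩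
      have h1 := h.param_mem_orbit hg
      have h2 := h.param_mem_orbit hg₀
      rw [orbit_smul] at h1 h2
      rw [hR (τ (g • y)) (τ (g₀ • y)) (h.norm_retract_lt _ hg) (h.norm_retract_lt _ hg₀)
        (by rw [hiG h1]; exact hyc) (by rw [← orbit_eq_iff] at h1 h2 ⊢; rw [h1, h2])]
    · exact ⟨0, fun h ↦ absurd h hy⟩
  choose x hx using hex
  have hxG : ∀ (g : G), ∀ y ∈ U₀, x (g • y) = x y := by
    intro g y hy
    obtain ⟨g₀, hg₀⟩ := (hU₀G g y hy).2
    rw [← hx _ (hU₀G g y hy) g₀ hg₀]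
    rw [smul_smul] at hg₀ ⊢
    exact hx y hy _ hg₀
  have hxs : ContMDiffOn (𝓡 n) 𝓘(ℝ, ℝ) ∞ x U₀ := by
    intro y hy
    obtain ⟨g, hg⟩ := hy.2
    refine ContMDiffAt.contMDiffWithinAt ?_
    have h1 : ContMDiffAt (𝓡 n) 𝓘(ℝ, ℝ) ∞ (fun y ↦ τ (g • y) 0) y := by
      refine ContMDiffAt.comp (g := fun v : EuclideanSpace ℝ (Fin 1) ↦ v 0) (f := fun y ↦ τ (g • y))
        (I' := 𝓘(ℝ, EuclideanSpace ℝ (Fin 1))) y ?_ ?_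
      · exact ContDiff.contDiffAt (by fun_prop) |>.contMDiffAt
      · exact (h.contMDiffAt_retract hg).comp y (hG g).contMDiffAt
    refine h1.congr_of_eventuallyEq ?_
    filter_upwards [hU₀.mem_nhds hy, (h.isOpen.preimage (continuous_const_smul g)).mem_nhds hg]
      with z hz hzg
    exact (hx z hz g hzg).symm
  have hsj : ContinuousAt (fun t : ℝ ↦ s (j (t • e))) 0 := by
    refine hs.continuous.continuousAt.comp (f := fun t : ℝ ↦ j (t • e)) ?_
    refine ContinuousAt.comp (g := j) (f := fun t : ℝ ↦ t • e) ?_ (by fun_prop)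
    rw [zero_smul]
    exact h.continuousAt_param (by simpa using h.pos)
  obtain ⟨δ₁, hδ₁, hδc⟩ := Metric.eventually_nhds_iff_ball.1 (hsj.eventually (Iio_mem_nhds (a := c₀) (by
    beta_reduce; rw [zero_smul, hj0]; exact hc₀)))
  let η := min δ₁ δ
  have hη : 0 < η := lt_min hδ₁ h.pos
  have hηδ : ∀ t ∈ Ioo (-η) η, ‖t • e‖ < δ := fun t ht ↦ by
    rw [hte]
    exact (abs_lt.2 ht).trans_le (min_le_right _ _)
  have hjU : ∀ t ∈ Ioo (-η) η, j (t • e) ∈ U₀ ∧ x (j (t • e)) = t := by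
    intro t ht
    have h1 : j (t • e) ∈ O := h.param_mem _ (hηδ t ht)
    have h2 : j (t • e) ∈ U₀ := by
      refine ⟨hδc t ?_, 1, by rwa [one_smul]⟩
      rw [mem_ball_zero_iff]
      exact (abs_lt.2 ht).trans_le (min_le_left _ _)
    refine ⟨h2, ?_⟩
    have h3 := hx _ h2 1 (by rwa [one_smul])
    rw [one_smul, h.retract_param _ (hηδ t ht)] at h3
    rw [← h3]
    simp [e]
  have hc : ∀ t ∈ Ioo (-η) η, ContMDiffAt 𝓘(ℝ, ℝ) (𝓡 n) ∞ (fun t : ℝ ↦ j (t • e)) t := by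
    intro t ht
    refine ContMDiffAt.comp (g := j) (f := fun t : ℝ ↦ t • e)
      (I' := 𝓘(ℝ, EuclideanSpace ℝ (Fin 1))) t (h.contMDiffAt_param (hηδ t ht)) ?_
    exact (contDiff_id.smul contDiff_const).contMDiff.contMDiffAt
  let β : ℝ → ℝ := fun t ↦ ‖gradientField n x (j (t • e))‖ ^ 2
  have hxat : ∀ y ∈ U₀, ContMDiffAt (𝓡 n) 𝓘(ℝ, ℝ) ∞ x y := fun y hy ↦
    hxs.contMDiffAt (hU₀.mem_nhds hy)
  have hβs : ContDiffOn ℝ ∞ β (Ioo (-η) η) := fun t ht ↦ by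
    refine ContDiffAt.contDiffWithinAt (ContMDiffAt.contDiffAt ?_)
    exact ContMDiffAt.comp (g := fun y ↦ ‖gradientField n x y‖ ^ 2) (f := fun t : ℝ ↦ j (t • e)) t
      (contMDiffAt_norm_gradientField_sq (hxat _ (hjU t ht).1)) (hc t ht)
  have hβpos : ∀ t ∈ Ioo (-η) η, 0 < β t := by
    intro t ht
    have h1 : gradientField n x (j (t • e)) ≠ 0 := by
      intro h0
      rw [gradientField_eq_zero_iff] at h0
      have h2 := hasFDerivAt_comp_param (j := fun t : ℝ ↦ j (t • e)) ((hxat _ (hjU t ht).1).mdifferentiableAt (by simp))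
        ((hc t ht).mdifferentiableAt (by simp))
      beta_reduce at h2
      rw [h0] at h2
      have h3 : HasFDerivAt (fun t ↦ x (j (t • e))) (ContinuousLinearMap.id ℝ ℝ) t := by
        refine (hasFDerivAt_id t).congr_of_eventuallyEq ?_
        filter_upwards [Ioo_mem_nhds ht.1 ht.2] with t' ht' using (hjU t' ht').2
      have h4 := DFunLike.congr_fun (h2.unique h3) (1 : ℝ)
      exact zero_ne_one h4
    have h2 : 0 < ‖gradientField n x (j (t • e))‖ := norm_pos_iff.2 h1
    positivity
  obtain ⟨Ω, R, hΩ, hRs, hR0, hRd, hΩa, -⟩ := exists_primitive hη hβs hβpos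
  have hη2 : ∀ t ∈ Ioo (-(η / 2)) (η / 2), t ∈ Ioo (-η) η := fun t ht ↦
    ⟨by linarith [ht.1], by linarith [ht.2]⟩
  have hRm : StrictMonoOn R (Ioo (-(η / 2)) (η / 2)) := by
    refine strictMonoOn_of_deriv_pos (convex_Ioo _ _) hRs.continuous.continuousOn fun t ht ↦ ?_
    rw [interior_Ioo] at ht
    rw [(hRd t).deriv]
    exact (hΩa t ht).1
  let U : Set N := U₀ ∩ x ⁻¹' Ioo (-(η / 2)) (η / 2)
  have hUorb : ∀ y ∈ U₀, x y ∈ Ioo (-(η / 2)) (η / 2) → y ∈ orbit G (j (x y • e)) := by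
    intro y hy hxy
    obtain ⟨g, hg⟩ := hy.2
    have h1 := hx y hy g hg
    have h2 := h.param_mem_orbit hg
    rw [hspan (τ (g • y)), h1, orbit_smul] at h2
    exact mem_orbit_symm.1 h2
  have hUo : IsOpen U := hxs.continuousOn.isOpen_inter_preimage hU₀ isOpen_Ioo
  have hUG : ∀ (g : G), ∀ y ∈ U, g • y ∈ U := fun g y hy ↦
    ⟨hU₀G g y hy.1, by rw [mem_preimage, hxG g y hy.1]; exact hy.2⟩
  refine ⟨U, fun y ↦ R (x y), ?_, hUo, hUG, ?_, ?_, ?_, ?_⟩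
  · have h1 := hjU 0 ⟨by linarith, hη⟩
    rw [zero_smul, h.base] at h1
    refine ⟨h1.1, ?_⟩
    rw [mem_preimage, h1.2]
    exact ⟨by linarith, by linarith⟩
  · exact hRs.contMDiff.comp_contMDiffOn (hxs.mono inter_subset_left)
  · intro y hy
    rw [norm_gradientField_real_comp ((hxat y hy.1).mdifferentiableAt (by simp)) (hRd (x y))]
    have h1 := norm_gradientField_smul hG hiso hU₀ hU₀G hxs hxG (hjU _ (hη2 _ hy.2)).1
      (hUorb y hy.1 hy.2)
    rw [h1]
    exact (hΩa _ hy.2).2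
  · intro y hy z hz
    constructor
    · intro hyz
      have h1 := hRm.injOn hz.2 hy.2 hyz
      have h2 := hUorb y hy.1 hy.2
      have h3 := hUorb z hz.1 hz.2
      rw [h1] at h3
      rw [← orbit_eq_iff] at h2 h3 ⊢
      rw [h3, h2]
    · rintro ⟨g, rfl⟩
      exact congrArg R (hxG g y hy.1)
  · have h1 : (fun y ↦ R (x y)) '' U = R '' Ioo (-(η / 2)) (η / 2) := by
      ext t
      constructor
      · rintro ⟨y, hy, rfl⟩
        exact ⟨x y, hy.2, rfl⟩
      · rintro ⟨a, ha, rfl⟩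
        have h2 := hjU a (hη2 a ha)
        exact ⟨j (a • e), ⟨h2.1, by rw [mem_preimage, h2.2]; exact ha⟩, congrArg R h2.2⟩
    rw [h1]
    exact (isPreconnected_Ioo.image R hRs.continuous.continuousOn).ordConnected

end CoordinatesExist

section Conjugation

/-- In a compact group a closed subgroup which is conjugate into itself is normalized. -/
theorem conj_mem_of_forall_conj_mem {G : Type*} [Group G] [TopologicalSpace G]
    [CompactSpace G] [IsTopologicalGroup G] {H : Subgroup G} (hH : IsClosed (H : Set G)) {a : G}
    (ha : ∀ h ∈ H, a * h * a⁻¹ ∈ H) : ∀ h ∈ H, a⁻¹ * h * a ∈ H := by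
  let S : Set G := {x | ∀ h ∈ H, x * h * x⁻¹ ∈ H}
  have hS : IsClosed S := by
    have : S = ⋂ h : H, (fun x ↦ x * (h : G) * x⁻¹) ⁻¹' (H : Set G) := by
      ext x; simp [S]
    rw [this]
    exact isClosed_iInter fun h ↦ hH.preimage (by fun_prop)
  have hpow : range (a ^ · : ℕ → G) ⊆ S := by
    rintro _ ⟨k, rfl⟩
    induction k with
    | zero => intro h hh; simpa using hh
    | succ k ih =>
      intro h hh
      have := ih _ (ha h hh)
      simp only [pow_succ, mul_inv_rev]
      simpa only [mul_assoc] using this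
  have h1 : a⁻¹ ∈ closure (range (a ^ · : ℕ → G)) := by
    rw [← closure_range_zpow_eq_pow]
    exact subset_closure ⟨-1, by simp⟩
  have h2 := closure_minimal hpow hS h1
  intro h hh
  simpa using h2 h hh

theorem isClosed_stabilizer {G : Type*} [TopologicalSpace G] [Group G] {N : Type*}
    [TopologicalSpace N] [T2Space N] [MulAction G N] [ContinuousSMul G N] (p : N) :
    IsClosed (stabilizer G p : Set G) :=
  isClosed_eq (f := fun g : G ↦ g • p) (by fun_prop) continuous_const

end Conjugation

section Flip

variable {m n : ℕ} {G : Type*} [TopologicalSpace G] [ChartedSpace (EuclideanSpace ℝ (Fin m)) G]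
  [Group G] [LieGroup (𝓡 m) ∞ G] [CompactSpace G] {N : Type*} [TopologicalSpace N] [T2Space N]
  [ChartedSpace (EuclideanSpace ℝ (Fin n)) N] [IsManifold (𝓡 n) ∞ N]
  [MulAction G N] [ContMDiffSMul (𝓡 m) (𝓡 n) ∞ G N]

/-- An element of the isotropy group of `p` either preserves or exchanges the two sides of the
orbit of `p`, and so do the nearby elements of `G`. -/
theorem IsSlice.preserves_or_exchanges {p : N}
    {j : EuclideanSpace ℝ (Fin 1) → N} {τ : N → EuclideanSpace ℝ (Fin 1)} {O : Set N} {δ : ℝ}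
    (h : IsSlice m n G p 1 j τ O δ) {s : N → ℝ} {κ : ℝ} (hs : ContMDiff (𝓡 n) 𝓘(ℝ, ℝ) ∞ s)
    (hsG : ∀ (g : G) y, s (g • y) = s y) (hsp : s p = 0) (hκ : 0 < κ)
    (hle : ∀ v, ‖v‖ < δ → κ * ‖v‖ ^ 2 ≤ s (j v)) {e : EuclideanSpace ℝ (Fin 1)} (he : ‖e‖ = 1)
    (hspan : ∀ v : EuclideanSpace ℝ (Fin 1), v = v 0 • e) {f : G} (hf : f • p = p) :
    (∀ᶠ q in 𝓝 ((0 : ℝ), f), q.1 ≠ 0 → 0 < τ (q.2 • j (q.1 • e)) 0 * q.1) ∨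
      (∀ᶠ q in 𝓝 ((0 : ℝ), f), q.1 ≠ 0 → τ (q.2 • j (q.1 • e)) 0 * q.1 < 0) := by
  have : ContinuousSMul G N := ContMDiffSMul.continuousSMul (I := 𝓡 m) (I' := 𝓡 n) ∞
  have hte : ∀ t : ℝ, ‖t • e‖ = |t| := fun t ↦ by rw [norm_smul, he, mul_one, Real.norm_eq_abs]
  have hte' : ∀ t ∈ Ioo (-δ) δ, ‖t • e‖ < δ := fun t ht ↦ by rw [hte]; exact abs_lt.2 ht
  let c := chartAt (EuclideanSpace ℝ (Fin m)) f
  have hc : c ∈ IsManifold.maximalAtlas (𝓡 m) ∞ G := IsManifold.chart_mem_maximalAtlas f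
  have hfs : f ∈ c.source := mem_chart_source _ f
  have hcf : c.symm (c f) = f := c.left_inv hfs
  have hj0 : j ((0 : ℝ) • e) = p := by rw [zero_smul, h.base]
  let F : ℝ × EuclideanSpace ℝ (Fin m) → ℝ := fun q ↦ τ (c.symm q.2 • j (q.1 • e)) 0
  have hpt : c.symm (c f) • j ((0 : ℝ) • e) = p := by rw [hcf, hj0, hf]
  -- the map `(t, x) ↦ c.symm x • j (t • e)`
  have hact : ContMDiffAt 𝓘(ℝ, ℝ × EuclideanSpace ℝ (Fin m)) (𝓡 n) ∞
      (fun q : ℝ × EuclideanSpace ℝ (Fin m) ↦ c.symm q.2 • j (q.1 • e)) (0, c f) := by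
    have h1 : ContMDiffAt 𝓘(ℝ, ℝ × EuclideanSpace ℝ (Fin m)) (𝓡 n) ∞
        (fun q : ℝ × EuclideanSpace ℝ (Fin m) ↦ j (q.1 • e)) (0, c f) := by
      refine ContMDiffAt.comp (g := j) (f := fun q : ℝ × EuclideanSpace ℝ (Fin m) ↦ q.1 • e)
        (I' := 𝓘(ℝ, EuclideanSpace ℝ (Fin 1))) _ (h.contMDiffAt_param ?_) ?_
      · rw [hte]; simpa using h.pos
      · exact (contDiff_fst.smul contDiff_const).contMDiff.contMDiffAt
    have h2 : ContMDiffAt 𝓘(ℝ, ℝ × EuclideanSpace ℝ (Fin m)) (𝓡 m) ∞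
        (fun q : ℝ × EuclideanSpace ℝ (Fin m) ↦ c.symm q.2) (0, c f) := by
      refine ContMDiffAt.comp (g := c.symm) (f := fun q : ℝ × EuclideanSpace ℝ (Fin m) ↦ q.2)
        (I' := 𝓘(ℝ, EuclideanSpace ℝ (Fin m))) _
        (contMDiffAt_symm_of_mem_maximalAtlas hc (c.map_source hfs)) ?_
      exact contDiff_snd.contMDiff.contMDiffAt
    exact (contMDiff_smul_prod m n G N).contMDiffAt.comp _ (h2.prodMk h1)
  have hF : ContDiffAt ℝ ∞ F (0, c f) := by
    refine ContMDiffAt.contDiffAt ?_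
    refine ContMDiffAt.comp (g := fun y ↦ τ y 0)
      (f := fun q : ℝ × EuclideanSpace ℝ (Fin m) ↦ c.symm q.2 • j (q.1 • e)) (I' := 𝓡 n) _ ?_ hact
    beta_reduce
    rw [hpt]
    refine ContMDiffAt.comp (g := fun v : EuclideanSpace ℝ (Fin 1) ↦ v 0) (f := τ)
      (I' := 𝓘(ℝ, EuclideanSpace ℝ (Fin 1))) p ?_ (h.contMDiffAt_retract h.mem)
    exact ContDiff.contDiffAt (by fun_prop) |>.contMDiffAt
  have hF0 : ∀ x, c.symm x • j ((0 : ℝ) • e) ∈ O → F (0, x) = 0 := by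
    intro x hx
    have h1 := (h.mem_orbit_iff _ hx).1 (by rw [hj0]; exact mem_orbit p _)
    simp only [F, h1]
    rfl
  have hO : ∀ᶠ q in 𝓝 ((0 : ℝ), c f), c.symm q.2 • j (q.1 • e) ∈ O := by
    refine hact.continuousAt.eventually (h.isOpen.mem_nhds ?_)
    beta_reduce
    rw [hpt]
    exact h.mem
  have hF00 : F (0, c f) = 0 := hF0 _ (by rw [hpt]; exact h.mem)
  let D : ℝ × EuclideanSpace ℝ (Fin m) → ℝ := fun q ↦ fderiv ℝ F q (1, 0)
  have hD : ContinuousAt D (0, c f) :=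
    (hF.fderiv_right (m := 0) (by simp)).continuousAt.clm_apply continuousAt_const
  have hline : ∀ q : ℝ × EuclideanSpace ℝ (Fin m), DifferentiableAt ℝ F q →
      HasDerivAt (fun t ↦ F (t, q.2)) (D q) q.1 := by
    intro q hq
    have h1 : HasDerivAt (fun t : ℝ ↦ (t, q.2)) ((1 : ℝ), (0 : EuclideanSpace ℝ (Fin m))) q.1 :=
      (hasDerivAt_id q.1).prodMk (hasDerivAt_const _ _)
    exact hq.hasFDerivAt.comp_hasDerivAt q.1 h1
  have hFd : ∀ᶠ q in 𝓝 ((0 : ℝ), c f), DifferentiableAt ℝ F q := by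
    have := (hF.of_le (natCast_le_infty 1)).eventually (by simp)
    exact this.mono fun y hy ↦ hy.differentiableAt (by simp)
  have hsF : ∀ᶠ t in 𝓝 (0 : ℝ), κ * t ^ 2 ≤ s (j (F (t, c f) • e)) := by
    have h1 : Tendsto (fun t : ℝ ↦ (t, c f)) (𝓝 0) (𝓝 (0, c f)) := by
      have : ContinuousAt (fun t : ℝ ↦ (t, c f)) 0 := by fun_prop
      exact this
    filter_upwards [h1.eventually hO, Ioo_mem_nhds (neg_neg_of_pos h.pos) h.pos] with t ht ht'
    obtain ⟨g, hg⟩ := h.exists_smul _ ht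
    have h2 := hspan (τ (c.symm (c f) • j (t • e)))
    rw [h2] at hg
    have h3 := hle _ (hte' t ht')
    rw [hte, sq_abs] at h3
    have h4 := congrArg s hg
    rw [hsG, hsG] at h4
    rw [h4] at h3
    exact h3
  have hD0 : D (0, c f) ≠ 0 := by
    intro hD0
    have hq : ContDiffOn ℝ ∞ (fun t : ℝ ↦ s (j (t • e))) (Ioo (-δ) δ) := by
      refine ContMDiffOn.contDiffOn (hs.comp_contMDiffOn (h.contMDiffOn_param.comp
        (t := Metric.ball 0 δ) (f := fun t : ℝ ↦ t • e) ?_ fun t ht ↦ ?_))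
      · exact (contDiff_id.smul contDiff_const).contMDiff.contMDiffOn
      · simpa using hte' t ht
    obtain ⟨η, hη, -, w, hw, hqw⟩ := exists_eq_sq_mul h.pos hκ hq (by rw [hj0, hsp])
      (fun t ht ↦ by
        have := hle _ (hte' t ht)
        rwa [hte, sq_abs] at this)
    have hd := hline (0, c f) hFd.self_of_nhds
    rw [hD0] at hd
    have hFc : ContinuousAt (fun t ↦ F (t, c f)) 0 := hd.continuousAt
    have hFt : Tendsto (fun t ↦ F (t, c f)) (𝓝 0) (𝓝 0) := by
      have := hFc.tendsto
      rwa [hF00] at this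
    have hwt : ∀ᶠ t in 𝓝 (0 : ℝ), w (F (t, c f)) < w 0 + 1 :=
      (hw.continuous.continuousAt.tendsto.comp hFt).eventually (gt_mem_nhds (by linarith))
    have hw0 : 0 < w 0 := (hqw 0 ⟨by linarith, hη⟩).2
    have hslope := hasDerivAt_iff_tendsto_slope.1 hd
    have h1 : Tendsto (fun t ↦ slope (fun t ↦ F (t, c f)) 0 t ^ 2 * (w 0 + 1)) (𝓝[≠] 0) (𝓝 0) := by
      have := (hslope.pow 2).mul_const (w 0 + 1)
      simpa using this
    have h2 := h1.eventually (gt_mem_nhds hκ)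
    have h3 : ∀ᶠ t in 𝓝[≠] (0 : ℝ), t ≠ 0 := self_mem_nhdsWithin
    obtain ⟨t, ⟨ht2, ht0⟩, htw, hts, hti⟩ := ((h2.and h3).and (nhdsWithin_le_nhds (hwt.and (hsF.and
      (hFt.eventually (Ioo_mem_nhds (neg_neg_of_pos hη) hη)))))).exists
    rw [(hqw _ hti).1] at hts
    rw [slope_def_field, hF00, sub_zero, sub_zero, div_pow, div_mul_eq_mul_div,
      div_lt_iff₀ (by positivity)] at ht2
    have h4 : F (t, c f) ^ 2 * w (F (t, c f)) ≤ F (t, c f) ^ 2 * (w 0 + 1) :=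
      mul_le_mul_of_nonneg_left htw.le (sq_nonneg _)
    linarith
  have key : ∀ σ : ℝ, 0 < σ * D (0, c f) →
      ∀ᶠ q in 𝓝 ((0 : ℝ), f), q.1 ≠ 0 → 0 < σ * (τ (q.2 • j (q.1 • e)) 0 * q.1) := by
    intro σ hσ
    have h1 : ∀ᶠ q in 𝓝 ((0 : ℝ), c f), 0 < σ * D q :=
      (continuousAt_const.mul hD).eventually (lt_mem_nhds hσ)
    have h2 := (h1.and (hFd.and hO))
    rw [nhds_prod_eq, Filter.eventually_prod_iff] at h2
    obtain ⟨pa, hpa, pb, hpb, hab⟩ := h2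
    obtain ⟨r, hr, hball⟩ := Metric.eventually_nhds_iff_ball.1 hpa
    have hcs : ∀ᶠ g in 𝓝 f, pb (c g) ∧ g ∈ c.source :=
      Filter.Eventually.and ((c.continuousAt hfs).eventually hpb) (c.open_source.mem_nhds hfs)
    rw [nhds_prod_eq]
    refine Filter.Eventually.mono (Filter.prod_mem_prod (Metric.ball_mem_nhds 0 hr) hcs) ?_
    rintro ⟨t, g⟩ ⟨ht, hg, hgs⟩ ht0
    have ht : t ∈ Metric.ball (0 : ℝ) r := ht
    have hmono : StrictMonoOn (fun t ↦ σ * F (t, c g)) (Metric.ball 0 r) := by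
      refine strictMonoOn_of_deriv_pos (convex_ball _ _) (fun t ht ↦ ?_) fun t ht ↦ ?_
      · exact ((hline (t, c g) (hab (hball t ht) hg).2.1).const_mul σ).continuousAt.continuousWithinAt
      · rw [Metric.isOpen_ball.interior_eq] at ht
        rw [((hline (t, c g) (hab (hball t ht) hg).2.1).const_mul σ).deriv]
        exact (hab (hball t ht) hg).1
    have h00 := hF0 (c g) (hab (hball 0 (Metric.mem_ball_self hr)) hg).2.2
    have hFg : F (t, c g) = τ (g • j (t • e)) 0 := by
      simp only [F, c.left_inv hgs]
    rw [← hFg]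
    rcases lt_or_gt_of_ne ht0 with h3 | h3
    · have h4 := hmono ht (Metric.mem_ball_self hr) h3
      simp only [h00, mul_zero] at h4
      have := mul_pos_of_neg_of_neg h4 h3
      linarith
    · have h4 := hmono (Metric.mem_ball_self hr) ht h3
      simp only [h00, mul_zero] at h4
      have := mul_pos h4 h3
      linarith
  rcases lt_or_gt_of_ne hD0 with hneg | hpos
  · right
    filter_upwards [key (-1) (by linarith)] with q hq hq0
    linarith [hq hq0]
  · left
    filter_upwards [key 1 (by linarith)] with q hq hq0
    linarith [hq hq0]

/-- If the two sides of an orbit of codimension one are exchanged by the isotropy group, then the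
orbit is not principal. -/
theorem IsSlice.not_isPrincipalPoint {p : N}
    {j : EuclideanSpace ℝ (Fin 1) → N} {τ : N → EuclideanSpace ℝ (Fin 1)} {O : Set N} {δ : ℝ}
    (h : IsSlice m n G p 1 j τ O δ) {s : N → ℝ} {κ : ℝ} (hs : ContMDiff (𝓡 n) 𝓘(ℝ, ℝ) ∞ s)
    (hsG : ∀ (g : G) y, s (g • y) = s y) (hsp : s p = 0) (hκ : 0 < κ)
    (hle : ∀ v, ‖v‖ < δ → κ * ‖v‖ ^ 2 ≤ s (j v))
    (hflip : ∀ e, ‖e‖ = 1 → ∀ ε > 0, ∃ t ∈ Ioo (0 : ℝ) ε, ∃ t' ∈ Ioo (0 : ℝ) ε,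
      j (t • e) ∈ orbit G (j (-t' • e))) : ¬ IsPrincipalPoint G p := by
  have : IsTopologicalGroup G := topologicalGroup_of_lieGroup (𝓡 m) ∞
  have : ContinuousSMul G N := ContMDiffSMul.continuousSMul (I := 𝓡 m) (I' := 𝓡 n) ∞
  intro hp
  let e : EuclideanSpace ℝ (Fin 1) := EuclideanSpace.single 0 1
  have he : ‖e‖ = 1 := by simp [e]
  have he0 : ∀ t : ℝ, (t • e) 0 = t := fun t ↦ by simp [e]
  have hspan : ∀ v : EuclideanSpace ℝ (Fin 1), v = v 0 • e := by
    intro v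
    ext i
    fin_cases i
    simp [e]
  have hte : ∀ t : ℝ, ‖t • e‖ = |t| := fun t ↦ by rw [norm_smul, he, mul_one, Real.norm_eq_abs]
  have hj0 : j ((0 : ℝ) • e) = p := by rw [zero_smul, h.base]
  have hjc : ContinuousAt (fun t : ℝ ↦ j (t • e)) 0 := by
    refine ContinuousAt.comp (g := j) (f := fun t : ℝ ↦ t • e) ?_ (by fun_prop)
    rw [zero_smul]
    exact h.continuousAt_param (by simpa using h.pos)
  have hτ : ∀ t ∈ Ioo (-δ) δ, τ (j (t • e)) 0 = t := fun t ht ↦ by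
    rw [h.retract_param _ (by rw [hte]; exact abs_lt.2 ht), he0]
  have hdich : ∀ f : G, f • p = p → _ := fun f hf ↦
    h.preserves_or_exchanges hs hsG hsp hκ hle he hspan (f := f) hf
  obtain ⟨f, hf, hex⟩ : ∃ f : G, f • p = p ∧
      ∀ᶠ q in 𝓝 ((0 : ℝ), f), q.1 ≠ 0 → τ (q.2 • j (q.1 • e)) 0 * q.1 < 0 := by
    by_contra hno
    have h1 : ∀ᶠ q : ℝ × ℝ in 𝓝 (0, 0), ∀ g ∈ (univ : Set G),
        0 < q.1 → 0 < q.2 → g • j (-q.2 • e) ≠ j (q.1 • e) := by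
      refine isCompact_univ.eventually_forall_of_forall_eventually (P := fun (q : ℝ × ℝ) (g : G) ↦
        0 < q.1 → 0 < q.2 → g • j (-q.2 • e) ≠ j (q.1 • e)) fun g _ ↦ ?_
      by_cases hg : g • p = p
      · have h2 := (hdich g hg).resolve_right (fun h3 ↦ hno ⟨g, hg, h3⟩)
        have h3 : Tendsto (fun z : (ℝ × ℝ) × G ↦ (-z.1.2, z.2)) (𝓝 ((0, 0), g)) (𝓝 (0, g)) := by
          have : ContinuousAt (fun z : (ℝ × ℝ) × G ↦ (-z.1.2, z.2)) ((0, 0), g) := by fun_prop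
          simpa [ContinuousAt] using this
        have h4 : Tendsto (fun z : (ℝ × ℝ) × G ↦ z.1.1) (𝓝 ((0, 0), g)) (𝓝 0) := by
          have : ContinuousAt (fun z : (ℝ × ℝ) × G ↦ z.1.1) ((0, 0), g) := by fun_prop
          exact this
        filter_upwards [h3.eventually h2, h4.eventually (Ioo_mem_nhds (neg_neg_of_pos h.pos) h.pos)]
          with z hz hz1 hz2 hz3 heq
        have h5 := hz (by linarith)
        rw [heq, hτ _ hz1] at h5
        nlinarith
      · have h2 : ContinuousAt (fun z : (ℝ × ℝ) × G ↦ z.2 • j (-z.1.2 • e)) ((0, 0), g) := by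
          refine continuousAt_snd.smul (ContinuousAt.comp (g := fun t : ℝ ↦ j (t • e))
            (f := fun z : (ℝ × ℝ) × G ↦ -z.1.2) ?_ (by fun_prop))
          simpa using hjc
        have h3 : ContinuousAt (fun z : (ℝ × ℝ) × G ↦ j (z.1.1 • e)) ((0, 0), g) :=
          ContinuousAt.comp (g := fun t : ℝ ↦ j (t • e))
            (f := fun z : (ℝ × ℝ) × G ↦ z.1.1) hjc (by fun_prop)
        have h4 := (h2.ne_iff_eventually_ne h3).1 (by
          beta_reduce
          rw [neg_zero, hj0]
          exact hg)
        exact h4.mono fun z hz _ _ ↦ hz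
    rw [nhds_prod_eq, Filter.eventually_prod_iff] at h1
    obtain ⟨pa, hpa, pb, hpb, hab⟩ := h1
    obtain ⟨r, hr, hball⟩ := Metric.eventually_nhds_iff_ball.1 (hpa.and hpb)
    obtain ⟨t, ht, t', ht', g, hg⟩ := hflip e he r hr
    refine hab (hball t ?_).1 (hball t' ?_).2 g (mem_univ _) ht.1 ht'.1 hg
    · rw [mem_ball_zero_iff, Real.norm_eq_abs, abs_of_pos ht.1]; exact ht.2
    · rw [mem_ball_zero_iff, Real.norm_eq_abs, abs_of_pos ht'.1]; exact ht'.2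
  let H := stabilizer G p
  have h1 : ∀ᶠ t : ℝ in 𝓝 0, ∀ g ∈ (univ : Set G),
      t ≠ 0 → ¬ H ≤ stabilizer G (g • j (t • e)) := by
    refine isCompact_univ.eventually_forall_of_forall_eventually (P := fun (t : ℝ) (g : G) ↦
        t ≠ 0 → ¬ H ≤ stabilizer G (g • j (t • e))) fun g _ ↦ ?_
    by_cases hg : H ≤ stabilizer G (g • p)
    · have hconj : ∀ a ∈ H, g⁻¹ * a * g ∈ H := by
        intro a ha
        have h2 : a • g • p = g • p := hg ha
        change (g⁻¹ * a * g) • p = p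
        rw [mul_smul, mul_smul, h2, inv_smul_smul]
      have hconj' : g * f * g⁻¹ ∈ H := by
        have := conj_mem_of_forall_conj_mem (isClosed_stabilizer (G := G) p) (a := g⁻¹)
          (by rw [inv_inv]; exact hconj) f hf
        rwa [inv_inv] at this
      have h2 : Tendsto (fun z : ℝ × G ↦ (z.1, z.2⁻¹ * (g * f * g⁻¹) * z.2)) (𝓝 (0, g))
          (𝓝 (0, f)) := by
        have : ContinuousAt (fun z : ℝ × G ↦ (z.1, z.2⁻¹ * (g * f * g⁻¹) * z.2)) (0, g) := by
          fun_prop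
        simpa [ContinuousAt, mul_assoc] using this
      have h3 : Tendsto (fun z : ℝ × G ↦ z.1) (𝓝 (0, g)) (𝓝 0) := continuousAt_fst
      filter_upwards [h2.eventually hex, h3.eventually (Ioo_mem_nhds (neg_neg_of_pos h.pos) h.pos)]
        with z hz hz1 hz0 hle
      have h4 : (g * f * g⁻¹) • z.2 • j (z.1 • e) = z.2 • j (z.1 • e) := hle hconj'
      have h5 := hz hz0
      beta_reduce at h5
      rw [mul_smul, mul_smul, h4, inv_smul_smul, hτ _ hz1] at h5
      nlinarith
    · obtain ⟨a, ha, hag⟩ := SetLike.not_le_iff_exists.1 hg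
      have hag : a • g • p ≠ g • p := hag
      have h2 : ContinuousAt (fun z : ℝ × G ↦ z.2 • j (z.1 • e)) (0, g) :=
        continuousAt_snd.smul (ContinuousAt.comp (g := fun t : ℝ ↦ j (t • e))
            (f := fun z : ℝ × G ↦ z.1) hjc (by fun_prop))
      have h3 : ContinuousAt (fun z : ℝ × G ↦ a • z.2 • j (z.1 • e)) (0, g) := h2.const_smul a
      have h4 := (h3.ne_iff_eventually_ne h2).1 (by
          beta_reduce
          rw [hj0]
          exact hag)
      exact h4.mono fun z hz _ hle ↦ hz (hle ha)
  have h2 : ∀ᶠ t : ℝ in 𝓝[≠] 0, t ≠ 0 := self_mem_nhdsWithin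
  obtain ⟨t, ht, ht0⟩ := (Filter.Eventually.and (nhdsWithin_le_nhds h1) h2).exists
  obtain ⟨g, hg⟩ := hp (j (t • e))
  exact ht g (mem_univ _) ht0 hg

end Flip

section CoordinateLemmas

variable {n : ℕ} {G : Type*} [Group G] {N : Type*} [TopologicalSpace N]
  [ChartedSpace (EuclideanSpace ℝ (Fin n)) N] [MulAction G N]
  [RiemannianBundle (fun x : N ↦ TangentSpace (𝓡 n) x)]

theorem IsRegularCoord.mvfderiv_ne_zero {U : Set N} {r : N → ℝ} (h : IsRegularCoord n G U r)
    {x : N} (hx : x ∈ U) : mvfderiv (𝓡 n) r x ≠ 0 := by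
  rw [ne_eq, ← gradientField_eq_zero_iff]
  intro h0
  have := h.norm_gradient x hx
  rw [h0, norm_zero] at this
  norm_num at this

theorem IsBoundaryCoord.nonneg {p : N} {U : Set N} {u : N → ℝ} {ε : ℝ}
    (h : IsBoundaryCoord n G p U u ε) {x : N} (hx : x ∈ U) : 0 ≤ u x := by
  have : u x ∈ u '' U := ⟨x, hx, rfl⟩
  rw [h.image] at this
  exact this.1

theorem IsBoundaryCoord.mem_orbit_iff {p : N} {U : Set N} {u : N → ℝ} {ε : ℝ}
    (h : IsBoundaryCoord n G p U u ε) {x : N} (hx : x ∈ U) : x ∈ orbit G p ↔ u x = 0 := by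
  rw [← h.levelSets p h.mem x hx, h.apply_base]

theorem IsBoundaryCoord.isRegularCoord {p : N} {U : Set N} {u : N → ℝ} {ε : ℝ}
    (h : IsBoundaryCoord n G p U u ε) :
    IsRegularCoord n G (U ∩ {x | 0 < u x}) (fun x ↦ √(u x)) ∧
      (fun x ↦ √(u x)) '' (U ∩ {x | 0 < u x}) = Ioo 0 ε := by
  have hsub : U ∩ {x | 0 < u x} ⊆ U := inter_subset_left
  have him : (fun x ↦ √(u x)) '' (U ∩ {x | 0 < u x}) = Ioo 0 ε := by
    ext t
    constructor
    · rintro ⟨x, ⟨hx, hx0⟩, rfl⟩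
      refine ⟨Real.sqrt_pos.2 hx0, ?_⟩
      have : u x ∈ u '' U := ⟨x, hx, rfl⟩
      rw [h.image] at this
      exact (Real.sqrt_lt' h.pos).2 this.2
    · intro ht
      have : t ^ 2 ∈ u '' U := by
        rw [h.image]
        exact ⟨sq_nonneg t, pow_lt_pow_left₀ ht.2 ht.1.le two_ne_zero⟩
      obtain ⟨x, hx, hxt⟩ := this
      refine ⟨x, ⟨hx, ?_⟩, ?_⟩
      · change 0 < u x
        rw [hxt]
        exact pow_pos ht.1 2
      · beta_reduce
        rw [hxt, Real.sqrt_sq ht.1.le]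
  have hUG : ∀ (g : G), ∀ x ∈ U, u (g • x) = u x := fun g x hx ↦
    h.levelSets.apply_smul h.smul_mem g hx
  refine ⟨⟨?_, ?_, ?_, ?_, ?_, ?_⟩, him⟩
  · exact h.contMDiffOn.continuousOn.isOpen_inter_preimage h.isOpen isOpen_Ioi
  · rintro g x ⟨hx, hx0⟩
    refine ⟨h.smul_mem g x hx, ?_⟩
    change 0 < u (g • x)
    rw [hUG g x hx]
    exact hx0
  · intro x hx
    refine ContMDiffAt.contMDiffWithinAt ?_
    refine ContMDiffAt.comp (g := Real.sqrt) (f := u) (I' := 𝓘(ℝ, ℝ)) x ?_ ?_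
    · exact (Real.contDiffAt_sqrt hx.2.ne').contMDiffAt
    · exact h.contMDiffOn.contMDiffAt (h.isOpen.mem_nhds hx.1)
  · rintro x ⟨hx, hx0⟩
    have hx0 : 0 < u x := hx0
    rw [norm_gradientField_real_comp ((h.contMDiffOn.contMDiffAt
      (h.isOpen.mem_nhds hx)).mdifferentiableAt (by simp)) (Real.hasDerivAt_sqrt hx0.ne'),
      h.norm_gradient x hx, div_pow, mul_pow, Real.sq_sqrt hx0.le]
    field_simp
    norm_num
  · rintro x ⟨hx, hx0⟩ y ⟨hy, hy0⟩
    rw [← h.levelSets x hx y hy, Real.sqrt_inj (h.nonneg hy) (h.nonneg hx)]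
  · rw [him]
    exact ordConnected_Ioo

theorem IsBoundaryCoord.mem_closure {p : N} {U : Set N} {u : N → ℝ} {ε : ℝ}
    (h : IsBoundaryCoord n G p U u ε) (hG : ∀ g : G, Continuous (fun y : N ↦ g • y)) {M : Set N}
    (hM : p ∈ closure M) (hMG : ∀ (g : G), ∀ x ∈ M, g • x ∈ M) {x : N}
    (hx : x ∈ orbit G p) : x ∈ closure M := by
  obtain ⟨g, rfl⟩ := hx
  exact map_mem_closure (hG g) hM (hMG g)

variable [T2Space N] [IsManifold (𝓡 n) ∞ N]
  [IsContMDiffRiemannianBundle (𝓡 n) ∞ (EuclideanSpace ℝ (Fin n))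
    (fun x : N ↦ TangentSpace (𝓡 n) x)]

/-- Orbits near a given one in the domain of a unit speed coordinate have the same type. -/
theorem IsRegularCoord.eventually_conj
    (hG : ∀ g : G, ContMDiff (𝓡 n) (𝓡 n) ∞ (fun y : N ↦ g • y))
    (hiso : ∀ g : G, PreservesMetric (n := n) (fun y : N ↦ g • y)) {U : Set N} {r : N → ℝ}
    (h : IsRegularCoord n G U r) {x : N} (hx : x ∈ U) :
    ∀ᶠ y in 𝓝 x, ∃ g : G, stabilizer G (g • y) = stabilizer G x := by
  have hrat : ∀ y ∈ U, ContMDiffAt (𝓡 n) 𝓘(ℝ, ℝ) ∞ r y := fun y hy ↦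
    h.contMDiffOn.contMDiffAt (h.isOpen.mem_nhds hy)
  have hIM : IsManifold (𝓡 n) 1 N := IsManifold.of_le (n := ∞) (by simp)
  have hv : ∀ y ∈ U, ContMDiffAt (𝓡 n) (𝓡 n).tangent 1
      (fun x ↦ (⟨x, gradientField n r x⟩ : TangentBundle (𝓡 n) N)) y := fun y hy ↦
    (smoothFieldAt_gradientField (hrat y hy)).of_le (natCast_le_infty 1)
  obtain ⟨γ, hγ0, hγ⟩ := exists_isMIntegralCurveAt_of_contMDiffAt_boundaryless (t₀ := 0) (hv x hx)
  have hγU : ∀ᶠ t in 𝓝 0, γ t ∈ U := by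
    refine hγ.continuousAt.eventually (h.isOpen.mem_nhds ?_)
    rwa [hγ0]
  obtain ⟨ε, hε, hball⟩ := Metric.eventually_nhds_iff_ball.1 (hγ.and hγU)
  have hcont : ∀ t ∈ Metric.ball (0 : ℝ) ε, ContinuousAt γ t := fun t ht ↦
    (hball t ht).1.continuousAt
  have hstab : ∀ t₁ ∈ Metric.ball (0 : ℝ) ε, ∀ t₂ ∈ Metric.ball (0 : ℝ) ε,
      stabilizer G (γ t₁) ≤ stabilizer G (γ t₂) := by
    intro t₁ ht₁ t₂ ht₂ g hg
    have hat : ∀ t ∈ Metric.ball (0 : ℝ) ε, IsMIntegralCurveAt γ (gradientField n r) t ∧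
        IsMIntegralCurveAt (fun t ↦ g • γ t) (gradientField n r) t := by
      intro t ht
      have h1 : ∀ᶠ t' in 𝓝 t, t' ∈ Metric.ball (0 : ℝ) ε := Metric.isOpen_ball.mem_nhds ht
      refine ⟨h1.mono fun t' ht' ↦ (hball t' ht').1, h1.mono fun t' ht' ↦ ?_⟩
      have h2 := ((hG g).contMDiffAt.mdifferentiableAt (x := γ t') (by simp)).hasMFDerivAt.comp t'
        (hball t' ht').1
      have h3 := (hiso g).mfderiv_gradientField
        ((hG g).contMDiffAt.mdifferentiableAt (x := γ t') (by simp))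
        ((hrat _ (h.smul_mem g _ (hball t' ht').2)).mdifferentiableAt (by simp)) (by
          filter_upwards [h.isOpen.mem_nhds (hball t' ht').2] with y hy
          exact h.levelSets.apply_smul h.smul_mem g hy)
      beta_reduce
      rw [← h3]
      refine h2.congr_mfderiv ?_
      ext
      exact map_smul (mfderiv (𝓡 n) (𝓡 n) (fun y : N ↦ g • y) (γ t')) (1 : ℝ)
        (gradientField n r (γ t'))
    refine (convex_ball (0 : ℝ) ε).isPreconnected.forall_of_isClopen
      (P := fun t ↦ g • γ t = γ t) (fun t ht hP ↦ ?_) (fun t ht hP ↦ ?_) ht₁ hg ht₂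
    · have h1 := isMIntegralCurveAt_eventuallyEq_of_contMDiffAt_boundaryless
        (hv _ (hball t ht).2) (hat t ht).1 (hat t ht).2 hP.symm
      exact nhdsWithin_le_nhds (h1.mono fun t' ht' ↦ ht'.symm)
    · have h1 : Tendsto (fun t ↦ (g • γ t, γ t)) (𝓝[Metric.ball 0 ε] t) (𝓝 (g • γ t, γ t)) :=
        (((hG g).continuous.continuousAt.comp (hcont t ht)).prodMk_nhds (hcont t ht)).mono_left nhdsWithin_le_nhds
      exact isClosed_diagonal.mem_of_frequently_of_tendsto hP h1
  have hder : ∀ t ∈ Metric.ball (0 : ℝ) ε, HasDerivAt (fun t ↦ r (γ t)) 1 t := by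
    intro t ht
    have h1 := hasDerivAt_comp_curve ((hrat _ (hball t ht).2).mdifferentiableAt (by simp))
      (hball t ht).1
    rwa [← inner_gradientField, real_inner_self_eq_norm_sq, h.norm_gradient _ (hball t ht).2] at h1
  have hmono : StrictMonoOn (fun t ↦ r (γ t)) (Metric.ball 0 ε) := by
    refine strictMonoOn_of_deriv_pos (convex_ball _ _)
      (fun t ht ↦ (hder t ht).continuousAt.continuousWithinAt) fun t ht ↦ ?_
    rw [Metric.isOpen_ball.interior_eq] at ht
    rw [(hder t ht).deriv]
    exact one_pos
  have hIcc : Icc (-(ε / 2)) (ε / 2) ⊆ Metric.ball 0 ε := by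
    intro t ht
    rw [Real.ball_eq_Ioo]
    exact ⟨by linarith [ht.1], by linarith [ht.2]⟩
  have h0m : (0 : ℝ) ∈ Metric.ball 0 ε := Metric.mem_ball_self hε
  have hl := hmono (hIcc (left_mem_Icc.2 (by linarith))) h0m (by linarith)
  have hr := hmono h0m (hIcc (right_mem_Icc.2 (by linarith))) (by linarith)
  beta_reduce at hl hr
  rw [hγ0] at hl hr
  have hivt := intermediate_value_Icc (show -(ε / 2) ≤ ε / 2 by linarith)
    (f := fun t ↦ r (γ t)) fun t ht ↦ (hder t (hIcc ht)).continuousAt.continuousWithinAt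
  filter_upwards [(hrat x hx).continuousAt.eventually (Icc_mem_nhds hl hr), h.isOpen.mem_nhds hx]
    with y hy hyU
  obtain ⟨t, ht, hty⟩ := hivt hy
  obtain ⟨g, hg⟩ := (h.levelSets y hyU (γ t) (hball t (hIcc ht)).2).1 hty
  refine ⟨g, ?_⟩
  have hg : g • y = γ t := hg
  rw [hg, ← hγ0]
  exact le_antisymm (hstab _ (hIcc ht) _ h0m) (hstab _ h0m _ (hIcc ht))

end CoordinateLemmas

section LocalStructure

variable {m n : ℕ} {G : Type*} [TopologicalSpace G] [ChartedSpace (EuclideanSpace ℝ (Fin m)) G]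
  [Group G] [LieGroup (𝓡 m) ∞ G] [CompactSpace G] {N : Type*} [TopologicalSpace N] [T2Space N]
  [ChartedSpace (EuclideanSpace ℝ (Fin n)) N] [IsManifold (𝓡 n) ∞ N]
  [RiemannianBundle (fun x : N ↦ TangentSpace (𝓡 n) x)]
  [IsContMDiffRiemannianBundle (𝓡 n) ∞ (EuclideanSpace ℝ (Fin n))
    (fun x : N ↦ TangentSpace (𝓡 n) x)]
  [MulAction G N] [ContMDiffSMul (𝓡 m) (𝓡 n) ∞ G N]

omit [RiemannianBundle (fun x : N ↦ TangentSpace (𝓡 n) x)]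
  [IsContMDiffRiemannianBundle (𝓡 n) ∞ (EuclideanSpace ℝ (Fin n))
    (fun x : N ↦ TangentSpace (𝓡 n) x)] in
theorem LevelSetsAreOrbits.orbitDim_eq (hcoh : ∀ x : N, orbitDim m n G x + 1 ≤ n) {f : N → ℝ}
    {U : Set N} (h : LevelSetsAreOrbits G f U) (hU : IsOpen U)
    (hUG : ∀ (g : G), ∀ x ∈ U, g • x ∈ U) (hf : ContMDiffOn (𝓡 n) 𝓘(ℝ, ℝ) ∞ f U) {x : N}
    (hx : x ∈ U) (hd : mvfderiv (𝓡 n) f x ≠ 0) : orbitDim m n G x + 1 = n := by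
  by_contra hne
  refine hd (mvfderiv_eq_zero_of_codim (m := m) (G := G) ?_ (hf.contMDiffAt (hU.mem_nhds hx)) ?_ ?_)
  · have := hcoh x
    omega
  · filter_upwards [hU.mem_nhds hx] with y hy z hz
    obtain ⟨g, rfl⟩ := hz
    exact h.apply_smul hUG g hy
  · filter_upwards [hU.mem_nhds hx] with y hy hxy
    exact (h x hx y hy).1 hxy

/-- Near each of its points, `N` has either a unit speed coordinate transverse to the orbits, or
the orbit is not principal and there is a smooth squared distance from it. -/
theorem exists_coord [ConnectedSpace N] (hcoh : IsCohomogeneityOne m n G N)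
    (hiso : ∀ g : G, PreservesMetric (n := n) (fun y : N ↦ g • y)) (p : N) :
    (∃ U r, p ∈ U ∧ IsRegularCoord n G U r) ∨
      (¬ IsPrincipalPoint G p ∧ ∃ U u ε, IsBoundaryCoord n G p U u ε) := by
  have : ContinuousSMul G N := ContMDiffSMul.continuousSMul (I := 𝓡 m) (I' := 𝓡 n) ∞
  obtain ⟨hcoh, x₀, hx₀⟩ := hcoh
  let M := {x : N | orbitDim m n G x + 1 = n}
  have hMG : ∀ (g : G), ∀ x ∈ M, g • x ∈ M := fun g x hx ↦ by
    change orbitDim m n G (g • x) + 1 = n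
    rw [orbitDim_smul]
    exact hx
  have hloc : ∀ p ∈ closure M, (∃ U r, p ∈ U ∧ IsRegularCoord n G U r) ∨
      (¬ IsPrincipalPoint G p ∧ ∃ U u ε, IsBoundaryCoord n G p U u ε) := by
    intro p hp
    obtain ⟨k, j, τ, O, δ, h, s, κ, c₀, hs, hsG, hsp, hκ, hc₀, hk, hle, ⟨hB, hflip⟩ | ⟨hk1, hR⟩⟩ :=
      exists_slice_dichotomy hcoh hp
    · right
      refine ⟨?_, h.exists_isBoundaryCoord hiso hs hsG hsp hκ hc₀ hk hle hB⟩
      by_cases hk1 : k = 1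
      · subst hk1
        exact h.not_isPrincipalPoint hs hsG hsp hκ hle hflip
      · intro hprin
        obtain ⟨g, hg⟩ := hprin x₀
        have h1 := orbitDim_le_of_stabilizer_le (m := m) (n := n) hg
        rw [orbitDim_smul] at h1
        have := h.dim_eq
        omega
    · left
      subst hk1
      exact h.exists_isRegularCoord hiso hs hsG hsp hc₀ hR
  refine hloc p ?_
  have hopen : IsOpen (closure M) := by
    refine isOpen_iff_mem_nhds.2 fun p hp ↦ ?_
    rcases hloc p hp with ⟨U, r, hpU, hr⟩ | ⟨-, U, u, ε, hu⟩
    · filter_upwards [hr.isOpen.mem_nhds hpU] with x hx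
      exact subset_closure (hr.levelSets.orbitDim_eq hcoh hr.isOpen hr.smul_mem hr.contMDiffOn hx
        (hr.mvfderiv_ne_zero hx))
    · filter_upwards [hu.isOpen.mem_nhds hu.mem] with x hx
      rcases (hu.nonneg hx).eq_or_lt with h0 | h0
      · exact hu.mem_closure (fun g ↦ continuous_const_smul g) hp hMG ((hu.mem_orbit_iff hx).2 h0.symm)
      · have hr := hu.isRegularCoord.1
        exact subset_closure (hr.levelSets.orbitDim_eq hcoh hr.isOpen hr.smul_mem hr.contMDiffOn
          ⟨hx, h0⟩ (hr.mvfderiv_ne_zero ⟨hx, h0⟩))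
  have huniv := IsClopen.eq_univ ⟨isClosed_closure, hopen⟩ ⟨x₀, subset_closure hx₀⟩
  rw [huniv]
  exact mem_univ p

end LocalStructure

section CoordinateTopology

variable {n : ℕ} {G : Type*} [Group G] {N : Type*} [TopologicalSpace N]
  [ChartedSpace (EuclideanSpace ℝ (Fin n)) N] [MulAction G N]
  [RiemannianBundle (fun x : N ↦ TangentSpace (𝓡 n) x)] {U V : Set N} {r s : N → ℝ}

theorem IsRegularCoord.contMDiffAt (h : IsRegularCoord n G U r) {x : N} (hx : x ∈ U) :
    ContMDiffAt (𝓡 n) 𝓘(ℝ, ℝ) ∞ r x :=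
  h.contMDiffOn.contMDiffAt (h.isOpen.mem_nhds hx)

theorem IsRegularCoord.apply_smul (h : IsRegularCoord n G U r) (g : G) {x : N} (hx : x ∈ U) :
    r (g • x) = r x :=
  h.levelSets.apply_smul h.smul_mem g hx

theorem IsRegularCoord.mem_of_mem_orbit (h : IsRegularCoord n G U r) {x y : N} (hx : x ∈ U)
    (hy : y ∈ orbit G x) : y ∈ U := by
  obtain ⟨g, rfl⟩ := hy
  exact h.smul_mem g x hx

/-- If a real function `f` is composed with an affine isometry of `ℝ`, the result is again a
unit speed coordinate. -/
theorem IsRegularCoord.affine (h : IsRegularCoord n G U r) {σ : ℝ} (hσ : σ ^ 2 = 1) (c : ℝ) :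
    IsRegularCoord n G U (fun x ↦ σ * r x + c) := by
  have hσ0 : σ ≠ 0 := by rintro rfl; norm_num at hσ
  have hd : ∀ t, HasDerivAt (fun t ↦ σ * t + c) σ t := fun t ↦ by
    simpa using ((hasDerivAt_id t).const_mul σ).add_const c
  refine ⟨h.isOpen, h.smul_mem, ?_, fun x hx ↦ ?_, fun x hx y hy ↦ ?_, ?_⟩
  · have : ContMDiff 𝓘(ℝ, ℝ) 𝓘(ℝ, ℝ) ∞ (fun t : ℝ ↦ σ * t + c) := by
      rw [contMDiff_iff_contDiff]
      fun_prop
    exact this.comp_contMDiffOn h.contMDiffOn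
  · rw [norm_gradientField_real_comp ((h.contMDiffAt hx).mdifferentiableAt (by simp)) (hd _), hσ,
      one_mul, h.norm_gradient x hx]
  · rw [← h.levelSets x hx y hy]
    simp [hσ0]
  · have h1 : (fun x ↦ σ * r x + c) '' U = (fun t ↦ σ * t + c) '' (r '' U) := by
      rw [image_image]
    rw [h1]
    exact (h.ordConnected.isPreconnected.image _ (by fun_prop)).ordConnected

variable [IsManifold (𝓡 n) ∞ N]

/-- A unit speed coordinate has continuous local sections. -/
theorem IsRegularCoord.exists_section (h : IsRegularCoord n G U r) {x : N} (hx : x ∈ U) :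
    ∃ c : ℝ → N, ContMDiffAt 𝓘(ℝ, ℝ) (𝓡 n) ∞ c (r x) ∧ c (r x) = x ∧
      ∀ᶠ t in 𝓝 (r x), ContinuousAt c t ∧ c t ∈ U ∧ r (c t) = t := by
  obtain ⟨c, h1, h2, h3⟩ := exists_local_section (h.contMDiffAt hx) (h.mvfderiv_ne_zero hx)
  refine ⟨c, h1, h2, ?_⟩
  have h4 := (contMDiffAt_iff_contMDiffAt_nhds (n := 1) (by simp)).1 (h1.of_le (by simp))
  have h5 := h1.continuousAt.eventually_mem (h.isOpen.mem_nhds (h2.symm ▸ hx))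
  filter_upwards [h3, h4, h5] with t h3 h4 h5 using ⟨h4.continuousAt, h5, h3⟩

theorem IsRegularCoord.isOpen_image (h : IsRegularCoord n G U r) : IsOpen (r '' U) := by
  rw [isOpen_iff_mem_nhds]
  rintro _ ⟨x, hx, rfl⟩
  obtain ⟨c, -, -, h1⟩ := h.exists_section hx
  filter_upwards [h1] with t ht using ⟨c t, ht.2⟩

/-- Connectedness of the orbit space of the domain of a unit speed coordinate. -/
theorem IsRegularCoord.forall_of_isClopen (h : IsRegularCoord n G U r) {P : N → Prop}
    (hPG : ∀ (g : G), ∀ x ∈ U, P x → P (g • x)) (hopen : ∀ x ∈ U, P x → ∀ᶠ y in 𝓝 x, P y)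
    (hclosed : ∀ x ∈ U, ¬ P x → ∀ᶠ y in 𝓝 x, ¬ P y) {x y : N} (hx : x ∈ U) (hP : P x)
    (hy : y ∈ U) : P y := by
  have key : ∀ z ∈ U, ∀ w ∈ U, r z = r w → P z → P w := by
    intro z hz w hw hzw hPz
    obtain ⟨g, rfl⟩ := (h.levelSets z hz w hw).1 hzw.symm
    exact hPG g z hz hPz
  suffices h0 : ∃ z ∈ U, r z = r y ∧ P z by
    obtain ⟨z, hz, hz1, hz2⟩ := h0
    exact key z hz y hy hz1 hz2
  refine h.ordConnected.isPreconnected.forall_of_isClopen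
    (P := fun t ↦ ∃ z ∈ U, r z = t ∧ P z) ?_ ?_ (mem_image_of_mem r hx) ⟨x, hx, rfl, hP⟩
    (mem_image_of_mem r hy)
  · rintro _ - ⟨z, hz, rfl, hPz⟩
    obtain ⟨c, h1, h2, h3⟩ := h.exists_section hz
    have h4 := h1.continuousAt.eventually (h2.symm ▸ hopen z hz hPz)
    exact nhdsWithin_le_nhds (by filter_upwards [h3, h4] with t h3 h4 using ⟨c t, h3.2.1, h3.2.2, h4⟩)
  · rintro _ ⟨z, hz, rfl⟩ hf
    refine ⟨z, hz, rfl, ?_⟩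
    by_contra hPz
    obtain ⟨c, h1, h2, h3⟩ := h.exists_section hz
    have h4 := h1.continuousAt.eventually (h2.symm ▸ hclosed z hz hPz)
    refine hf (nhdsWithin_le_nhds ?_)
    filter_upwards [h3, h4] with t h3 h4
    rintro ⟨w, hw, hwt, hPw⟩
    exact h4 (key w hw _ h3.2.1 (by rw [hwt, h3.2.2]) hPw)

/-- A continuous function that separates the orbits has no local extremum at a point of the domain
of a unit speed coordinate. -/
theorem IsRegularCoord.exists_lt_and_gt (h : IsRegularCoord n G U r) {x : N} (hx : x ∈ U)
    {f : N → ℝ} {W O : Set N} (hW : IsOpen W) (hxW : x ∈ W) (hf : ContinuousOn f W)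
    (hlev : ∀ y ∈ W, ∀ z ∈ W, f y = f z → y ∈ orbit G z) (hO : O ∈ 𝓝 x) :
    (∃ y ∈ O, f y < f x) ∧ ∃ y ∈ O, f x < f y := by
  obtain ⟨c, h1, h2, h3⟩ := h.exists_section hx
  have h4 := h1.continuousAt.eventually_mem (h2.symm ▸ inter_mem (hW.mem_nhds hxW) hO)
  obtain ⟨δ, hδ, hb⟩ := Metric.eventually_nhds_iff_ball.1 (h3.and h4)
  have hsub : ∀ t ∈ Icc (r x - δ / 2) (r x + δ / 2), t ∈ Metric.ball (r x) δ := by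
    intro t ht
    rw [Real.ball_eq_Ioo]
    exact ⟨by linarith [ht.1], by linarith [ht.2]⟩
  have hcont : ContinuousOn (fun t ↦ f (c t)) (Icc (r x - δ / 2) (r x + δ / 2)) := by
    intro t ht
    obtain ⟨⟨h5, -⟩, h6, -⟩ := hb t (hsub t ht)
    exact ((hf.continuousAt (hW.mem_nhds h6)).comp h5).continuousWithinAt
  have hinj : InjOn (fun t ↦ f (c t)) (Icc (r x - δ / 2) (r x + δ / 2)) := by
    intro t ht t' ht' he
    obtain ⟨⟨-, h5, h5'⟩, h6, -⟩ := hb t (hsub t ht)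
    obtain ⟨⟨-, h7, h7'⟩, h8, -⟩ := hb t' (hsub t' ht')
    rw [← h5', ← h7']
    exact (h.levelSets _ h7 _ h5).2 (hlev _ h6 _ h8 he)
  have hl : r x - δ / 2 ∈ Icc (r x - δ / 2) (r x + δ / 2) := ⟨le_rfl, by linarith⟩
  have hm : r x ∈ Icc (r x - δ / 2) (r x + δ / 2) := ⟨by linarith, by linarith⟩
  have hr : r x + δ / 2 ∈ Icc (r x - δ / 2) (r x + δ / 2) := ⟨by linarith, le_rfl⟩
  have e1 := (hb _ (hsub _ hl)).2.2
  have e2 := (hb _ (hsub _ hr)).2.2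
  rcases hcont.strictMonoOn_of_injOn_Icc' (by linarith) hinj with hs | hs
  · have a1 := hs hl hm (by linarith)
    have a2 := hs hm hr (by linarith)
    simp only [h2] at a1 a2
    exact ⟨⟨_, e1, a1⟩, _, e2, a2⟩
  · have a1 := hs hl hm (by linarith)
    have a2 := hs hm hr (by linarith)
    simp only [h2] at a1 a2
    exact ⟨⟨_, e2, a2⟩, _, e1, a1⟩

/-- On an interval of values, two unit speed coordinates differ by an isometry of `ℝ`. -/
theorem IsRegularCoord.exists_transition (h : IsRegularCoord n G U r) (h' : IsRegularCoord n G V s)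
    {a b : ℝ} (hab : Ioo a b ⊆ s '' V) (hU : ∀ y ∈ V, s y ∈ Ioo a b → y ∈ U) :
    ∃ σ c : ℝ, σ ^ 2 = 1 ∧ ∀ y ∈ V, s y ∈ Ioo a b → r y = σ * s y + c := by
  rcases isEmpty_or_nonempty N with hN | hN
  · exact ⟨1, 0, by norm_num, fun y ↦ (hN.false y).elim⟩
  have hab' : ∀ t, t ∈ Ioo a b → ∃ y ∈ V, s y = t := fun t ht ↦ hab ht
  choose! j hjV hj using hab'
  have key : ∀ y ∈ V, s y ∈ Ioo a b → r y = r (j (s y)) := by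
    intro y hy hsy
    exact (h.levelSets _ (hU _ (hjV _ hsy) ((hj _ hsy).symm ▸ hsy)) _ (hU y hy hsy)).2
      ((h'.levelSets _ (hjV _ hsy) _ hy).1 (hj _ hsy).symm)
  have hsm : ∀ t ∈ Ioo a b, ContDiffAt ℝ ∞ (fun t ↦ r (j t)) t := by
    intro t ht
    obtain ⟨c, h1, h2, h3⟩ := h'.exists_section (hjV t ht)
    rw [hj t ht] at h1 h2 h3
    have h4 : ContMDiffAt 𝓘(ℝ, ℝ) 𝓘(ℝ, ℝ) ∞ (fun t ↦ r (c t)) t :=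
      ContMDiffAt.comp t (h2.symm ▸ h.contMDiffAt (hU _ (hjV t ht) ((hj t ht).symm ▸ ht))) h1
    refine (contMDiffAt_iff_contDiffAt.1 h4).congr_of_eventuallyEq ?_
    filter_upwards [h3, isOpen_Ioo.mem_nhds ht] with t' h3 ht'
    rw [key (c t') h3.2.1 (h3.2.2.symm ▸ ht'), h3.2.2]
  have hsq : ∀ t ∈ Ioo a b, deriv (fun t ↦ r (j t)) t ^ 2 = 1 := by
    intro t ht
    have h1 := ((hsm t ht).differentiableAt (by simp)).hasDerivAt
    have hmem := hU _ (hjV t ht) ((hj t ht).symm ▸ ht)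
    rw [← h.norm_gradient _ hmem, gradientField_congr (g := fun y ↦ (fun t ↦ r (j t)) (s y)),
      norm_gradientField_real_comp (f := s) (h := fun t ↦ r (j t))
        ((h'.contMDiffAt (hjV t ht)).mdifferentiableAt (by simp))
        ((hj t ht).symm ▸ h1), h'.norm_gradient _ (hjV t ht), mul_one, hj t ht]
    have h5 : ∀ᶠ y in 𝓝 (j t), s y ∈ Ioo a b :=
      (h'.contMDiffAt (hjV t ht)).continuousAt.eventually_mem
        (isOpen_Ioo.mem_nhds ((hj t ht).symm ▸ ht))
    filter_upwards [h5, h'.isOpen.mem_nhds (hjV t ht)] with y hy hyV using key y hyV hy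
  have hcd : ContDiffOn ℝ ∞ (fun t ↦ r (j t)) (Ioo a b) := fun t ht ↦ (hsm t ht).contDiffWithinAt
  have hdc : ContinuousOn (deriv (fun t ↦ r (j t))) (Ioo a b) :=
    hcd.continuousOn_deriv_of_isOpen isOpen_Ioo (by simp)
  obtain ⟨σ, hσ, hσd⟩ : ∃ σ : ℝ, σ ^ 2 = 1 ∧ ∀ t ∈ Ioo a b, deriv (fun t ↦ r (j t)) t = σ := by
    rcases isPreconnected_Ioo.eq_or_eq_neg_of_sq_eq hdc (continuousOn_const (c := (1 : ℝ)))
      (fun t ht ↦ by simp [hsq t ht]) (fun _ ↦ one_ne_zero) with h1 | h1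
    · exact ⟨1, by norm_num, fun t ht ↦ h1 ht⟩
    · exact ⟨-1, by norm_num, fun t ht ↦ h1 ht⟩
  have hd : ∀ t ∈ Ioo a b, HasDerivAt (fun t ↦ r (j t) - σ * t) 0 t := by
    intro t ht
    have h1 := ((hsm t ht).differentiableAt (by simp)).hasDerivAt
    rw [hσd t ht] at h1
    convert! h1.sub ((hasDerivAt_id t).const_mul σ) using 1
    ring
  obtain ⟨c, hc⟩ := isOpen_Ioo.exists_is_const_of_deriv_eq_zero isPreconnected_Ioo
    (fun t ht ↦ (hd t ht).differentiableAt.differentiableWithinAt) (fun t ht ↦ (hd t ht).deriv)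
  refine ⟨σ, c, hσ, fun y hy hsy ↦ ?_⟩
  rw [key y hy hsy, ← hc _ hsy]
  ring

variable [TopologicalSpace G] [CompactSpace G] [ContinuousSMul G N] [T2Space N]

theorem IsRegularCoord.mem_orbit_of_tendsto (h : IsRegularCoord n G U r) {F : Filter N} [F.NeBot]
    {z x : N} (hF : F ≤ 𝓝 z) (hU : U ∈ F) (hx : x ∈ U) (hr : Tendsto r F (𝓝 (r x))) :
    z ∈ orbit G x := by
  obtain ⟨c, h1, h2, h3⟩ := h.exists_section hx
  have h4 : Tendsto (fun y ↦ (y, c (r y))) F (𝓝 (z, x)) := by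
    have h5 := h1.continuousAt.tendsto.comp hr
    rw [h2] at h5
    exact (tendsto_id.mono_right hF).prodMk_nhds h5
  refine (isClosed_orbitRel G).mem_of_tendsto h4 ?_
  filter_upwards [hr.eventually h3, hU] with y hy hyU
  exact (h.levelSets _ hy.2.1 _ hyU).1 hy.2.2.symm

theorem IsRegularCoord.isClosed_preimage_Icc (h : IsRegularCoord n G U r) {a b : ℝ}
    (hab : Icc a b ⊆ r '' U) : IsClosed (U ∩ r ⁻¹' Icc a b) := by
  refine isClosed_of_closure_subset fun z hz ↦ ?_
  have := mem_closure_iff_nhdsWithin_neBot.1 hz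
  let F := Ultrafilter.of (𝓝[U ∩ r ⁻¹' Icc a b] z)
  have hF : (F : Filter N) ≤ 𝓝[U ∩ r ⁻¹' Icc a b] z := Ultrafilter.of_le _
  have hS : U ∩ r ⁻¹' Icc a b ∈ (F : Filter N) := hF self_mem_nhdsWithin
  obtain ⟨t, ht, htF⟩ := isCompact_Icc.ultrafilter_le_nhds (F.map r)
    (by
      rw [le_principal_iff, Ultrafilter.coe_map, Filter.mem_map]
      exact Filter.mem_of_superset hS inter_subset_right)
  obtain ⟨x, hx, rfl⟩ := hab ht
  have hz := h.mem_orbit_of_tendsto (hF.trans nhdsWithin_le_nhds)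
    (Filter.mem_of_superset hS inter_subset_left) hx htF
  have hzU := h.mem_of_mem_orbit hx hz
  refine ⟨hzU, ?_⟩
  change r z ∈ Icc a b
  rwa [(h.levelSets x hx z hzU).2 hz]

/-- The domain of a unit speed coordinate either contains a one-sided neighbourhood of a value of
another unit speed coordinate, or does not meet it. -/
theorem IsRegularCoord.exists_collar (h : IsRegularCoord n G U r) (h' : IsRegularCoord n G V s)
    {t₀ ε : ℝ} (hε : 0 < ε) (hI : Ioo t₀ (t₀ + ε) ⊆ s '' V) :
    ∃ δ ∈ Ioc 0 ε, (∀ y ∈ V, s y ∈ Ioo t₀ (t₀ + δ) → y ∈ U) ∨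
      ∀ y ∈ V, s y ∈ Ioo t₀ (t₀ + δ) → y ∉ U := by
  by_contra! hne
  have step : ∀ t ∈ Ioc t₀ (t₀ + ε), (∃ y ∈ V, s y ∈ Ioo t₀ t ∧ y ∉ U) ∧
      ∃ y ∈ V, s y ∈ Ioo t₀ t ∧ y ∈ U := by
    intro t ht
    have := hne (t - t₀) ⟨by linarith [ht.1], by linarith [ht.2]⟩
    rwa [add_sub_cancel] at this
  obtain ⟨y₁, h1V, h1, h1U⟩ := (step _ ⟨by linarith, le_rfl⟩).2
  obtain ⟨y₂, h2V, h2, h2U⟩ := (step (s y₁) ⟨h1.1, h1.2.le⟩).1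
  obtain ⟨y₃, h3V, h3, h3U⟩ := (step (s y₂) ⟨h2.1, (h2.2.trans h1.2).le⟩).2
  obtain ⟨y₄, h4V, h4, h4U⟩ := (step (s y₃) ⟨h3.1, (h3.2.trans (h2.2.trans h1.2)).le⟩).1
  have hcl := h'.isClosed_preimage_Icc (a := s y₄) (b := s y₂) (fun t ht ↦
    hI ⟨h4.1.trans_le ht.1, ht.2.trans_lt (h2.2.trans h1.2)⟩)
  have hnot : ∀ z ∈ V, z ∉ U → ∀ y ∈ U, y ∈ V → s y ≠ s z := by
    intro z hz hzU y hy hyV he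
    exact hzU (h.mem_of_mem_orbit hy ((h'.levelSets y hyV z hz).1 he.symm))
  have h5 := h.forall_of_isClopen (P := fun y ↦ y ∈ V ∩ s ⁻¹' Icc (s y₄) (s y₂)) ?_ ?_ ?_ h3U
    ⟨h3V, h4.2.le, h3.2.le⟩ h1U
  · exact absurd h5.2.2 (not_le.2 h2.2)
  · rintro g x - ⟨hxV, hx⟩
    refine ⟨h'.smul_mem g x hxV, ?_⟩
    change s (g • x) ∈ Icc (s y₄) (s y₂)
    rwa [h'.apply_smul g hxV]
  · rintro x hxU ⟨hxV, hx⟩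
    have h6 : s x ∈ Ioo (s y₄) (s y₂) :=
      ⟨lt_of_le_of_ne hx.1 (hnot y₄ h4V h4U x hxU hxV).symm,
        lt_of_le_of_ne hx.2 (hnot y₂ h2V h2U x hxU hxV)⟩
    filter_upwards [h'.isOpen.mem_nhds hxV, (h'.contMDiffAt hxV).continuousAt.eventually_mem
      (isOpen_Ioo.mem_nhds h6)] with y hy hy' using ⟨hy, Ioo_subset_Icc_self hy'⟩
  · intro x _ hx
    exact hcl.isOpen_compl.mem_nhds hx

end CoordinateTopology

section Gluing

variable {n : ℕ} {G : Type*} [Group G] {N : Type*} [TopologicalSpace N]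
  [ChartedSpace (EuclideanSpace ℝ (Fin n)) N] [MulAction G N]
  [RiemannianBundle (fun x : N ↦ TangentSpace (𝓡 n) x)] {U V : Set N} {r s : N → ℝ}

theorem IsRegularCoord.restrict (h : IsRegularCoord n G U r) {a b : ℝ} (hab : Ioo a b ⊆ r '' U) :
    IsRegularCoord n G (U ∩ r ⁻¹' Ioo a b) r := by
  refine ⟨h.contMDiffOn.continuousOn.isOpen_inter_preimage h.isOpen isOpen_Ioo, ?_,
    h.contMDiffOn.mono inter_subset_left, fun x hx ↦ h.norm_gradient x hx.1,
    fun x hx y hy ↦ h.levelSets x hx.1 y hy.1, ?_⟩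
  · rintro g x ⟨hx, hx'⟩
    refine ⟨h.smul_mem g x hx, ?_⟩
    change r (g • x) ∈ Ioo a b
    rwa [h.apply_smul g hx]
  · rw [image_inter_preimage, inter_eq_right.2 hab]
    exact ordConnected_Ioo

/-- Unit speed coordinates which agree on the intersection of their domains can be glued. -/
theorem IsRegularCoord.union (h : IsRegularCoord n G U r) (h' : IsRegularCoord n G V s)
    (heq : ∀ x ∈ U, x ∈ V → r x = s x) (hne : (U ∩ V).Nonempty)
    (hsep : ∀ x ∈ U, ∀ y ∈ V, r x = s y → y ∈ U) :
    ∃ q : N → ℝ, IsRegularCoord n G (U ∪ V) q ∧ ∀ x ∈ U, q x = r x := by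
  classical
  let q : N → ℝ := U.piecewise r s
  have hqU : ∀ x ∈ U, q x = r x := fun x hx ↦ piecewise_eq_of_mem U r s hx
  have hqV : ∀ x ∈ V, q x = s x := by
    intro x hx
    by_cases hxU : x ∈ U
    · rw [hqU x hxU, heq x hxU hx]
    · exact piecewise_eq_of_notMem U r s hxU
  have hq : ∀ x ∈ U ∪ V, ∃ W t, IsRegularCoord n G W t ∧ x ∈ W ∧ q =ᶠ[𝓝 x] t := by
    rintro x (hx | hx)
    · exact ⟨U, r, h, hx, by filter_upwards [h.isOpen.mem_nhds hx] with y hy using hqU y hy⟩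
    · exact ⟨V, s, h', hx, by filter_upwards [h'.isOpen.mem_nhds hx] with y hy using hqV y hy⟩
  refine ⟨q, ⟨h.isOpen.union h'.isOpen, ?_, fun x hx ↦ ?_, fun x hx ↦ ?_, ?_, ?_⟩, hqU⟩
  · rintro g x (hx | hx)
    · exact Or.inl (h.smul_mem g x hx)
    · exact Or.inr (h'.smul_mem g x hx)
  · obtain ⟨W, t, ht, hxW, he⟩ := hq x hx
    exact ((ht.contMDiffAt hxW).congr_of_eventuallyEq he).contMDiffWithinAt
  · obtain ⟨W, t, ht, hxW, he⟩ := hq x hx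
    rw [gradientField_congr he, ht.norm_gradient x hxW]
  · have hUV : ∀ x ∈ U, ∀ y ∈ V, q y = q x ↔ y ∈ orbit G x := by
      intro x hx y hy
      constructor
      · intro he
        have hyU := hsep x hx y hy (by rw [← hqU x hx, ← hqV y hy, he])
        rwa [hqU y hyU, hqU x hx, h.levelSets x hx y hyU] at he
      · intro he
        have hyU := h.mem_of_mem_orbit hx he
        rwa [hqU y hyU, hqU x hx, h.levelSets x hx y hyU]
    rintro x (hx | hx) y (hy | hy)
    · rw [hqU x hx, hqU y hy, h.levelSets x hx y hy]
    · exact hUV x hx y hy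
    · rw [eq_comm, hUV y hy x hx, orbit_eq_iff.symm, orbit_eq_iff.symm, eq_comm]
    · rw [hqV x hx, hqV y hy, h'.levelSets x hx y hy]
  · obtain ⟨x, hxU, hxV⟩ := hne
    rw [image_union, image_congr hqU, image_congr hqV]
    exact (IsPreconnected.union (r x) (mem_image_of_mem r hxU)
      (show r x ∈ s '' V from ⟨x, hxV, (heq x hxU hxV).symm⟩) h.ordConnected.isPreconnected
      h'.ordConnected.isPreconnected).ordConnected

/-- Among the unit speed coordinates with domain in `A` there are maximal ones. -/
theorem IsRegularCoord.exists_maximal (h : IsRegularCoord n G U r) (hU : U.Nonempty) {A : Set N}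
    (hA : U ⊆ A) : ∃ Ω q, IsRegularCoord n G Ω q ∧ Ω ⊆ A ∧ Ω.Nonempty ∧
      ∀ Ω' q', IsRegularCoord n G Ω' q' → Ω' ⊆ A → Ω ⊆ Ω' → (∀ x ∈ Ω, q' x = q x) → Ω' ⊆ Ω := by
  let T := {c : Set N × (N → ℝ) // IsRegularCoord n G c.1 c.2 ∧ c.1 ⊆ A ∧ c.1.Nonempty}
  let R : T → T → Prop := fun a b ↦ a.1.1 ⊆ b.1.1 ∧ ∀ x ∈ a.1.1, b.1.2 x = a.1.2 x
  suffices hM : ∃ M : T, ∀ a, R M a → R a M by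
    obtain ⟨M, hM⟩ := hM
    refine ⟨M.1.1, M.1.2, M.2.1, M.2.2.1, M.2.2.2, fun Ω' q' h' hA' hΩ hq ↦ ?_⟩
    exact (hM ⟨(Ω', q'), h', hA', M.2.2.2.mono hΩ⟩ ⟨hΩ, hq⟩).1
  refine exists_maximal_of_chains_bounded ?_ fun {a b d} (h1 : R a b) (h2 : R b d) ↦
    ⟨h1.1.trans h2.1, fun x hx ↦ (h2.2 x (h1.1 hx)).trans (h1.2 x hx)⟩
  · intro c hc
    rcases c.eq_empty_or_nonempty with rfl | ⟨a₀, ha₀⟩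
    · exact ⟨⟨(U, r), h, hA, hU⟩, by simp⟩
    have hcon : ∀ a ∈ c, ∀ b ∈ c, ∃ d ∈ c, R a d ∧ R b d := by
      intro a ha b hb
      rcases eq_or_ne a b with rfl | hne
      · exact ⟨a, ha, ⟨subset_rfl, fun _ _ ↦ rfl⟩, subset_rfl, fun _ _ ↦ rfl⟩
      · rcases hc ha hb hne with h1 | h1
        · exact ⟨b, hb, h1, subset_rfl, fun _ _ ↦ rfl⟩
        · exact ⟨a, ha, ⟨subset_rfl, fun _ _ ↦ rfl⟩, h1⟩
    let Ω : Set N := ⋃ a ∈ c, a.1.1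
    have hΩ : ∀ x ∈ Ω, ∃ a ∈ c, x ∈ a.1.1 := by simp [Ω]
    have : Nonempty T := ⟨a₀⟩
    choose! j hjc hj using hΩ
    let q : N → ℝ := fun x ↦ (j x).1.2 x
    have hsub : ∀ a ∈ c, a.1.1 ⊆ Ω := fun a ha ↦ subset_biUnion_of_mem (u := fun a : T ↦ a.1.1) ha
    have hq : ∀ a ∈ c, ∀ x ∈ a.1.1, q x = a.1.2 x := by
      intro a ha x hx
      have hxΩ := hsub a ha hx
      obtain ⟨d, -, h1, h2⟩ := hcon a ha _ (hjc x hxΩ)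
      exact (h2.2 x (hj x hxΩ)).symm.trans (h1.2 x hx)
    have hboth : ∀ x ∈ Ω, ∀ y ∈ Ω, ∃ a ∈ c, x ∈ a.1.1 ∧ y ∈ a.1.1 := by
      intro x hx y hy
      obtain ⟨d, hd, h1, h2⟩ := hcon _ (hjc x hx) _ (hjc y hy)
      exact ⟨d, hd, h1.1 (hj x hx), h2.1 (hj y hy)⟩
    have hev : ∀ a ∈ c, ∀ x ∈ a.1.1, q =ᶠ[𝓝 x] a.1.2 := fun a ha x hx ↦ by
      filter_upwards [a.2.1.isOpen.mem_nhds hx] with y hy using hq a ha y hy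
    refine ⟨⟨(Ω, q), ⟨isOpen_biUnion fun a _ ↦ a.2.1.isOpen, ?_, fun x hx ↦ ?_, fun x hx ↦ ?_,
      fun x hx y hy ↦ ?_, ⟨?_⟩⟩, iUnion₂_subset fun a _ ↦ a.2.2.1, a₀.2.2.2.mono (hsub a₀ ha₀)⟩,
      fun a ha ↦ ⟨hsub a ha, hq a ha⟩⟩
    · intro g x hx
      exact hsub _ (hjc x hx) ((j x).2.1.smul_mem g x (hj x hx))
    · exact (((j x).2.1.contMDiffAt (hj x hx)).congr_of_eventuallyEq
        (hev _ (hjc x hx) x (hj x hx))).contMDiffWithinAt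
    · change ‖gradientField n q x‖ ^ 2 = 1
      rw [gradientField_congr (hev _ (hjc x hx) x (hj x hx)),
        (j x).2.1.norm_gradient x (hj x hx)]
    · obtain ⟨a, ha, hxa, hya⟩ := hboth x hx y hy
      change q y = q x ↔ _
      rw [hq a ha x hxa, hq a ha y hya, a.2.1.levelSets x hxa y hya]
    · rintro _ ⟨x, hx, rfl⟩ _ ⟨y, hy, rfl⟩ t ht
      obtain ⟨a, ha, hxa, hya⟩ := hboth x hx y hy
      change t ∈ Icc (q x) (q y) at ht
      rw [hq a ha x hxa, hq a ha y hya] at ht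
      obtain ⟨z, hz, rfl⟩ := a.2.1.ordConnected.out (mem_image_of_mem _ hxa)
        (mem_image_of_mem _ hya) ht
      exact ⟨z, hsub a ha hz, hq a ha z hz⟩

variable [IsManifold (𝓡 n) ∞ N]

theorem IsRegularCoord.mem_closure_right (h : IsRegularCoord n G U r) {x : N} (hx : x ∈ U) {δ : ℝ}
    (hδ : 0 < δ) : x ∈ closure (U ∩ r ⁻¹' Ioo (r x) (r x + δ)) := by
  refine mem_closure_iff_nhds.2 fun O hO ↦ ?_
  have h1 := (h.contMDiffAt hx).continuousAt.eventually_mem (Iio_mem_nhds (show r x < r x + δ by linarith))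
  obtain ⟨y, ⟨hyO, hyU, hy⟩, hxy⟩ := (h.exists_lt_and_gt hx h.isOpen hx h.contMDiffOn.continuousOn
    (fun y hy z hz he ↦ (h.levelSets z hz y hy).1 he)
    (inter_mem hO (inter_mem (h.isOpen.mem_nhds hx) h1))).2
  exact ⟨y, hyO, hyU, hxy, hy⟩

theorem IsRegularCoord.exists_Ioo (h : IsRegularCoord n G U r) {x : N} (hx : x ∈ U) {A : Set N}
    (hA : A ∈ 𝓝 x) (hAG : ∀ (g : G), ∀ y ∈ A, g • y ∈ A) :
    ∃ δ > 0, Ioo (r x - δ) (r x + δ) ⊆ r '' U ∧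
      ∀ y ∈ U, r y ∈ Ioo (r x - δ) (r x + δ) → y ∈ A := by
  obtain ⟨c, h1, h2, h3⟩ := h.exists_section hx
  have h4 := h1.continuousAt.eventually_mem (h2.symm ▸ hA)
  obtain ⟨δ, hδ, hb⟩ := Metric.eventually_nhds_iff_ball.1 (h3.and h4)
  rw [Real.ball_eq_Ioo] at hb
  refine ⟨δ, hδ, fun t ht ↦ ⟨c t, (hb t ht).1.2⟩, fun y hy hyt ↦ ?_⟩
  obtain ⟨⟨-, h5, h6⟩, h7⟩ := hb _ hyt
  obtain ⟨g, hg⟩ := (h.levelSets _ h5 y hy).1 h6.symm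
  exact hg ▸ hAG g _ h7

variable [TopologicalSpace G] [CompactSpace G] [ContinuousSMul G N] [T2Space N]

theorem IsRegularCoord.notMem_image_of_tendsto (h : IsRegularCoord n G U r) {F : Filter N} [F.NeBot]
    {z : N} (hF : F ≤ 𝓝 z) (hU : U ∈ F) (hz : z ∉ U) {t : ℝ} (hr : Tendsto r F (𝓝 t)) :
    t ∉ r '' U := by
  rintro ⟨x, hx, rfl⟩
  exact hz (h.mem_of_mem_orbit hx (h.mem_orbit_of_tendsto hF hU hx hr))

/-- The value approached at a boundary point of the domain is not attained. -/
theorem IsRegularCoord.notMem_image_of_collar (h : IsRegularCoord n G U r)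
    (h' : IsRegularCoord n G V s) {p : N} (hpV : p ∈ V) (hpU : p ∉ U) {δ σ c : ℝ} (hδ : 0 < δ)
    (hR : ∀ y ∈ V, s y ∈ Ioo (s p) (s p + δ) → y ∈ U ∧ r y = σ * s y + c) :
    σ * s p + c ∉ r '' U := by
  have := mem_closure_iff_nhdsWithin_neBot.1 (h'.mem_closure_right hpV hδ)
  have hself := self_mem_nhdsWithin (a := p) (s := V ∩ s ⁻¹' Ioo (s p) (s p + δ))
  refine h.notMem_image_of_tendsto nhdsWithin_le_nhds
    (Filter.mem_of_superset hself fun y hy ↦ (hR y hy.1 hy.2).1) hpU ?_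
  have h1 : Tendsto (fun y ↦ σ * s y + c) (𝓝[V ∩ s ⁻¹' Ioo (s p) (s p + δ)] p)
      (𝓝 (σ * s p + c)) :=
    (((h'.contMDiffAt hpV).continuousAt.tendsto.const_mul σ).add_const c).mono_left
      nhdsWithin_le_nhds
  refine h1.congr' ?_
  filter_upwards [hself] with y hy using (hR y hy.1 hy.2).2.symm

/-- A unit speed coordinate can be continued across a boundary point of its domain at which only one
side belongs to the domain. -/
theorem IsRegularCoord.exists_extension (h : IsRegularCoord n G U r) (h' : IsRegularCoord n G V s)
    {p : N} (hpV : p ∈ V) (hpU : p ∉ U) {δ : ℝ} (hδ : 0 < δ)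
    (hI : Ioo (s p - δ) (s p + δ) ⊆ s '' V)
    (hR : ∀ y ∈ V, s y ∈ Ioo (s p) (s p + δ) → y ∈ U)
    (hL : ∀ y ∈ V, s y ∈ Ioo (s p - δ) (s p) → y ∉ U) :
    ∃ q, IsRegularCoord n G (U ∪ V ∩ s ⁻¹' Ioo (s p - δ) (s p + δ)) q ∧ ∀ x ∈ U, q x = r x := by
  have hIR : Ioo (s p) (s p + δ) ⊆ s '' V :=
    (Ioo_subset_Ioo_left (by linarith)).trans hI
  obtain ⟨σ, c, hσ, hσc⟩ := h.exists_transition h' hIR hR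
  have hnot := h.notMem_image_of_collar h' hpV hpU hδ fun y hy hy' ↦ ⟨hR y hy hy', hσc y hy hy'⟩
  have hne : ∀ y ∈ V, y ∈ U → s y ≠ s p := fun y hy hyU he ↦
    hpU (h.mem_of_mem_orbit hyU ((h'.levelSets y hy p hpV).1 he.symm))
  refine h.union ((h'.restrict hI).affine hσ c) ?_ ?_ ?_
  · rintro x hxU ⟨hxV, hx⟩
    refine hσc x hxV ⟨?_, hx.2⟩
    by_contra! hle
    exact hL x hxV ⟨hx.1, lt_of_le_of_ne hle (hne x hxV hxU)⟩ hxU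
  · obtain ⟨y, hy, hys⟩ := hIR ⟨by linarith, by linarith⟩ (a := s p + δ / 2)
    have hy' : s y ∈ Ioo (s p) (s p + δ) := by rw [hys]; constructor <;> linarith
    exact ⟨y, hR y hy hy', hy, by linarith [hy'.1], hy'.2⟩
  · rintro x hxU y ⟨hyV, hy⟩ hxy
    by_contra hyU
    have hle : s y ≤ s p := by
      by_contra! hlt
      exact hyU (hR y hyV ⟨hlt, hy.2⟩)
    obtain ⟨z, hz, hzs⟩ := hIR ⟨by linarith, by linarith⟩ (a := s p + δ / 2)
    have hz' : s z ∈ Ioo (s p) (s p + δ) := by rw [hzs]; constructor <;> linarith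
    refine hnot (h.ordConnected.uIcc_subset (mem_image_of_mem r hxU)
      (mem_image_of_mem r (hR z hz hz')) ?_)
    rw [hxy, hσc z hz hz', mem_uIcc]
    rcases mul_self_eq_one_iff.1 ((sq σ).symm.trans hσ) with rfl | rfl
    · left; constructor <;> linarith [hz'.1]
    · right; constructor <;> linarith [hz'.1]

/-- The boundary points of the domain of a maximal unit speed coordinate lie in its interior in the
orbit space, unless they are not in the domain of any unit speed coordinate. -/
theorem IsRegularCoord.exists_two_sided (h : IsRegularCoord n G U r) {A : Set N} (hA : IsOpen A)
    (hAG : ∀ (g : G), ∀ x ∈ A, g • x ∈ A) (hUA : U ⊆ A)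
    (hmax : ∀ U' r', IsRegularCoord n G U' r' → U' ⊆ A → U ⊆ U' → (∀ x ∈ U, r' x = r x) → U' ⊆ U)
    (h' : IsRegularCoord n G V s) {p : N} (hpV : p ∈ V) (hpA : p ∈ A) (hpU : p ∉ U)
    (hp : p ∈ closure U) : ∃ δ > 0, Ioo (s p - δ) (s p + δ) ⊆ s '' V ∧
      (∀ y ∈ V, s y ∈ Ioo (s p) (s p + δ) → y ∈ U) ∧
      ∀ y ∈ V, s y ∈ Ioo (s p - δ) (s p) → y ∈ U := by
  have hneg : IsRegularCoord n G V (fun x ↦ (-1) * s x + 0) := h'.affine (by norm_num) 0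
  obtain ⟨ε, hε, hεV, hεA⟩ := h'.exists_Ioo hpV (hA.mem_nhds hpA) hAG
  obtain ⟨δ₁, hδ₁, H₁⟩ := h.exists_collar h' hε ((Ioo_subset_Ioo_left (by linarith)).trans hεV)
  obtain ⟨δ₂, hδ₂, H₂⟩ := h.exists_collar hneg (t₀ := -1 * s p + 0) hε (by
    intro t ht
    obtain ⟨y, hy, hys⟩ := hεV (show -t ∈ _ by constructor <;> linarith [ht.1, ht.2])
    exact ⟨y, hy, by linarith⟩)
  let δ := min δ₁ δ₂
  have hδ : 0 < δ := lt_min hδ₁.1 hδ₂.1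
  have h1 : δ ≤ δ₁ := min_le_left _ _
  have h2 : δ ≤ δ₂ := min_le_right _ _
  have hδε : δ ≤ ε := h1.trans hδ₁.2
  have hδV : Ioo (s p - δ) (s p + δ) ⊆ s '' V :=
    (Ioo_subset_Ioo (by linarith) (by linarith)).trans hεV
  have hcontra : ∀ q, IsRegularCoord n G (U ∪ V ∩ s ⁻¹' Ioo (s p - δ) (s p + δ)) q →
      (∀ x ∈ U, q x = r x) → False := by
    intro q hq hqr
    refine hpU (hmax _ q hq (union_subset hUA ?_) subset_union_left hqr
      (Or.inr ⟨hpV, ?_, ?_⟩))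
    · rintro y ⟨hyV, hy⟩
      exact hεA y hyV ⟨by linarith [hy.1], by linarith [hy.2]⟩
    · linarith
    · linarith
  rcases H₁ with H₁ | H₁ <;> rcases H₂ with H₂ | H₂
  · exact ⟨δ, hδ, hδV, fun y hy hys ↦ H₁ y hy ⟨hys.1, by linarith [hys.2]⟩,
      fun y hy hys ↦ H₂ y hy ⟨by linarith [hys.2], by linarith [hys.1]⟩⟩
  · obtain ⟨q, hq, hqr⟩ := h.exists_extension h' hpV hpU hδ hδV
      (fun y hy hys ↦ H₁ y hy ⟨hys.1, by linarith [hys.2]⟩)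
      (fun y hy hys ↦ H₂ y hy ⟨by linarith [hys.2], by linarith [hys.1]⟩)
    exact (hcontra q hq hqr).elim
  · obtain ⟨q, hq, hqr⟩ := h.exists_extension hneg hpV hpU hδ (by
      intro t ht
      obtain ⟨y, hy, hys⟩ := hδV (show -t ∈ _ by constructor <;> linarith [ht.1, ht.2])
      exact ⟨y, hy, by linarith⟩)
      (fun y hy hys ↦ H₂ y hy ⟨hys.1, by linarith [hys.2]⟩)
      (fun y hy hys ↦ H₁ y hy ⟨by linarith [hys.2], by linarith [hys.1]⟩)
    refine (hcontra q ?_ hqr).elim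
    have he : s ⁻¹' Ioo (s p - δ) (s p + δ) =
        (fun x ↦ -1 * s x + 0) ⁻¹' Ioo (-1 * s p + 0 - δ) (-1 * s p + 0 + δ) := by
      ext t
      constructor <;> rintro ⟨h3, h4⟩ <;> constructor <;> linarith
    rwa [he]
  · exfalso
    have h3 := (h'.contMDiffAt hpV).continuousAt.eventually_mem
      (Ioo_mem_nhds (show s p - δ < s p by linarith) (show s p < s p + δ by linarith))
    obtain ⟨y, ⟨hyV, hy⟩, hyU⟩ := mem_closure_iff_nhds.1 hp _
      (inter_mem (h'.isOpen.mem_nhds hpV) h3)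
    rcases lt_trichotomy (s y) (s p) with h4 | h4 | h4
    · exact H₂ y hyV ⟨by linarith, by linarith [hy.1]⟩ hyU
    · exact hpU (h.mem_of_mem_orbit hyU ((h'.levelSets y hyV p hpV).1 h4.symm))
    · exact H₁ y hyV ⟨h4, by linarith [hy.2]⟩ hyU

end Gluing

section OrbitSpace

variable {G : Type*} [Group G] {N : Type*} [MulAction G N]

theorem quotientMk_eq_iff {x y : N} : Quotient.mk (orbitRel G N) x =
    Quotient.mk (orbitRel G N) y ↔ x ∈ orbit G y :=
  Quotient.eq

theorem quotientMk_mem_image_iff {A : Set N} (hA : ∀ (g : G), ∀ x ∈ A, g • x ∈ A) {x : N} :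
    Quotient.mk (orbitRel G N) x ∈ Quotient.mk (orbitRel G N) '' A ↔ x ∈ A := by
  constructor
  · rintro ⟨y, hy, he⟩
    obtain ⟨g, rfl⟩ := quotientMk_eq_iff.1 he.symm
    exact hA g y hy
  · exact mem_image_of_mem _

variable [TopologicalSpace N] [TopologicalSpace G] [CompactSpace G] [ContinuousSMul G N] [T2Space N]

variable (G) in
theorem isClosed_orbit_of_compactSpace (p : N) : IsClosed (orbit G p) :=
  (isClosed_orbitRel G).preimage (f := fun y : N ↦ (y, p)) (by fun_prop)

variable (G N) in
theorem t2Space_orbitRel_quotient : T2Space (orbitRel.Quotient G N) := by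
  refine (t2Space_iff_of_isOpenQuotientMap isOpenQuotientMap_quotientMk).2 ?_
  convert! isClosed_orbitRel G (N := N) using 1
  ext q
  exact quotientMk_eq_iff

theorem isPreconnected_compl_singleton_circle (z : Circle) : IsPreconnected ({z}ᶜ : Set Circle) := by
  have : Fact (0 < (1 : ℝ)) := ⟨one_pos⟩
  let e := AddCircle.homeomorphCircle (one_ne_zero (α := ℝ))
  obtain ⟨a, ha⟩ := QuotientAddGroup.mk_surjective (e.symm z)
  have h1 := (AddCircle.openPartialHomeomorphCoe (1 : ℝ) a).image_source_eq_target
  rw [AddCircle.openPartialHomeomorphCoe_source, AddCircle.openPartialHomeomorphCoe_target] at h1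
  have h2 : IsPreconnected ({(a : AddCircle (1 : ℝ))}ᶜ : Set (AddCircle (1 : ℝ))) := by
    rw [← h1]
    refine isPreconnected_Ioo.image _ ?_
    rw [← AddCircle.openPartialHomeomorphCoe_source (1 : ℝ) a]
    exact (AddCircle.openPartialHomeomorphCoe (1 : ℝ) a).continuousOn
  have h3 : e '' {(a : AddCircle (1 : ℝ))}ᶜ = {z}ᶜ := by
    rw [image_compl_eq e.bijective, image_singleton]
    congr 2
    exact (congrArg e ha).trans (e.apply_symm_apply z)
  rw [← h3]
  exact h2.image _ e.continuous.continuousOn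

omit [CompactSpace G] [T2Space N] in
/-- If the orbit space is a circle, the complement of an orbit is connected in it. -/
theorem eq_compl_orbit_of_isClosed
    (e : orbitRel.Quotient G N ≃ₜ Circle) {A : Set N} {x : N} (hA : IsOpen A)
    (hAG : ∀ (g : G), ∀ x ∈ A, g • x ∈ A) (hne : A.Nonempty) (hx : x ∉ A)
    (hcl : IsClosed (A ∪ orbit G x)) : A = (orbit G x)ᶜ := by
  let q := Quotient.mk (orbitRel G N)
  have hq : IsOpenQuotientMap q := isOpenQuotientMap_quotientMk
  have h1 : IsPreconnected ({q x}ᶜ : Set (orbitRel.Quotient G N)) := by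
    have h2 : e.symm '' {e (q x)}ᶜ = {q x}ᶜ := by
      rw [image_compl_eq e.symm.bijective, image_singleton, e.symm_apply_apply]
    rw [← h2]
    exact (isPreconnected_compl_singleton_circle _).image _ e.symm.continuous.continuousOn
  have hxA : A ⊆ (orbit G x)ᶜ := by
    rintro y hy ⟨g, rfl⟩
    exact hx (by simpa using hAG g⁻¹ _ hy)
  have hmem : ∀ y, q y ∈ q '' A ↔ y ∈ A := fun y ↦ quotientMk_mem_image_iff hAG
  have h3 : IsClosed (q '' A ∪ {q x}) := by
    rw [← hq.isQuotientMap.isClosed_preimage]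
    convert! hcl using 1
    ext y
    rw [mem_preimage, mem_union, hmem, mem_singleton_iff, mem_union]
    exact or_congr_right quotientMk_eq_iff
  have h4 := h1.subset_of_closure_inter_subset (hq.isOpenMap A hA) (by
    obtain ⟨y, hy⟩ := hne
    exact ⟨q y, fun he ↦ hxA hy (quotientMk_eq_iff.1 he), y, hy, rfl⟩) (by
    rintro y ⟨hy, hyx⟩
    rcases closure_minimal subset_union_left h3 hy with h5 | h5
    · exact h5
    · exact absurd h5 hyx)
  refine hxA.antisymm fun y hy ↦ (hmem y).1 (h4 fun he ↦ hy (quotientMk_eq_iff.1 he))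

end OrbitSpace

section CircleCase

variable {n : ℕ} {G : Type*} [Group G] {N : Type*} [TopologicalSpace N]
  [ChartedSpace (EuclideanSpace ℝ (Fin n)) N] [MulAction G N]
  [RiemannianBundle (fun x : N ↦ TangentSpace (𝓡 n) x)] {U V : Set N} {r s : N → ℝ}
  [IsManifold (𝓡 n) ∞ N]

/-- The inverse of a unit speed coordinate, as a continuous curve in the orbit space. -/
theorem IsRegularCoord.exists_inverse (h : IsRegularCoord n G U r) (hU : U.Nonempty) :
    ∃ j : ℝ → orbitRel.Quotient G N, ContinuousOn j (r '' U) ∧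
      ∀ x ∈ U, j (r x) = Quotient.mk (orbitRel G N) x := by
  have : Nonempty N := hU.nonempty
  have h0 : ∀ t ∈ r '' U, ∃ x ∈ U, r x = t := fun t ht ↦ ht
  choose! j hjU hj using h0
  have hq : ∀ x ∈ U, Quotient.mk (orbitRel G N) (j (r x)) = Quotient.mk _ x := by
    intro x hx
    have hm := mem_image_of_mem r hx
    exact quotientMk_eq_iff.2 ((h.levelSets x hx _ (hjU _ hm)).1 (hj _ hm))
  refine ⟨fun t ↦ Quotient.mk (orbitRel G N) (j t), ?_, hq⟩
  rintro _ ⟨x, hx, rfl⟩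
  obtain ⟨c, h1, h2, h3⟩ := h.exists_section hx
  have h4 : ContinuousAt (fun t ↦ Quotient.mk (orbitRel G N) (c t)) (r x) :=
    continuous_quot_mk.continuousAt.comp h1.continuousAt
  refine (h4.congr ?_).continuousWithinAt
  filter_upwards [h3] with t ht
  rw [← hq _ ht.2.1, ht.2.2]

variable [TopologicalSpace G] [CompactSpace G] [ContinuousSMul G N] [T2Space N] [ConnectedSpace N]

/-- If the domain of a unit speed coordinate contains both sides of an orbit in its boundary, it is
the complement of this orbit, and the orbit space is compact. -/
theorem IsRegularCoord.eq_compl_of_two_sided (h : IsRegularCoord n G U r)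
    (h' : IsRegularCoord n G V s) {p : N} (hpV : p ∈ V) (hpU : p ∉ U) {δ : ℝ} (hδ : 0 < δ)
    (hI : Ioo (s p - δ) (s p + δ) ⊆ s '' V)
    (hR : ∀ y ∈ V, s y ∈ Ioo (s p) (s p + δ) → y ∈ U)
    (hL : ∀ y ∈ V, s y ∈ Ioo (s p - δ) (s p) → y ∈ U) :
    CompactSpace (orbitRel.Quotient G N) ∧ U = (orbit G p)ᶜ ∧
      ∃ q a b, a < b ∧ IsRegularCoord n G U q ∧ q '' U = Ioo a b := by
  obtain ⟨σ₁, c₁, hσ₁, hr₁⟩ := h.exists_transition h' ((Ioo_subset_Ioo_left (by linarith)).trans hI) hR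
  have hq := h.affine hσ₁ (-(σ₁ * c₁))
  set q : N → ℝ := fun x ↦ σ₁ * r x + -(σ₁ * c₁) with hqdef
  have hqR : ∀ y ∈ V, s y ∈ Ioo (s p) (s p + δ) → q y = s y := by
    intro y hy hys
    simp only [hqdef, hr₁ y hy hys]
    linear_combination s y * hσ₁
  obtain ⟨σ, c, hσ, hqL⟩ := hq.exists_transition h' ((Ioo_subset_Ioo_right (by linarith)).trans hI) hL
  have hneg : IsRegularCoord n G V (fun x ↦ (-1) * s x + 0) := h'.affine (by norm_num) 0
  have ha := hq.notMem_image_of_collar h' (σ := 1) (c := 0) hpV hpU hδ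
    fun y hy hys ↦ ⟨hR y hy hys, by rw [hqR y hy hys]; ring⟩
  have hb := hq.notMem_image_of_collar hneg (σ := -σ) (c := c) hpV hpU hδ (by
    intro y hy hys
    have hys' : s y ∈ Ioo (s p - δ) (s p) := by constructor <;> linarith [hys.1, hys.2]
    exact ⟨hL y hy hys', by rw [hqL y hy hys']; ring⟩)
  have hRI : ∀ t ∈ Ioo (s p) (s p + δ), ∃ y ∈ U, y ∈ V ∧ s y = t ∧ q y = t := by
    intro t ht
    obtain ⟨y, hy, rfl⟩ := hI (show t ∈ _ from ⟨by linarith [ht.1], ht.2⟩)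
    exact ⟨y, hR y hy ht, hy, rfl, hqR y hy ht⟩
  have hLI : ∀ t ∈ Ioo (s p - δ) (s p), ∃ y ∈ U, y ∈ V ∧ s y = t ∧ q y = σ * t + c := by
    intro t ht
    obtain ⟨y, hy, rfl⟩ := hI (show t ∈ _ from ⟨ht.1, by linarith [ht.2]⟩)
    exact ⟨y, hL y hy ht, hy, rfl, hqL y hy ht⟩
  have hsame : ∀ y ∈ U, y ∈ V → ∀ z ∈ U, z ∈ V → q y = q z → s y = s z := fun y hy hyV z hz hzV he ↦
    (h'.levelSets z hzV y hyV).2 ((hq.levelSets z hz y hy).1 he)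
  have hlow : ∀ x ∈ U, s p < q x := by
    intro x hx
    by_contra! hle
    obtain ⟨y, hy, -, -, hqy⟩ := hRI (s p + δ / 2) ⟨by linarith, by linarith⟩
    refine ha (hq.ordConnected.out (mem_image_of_mem q hx) (mem_image_of_mem q hy) ⟨?_, ?_⟩) <;>
      linarith
  obtain rfl : σ = 1 := by
    rcases mul_self_eq_one_iff.1 ((sq σ).symm.trans hσ) with h1 | rfl
    · exact h1
    exfalso
    have hc : c = 2 * s p := by
      apply le_antisymm
      · by_contra! hlt
        let η := min (δ / 2) ((c - 2 * s p) / 2)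
        have hη : 0 < η := lt_min (by linarith) (by linarith)
        have hη1 : η ≤ δ / 2 := min_le_left _ _
        have hη2 : η ≤ (c - 2 * s p) / 2 := min_le_right _ _
        obtain ⟨y, hy, -, -, hqy⟩ := hRI (s p + η) ⟨by linarith, by linarith⟩
        obtain ⟨z, hz, -, -, hqz⟩ := hLI (s p - δ / 2) ⟨by linarith, by linarith⟩
        refine hb (hq.ordConnected.out (mem_image_of_mem q hy) (mem_image_of_mem q hz) ⟨?_, ?_⟩) <;>
          linarith
      · by_contra! hlt
        let η := min (δ / 2) ((2 * s p - c) / 2)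
        have hη : 0 < η := lt_min (by linarith) (by linarith)
        have hη1 : η ≤ δ / 2 := min_le_left _ _
        have hη2 : η ≤ (2 * s p - c) / 2 := min_le_right _ _
        obtain ⟨z, hz, -, -, hqz⟩ := hLI (s p - η) ⟨by linarith, by linarith⟩
        linarith [hlow z hz]
    obtain ⟨y, hy, hyV, hys, hqy⟩ := hRI (s p + δ / 2) ⟨by linarith, by linarith⟩
    obtain ⟨z, hz, hzV, hzs, hqz⟩ := hLI (s p - δ / 2) ⟨by linarith, by linarith⟩
    have := hsame y hy hyV z hz hzV (by rw [hqy, hqz, hc]; ring)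
    linarith
  have hupp : ∀ x ∈ U, q x < s p + c := by
    intro x hx
    by_contra! hle
    obtain ⟨z, hz, -, -, hqz⟩ := hLI (s p - δ / 2) ⟨by linarith, by linarith⟩
    refine hb (hq.ordConnected.out (mem_image_of_mem q hz) (mem_image_of_mem q hx) ⟨?_, ?_⟩) <;>
      linarith
  have himage : q '' U = Ioo (s p) (s p + c) := by
    apply Subset.antisymm
    · rintro _ ⟨x, hx, rfl⟩
      exact ⟨hlow x hx, hupp x hx⟩
    · intro t ht
      let η := min (δ / 2) (min (t - s p) (s p + c - t))
      have hη : 0 < η := lt_min (by linarith) (lt_min (by linarith [ht.1]) (by linarith [ht.2]))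
      have hη1 : η ≤ δ / 2 := min_le_left _ _
      have hη2 : η ≤ t - s p := (min_le_right _ _).trans (min_le_left _ _)
      have hη3 : η ≤ s p + c - t := (min_le_right _ _).trans (min_le_right _ _)
      obtain ⟨y, hy, -, -, hqy⟩ := hRI (s p + η) ⟨by linarith, by linarith⟩
      obtain ⟨z, hz, -, -, hqz⟩ := hLI (s p - η) ⟨by linarith, by linarith⟩
      refine hq.ordConnected.out (mem_image_of_mem q hy) (mem_image_of_mem q hz) ⟨?_, ?_⟩ <;>
        linarith
  let C := U ∩ q ⁻¹' Icc (s p + δ / 2) (s p + c - δ / 2)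
  let D := V ∩ s ⁻¹' Icc (s p - δ / 2) (s p + δ / 2)
  have hCI : Icc (s p + δ / 2) (s p + c - δ / 2) ⊆ q '' U := by
    rw [himage]
    intro t ht
    constructor <;> linarith [ht.1, ht.2]
  have hDI : Icc (s p - δ / 2) (s p + δ / 2) ⊆ s '' V := fun t ht ↦
    hI ⟨by linarith [ht.1], by linarith [ht.2]⟩
  have hUCD : ∀ x ∈ U, x ∈ C ∪ D := by
    intro x hx
    by_cases h1 : q x < s p + δ / 2
    · right
      obtain ⟨y, hy, hyV, hys, hqy⟩ := hRI (q x) ⟨hlow x hx, by linarith⟩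
      have h2 := (hq.levelSets y hy x hx).1 hqy.symm
      have h3 := h'.mem_of_mem_orbit hyV h2
      have h4 : s x = q x := ((h'.levelSets y hyV x h3).2 h2).trans hys
      exact ⟨h3, by constructor <;> linarith [hlow x hx]⟩
    · by_cases h5 : s p + c - δ / 2 < q x
      · right
        obtain ⟨y, hy, hyV, hys, hqy⟩ := hLI (q x - c) ⟨by linarith, by linarith [hupp x hx]⟩
        have h2 := (hq.levelSets y hy x hx).1 (by rw [hqy]; ring)
        have h3 := h'.mem_of_mem_orbit hyV h2
        have h4 : s x = q x - c := ((h'.levelSets y hyV x h3).2 h2).trans hys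
        exact ⟨h3, by constructor <;> linarith [hupp x hx]⟩
      · exact Or.inl ⟨hx, not_lt.1 h1, not_lt.1 h5⟩
  have hUp : ∀ x ∈ D, x ∈ U ∨ x ∈ orbit G p := by
    rintro x ⟨hx, hxs⟩
    rcases lt_trichotomy (s x) (s p) with h1 | h1 | h1
    · exact Or.inl (hL x hx ⟨by linarith [hxs.1], h1⟩)
    · exact Or.inr ((h'.levelSets p hpV x hx).1 h1)
    · exact Or.inl (hR x hx ⟨h1, by linarith [hxs.2]⟩)
  have hopen : IsOpen (U ∪ V ∩ s ⁻¹' Ioo (s p - δ / 2) (s p + δ / 2)) :=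
    hq.isOpen.union (h'.contMDiffOn.continuousOn.isOpen_inter_preimage h'.isOpen isOpen_Ioo)
  have hCD : C ∪ D = U ∪ V ∩ s ⁻¹' Ioo (s p - δ / 2) (s p + δ / 2) := by
    apply Subset.antisymm
    · rintro x (hx | hx)
      · exact Or.inl hx.1
      · rcases hUp x hx with h1 | h1
        · exact Or.inl h1
        · have h2 := (h'.levelSets p hpV x hx.1).2 h1
          exact Or.inr ⟨hx.1, by constructor <;> linarith⟩
    · rintro x (hx | hx)
      · exact hUCD x hx
      · exact Or.inr ⟨hx.1, Ioo_subset_Icc_self hx.2⟩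
  have huniv : C ∪ D = univ := by
    refine IsClopen.eq_univ ⟨(hq.isClosed_preimage_Icc hCI).union (h'.isClosed_preimage_Icc hDI),
      hCD ▸ hopen⟩ ⟨p, Or.inr ⟨hpV, ?_⟩⟩
    constructor <;> linarith
  have hpU' : ∀ x ∈ U, x ∉ orbit G p := by
    rintro x hx ⟨g, rfl⟩
    exact hpU (by simpa using hq.smul_mem g⁻¹ _ hx)
  have hcompl : U = (orbit G p)ᶜ := by
    refine Subset.antisymm hpU' fun x hx ↦ ?_
    rcases (huniv ▸ mem_univ x : x ∈ C ∪ D) with h1 | h1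
    · exact h1.1
    · exact (hUp x h1).resolve_right hx
  obtain ⟨y, hy, -⟩ := hRI (s p + δ / 2) ⟨by linarith, by linarith⟩
  refine ⟨?_, hcompl, q, s p, s p + c, (hlow y hy).trans (hupp y hy), hq, himage⟩
  obtain ⟨j, hjc, hj⟩ := hq.exists_inverse ⟨y, hy⟩
  obtain ⟨j', hjc', hj'⟩ := h'.exists_inverse ⟨p, hpV⟩
  refine ⟨?_⟩
  convert! (isCompact_Icc.image_of_continuousOn (hjc.mono hCI)).union
    (isCompact_Icc.image_of_continuousOn (hjc'.mono hDI))
  refine (eq_univ_of_forall fun z ↦ ?_).symm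
  obtain ⟨x, rfl⟩ := Quotient.mk_surjective z
  rcases (huniv ▸ mem_univ x : x ∈ C ∪ D) with h1 | h1
  · exact Or.inl ⟨q x, h1.2, hj x h1.1⟩
  · exact Or.inr ⟨s x, h1.2, hj' x h1.1⟩

omit [ConnectedSpace N] in
/-- If the complement of an orbit has a unit speed coordinate and the orbit space is compact, then
the orbit space is a circle. -/
theorem IsRegularCoord.nonempty_homeomorph_circle
    [CompactSpace (orbitRel.Quotient G N)] {p : N}
    (h : IsRegularCoord n G (orbit G p)ᶜ r) {a b : ℝ} (hab : a < b)
    (hI : r '' (orbit G p)ᶜ = Ioo a b) :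
    Nonempty (orbitRel.Quotient G N ≃ₜ Circle) := by
  have := t2Space_orbitRel_quotient G N
  have : Fact (0 < b - a) := ⟨sub_pos.2 hab⟩
  have hne : (orbit G p)ᶜ.Nonempty := by
    rw [← image_nonempty (f := r), hI]
    exact nonempty_Ioo.2 hab
  obtain ⟨j, hjc, hj⟩ := h.exists_inverse hne
  rw [hI] at hjc
  have hsurj : ∀ t ∈ Ioo a b, ∃ x ∉ orbit G p, r x = t := by
    intro t ht
    rw [← hI] at ht
    exact ht
  have h1 : Topology.IsOpenEmbedding (fun t : Ioo a b ↦ j t) := by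
    refine .of_continuous_injective_isOpenMap hjc.domRestrict ?_ ?_
    · rintro ⟨t, ht⟩ ⟨t', ht'⟩ he
      obtain ⟨x, hx, rfl⟩ := hsurj t ht
      obtain ⟨x', hx', rfl⟩ := hsurj t' ht'
      simp only [hj x hx, hj x' hx', quotientMk_eq_iff] at he
      exact Subtype.ext ((h.levelSets x' hx' x hx).2 he)
    · intro O hO
      obtain ⟨W, hW, rfl⟩ := isOpen_induced_iff.1 hO
      have h2 : (fun t : Ioo a b ↦ j t) '' (Subtype.val ⁻¹' W) =
          Quotient.mk (orbitRel G N) '' ((orbit G p)ᶜ ∩ r ⁻¹' W) := by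
        ext z
        constructor
        · rintro ⟨⟨t, ht⟩, htW, rfl⟩
          obtain ⟨x, hx, rfl⟩ := hsurj t ht
          exact ⟨x, ⟨hx, htW⟩, (hj x hx).symm⟩
        · rintro ⟨x, ⟨hx, hxW⟩, rfl⟩
          exact ⟨⟨r x, hI ▸ mem_image_of_mem r hx⟩, hxW, hj x hx⟩
      rw [h2]
      exact isOpenQuotientMap_quotientMk.isOpenMap _
        (h.contMDiffOn.continuousOn.isOpen_inter_preimage h.isOpen hW)
  have h3 : range (fun t : Ioo a b ↦ j t) = {Quotient.mk (orbitRel G N) p}ᶜ := by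
    ext z
    obtain ⟨x, rfl⟩ := Quotient.mk_surjective z
    rw [mem_compl_singleton_iff, ne_eq, quotientMk_eq_iff]
    constructor
    · rintro ⟨⟨t, ht⟩, he⟩
      obtain ⟨y, hy, rfl⟩ := hsurj t ht
      simp only [hj y hy, quotientMk_eq_iff] at he
      intro hx
      exact hy (orbit_eq_iff.2 hx ▸ he)
    · intro hx
      exact ⟨⟨r x, hI ▸ mem_image_of_mem r hx⟩, hj x hx⟩
  let E := AddCircle.openPartialHomeomorphCoe (b - a) a
  have hE : E.source = Ioo a b := by
    rw [AddCircle.openPartialHomeomorphCoe_source, add_sub_cancel]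
  have h4 := E.isOpenEmbedding_restrict
  have h5 : range (E.source.domRestrict E) = {(a : AddCircle (b - a))}ᶜ := by
    rw [range_domRestrict, E.image_source_eq_target, AddCircle.openPartialHomeomorphCoe_target]
  rw [hE] at h4 h5
  exact ⟨((OnePoint.equivOfIsEmbeddingOfRangeEq _ _ h1.isEmbedding h3).symm.trans
    (OnePoint.equivOfIsEmbeddingOfRangeEq _ _ h4.isEmbedding h5)).trans
    (AddCircle.homeomorphCircle (sub_pos.2 hab).ne')⟩

end CircleCase

section BoundaryCoordinates

variable {n : ℕ} {G : Type*} [Group G] {N : Type*} [TopologicalSpace N]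
  [ChartedSpace (EuclideanSpace ℝ (Fin n)) N] [MulAction G N]
  [RiemannianBundle (fun x : N ↦ TangentSpace (𝓡 n) x)] {p : N} {U W : Set N} {r u : N → ℝ} {ε : ℝ}

theorem IsBoundaryCoord.continuousAt (h : IsBoundaryCoord n G p W u ε) {x : N} (hx : x ∈ W) :
    ContinuousAt u x :=
  h.contMDiffOn.continuousOn.continuousAt (h.isOpen.mem_nhds hx)

theorem IsBoundaryCoord.eventually_lt (h : IsBoundaryCoord n G p W u ε) {η : ℝ} (hη : 0 < η) :
    ∀ᶠ y in 𝓝 p, y ∈ W ∧ u y < η := by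
  filter_upwards [h.isOpen.mem_nhds h.mem,
    (h.continuousAt h.mem).eventually_mem (Iio_mem_nhds (h.apply_base.symm ▸ hη))] with y h1 h2
  exact ⟨h1, h2⟩

theorem IsRegularCoord.notMem_of_isBoundaryCoord [IsManifold (𝓡 n) ∞ N]
    (h : IsRegularCoord n G U r) (hb : IsBoundaryCoord n G p W u ε) : p ∉ U := by
  intro hp
  obtain ⟨⟨y, hy, hlt⟩, -⟩ := h.exists_lt_and_gt hp hb.isOpen hb.mem hb.contMDiffOn.continuousOn
    (fun y hy z hz he ↦ (hb.levelSets z hz y hy).1 he) (hb.isOpen.mem_nhds hb.mem)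
  rw [hb.apply_base] at hlt
  exact hlt.not_ge (hb.nonneg hy)

variable [TopologicalSpace G] [CompactSpace G] [ContinuousSMul G N] [T2Space N] [ConnectedSpace N]

/-- The boundary coordinate is open at the boundary orbit. -/
theorem IsBoundaryCoord.exists_Ico_subset (h : IsBoundaryCoord n G p W u ε) {O : Set N}
    (hO : O ∈ 𝓝 p) : ∃ η > 0, Ico 0 η ⊆ u '' (O ∩ W) := by
  have := ChartedSpace.locallyConnectedSpace (EuclideanSpace ℝ (Fin n)) N
  obtain ⟨V, hV, hVc, hVO⟩ := locallyConnectedSpace_iff_connected_subsets.1 this p (O ∩ W)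
    (inter_mem hO (h.isOpen.mem_nhds h.mem))
  have h0 : (0 : ℝ) ∈ u '' V := ⟨p, mem_of_mem_nhds hV, h.apply_base⟩
  obtain ⟨y, hy, hy0⟩ : ∃ y ∈ V, u y ≠ 0 := by
    by_contra! hne
    have hsub : orbit G p ∈ 𝓝 p := Filter.mem_of_superset hV fun y hy ↦
      (h.mem_orbit_iff (hVO hy).2).2 (hne y hy)
    have hopen : IsOpen (orbit G p) := by
      rw [isOpen_iff_mem_nhds]
      rintro _ ⟨g, rfl⟩
      rw [← smul_orbit g p]
      exact (smul_mem_nhds_smul_iff g).2 hsub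
    have huniv := IsClopen.eq_univ ⟨isClosed_orbit_of_compactSpace G p, hopen⟩
      ⟨p, mem_orbit_self p⟩
    have hε := h.pos
    obtain ⟨x, hx, hxε⟩ := h.image.symm.subset (show ε ^ 2 / 2 ∈ Ico 0 (ε ^ 2) by
      constructor <;> nlinarith)
    have := (h.mem_orbit_iff hx).1 (huniv ▸ mem_univ x)
    nlinarith
  refine ⟨u y, lt_of_le_of_ne (h.nonneg (hVO hy).2) hy0.symm, fun t ht ↦ ?_⟩
  exact image_mono hVO ((hVc.image u (h.contMDiffOn.continuousOn.mono
    fun y hy ↦ (hVO hy).2)).ordConnected.out h0 (mem_image_of_mem u hy) ⟨ht.1, ht.2.le⟩)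

theorem IsBoundaryCoord.mem_closure_pos (h : IsBoundaryCoord n G p W u ε) {η : ℝ} (hη : 0 < η) :
    p ∈ closure (W ∩ {y | 0 < u y ∧ u y < η}) := by
  refine mem_closure_iff_nhds.2 fun O hO ↦ ?_
  obtain ⟨η', hη', hsub⟩ := h.exists_Ico_subset hO
  have h1 : min (η / 2) (η' / 2) ≤ η / 2 := min_le_left _ _
  have h2 : min (η / 2) (η' / 2) ≤ η' / 2 := min_le_right _ _
  have h3 : 0 < min (η / 2) (η' / 2) := lt_min (by linarith) (by linarith)
  obtain ⟨y, ⟨hyO, hyW⟩, hy⟩ := hsub ⟨h3.le, by linarith⟩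
  exact ⟨y, hyO, hyW, by rw [hy]; exact h3, by rw [hy]; linarith⟩

theorem IsBoundaryCoord.mem_orbit_of_tendsto (h : IsBoundaryCoord n G p W u ε) {F : Filter N}
    [F.NeBot] {z : N} (hF : F ≤ 𝓝 z) (hW : W ∈ F) (hu : Tendsto u F (𝓝 0)) :
    z ∈ orbit G p := by
  refine (isClosed_orbitRel G (N := N)).closure_subset (a := (z, p)) (mem_closure_iff_nhds.2 ?_)
  intro t ht
  rw [nhds_prod_eq] at ht
  obtain ⟨O₁, hO₁, O₂, hO₂, hsub⟩ := mem_prod_iff.1 ht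
  obtain ⟨η, hη, hη'⟩ := h.exists_Ico_subset hO₂
  obtain ⟨y, ⟨hy1, hyW⟩, hyη⟩ := (((show ∀ᶠ y in F, y ∈ O₁ from hF hO₁).and
    (show ∀ᶠ y in F, y ∈ W from hW)).and (hu.eventually_mem (Iio_mem_nhds hη))).exists
  obtain ⟨o, ⟨ho2, hoW⟩, ho⟩ := hη' ⟨h.nonneg hyW, hyη⟩
  exact ⟨(y, o), hsub ⟨hy1, ho2⟩, (h.levelSets o hoW y hyW).1 ho.symm⟩

variable [IsManifold (𝓡 n) ∞ N]

theorem IsBoundaryCoord.isClosed_sublevel (h : IsBoundaryCoord n G p W u ε) {η : ℝ}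
    (hη : η < ε ^ 2) : IsClosed (W ∩ {y | u y ≤ η}) := by
  refine isClosed_of_closure_subset fun z hz ↦ ?_
  have := mem_closure_iff_nhdsWithin_neBot.1 hz
  let F := Ultrafilter.of (𝓝[W ∩ {y | u y ≤ η}] z)
  have hF : (F : Filter N) ≤ 𝓝[W ∩ {y | u y ≤ η}] z := Ultrafilter.of_le _
  have hFz : (F : Filter N) ≤ 𝓝 z := hF.trans nhdsWithin_le_nhds
  have hS : W ∩ {y | u y ≤ η} ∈ (F : Filter N) := hF self_mem_nhdsWithin
  have hSW : W ∈ (F : Filter N) := Filter.mem_of_superset hS inter_subset_left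
  obtain ⟨t, ht, htF⟩ := (isCompact_Icc (a := (0 : ℝ)) (b := η)).ultrafilter_le_nhds (F.map u) (by
    rw [le_principal_iff, Ultrafilter.coe_map, Filter.mem_map]
    exact Filter.mem_of_superset hS fun y hy ↦ ⟨h.nonneg hy.1, hy.2⟩)
  rcases ht.1.eq_or_lt with rfl | h0
  · obtain ⟨g, rfl⟩ := h.mem_orbit_of_tendsto hFz hSW htF
    refine ⟨h.smul_mem g p h.mem, ?_⟩
    change u (g • p) ≤ η
    rw [h.levelSets.apply_smul h.smul_mem g h.mem, h.apply_base]
    exact ht.2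
  · obtain ⟨x, hx, hxt⟩ := h.image.symm.subset (show t ∈ Ico 0 (ε ^ 2) from
      ⟨ht.1, ht.2.trans_lt hη⟩)
    have htF' : Tendsto u F (𝓝 t) := htF
    obtain ⟨g, rfl⟩ := h.isRegularCoord.1.mem_orbit_of_tendsto (x := x) hFz
      (by filter_upwards [hSW, htF'.eventually_mem (Ioi_mem_nhds h0)] with y h1 h2 using ⟨h1, h2⟩)
      ⟨hx, show 0 < u x by rwa [hxt]⟩
      (by rw [hxt]; exact (Real.continuous_sqrt.tendsto t).comp htF')
    refine ⟨h.smul_mem g x hx, ?_⟩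
    change u (g • x) ≤ η
    rw [h.levelSets.apply_smul h.smul_mem g hx, hxt]
    exact ht.2

/-- An orbit space with boundary is not a circle. -/
theorem IsBoundaryCoord.false_of_homeomorph_circle (h : IsBoundaryCoord n G p W u ε)
    (e : orbitRel.Quotient G N ≃ₜ Circle) : False := by
  have hε := sq_pos_of_pos h.pos
  obtain ⟨x, hx, hxε⟩ := h.image.symm.subset (show ε ^ 2 / 3 ∈ Ico 0 (ε ^ 2) by
    constructor <;> linarith)
  obtain ⟨y, hy, hyε⟩ := h.image.symm.subset (show ε ^ 2 / 2 ∈ Ico 0 (ε ^ 2) by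
    constructor <;> linarith)
  have h1 := eq_compl_orbit_of_isClosed (x := x) (A := W ∩ u ⁻¹' Iio (ε ^ 2 / 3)) e
    (h.contMDiffOn.continuousOn.isOpen_inter_preimage h.isOpen isOpen_Iio) ?_
    ⟨p, h.mem, by simp only [mem_preimage, h.apply_base, mem_Iio]; linarith⟩
    (fun h2 ↦ h2.2.ne hxε) ?_
  · have h2 : y ∈ W ∩ u ⁻¹' Iio (ε ^ 2 / 3) := by
      rw [h1]
      intro h3
      have := (h.levelSets x hx y hy).2 h3
      linarith
    have h4 : u y < ε ^ 2 / 3 := h2.2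
    linarith
  · rintro g z ⟨hz, hzε⟩
    refine ⟨h.smul_mem g z hz, ?_⟩
    rwa [mem_preimage, h.levelSets.apply_smul h.smul_mem g hz]
  · convert! h.isClosed_sublevel (show ε ^ 2 / 3 < ε ^ 2 by linarith) using 1
    ext z
    constructor
    · rintro (⟨hz, hzε⟩ | ⟨g, rfl⟩)
      · exact ⟨hz, (show u z < ε ^ 2 / 3 from hzε).le⟩
      · refine ⟨h.smul_mem g x hx, ?_⟩
        change u (g • x) ≤ _
        rw [h.levelSets.apply_smul h.smul_mem g hx, hxε]
    · rintro ⟨hz, hzε⟩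
      rcases lt_or_eq_of_le (show u z ≤ ε ^ 2 / 3 from hzε) with h5 | h5
      · exact Or.inl ⟨hz, h5⟩
      · exact Or.inr ((h.levelSets x hx z hz).1 (by rw [h5, hxε]))

/-- Near a boundary orbit in the closure of its domain, a unit speed coordinate is the distance to
the orbit, up to an isometry of `ℝ`. -/
theorem IsRegularCoord.exists_boundary_collar (h : IsRegularCoord n G U r)
    (hb : IsBoundaryCoord n G p W u ε) (hp : p ∈ closure U) :
    ∃ δ > 0, ∃ σ c : ℝ, σ ^ 2 = 1 ∧ c ∉ r '' U ∧ δ ≤ ε ∧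
      ∀ y ∈ W, 0 < u y → u y < δ ^ 2 → y ∈ U ∧ r y = σ * √(u y) + c := by
  have hpU := h.notMem_of_isBoundaryCoord hb
  obtain ⟨hs, hsI⟩ := hb.isRegularCoord
  obtain ⟨δ, ⟨hδ, hδε⟩, H⟩ := h.exists_collar hs (t₀ := 0) hb.pos (by rw [hsI, zero_add])
  rw [zero_add] at H
  have hmem : ∀ y ∈ W, 0 < u y → u y < δ ^ 2 → y ∈ W ∩ {x | 0 < u x} ∧ √(u y) ∈ Ioo 0 δ :=
    fun y hy h0 hyδ ↦ ⟨⟨hy, h0⟩, Real.sqrt_pos.2 h0, (Real.sqrt_lt' hδ).2 hyδ⟩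
  have hU : ∀ y ∈ W ∩ {x | 0 < u x}, √(u y) ∈ Ioo 0 δ → y ∈ U := by
    rcases H with H | H
    · exact H
    exfalso
    obtain ⟨y, ⟨hyW, hyδ⟩, hyU⟩ := mem_closure_iff_nhds.1 hp _ (hb.eventually_lt (sq_pos_of_pos hδ))
    rcases (hb.nonneg hyW).eq_or_lt with h0 | h0
    · obtain ⟨g, rfl⟩ := (hb.mem_orbit_iff hyW).2 h0.symm
      exact hpU (by simpa using h.smul_mem g⁻¹ _ hyU)
    · obtain ⟨h1, h2⟩ := hmem y hyW h0 hyδ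
      exact H y h1 h2 hyU
  obtain ⟨σ, c, hσ, hr⟩ := h.exists_transition hs (hsI ▸ Ioo_subset_Ioo_right hδε) hU
  have hall : ∀ y ∈ W, 0 < u y → u y < δ ^ 2 → y ∈ U ∧ r y = σ * √(u y) + c := by
    intro y hy h0 hyδ
    obtain ⟨h1, h2⟩ := hmem y hy h0 hyδ
    exact ⟨hU y h1 h2, hr y h1 h2⟩
  refine ⟨δ, hδ, σ, c, hσ, ?_, hδε, hall⟩
  have := mem_closure_iff_nhdsWithin_neBot.1 (hb.mem_closure_pos (sq_pos_of_pos hδ))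
  have hself := self_mem_nhdsWithin (a := p) (s := W ∩ {y | 0 < u y ∧ u y < δ ^ 2})
  refine h.notMem_image_of_tendsto (F := 𝓝[W ∩ {y | 0 < u y ∧ u y < δ ^ 2}] p)
    nhdsWithin_le_nhds (Filter.mem_of_superset hself fun y hy ↦ (hall y hy.1 hy.2.1 hy.2.2).1)
    hpU ?_
  have h1 : Tendsto (fun y ↦ σ * √(u y) + c) (𝓝 p) (𝓝 (σ * √(u p) + c)) :=
    (((hb.continuousAt hb.mem).tendsto.sqrt).const_mul σ).add_const c
  rw [hb.apply_base, Real.sqrt_zero, mul_zero, zero_add] at h1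
  refine (h1.mono_left nhdsWithin_le_nhds).congr' ?_
  filter_upwards [hself] with y hy using (hall y hy.1 hy.2.1 hy.2.2).2.symm

end BoundaryCoordinates

section Conjugacy

variable {G : Type*} [Group G] {N : Type*} [MulAction G N]

theorem exists_stabilizer_eq_trans {x y z : N}
    (h : ∃ g : G, stabilizer G (g • x) = stabilizer G y)
    (h' : ∃ g : G, stabilizer G (g • y) = stabilizer G z) :
    ∃ g : G, stabilizer G (g • x) = stabilizer G z := by
  obtain ⟨g, hg⟩ := h
  obtain ⟨g', hg'⟩ := h'
  refine ⟨g' * g, ?_⟩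
  rw [← hg', mul_smul, stabilizer_smul_eq_stabilizer_map_conj g' (g • x), hg,
    ← stabilizer_smul_eq_stabilizer_map_conj]

theorem exists_stabilizer_eq_symm {x y : N}
    (h : ∃ g : G, stabilizer G (g • x) = stabilizer G y) :
    ∃ g : G, stabilizer G (g • y) = stabilizer G x := by
  obtain ⟨g, hg⟩ := h
  refine ⟨g⁻¹, ?_⟩
  rw [stabilizer_smul_eq_stabilizer_map_conj, ← hg,
    ← stabilizer_smul_eq_stabilizer_map_conj, inv_smul_smul]

end Conjugacy

section GlobalCoordinates

variable {m n : ℕ} {G : Type*} [TopologicalSpace G] [ChartedSpace (EuclideanSpace ℝ (Fin m)) G]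
  [Group G] [LieGroup (𝓡 m) ∞ G] [CompactSpace G] {N : Type*} [TopologicalSpace N]
  [ChartedSpace (EuclideanSpace ℝ (Fin n)) N] [IsManifold (𝓡 n) ∞ N] [T2Space N]
  [ConnectedSpace N] [RiemannianBundle (fun x : N ↦ TangentSpace (𝓡 n) x)]
  [IsContMDiffRiemannianBundle (𝓡 n) ∞ (EuclideanSpace ℝ (Fin n))
    (fun x : N ↦ TangentSpace (𝓡 n) x)]
  [MulAction G N] [ContMDiffSMul (𝓡 m) (𝓡 n) ∞ G N] {U : Set N} {r : N → ℝ}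

/-- If the orbit space is not a circle, the orbits that are not on the boundary of the orbit space
have a global unit speed coordinate. -/
theorem exists_isRegularCoord_dense (hcoh : IsCohomogeneityOne m n G N)
    (hiso : ∀ g : G, PreservesMetric (n := n) (fun y : N ↦ g • y))
    (hQ : ¬ Nonempty (orbitRel.Quotient G N ≃ₜ Circle)) :
    ∃ (U : Set N) (r : N → ℝ), IsRegularCoord n G U r ∧ Dense U ∧
      ∀ p ∉ U, ¬ IsPrincipalPoint G p ∧ ∃ W u ε, IsBoundaryCoord n G p W u ε := by
  have : ContinuousSMul G N := ContMDiffSMul.continuousSMul (I := 𝓡 m) (I' := 𝓡 n) ∞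
  obtain ⟨U₀, r₀, h₀, hne₀⟩ : ∃ (U : Set N) (r : N → ℝ), IsRegularCoord n G U r ∧ U.Nonempty := by
    obtain ⟨p⟩ := (inferInstance : Nonempty N)
    rcases exists_coord hcoh hiso p with ⟨U, r, hp, h⟩ | ⟨-, U, u, ε, h⟩
    · exact ⟨U, r, h, p, hp⟩
    · refine ⟨_, _, h.isRegularCoord.1, ?_⟩
      rw [← image_nonempty (f := fun x ↦ √(u x)), h.isRegularCoord.2]
      exact nonempty_Ioo.2 h.pos
  obtain ⟨U, r, h, -, hne, hmax⟩ := h₀.exists_maximal hne₀ (subset_univ _)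
  have hbd : ∀ p ∈ closure U, p ∉ U → ¬ IsPrincipalPoint G p ∧ ∃ W u ε, IsBoundaryCoord n G p W u ε := by
    intro p hp hpU
    rcases exists_coord hcoh hiso p with ⟨V, s, hpV, h'⟩ | hb
    · obtain ⟨δ, hδ, hI, hR, hL⟩ := h.exists_two_sided isOpen_univ (fun _ _ _ ↦ mem_univ _)
        (subset_univ _) hmax h' hpV (mem_univ p) hpU hp
      obtain ⟨hc, hU, q, a, b, hab, hq, hqI⟩ := h.eq_compl_of_two_sided h' hpV hpU hδ hI hR hL
      subst hU
      exact absurd (hq.nonempty_homeomorph_circle hab hqI) hQ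
    · exact hb
  have hopen : IsOpen (closure U) := by
    rw [isOpen_iff_mem_nhds]
    intro p hp
    by_cases hpU : p ∈ U
    · exact Filter.mem_of_superset (h.isOpen.mem_nhds hpU) subset_closure
    obtain ⟨-, W, u, ε, hb⟩ := hbd p hp hpU
    obtain ⟨δ, hδ, σ, c, -, -, -, hall⟩ := h.exists_boundary_collar hb hp
    filter_upwards [hb.eventually_lt (sq_pos_of_pos hδ)] with y hy
    rcases (hb.nonneg hy.1).eq_or_lt with h0 | h0
    · exact hb.mem_closure (fun g ↦ continuous_const_smul g) hp h.smul_mem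
        ((hb.mem_orbit_iff hy.1).2 h0.symm)
    · exact subset_closure (hall y hy.1 h0 hy.2).1
  have hdense : closure U = univ := IsClopen.eq_univ ⟨isClosed_closure, hopen⟩ hne.closure
  exact ⟨U, r, h, dense_iff_closure_eq.2 hdense, fun p hp ↦ hbd p (hdense ▸ mem_univ p) hp⟩

/-- If the orbit space is a circle, the complement of every orbit has a unit speed coordinate. -/
theorem exists_isRegularCoord_compl_orbit (hcoh : IsCohomogeneityOne m n G N)
    (hiso : ∀ g : G, PreservesMetric (n := n) (fun y : N ↦ g • y))
    (e : orbitRel.Quotient G N ≃ₜ Circle) (x : N) :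
    (orbit G x)ᶜ.Nonempty ∧ ∃ r : N → ℝ, IsRegularCoord n G (orbit G x)ᶜ r := by
  have : ContinuousSMul G N := ContMDiffSMul.continuousSMul (I := 𝓡 m) (I' := 𝓡 n) ∞
  have hreg : ∀ p : N, ∃ V s, p ∈ V ∧ IsRegularCoord n G V s := by
    intro p
    rcases exists_coord hcoh hiso p with h | ⟨-, W, u, ε, hb⟩
    · exact h
    · exact (hb.false_of_homeomorph_circle e).elim
  have hA : IsOpen (orbit G x)ᶜ := (isClosed_orbit_of_compactSpace G x).isOpen_compl
  have hAG : ∀ (g : G), ∀ y ∈ (orbit G x)ᶜ, g • y ∈ (orbit G x)ᶜ :=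
    fun g y hy ⟨k, hk⟩ ↦ hy ⟨g⁻¹ * k, by
      change (g⁻¹ * k) • x = y
      change k • x = g • y at hk
      rw [mul_smul, hk, inv_smul_smul]⟩
  obtain ⟨y, hy⟩ : (orbit G x)ᶜ.Nonempty := by
    obtain ⟨z, hz⟩ : ∃ z, z ≠ e (Quotient.mk _ x) := by
      exact ⟨Circle.exp Real.pi * e (Quotient.mk _ x), fun h ↦
        Circle.exp_pi_ne_one (mul_eq_right.1 h)⟩
    obtain ⟨y, hy⟩ := Quotient.mk_surjective (e.symm z)
    refine ⟨y, fun h ↦ hz ?_⟩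
    rw [← quotientMk_eq_iff.2 h, hy, e.apply_symm_apply]
  refine ⟨⟨y, hy⟩, ?_⟩
  obtain ⟨V, s, hyV, hs⟩ := hreg y
  obtain ⟨δ, hδ, hI, hδA⟩ := hs.exists_Ioo hyV (hA.mem_nhds hy) hAG
  obtain ⟨U, r, h, hUA, hne, hmax⟩ := (hs.restrict hI).exists_maximal
    ⟨y, hyV, by constructor <;> linarith⟩ (A := (orbit G x)ᶜ) fun z hz ↦ hδA z hz.1 hz.2
  have hxU : ∀ z ∈ U, z ∉ orbit G x := hUA
  refine ⟨r, ?_⟩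
  rw [← eq_compl_orbit_of_isClosed e h.isOpen h.smul_mem hne
    (fun hx ↦ hxU x hx (mem_orbit_self x)) ?_]
  · exact h
  refine isClosed_of_closure_subset ?_
  rw [closure_union, (isClosed_orbit_of_compactSpace G x).closure_eq]
  refine union_subset (fun p hp ↦ ?_) subset_union_right
  by_contra hpn
  rw [mem_union, not_or] at hpn
  obtain ⟨W, t, hpW, ht⟩ := hreg p
  obtain ⟨η, hη, hI', hR, hL⟩ := h.exists_two_sided hA hAG hUA hmax ht hpW hpn.2 hpn.1 hp
  obtain ⟨-, hU, -⟩ := h.eq_compl_of_two_sided ht hpW hpn.1 hη hI' hR hL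
  refine hxU x ?_ (mem_orbit_self x)
  rw [hU]
  intro hx
  exact hpn.2 (mem_orbit_symm.1 hx)

omit [ConnectedSpace N] in
/-- The orbits in the dense domain of a unit speed coordinate are principal. -/
theorem IsRegularCoord.isPrincipalPoint (hG : ∀ g : G, ContMDiff (𝓡 n) (𝓡 n) ∞ (fun y : N ↦ g • y))
    [ContinuousSMul G N]
    (hiso : ∀ g : G, PreservesMetric (n := n) (fun y : N ↦ g • y)) (h : IsRegularCoord n G U r)
    (hU : Dense U) {x : N} (hx : x ∈ U) : IsPrincipalPoint G x := by
  have h1 : ∀ y ∈ U, ∃ g : G, stabilizer G (g • y) = stabilizer G x := by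
    intro y hy
    refine h.forall_of_isClopen
      (P := fun y ↦ ∃ g : G, stabilizer G (g • y) = stabilizer G x) ?_ ?_ ?_
      hx ⟨1, by rw [one_smul]⟩ hy
    · rintro g z - ⟨g', hg'⟩
      exact ⟨g' * g⁻¹, by rwa [mul_smul, inv_smul_smul]⟩
    · intro z hz hPz
      filter_upwards [h.eventually_conj hG hiso hz] with w hw
      exact exists_stabilizer_eq_trans hw hPz
    · intro z hz hPz
      filter_upwards [h.eventually_conj hG hiso hz] with w hw hPw
      exact hPz (exists_stabilizer_eq_trans (exists_stabilizer_eq_symm hw) hPw)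
  have h2 : IsClosed {y : N | ∃ g : G, ∀ k ∈ stabilizer G x, k • g • y = g • y} := by
    have h3 : IsClosed {q : G × N | ∀ k ∈ stabilizer G x, k • q.1 • q.2 = q.1 • q.2} := by
      simp only [ofPred_forall]
      exact isClosed_iInter fun k ↦ isClosed_iInter fun _ ↦ isClosed_eq (by fun_prop) (by fun_prop)
    convert! isClosedMap_snd_of_compactSpace _ h3 using 1
    ext y
    simp
  intro y
  obtain ⟨g, hg⟩ := (h2.closure_subset_iff.2 fun y hy ↦ by
    obtain ⟨g, hg⟩ := h1 y hy
    exact ⟨g, fun k hk ↦ by rwa [← hg] at hk⟩) (hU y)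
  exact ⟨g, fun k hk ↦ hg k hk⟩

end GlobalCoordinates

section Profiles

/-- A function `F` with positive derivative on the interval `I` which solves `F' ^ 2 = b (F)`, is a
smooth function of the squared distance to each end point of `I` in `E`, and has closed range. -/
structure IsProfile (I E : Set ℝ) (F b : ℝ → ℝ) : Prop where
  contDiff : ContDiff ℝ ∞ b
  contDiffAt : ∀ t ∈ I, ContDiffAt ℝ ∞ F t
  hasDerivAt : ∀ t ∈ I, ∃ d > 0, HasDerivAt F d t ∧ d ^ 2 = b (F t)
  zero : ∀ e ∈ E, b (F e) = 0
  even : ∀ e ∈ E, ∃ δ > 0, ∃ H : ℝ → ℝ, ContDiffOn ℝ ∞ H (Ico 0 δ) ∧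
    ∀ t, t ^ 2 < δ → F (e + t) = H (t ^ 2)
  isClosed : IsClosed (F '' (I ∪ E))

variable {I E : Set ℝ} {F b : ℝ → ℝ}

theorem IsProfile.affine (h : IsProfile I E F b) {σ κ : ℝ} (hσ : σ ^ 2 = 1) (hκ : 0 < σ * κ)
    (c : ℝ) : IsProfile ((fun t ↦ κ * t + c) ⁻¹' I) ((fun t ↦ κ * t + c) ⁻¹' E)
      (fun t ↦ σ * F (κ * t + c)) (fun y ↦ κ ^ 2 * b (σ * y)) := by
  have hσy : ∀ y, σ * (σ * y) = y := fun y ↦ by rw [← mul_assoc, ← sq, hσ, one_mul]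
  have hκ0 : κ ≠ 0 := by rintro rfl; simp at hκ
  have hκ2 : 0 < κ ^ 2 := by positivity
  have hcd : ContDiff ℝ ∞ (fun t : ℝ ↦ κ * t + c) := by fun_prop
  refine ⟨contDiff_const.mul (h.contDiff.comp (by fun_prop)), fun t ht ↦ ?_, fun t ht ↦ ?_,
    fun e he ↦ ?_, fun e he ↦ ?_, ?_⟩
  · exact contDiffAt_const.mul ((h.contDiffAt _ ht).comp t hcd.contDiffAt)
  · obtain ⟨d, hd, h1, h2⟩ := h.hasDerivAt _ ht
    refine ⟨σ * (d * κ), by nlinarith, ?_, ?_⟩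
    · have h3 : HasDerivAt (fun t ↦ κ * t + c) κ t := by
        simpa using ((hasDerivAt_id t).const_mul κ).add_const c
      exact (h1.comp t h3).const_mul σ
    · rw [hσy, ← h2]
      linear_combination d ^ 2 * κ ^ 2 * hσ
  · rw [hσy, h.zero _ he, mul_zero]
  · obtain ⟨δ, hδ, H, hH, hF⟩ := h.even _ he
    refine ⟨δ / κ ^ 2, div_pos hδ hκ2, fun x ↦ σ * H (κ ^ 2 * x),
      contDiffOn_const.mul (hH.comp (by fun_prop) fun x hx ↦ ⟨mul_nonneg hκ2.le hx.1, ?_⟩),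
      fun t ht ↦ ?_⟩
    · have := (lt_div_iff₀ hκ2).1 hx.2
      linarith
    · have h6 := hF (κ * t) (by rw [mul_pow, mul_comm]; exact (lt_div_iff₀ hκ2).1 ht)
      have h7 : κ * (e + t) + c = κ * e + c + κ * t := by ring
      rw [mul_pow] at h6
      rw [h7]
      exact congrArg (σ * ·) h6
  · have h7 : (fun t ↦ σ * F (κ * t + c)) '' ((fun t ↦ κ * t + c) ⁻¹' I ∪ (fun t ↦ κ * t + c) ⁻¹' E) =
        (fun y ↦ σ * y) ⁻¹' (F '' (I ∪ E)) := by
      ext y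
      constructor
      · rintro ⟨t, ht, rfl⟩
        exact ⟨_, ht, (hσy _).symm⟩
      · rintro ⟨t, ht, hty⟩
        have h8 : κ * ((t - c) / κ) + c = t := by field_simp; ring
        refine ⟨(t - c) / κ, ?_, ?_⟩
        · change κ * ((t - c) / κ) + c ∈ I ∪ E
          rwa [h8]
        · simp only [h8]
          rw [hty, hσy]
    rw [h7]
    exact h.isClosed.preimage (by fun_prop)

theorem IsProfile.exists_affine (h : IsProfile I E F b) {σ κ : ℝ} (hσ : σ ^ 2 = 1) (hκ : 0 < σ * κ)
    (c : ℝ) {I' E' : Set ℝ} (hI : ∀ t, t ∈ I' ↔ κ * t + c ∈ I) (hE : ∀ t, t ∈ E' ↔ κ * t + c ∈ E) :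
    ∃ F b, IsProfile I' E' F b := by
  obtain rfl : I' = (fun t ↦ κ * t + c) ⁻¹' I := ext hI
  obtain rfl : E' = (fun t ↦ κ * t + c) ⁻¹' E := ext hE
  exact ⟨_, _, h.affine hσ hκ c⟩

theorem isProfile_id : IsProfile univ ∅ (fun t ↦ t) (fun _ ↦ 1) :=
  ⟨contDiff_const, fun t _ ↦ contDiffAt_id, fun t _ ↦ ⟨1, one_pos, hasDerivAt_id t, one_pow 2⟩,
    by simp, by simp, by simp⟩

theorem isProfile_log : IsProfile (Ioi 0) ∅ Real.log (fun y ↦ Real.exp (-y) ^ 2) := by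
  refine ⟨by fun_prop, fun t ht ↦ Real.contDiffAt_log.2 (ne_of_gt ht), fun t ht ↦
    ⟨t⁻¹, inv_pos.2 ht, Real.hasDerivAt_log (ne_of_gt ht), ?_⟩, by simp, by simp, ?_⟩
  · rw [Real.exp_neg, Real.exp_log ht]
  · convert! isClosed_univ
    exact eq_univ_of_forall fun y ↦ ⟨Real.exp y, Or.inl (Real.exp_pos y), Real.log_exp y⟩

theorem isProfile_sq : IsProfile (Ioi 0) {0} (fun t ↦ t ^ 2) (fun y ↦ 4 * y) := by
  refine ⟨by fun_prop, fun t ht ↦ by fun_prop, fun t ht ↦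
    ⟨2 * t, mul_pos two_pos ht, by simpa using hasDerivAt_pow 2 t, by ring⟩, by simp, ?_, ?_⟩
  · rintro e rfl
    exact ⟨1, one_pos, fun x ↦ x, contDiffOn_id, fun t _ ↦ by rw [zero_add]⟩
  · convert! isClosed_Ici (a := (0 : ℝ))
    ext y
    constructor
    · rintro ⟨t, -, rfl⟩
      exact sq_nonneg t
    · intro hy
      refine ⟨√y, ?_, Real.sq_sqrt hy⟩
      rcases (Real.sqrt_nonneg y).eq_or_lt with h | h
      · exact Or.inr h.symm
      · exact Or.inl h

theorem isProfile_tan : IsProfile (Ioo (-(Real.pi / 2)) (Real.pi / 2)) ∅ Real.tan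
    (fun y ↦ (1 + y ^ 2) ^ 2) := by
  refine ⟨by fun_prop, fun t ht ↦ Real.contDiffAt_tan.2 (Real.cos_pos_of_mem_Ioo ht).ne', fun t ht ↦
    ⟨1 / Real.cos t ^ 2, ?_, Real.hasDerivAt_tan (Real.cos_pos_of_mem_Ioo ht).ne', ?_⟩, by simp,
    by simp, ?_⟩
  · have := Real.cos_pos_of_mem_Ioo ht
    positivity
  · have := (Real.cos_pos_of_mem_Ioo ht).ne'
    rw [← Real.inv_one_add_tan_sq this, one_div, inv_inv]
  · convert! isClosed_univ
    exact eq_univ_of_forall fun y ↦ ⟨Real.arctan y,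
      Or.inl ⟨Real.neg_pi_div_two_lt_arctan y, Real.arctan_lt_pi_div_two y⟩, Real.tan_arctan y⟩

theorem isProfile_quotient : IsProfile (Ioo 0 1) {0} (fun t ↦ t ^ 2 / (1 - t ^ 2))
    (fun y ↦ 4 * y * (1 + y) ^ 3) := by
  have hpos : ∀ t ∈ Ioo (0 : ℝ) 1, 0 < 1 - t ^ 2 := fun t ht ↦ by nlinarith [ht.1, ht.2]
  refine ⟨by fun_prop, fun t ht ↦ ?_, fun t ht ↦
    ⟨2 * t / (1 - t ^ 2) ^ 2, ?_, ?_, ?_⟩, by simp, ?_, ?_⟩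
  · exact ContDiffAt.div (by fun_prop) (by fun_prop) (hpos t ht).ne'
  · exact div_pos (mul_pos two_pos ht.1) (pow_pos (hpos t ht) 2)
  · have h1 : HasDerivAt (fun t : ℝ ↦ t ^ 2) (2 * t) t := by simpa using hasDerivAt_pow 2 t
    convert! h1.div (h1.const_sub 1) (hpos t ht).ne' using 1
    ring
  · have := (hpos t ht).ne'
    field_simp
    ring
  · rintro e rfl
    refine ⟨1, one_pos, fun x ↦ x / (1 - x), ContDiffOn.div (by fun_prop) (by fun_prop) ?_,
      fun t _ ↦ by rw [zero_add]⟩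
    intro x hx
    linarith [hx.2]
  · convert! isClosed_Ici (a := (0 : ℝ))
    ext y
    constructor
    · rintro ⟨t, ht | rfl, rfl⟩
      · exact div_nonneg (sq_nonneg t) (hpos t ht).le
      · simp
    · intro hy
      have hy : 0 ≤ y := hy
      have h1 : y / (1 + y) < 1 := (div_lt_one (by linarith)).2 (by linarith)
      have h2 : 0 ≤ y / (1 + y) := by positivity
      refine ⟨√(y / (1 + y)), ?_, ?_⟩
      · rcases h2.eq_or_lt with h | h
        · exact Or.inr (by rw [← h, Real.sqrt_zero]; rfl)
        · exact Or.inl ⟨Real.sqrt_pos.2 h, (Real.sqrt_lt' one_pos).2 (by simpa using h1)⟩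
      · simp only [Real.sq_sqrt h2]
        field_simp
        ring

theorem isProfile_cos : IsProfile (Ioo 0 Real.pi) {0, Real.pi} (fun t ↦ -Real.cos t)
    (fun y ↦ 1 - y ^ 2) := by
  have heven := contDiffOn_comp_sqrt_of_even Real.contDiff_cos Real.cos_neg
  have hcos : ∀ t : ℝ, Real.cos √(t ^ 2) = Real.cos t := fun t ↦ by
    rw [Real.sqrt_sq_eq_abs, Real.cos_abs]
  refine ⟨by fun_prop, fun t ht ↦ Real.contDiff_cos.contDiffAt.neg, fun t ht ↦
    ⟨Real.sin t, Real.sin_pos_of_mem_Ioo ht, by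
      simpa using! (Real.hasDerivAt_cos t).neg, ?_⟩,
    ?_, ?_, ?_⟩
  · rw [neg_sq, Real.sin_sq]
  · rintro e (rfl | rfl) <;> simp
  · rintro e (rfl | rfl)
    · exact ⟨1, one_pos, fun x ↦ -Real.cos √x, (heven.mono Ico_subset_Ici_self).neg, fun t _ ↦ by
        simp only [hcos, zero_add]⟩
    · exact ⟨1, one_pos, fun x ↦ Real.cos √x, heven.mono Ico_subset_Ici_self, fun t _ ↦ by
        simp only [hcos]
        rw [add_comm, Real.cos_add_pi, neg_neg]⟩
  · convert! isClosed_Icc (a := (-1 : ℝ)) (b := 1)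
    have h1 : Ioo 0 Real.pi ∪ {0, Real.pi} = Icc 0 Real.pi := by
      rw [Ioo_union_both Real.pi_pos.le]
    rw [h1]
    ext y
    constructor
    · rintro ⟨t, -, rfl⟩
      constructor <;> linarith [Real.neg_one_le_cos t, Real.cos_le_one t]
    · intro hy
      exact ⟨Real.arccos (-y), ⟨Real.arccos_nonneg _, Real.arccos_le_pi _⟩, by
        simp only [Real.cos_arccos (show -1 ≤ -y by linarith [hy.2]) (by linarith [hy.1]), neg_neg]⟩

/-- Every open interval, with any set of its end points, has a profile. -/
theorem exists_isProfile (hI : IsOpen I) (hIc : I.OrdConnected) (hne : I.Nonempty)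
    (hE : ∀ e ∈ E, e ∉ I ∧ e ∈ closure I) : ∃ F b, IsProfile I E F b := by
  have hpc := hIc.isPreconnected
  have hlow : BddBelow I → ∀ t ∈ I, sInf I < t := by
    intro hb t ht
    obtain ⟨t', ht', hlt⟩ := ((frequently_lt_nhds t).and_eventually (hI.mem_nhds ht)).exists
    exact (csInf_le hb hlt).trans_lt ht'
  have hupp : BddAbove I → ∀ t ∈ I, t < sSup I := by
    intro hb t ht
    obtain ⟨t', ht', hlt⟩ := ((frequently_gt_nhds t).and_eventually (hI.mem_nhds ht)).exists
    exact lt_of_lt_of_le ht' (le_csSup hb hlt)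
  by_cases hb : BddBelow I <;> by_cases ha : BddAbove I
  · obtain ⟨a, b, hab, rfl⟩ : ∃ a b, a < b ∧ I = Ioo a b := by
      obtain ⟨t, ht⟩ := hne
      exact ⟨sInf I, sSup I, (hlow hb t ht).trans (hupp ha t ht),
        Subset.antisymm (fun t ht ↦ ⟨hlow hb t ht, hupp ha t ht⟩)
          (IsConnected.Ioo_csInf_csSup_subset ⟨⟨t, ht⟩, hpc⟩ hb ha)⟩
    have hL : 0 < b - a := sub_pos.2 hab
    have key : ∀ {E₀ : Set ℝ} {F b₀ : ℝ → ℝ}, IsProfile (Ioo 0 1) E₀ F b₀ →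
        (∃ F b₁, IsProfile (Ioo a b) {t | (t - a) / (b - a) ∈ E₀} F b₁) ∧
        ∃ F b₁, IsProfile (Ioo a b) {t | (b - t) / (b - a) ∈ E₀} F b₁ := by
      intro E₀ F b₀ h₀
      constructor
      · have h1 : ∀ t, 1 / (b - a) * t + -a / (b - a) = (t - a) / (b - a) := fun t ↦ by ring
        refine h₀.exists_affine (σ := 1) (κ := 1 / (b - a)) (by norm_num) (by positivity)
          (-a / (b - a)) (fun t ↦ ?_) fun t ↦ by rw [h1]; rfl
        rw [h1, mem_Ioo, mem_Ioo, div_pos_iff_of_pos_right hL, div_lt_one hL,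
          sub_pos, sub_lt_sub_iff_right]
      · have h1 : ∀ t, -(1 / (b - a)) * t + b / (b - a) = (b - t) / (b - a) := fun t ↦ by ring
        refine h₀.exists_affine (σ := -1) (κ := -(1 / (b - a))) (by norm_num)
          (by rw [neg_mul_neg]; positivity) (b / (b - a)) (fun t ↦ ?_) fun t ↦ by rw [h1]; rfl
        rw [h1, mem_Ioo, mem_Ioo, div_pos_iff_of_pos_right hL, div_lt_one hL,
          sub_pos, sub_lt_sub_iff_left, and_comm]
    have hL1 : ∀ t, (t - a) / (b - a) = 0 ↔ t = a := fun t ↦ by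
      rw [div_eq_zero_iff, or_iff_left hL.ne', sub_eq_zero]
    have hL2 : ∀ t, (b - t) / (b - a) = 0 ↔ t = b := fun t ↦ by
      rw [div_eq_zero_iff, or_iff_left hL.ne', sub_eq_zero, eq_comm]
    have hL3 : ∀ t, (t - a) / (b - a) = 1 ↔ t = b := fun t ↦ by
      rw [div_eq_one_iff_eq hL.ne', sub_left_inj]
    have hEab : E ⊆ {a, b} := by
      intro e he
      obtain ⟨h1, h2⟩ := hE e he
      rw [closure_Ioo hab.ne] at h2
      rcases h2.1.eq_or_lt with rfl | h3
      · exact Or.inl rfl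
      · rcases h2.2.eq_or_lt with rfl | h4
        · exact Or.inr rfl
        · exact (h1 ⟨h3, h4⟩).elim
    have htan := isProfile_tan.affine (σ := 1) (κ := Real.pi) (by norm_num)
      (by simpa using Real.pi_pos) (-(Real.pi / 2))
    have hcos := isProfile_cos.affine (σ := 1) (κ := Real.pi) (by norm_num)
      (by simpa using Real.pi_pos) 0
    have hpi := Real.pi_pos
    have hItan : (fun t ↦ Real.pi * t + -(Real.pi / 2)) ⁻¹' Ioo (-(Real.pi / 2)) (Real.pi / 2) =
        Ioo 0 1 := by
      ext t
      constructor <;> rintro ⟨h1, h2⟩ <;> constructor <;> simp only at h1 h2 ⊢ <;> nlinarith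
    have hIcos : (fun t ↦ Real.pi * t + 0) ⁻¹' Ioo 0 Real.pi = Ioo 0 1 := by
      ext t
      constructor <;> rintro ⟨h1, h2⟩ <;> constructor <;> simp only at h1 h2 ⊢ <;> nlinarith
    rw [hItan, preimage_empty] at htan
    rw [hIcos] at hcos
    rcases subset_pair_iff_eq.1 hEab with rfl | rfl | rfl | rfl
    · exact (key htan).1
    · convert (key isProfile_quotient).1 using 5
      ext t
      exact (hL1 t).symm
    · convert (key isProfile_quotient).2 using 5
      ext t
      exact (hL2 t).symm
    · convert (key hcos).1 using 5
      ext t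
      change (t = a ∨ t = b) ↔ (Real.pi * ((t - a) / (b - a)) + 0 = 0 ∨
        Real.pi * ((t - a) / (b - a)) + 0 = Real.pi)
      rw [add_zero, mul_eq_zero, or_iff_right hpi.ne', hL1, mul_eq_left₀ hpi.ne', hL3]
  · obtain ⟨a, rfl⟩ : ∃ a, I = Ioi a :=
      ⟨sInf I, Subset.antisymm (hlow hb) (hpc.Ioi_csInf_subset hb ha)⟩
    have hEa : E ⊆ {a} := by
      intro e he
      obtain ⟨h1, h2⟩ := hE e he
      rw [closure_Ioi] at h2
      exact le_antisymm (not_lt.1 h1) h2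
    rcases subset_singleton_iff_eq.1 hEa with rfl | rfl
    · exact isProfile_log.exists_affine (σ := 1) (κ := 1) (by norm_num) (by norm_num) (-a) (by simp) (by simp)
    · exact isProfile_sq.exists_affine (σ := 1) (κ := 1) (by norm_num) (by norm_num) (-a) (by simp)
        (by simp [add_neg_eq_zero])
  · obtain ⟨b, rfl⟩ : ∃ b, I = Iio b :=
      ⟨sSup I, Subset.antisymm (hupp ha) (hpc.Iio_csSup_subset hb ha)⟩
    have hEb : E ⊆ {b} := by
      intro e he
      obtain ⟨h1, h2⟩ := hE e he
      rw [closure_Iio] at h2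
      exact le_antisymm h2 (not_lt.1 h1)
    rcases subset_singleton_iff_eq.1 hEb with rfl | rfl
    · exact isProfile_log.exists_affine (σ := -1) (κ := -1) (by norm_num) (by norm_num) b (by simp) (by simp)
    · exact isProfile_sq.exists_affine (σ := -1) (κ := -1) (by norm_num) (by norm_num) b (by simp)
        (by simp [neg_add_eq_zero])
  · have huniv := hpc.eq_univ_of_unbounded hb ha
    have hE0 : E = ∅ := by
      rw [eq_empty_iff_forall_notMem]
      intro e he
      exact (hE e he).1 (huniv ▸ mem_univ e)
    rw [huniv, hE0]
    exact ⟨_, _, isProfile_id⟩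

end Profiles

section GlobalFunction

variable {n : ℕ} {G : Type*} [Group G] {N : Type*} [TopologicalSpace N]
  [ChartedSpace (EuclideanSpace ℝ (Fin n)) N] [MulAction G N]
  [RiemannianBundle (fun x : N ↦ TangentSpace (𝓡 n) x)] {U D W : Set N} {r q u : N → ℝ}

variable (n G) in
/-- Near the boundary orbit of `p`, the function `q` is the distance to this orbit up to an isometry
of `ℝ`, and `U` is the complement of this orbit. -/
structure IsCollar (U : Set N) (q : N → ℝ) (p : N) (W : Set N) (u : N → ℝ) (ε σ c : ℝ) : Prop
    extends IsBoundaryCoord n G p W u ε where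
  sq_eq : σ ^ 2 = 1
  notMem : c ∉ q '' U
  mem_of_pos : ∀ y ∈ W, 0 < u y → y ∈ U
  apply_eq : ∀ y ∈ W, q y = σ * √(u y) + c

theorem IsCollar.apply_center {p : N} {ε σ c : ℝ} (h : IsCollar n G U q p W u ε σ c) : q p = c := by
  rw [h.apply_eq p h.mem, h.apply_base, Real.sqrt_zero, mul_zero, zero_add]

theorem IsCollar.continuousAt_apply {p : N} {ε σ c : ℝ} (h : IsCollar n G U q p W u ε σ c) :
    ContinuousAt q p := by
  have h1 : ContinuousAt (fun y ↦ σ * √(u y) + c) p :=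
    (((h.toIsBoundaryCoord.continuousAt h.mem).sqrt).const_mul σ).add_const c
  refine h1.congr ?_
  filter_upwards [h.isOpen.mem_nhds h.mem] with y hy using (h.apply_eq y hy).symm

theorem IsBoundaryCoord.restrict {p : N} {ε δ : ℝ} (h : IsBoundaryCoord n G p W u ε) (hδ : 0 < δ)
    (hδε : δ ≤ ε) : IsBoundaryCoord n G p (W ∩ u ⁻¹' Iio (δ ^ 2)) u δ := by
  have h1 : δ ^ 2 ≤ ε ^ 2 := pow_le_pow_left₀ hδ.le hδε 2
  refine ⟨h.contMDiffOn.continuousOn.isOpen_inter_preimage h.isOpen isOpen_Iio, ?_,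
    ⟨h.mem, by simp only [mem_preimage, h.apply_base, mem_Iio]; positivity⟩, h.apply_base,
    h.contMDiffOn.mono inter_subset_left, fun x hx ↦ h.norm_gradient x hx.1,
    fun x hx y hy ↦ h.levelSets x hx.1 y hy.1, hδ, ?_⟩
  · rintro g x ⟨hx, hxδ⟩
    refine ⟨h.smul_mem g x hx, ?_⟩
    rwa [mem_preimage, h.levelSets.apply_smul h.smul_mem g hx]
  · rw [image_inter_preimage, h.image]
    ext t
    exact ⟨fun ht ↦ ⟨ht.1.1, ht.2⟩, fun ht ↦ ⟨⟨ht.1, ht.2.trans_le h1⟩, ht.2⟩⟩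

theorem IsRegularCoord.congr (h : IsRegularCoord n G U r) (he : ∀ x ∈ U, q x = r x) :
    IsRegularCoord n G U q := by
  refine ⟨h.isOpen, h.smul_mem, h.contMDiffOn.congr he, fun x hx ↦ ?_, fun x hx y hy ↦ ?_, ?_⟩
  · rw [gradientField_congr (g := r), h.norm_gradient x hx]
    filter_upwards [h.isOpen.mem_nhds hx] with y hy using he y hy
  · rw [he x hx, he y hy, h.levelSets x hx y hy]
  · rw [image_congr he]
    exact h.ordConnected

variable [TopologicalSpace G] [CompactSpace G] [ContinuousSMul G N] [T2Space N] [ConnectedSpace N]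
  [IsManifold (𝓡 n) ∞ N]

/-- A unit speed coordinate extends to the boundary orbits in the closure of its domain. -/
theorem IsRegularCoord.exists_extend (h : IsRegularCoord n G U r) :
    ∃ q : N → ℝ, IsRegularCoord n G U q ∧ ∀ p ∈ closure U,
      (∃ W u ε, IsBoundaryCoord n G p W u ε) → ∃ W u ε σ c, IsCollar n G U q p W u ε σ c := by
  have hqU : ∀ x ∈ U, extendFrom U r x = r x := fun x hx ↦
    extendFrom_eq (subset_closure hx) (h.contMDiffAt hx).continuousAt.continuousWithinAt
  refine ⟨extendFrom U r, h.congr hqU, ?_⟩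
  rintro p hp ⟨W, u, ε, hb⟩
  obtain ⟨δ, hδ, σ, c, hσ, hc, hδε, hall⟩ := h.exists_boundary_collar hb hp
  have hr := hb.restrict hδ hδε
  refine ⟨_, u, δ, σ, c, hr, hσ, by rwa [image_congr hqU], fun y hy h0 ↦ (hall y hy.1 h0 hy.2).1,
    fun y hy ↦ ?_⟩
  rcases (hr.nonneg hy).eq_or_lt with h0 | h0
  · have hyp := (hr.mem_orbit_iff hy).2 h0.symm
    refine extendFrom_eq (hb.mem_closure (fun g ↦ continuous_const_smul g) hp h.smul_mem hyp) ?_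
    have h1 : Tendsto (fun z ↦ σ * √(u z) + c) (𝓝 y) (𝓝 (σ * √(u y) + c)) :=
      (((hr.continuousAt hy).tendsto.sqrt).const_mul σ).add_const c
    refine (h1.mono_left nhdsWithin_le_nhds).congr' ?_
    filter_upwards [self_mem_nhdsWithin, nhdsWithin_le_nhds (hr.isOpen.mem_nhds hy)] with z hzU hz
    refine (hall z hz.1 (lt_of_le_of_ne (hr.nonneg hz) fun hz0 ↦ ?_) hz.2).2.symm
    refine h.notMem_of_isBoundaryCoord hb (h.mem_of_mem_orbit hzU ?_)
    rw [← hr.levelSets z hz p hr.mem, hr.apply_base, hz0]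
  · obtain ⟨h1, h2⟩ := hall y hy.1 h0 hy.2
    rw [hqU y h1, h2]

omit [IsManifold (𝓡 n) ∞ N] in
/-- The extension to the boundary orbits still separates the orbits. -/
theorem IsRegularCoord.levelSets_of_collars (h : IsRegularCoord n G U q)
    (hcol : ∀ p ∈ D, p ∉ U → ∃ W u ε σ c, IsCollar n G U q p W u ε σ c) :
    LevelSetsAreOrbits G q D := by
  have hmix : ∀ x ∈ U, ∀ y ∈ D, y ∉ U → q y ≠ q x := by
    intro x hx y hy hyU he
    obtain ⟨W, u, ε, σ, c, hc⟩ := hcol y hy hyU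
    exact hc.notMem ⟨x, hx, by rw [← he, hc.apply_center]⟩
  have hnot : ∀ {x y}, x ∉ U → y ∈ orbit G x → y ∉ U := fun hx hy hyU ↦
    hx (h.mem_of_mem_orbit hyU (mem_orbit_symm.1 hy))
  intro x hx y hy
  by_cases hxU : x ∈ U <;> by_cases hyU : y ∈ U
  · exact h.levelSets x hxU y hyU
  · exact iff_of_false (hmix x hxU y hy hyU) fun ho ↦ hyU (h.mem_of_mem_orbit hxU ho)
  · exact iff_of_false (hmix y hyU x hx hxU).symm fun ho ↦ hnot hxU ho hyU
  obtain ⟨W, u, ε, σ, c, hc⟩ := hcol x hx hxU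
  constructor
  · intro he
    obtain ⟨W', u', ε', σ', c', hc'⟩ := hcol y hy hyU
    obtain rfl : c' = c := by rw [← hc.apply_center, ← he, hc'.apply_center]
    have himage : ∀ {p W u ε σ}, IsCollar n G U q p W u ε σ c' → ∀ t ∈ Ioo 0 ε,
        ∃ z ∈ W, z ∈ U ∧ √(u z) = t ∧ q z = σ * t + c' := by
      intro p W u ε σ hc t ht
      obtain ⟨z, ⟨hz, hz0⟩, hzt⟩ := hc.isRegularCoord.2.symm.subset ht
      exact ⟨z, hz, hc.mem_of_pos z hz hz0, hzt, by rw [hc.apply_eq z hz, ← hzt]⟩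
    have hmin : 0 < min ε ε' := lt_min hc.pos hc'.pos
    obtain rfl : σ = σ' := by
      by_contra hne
      have hsum : σ' = -σ := by
        have h1 : (σ - σ') * (σ + σ') = 0 := by linear_combination hc.sq_eq - hc'.sq_eq
        linarith [(mul_eq_zero.1 h1).resolve_left (sub_ne_zero.2 hne)]
      have h1 : min ε ε' / 2 ∈ Ioo 0 ε := ⟨by linarith, by linarith [min_le_left ε ε']⟩
      have h2 : min ε ε' / 2 ∈ Ioo 0 ε' := ⟨by linarith, by linarith [min_le_right ε ε']⟩
      obtain ⟨z, -, hz, -, hqz⟩ := himage hc _ h1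
      obtain ⟨z', -, hz', -, hqz'⟩ := himage hc' _ h2
      refine hc.notMem (h.ordConnected.uIcc_subset (mem_image_of_mem q hz) (mem_image_of_mem q hz') ?_)
      rw [hqz, hqz', hsum, mem_uIcc]
      rcases le_total 0 (σ * (min ε ε' / 2)) with h3 | h3
      · right; constructor <;> linarith
      · left; constructor <;> linarith
    have hmin2 : 0 < min ε ε' ^ 2 := sq_pos_of_pos hmin
    have hnb := mem_closure_iff_nhdsWithin_neBot.1 (hc.mem_closure_pos hmin2)
    have hself := self_mem_nhdsWithin (a := x) (s := W ∩ {z | 0 < u z ∧ u z < min ε ε' ^ 2})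
    have hlift : ∀ z ∈ W ∩ {z | 0 < u z ∧ u z < min ε ε' ^ 2}, z ∈ W' ∧ u' z = u z := by
      rintro z ⟨hz, hz0, hzε⟩
      obtain ⟨w, hw, hwU, hwt, hqw⟩ := himage hc' (√(u z)) ⟨Real.sqrt_pos.2 hz0,
        ((Real.sqrt_lt' hmin).2 hzε).trans_le (min_le_right _ _)⟩
      have hzw : z ∈ orbit G w :=
        (h.levelSets w hwU z (hc.mem_of_pos z hz hz0)).1 (by rw [hqw, hc.apply_eq z hz])
      obtain ⟨g, rfl⟩ := hzw
      refine ⟨hc'.smul_mem g w hw, ?_⟩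
      have h5 : u' (g • w) = u' w := hc'.levelSets.apply_smul hc'.smul_mem g hw
      exact h5.trans ((Real.sqrt_inj (hc'.nonneg hw) hz0.le).1 hwt)
    have hxy := hc'.mem_orbit_of_tendsto (F := 𝓝[W ∩ {z | 0 < u z ∧ u z < min ε ε' ^ 2}] x)
      nhdsWithin_le_nhds (Filter.mem_of_superset hself fun z hz ↦ (hlift z hz).1) (by
        have h6 : Tendsto u (𝓝[W ∩ {z | 0 < u z ∧ u z < min ε ε' ^ 2}] x) (𝓝 0) :=
          hc.apply_base ▸ (hc.toIsBoundaryCoord.continuousAt hc.mem).tendsto.mono_left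
            nhdsWithin_le_nhds
        refine h6.congr' ?_
        filter_upwards [hself] with z hz using (hlift z hz).2.symm)
    exact mem_orbit_symm.1 hxy
  · rintro ⟨g, rfl⟩
    have h7 := hc.smul_mem g x hc.mem
    have h8 := hc.levelSets.apply_smul hc.smul_mem g hc.mem
    change q (g • x) = q x
    rw [hc.apply_eq _ h7, h8, hc.apply_eq x hc.mem]

end GlobalFunction

section ProfileLemmas

variable {I E : Set ℝ} {F b : ℝ → ℝ}

theorem IsProfile.continuousAt (h : IsProfile I E F b) {t : ℝ} (ht : t ∈ I ∪ E) :
    ContinuousAt F t := by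
  rcases ht with ht | ht
  · exact (h.contDiffAt t ht).continuousAt
  obtain ⟨δ, hδ, H, hH, hF⟩ := h.even t ht
  have h1 : Tendsto (fun s : ℝ ↦ (s - t) ^ 2) (𝓝 t) (𝓝 0) := by
    have : ContinuousAt (fun s : ℝ ↦ (s - t) ^ 2) t := by fun_prop
    simpa using this.tendsto
  have h2 : ∀ᶠ s in 𝓝 t, (s - t) ^ 2 < δ := h1.eventually_lt_const hδ
  have h3 : ContinuousWithinAt H (Ico 0 δ) 0 := hH.continuousOn 0 ⟨le_rfl, hδ⟩
  have h4 := h3.tendsto.comp (tendsto_nhdsWithin_iff.2 ⟨h1, h2.mono fun s hs ↦ ⟨sq_nonneg _, hs⟩⟩)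
  have h5 : F t = H 0 := by simpa using hF 0 (by simpa using hδ)
  rw [ContinuousAt, h5]
  refine h4.congr' (h2.mono fun s hs ↦ ?_)
  rw [Function.comp_apply, ← hF _ hs, add_sub_cancel]

theorem IsProfile.strictMonoOn (h : IsProfile I E F b) (hI : IsOpen I) (hIc : I.OrdConnected)
    (hE : E ⊆ closure I) : StrictMonoOn F (I ∪ E) := by
  have h1 : (I ∪ E).OrdConnected := (hIc.isPreconnected.subset_closure subset_union_left
    (union_subset subset_closure hE)).ordConnected
  refine strictMonoOn_of_deriv_pos (convex_iff_ordConnected.2 h1)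
    (fun t ht ↦ (h.continuousAt ht).continuousWithinAt) fun t ht ↦ ?_
  have h2 : t ∈ I := by
    rcases I.eq_empty_or_nonempty with rfl | hne
    · have := interior_mono (union_subset subset_closure hE) ht
      simp at this
    · rw [← hI.interior_eq, ← (convex_iff_ordConnected.2 hIc).interior_closure_eq_interior_of_nonempty_interior
        (hI.interior_eq.symm ▸ hne)]
      exact interior_mono (union_subset subset_closure hE) ht
  obtain ⟨d, hd, h3, -⟩ := h.hasDerivAt t h2
  rwa [h3.deriv]

end ProfileLemmas

section IsoparametricFunction

variable {n : ℕ} {G : Type*} [Group G] {N : Type*} [TopologicalSpace N]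
  [ChartedSpace (EuclideanSpace ℝ (Fin n)) N] [MulAction G N] [IsManifold (𝓡 n) ∞ N]
  [RiemannianBundle (fun x : N ↦ TangentSpace (𝓡 n) x)] {U D : Set N} {f q : N → ℝ}

/-- A continuous function which separates the orbits, and has an extremum on every orbit on the
boundary of the orbit space, is an open map onto its range. -/
theorem IsRegularCoord.image_mem_nhdsWithin (h : IsRegularCoord n G U q) (hUD : U ⊆ D)
    (hD : IsOpen D) (hcl : D ⊆ closure U) (hf : ContinuousOn f D) (hlev : LevelSetsAreOrbits G f D)
    (hext : ∀ x ∈ D, x ∉ U → (∀ y ∈ D, f x ≤ f y) ∨ ∀ y ∈ D, f y ≤ f x) {x : N} (hx : x ∈ D)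
    {O : Set N} (hO : O ∈ 𝓝 x) : f '' (O ∩ D) ∈ 𝓝[f '' D] (f x) := by
  have := ChartedSpace.locallyConnectedSpace (EuclideanSpace ℝ (Fin n)) N
  obtain ⟨V, hV, hVc, hVO⟩ := locallyConnectedSpace_iff_connected_subsets.1 this x (O ∩ D)
    (inter_mem hO (hD.mem_nhds hx))
  have hJ : (f '' V).OrdConnected := (hVc.image f (hf.mono fun y hy ↦ (hVO hy).2)).ordConnected
  have hxV : f x ∈ f '' V := mem_image_of_mem f (mem_of_mem_nhds hV)
  refine Filter.mem_of_superset ?_ (image_mono hVO)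
  by_cases hxU : x ∈ U
  · obtain ⟨⟨y, hy, hyx⟩, z, hz, hxz⟩ := h.exists_lt_and_gt hxU hD hx hf
      (fun y hy z hz he ↦ (hlev z hz y hy).1 he) hV
    exact nhdsWithin_le_nhds (Filter.mem_of_superset (Ioo_mem_nhds hyx hxz) (Ioo_subset_Icc_self.trans
      (hJ.out (mem_image_of_mem f hy) (mem_image_of_mem f hz))))
  · obtain ⟨y, hyV, hyU⟩ := mem_closure_iff_nhds.1 (hcl hx) V hV
    have hne : f x ≠ f y := fun he ↦
      hxU (h.mem_of_mem_orbit hyU ((hlev y (hUD hyU) x hx).1 he))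
    have hyJ := mem_image_of_mem f hyV
    rcases hext x hx hxU with hmin | hmax
    · have hlt : f x < f y := lt_of_le_of_ne (hmin y (hUD hyU)) hne
      refine mem_nhdsWithin.2 ⟨Iio (f y), isOpen_Iio, hlt, ?_⟩
      rintro _ ⟨ht, z, hz, rfl⟩
      exact hJ.out hxV hyJ ⟨hmin z hz, le_of_lt ht⟩
    · have hlt : f y < f x := lt_of_le_of_ne (hmax y (hUD hyU)) hne.symm
      refine mem_nhdsWithin.2 ⟨Ioi (f y), isOpen_Ioi, hlt, ?_⟩
      rintro _ ⟨ht, z, hz, rfl⟩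
      exact hJ.out hyJ hxV ⟨le_of_lt ht, hmax z hz⟩

/-- A continuous function that is constant on the orbits factors through a function with the
orbits as its level sets. -/
theorem exists_continuous_factor (hf : ∀ x ∈ D, ∀ O ∈ 𝓝 x, f '' (O ∩ D) ∈ 𝓝[f '' D] (f x))
    (hcl : IsClosed (f '' D)) {L : N → ℝ} (hL : ∀ x ∈ D, ContinuousAt L x)
    (hLf : ∀ x ∈ D, ∀ y ∈ D, f x = f y → L x = L y) :
    ∃ a : ℝ → ℝ, Continuous a ∧ ∀ x ∈ D, L x = a (f x) := by
  rcases isEmpty_or_nonempty N with hN | hN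
  · exact ⟨0, continuous_const, fun x ↦ (hN.false x).elim⟩
  have hs : ∀ s, s ∈ f '' D → ∃ x ∈ D, f x = s := fun s h ↦ h
  choose! j hjD hj using hs
  have ha : ∀ x ∈ D, L (j (f x)) = L x := fun x hx ↦
    hLf _ (hjD _ (mem_image_of_mem f hx)) x hx (hj _ (mem_image_of_mem f hx))
  have hc : ContinuousOn (fun s ↦ L (j s)) (f '' D) := by
    rintro _ ⟨x, hx, rfl⟩ V hV
    simp only [ha x hx] at hV
    refine Filter.mem_map.2 (Filter.mem_of_superset (hf x hx _ (hL x hx hV)) ?_)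
    rintro _ ⟨y, ⟨hyV, hyD⟩, rfl⟩
    change L (j (f y)) ∈ V
    rw [ha y hyD]
    exact hyV
  obtain ⟨a, ha'⟩ := ContinuousMap.exists_restrict_eq hcl ⟨_, hc.domRestrict⟩
  refine ⟨a, a.continuous, fun x hx ↦ ?_⟩
  rw [← ha x hx]
  exact (congrArg (fun φ : C(f '' D, ℝ) ↦ φ ⟨f x, mem_image_of_mem f hx⟩) ha').symm

variable [TopologicalSpace G] [CompactSpace G] [ContinuousSMul G N] [T2Space N] [ConnectedSpace N]
  [IsContMDiffRiemannianBundle (𝓡 n) ∞ (EuclideanSpace ℝ (Fin n))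
    (fun x : N ↦ TangentSpace (𝓡 n) x)]

/-- A unit speed coordinate with collars at the boundary orbits can be reparametrized to an
isoparametric function. -/
theorem IsRegularCoord.exists_isIsoparametricOn
    (hG : ∀ g : G, ContMDiff (𝓡 n) (𝓡 n) ∞ (fun y : N ↦ g • y))
    (hiso : ∀ g : G, PreservesMetric (n := n) (fun y : N ↦ g • y))
    (h : IsRegularCoord n G U q) (hne : U.Nonempty) (hUD : U ⊆ D) (hD : IsOpen D)
    (hDG : ∀ (g : G), ∀ x ∈ D, g • x ∈ D) (hcl : D ⊆ closure U)
    (hcol : ∀ p ∈ D, p ∉ U → ∃ W u ε σ c, IsCollar n G U q p W u ε σ c) :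
    ∃ f : N → ℝ, IsIsoparametricOn n f D ∧ LevelSetsAreOrbits G f D ∧
      ∀ x ∈ D, gradientField n f x ≠ 0 ↔ x ∈ U := by
  have hIo := h.isOpen_image
  have hqc : ∀ x ∈ D, ContinuousAt q x := by
    intro x hx
    by_cases hxU : x ∈ U
    · exact (h.contMDiffAt hxU).continuousAt
    · obtain ⟨W, u, ε, σ, c, hc⟩ := hcol x hx hxU
      exact hc.continuousAt_apply
  have hE : ∀ e ∈ q '' (D \ U), e ∉ q '' U ∧ e ∈ closure (q '' U) := by
    rintro _ ⟨x, ⟨hx, hxU⟩, rfl⟩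
    refine ⟨?_, (hqc x hx).continuousWithinAt.mem_closure_image (hcl hx)⟩
    obtain ⟨W, u, ε, σ, c, hc⟩ := hcol x hx hxU
    rw [hc.apply_center]
    exact hc.notMem
  obtain ⟨F, b, hF⟩ := exists_isProfile hIo h.ordConnected (hne.image q) hE
  have hIE : q '' U ∪ q '' (D \ U) = q '' D := by
    rw [← image_union, union_sdiff_cancel hUD]
  have hFm : StrictMonoOn F (q '' D) :=
    hIE ▸ hF.strictMonoOn hIo h.ordConnected fun e he ↦ (hE e he).2
  have hqD : ∀ x ∈ D, q x ∈ q '' D := fun x hx ↦ mem_image_of_mem q hx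
  have hlev : LevelSetsAreOrbits G (fun x ↦ F (q x)) D := by
    intro x hx y hy
    rw [← h.levelSets_of_collars hcol x hx y hy]
    exact hFm.injOn.eq_iff (hqD y hy) (hqD x hx)
  have hsm : ∀ x ∈ D, ContMDiffAt (𝓡 n) 𝓘(ℝ, ℝ) ∞ (fun x ↦ F (q x)) x := by
    intro x hx
    by_cases hxU : x ∈ U
    · exact (hF.contDiffAt _ (mem_image_of_mem q hxU)).contMDiffAt.comp x (h.contMDiffAt hxU)
    obtain ⟨W, u, ε, σ, c, hc⟩ := hcol x hx hxU
    obtain ⟨δ, hδ, H, hH, hFH⟩ := hF.even (q x) ⟨x, ⟨hx, hxU⟩, rfl⟩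
    have h1 : ContMDiffOn (𝓡 n) 𝓘(ℝ, ℝ) ∞ (fun y ↦ H (u y)) (W ∩ u ⁻¹' Iio δ) :=
      hH.contMDiffOn.comp (hc.contMDiffOn.mono inter_subset_left) fun y hy ↦ ⟨hc.nonneg hy.1, hy.2⟩
    have h2 : W ∩ u ⁻¹' Iio δ ∈ 𝓝 x := hc.eventually_lt hδ
    refine (h1.contMDiffAt h2).congr_of_eventuallyEq ?_
    filter_upwards [h2] with y hy
    have h3 : (σ * √(u y)) ^ 2 = u y := by
      rw [mul_pow, hc.sq_eq, one_mul, Real.sq_sqrt (hc.nonneg hy.1)]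
    rw [hc.apply_eq y hy.1, ← hc.apply_center, add_comm, hFH _ (h3.symm ▸ hy.2), h3]
  have hfc : ContinuousOn (fun x ↦ F (q x)) D := fun x hx ↦
    (hsm x hx).continuousAt.continuousWithinAt
  have hgU : ∀ x ∈ U, ∃ d > 0, ‖gradientField n (fun x ↦ F (q x)) x‖ ^ 2 = d ^ 2 ∧
      d ^ 2 = b (F (q x)) := by
    intro x hx
    obtain ⟨d, hd, h1, h2⟩ := hF.hasDerivAt _ (mem_image_of_mem q hx)
    refine ⟨d, hd, ?_, h2⟩
    rw [norm_gradientField_real_comp ((h.contMDiffAt hx).mdifferentiableAt (by simp)) h1,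
      h.norm_gradient x hx, mul_one]
  have hgD : ∀ x ∈ D, ‖gradientField n (fun x ↦ F (q x)) x‖ ^ 2 = b (F (q x)) := by
    intro x hx
    have := mem_closure_iff_nhdsWithin_neBot.1 (hcl hx)
    have h1 := (contMDiffAt_norm_gradientField_sq (hsm x hx)).continuousAt.tendsto.mono_left
      (nhdsWithin_le_nhds (s := U))
    have h2 : Tendsto (fun y ↦ b (F (q y))) (𝓝[U] x) (𝓝 (b (F (q x)))) :=
      (hF.contDiff.continuous.continuousAt.tendsto.comp (hsm x hx).continuousAt.tendsto).mono_left
        nhdsWithin_le_nhds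
    refine tendsto_nhds_unique_of_eventuallyEq h1 h2 ?_
    filter_upwards [self_mem_nhdsWithin] with y hy
    obtain ⟨d, -, h3, h4⟩ := hgU y hy
    exact h3.trans h4
  have hclosed : IsClosed ((fun x ↦ F (q x)) '' D) := by
    have h1 := hF.isClosed
    rwa [hIE, image_image] at h1
  have hext : ∀ x ∈ D, x ∉ U → (∀ y ∈ D, F (q x) ≤ F (q y)) ∨ ∀ y ∈ D, F (q y) ≤ F (q x) := by
    intro x hx hxU
    have hx' : q x ∈ q '' (D \ U) := ⟨x, ⟨hx, hxU⟩, rfl⟩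
    have h1 : (∀ t ∈ q '' U, q x ≤ t) ∨ ∀ t ∈ q '' U, t ≤ q x := by
      by_contra! hcon
      obtain ⟨⟨t, ht, htx⟩, t', ht', htx'⟩ := hcon
      exact (hE _ hx').1 (h.ordConnected.out ht ht' ⟨htx.le, htx'.le⟩)
    have h2 : ∀ y ∈ D, q y ∈ closure (q '' U) := fun y hy ↦
      (hqc y hy).continuousWithinAt.mem_closure_image (hcl hy)
    rcases h1 with h1 | h1
    · exact Or.inl fun y hy ↦ (hFm.le_iff_le (hqD x hx) (hqD y hy)).2
        (closure_minimal h1 isClosed_Ici (h2 y hy))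
    · exact Or.inr fun y hy ↦ (hFm.le_iff_le (hqD y hy) (hqD x hx)).2
        (closure_minimal h1 isClosed_Iic (h2 y hy))
  refine ⟨fun x ↦ F (q x), ⟨⟨fun x hx ↦ (hsm x hx).contMDiffWithinAt, ?_, b, hF.contDiff, hgD⟩, ?_⟩,
    hlev, fun x hx ↦ ?_⟩
  · obtain ⟨x, hx⟩ := hne
    obtain ⟨⟨y, hy, hlt⟩, -⟩ := h.exists_lt_and_gt hx hD (hUD hx) hfc
      (fun y hy z hz he ↦ (hlev z hz y hy).1 he) (hD.mem_nhds (hUD hx))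
    exact ⟨y, hy, x, hUD hx, hlt.ne⟩
  · refine exists_continuous_factor (fun x hx O hO ↦
      h.image_mem_nhdsWithin hUD hD hcl hfc hlev hext hx hO) hclosed
      (fun x hx ↦ continuousAt_laplacian (hsm x hx)) fun x hx y hy he ↦ ?_
    obtain ⟨g, rfl⟩ := (hlev x hx y hy).1 he.symm
    refine ((hiso g).laplacian_eq (hG g) (hsm _ hy) (hsm x hx) ?_).symm
    filter_upwards [hD.mem_nhds hx] with z hz
    exact hlev.apply_smul hDG g hz
  · constructor
    · intro h0
      by_contra hxU
      refine h0 (norm_eq_zero.1 (pow_eq_zero_iff two_ne_zero |>.1 ?_))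
      rw [hgD x hx]
      exact hF.zero _ ⟨x, ⟨hx, hxU⟩, rfl⟩
    · intro hxU h0
      obtain ⟨d, hd, h1, -⟩ := hgU x hxU
      rw [h0, norm_zero] at h1
      nlinarith

end IsoparametricFunction

section Orbits

variable {m n : ℕ} {G : Type*} [TopologicalSpace G] [ChartedSpace (EuclideanSpace ℝ (Fin m)) G]
  [Group G] [LieGroup (𝓡 m) ∞ G] {N : Type*} [TopologicalSpace N]
  [ChartedSpace (EuclideanSpace ℝ (Fin n)) N] [IsManifold (𝓡 n) ∞ N]
  [MulAction G N] [ContMDiffSMul (𝓡 m) (𝓡 n) ∞ G N]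

omit [IsManifold (𝓡 n) ∞ N] in
theorem IsSubmanifoldAt.congr {S S' O : Set N} {p : N} {d : ℕ} (h : IsSubmanifoldAt n S p d)
    (hO : IsOpen O) (hp : p ∈ O) (hS : ∀ q ∈ O, q ∈ S' ↔ q ∈ S) : IsSubmanifoldAt n S' p d := by
  obtain ⟨e, he, hpe, W, hW, hS'⟩ := h
  refine ⟨e.restr O, restr_mem_maximalAtlas _ he hO, ?_, W, hW, fun q hq ↦ ?_⟩
  · rw [e.restr_source' O hO]
    exact ⟨hpe, hp⟩
  · rw [e.restr_source' O hO] at hq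
    rw [hS q hq.2]
    exact hS' q hq.1

omit [IsManifold (𝓡 n) ∞ N] in
/-- The velocities of the one-parameter curves in the group are tangent to the orbit. -/
theorem mfderiv_orbitMap_mem_tangentVectors (x : N) (w : EuclideanSpace ℝ (Fin m)) :
    mfderiv (𝓡 m) (𝓡 n) (fun g : G ↦ g • x) 1 w ∈ tangentVectors n (orbit G x) x := by
  have he := IsManifold.chart_mem_maximalAtlas (I := 𝓡 m) (n := ∞) (1 : G)
  have hed := mdifferentiable_chart (I := 𝓡 m) (1 : G)
  have h1 : (1 : G) ∈ (chartAt (EuclideanSpace ℝ (Fin m)) (1 : G)).source := mem_chart_source _ _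
  set e := chartAt (EuclideanSpace ℝ (Fin m)) (1 : G)
  let w' : EuclideanSpace ℝ (Fin m) := mfderiv (𝓡 m) (𝓡 m) e 1 w
  let l : ℝ → EuclideanSpace ℝ (Fin m) := fun t ↦ e 1 + t • w'
  have hl0 : l 0 = e 1 := by simp [l]
  have hsymm : ContMDiffAt (𝓡 m) (𝓡 m) ∞ e.symm (l 0) :=
    contMDiffAt_symm_of_mem_maximalAtlas he (hl0 ▸ e.map_source h1)
  have hl : ContMDiff 𝓘(ℝ, ℝ) (𝓡 m) ∞ l := by
    rw [contMDiff_iff_contDiff]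
    fun_prop
  have hld : HasMFDerivAt 𝓘(ℝ, ℝ) (𝓡 m) l 0 ((1 : ℝ →L[ℝ] ℝ).smulRight w') := by
    have h2 : HasDerivAt l w' 0 := by
      have h3 := ((hasDerivAt_id (0 : ℝ)).smul_const w').const_add (e 1)
      rwa [one_smul] at h3
    exact h2.hasFDerivAt.hasMFDerivAt
  have hγ0 : e.symm (l 0) = 1 := by rw [hl0, e.left_inv h1]
  have ho := contMDiff_orbitMap m n G x
  have hγd := ((ho.contMDiffAt (x := e.symm (l 0))).mdifferentiableAt (by simp)).hasMFDerivAt.comp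
    (0 : ℝ) ((hsymm.mdifferentiableAt (by simp)).hasMFDerivAt.comp (0 : ℝ) hld)
  refine ⟨fun t ↦ e.symm (l t) • x, by simp only [hγ0, one_smul], ?_,
    Eventually.of_forall fun t ↦ mem_orbit x _, ?_⟩
  · exact ho.contMDiffAt.comp (0 : ℝ) (hsymm.comp (0 : ℝ) hl.contMDiffAt)
  · refine hγd.congr_mfderiv ?_
    ext
    have h3 := DFunLike.congr_fun (hed.symm_comp_deriv h1) w
    have h4 : mfderiv (𝓡 m) (𝓡 m) e.symm (l 0) w' = w := by
      rw [hl0]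
      exact h3
    change mfderiv (𝓡 m) (𝓡 n) (fun g : G ↦ g • x) (e.symm (l 0))
      (mfderiv (𝓡 m) (𝓡 m) e.symm (l 0) ((1 : ℝ) • w')) = (1 : ℝ) • mfderiv (𝓡 m) (𝓡 n) (fun g : G ↦ g • x) 1 w
    rw [one_smul, one_smul, h4, hγ0]

variable [RiemannianBundle (fun x : N ↦ TangentSpace (𝓡 n) x)]
  {U : Set N} {r : N → ℝ}

theorem IsRegularCoord.tangentVectors_orbit (h : IsRegularCoord n G U r) {x : N} (hx : x ∈ U)
    (hdim : orbitDim m n G x + 1 = n) :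
    tangentVectors n (orbit G x) x = {v | mvfderiv (𝓡 n) r x v = 0} := by
  have hsub : tangentVectors n (orbit G x) x ⊆ {v | mvfderiv (𝓡 n) r x v = 0} := by
    rintro v ⟨γ, rfl, -, hγ, hv⟩
    have h1 := hasDerivAt_comp_curve ((h.contMDiffAt hx).mdifferentiableAt (by simp)) hv
    refine h1.unique ((hasDerivAt_const 0 (r (γ 0))).congr_of_eventuallyEq ?_)
    filter_upwards [hγ] with t ht
    exact (h.levelSets _ hx _ (h.mem_of_mem_orbit hx ht)).2 ht
  refine hsub.antisymm fun v hv ↦ ?_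
  let A : EuclideanSpace ℝ (Fin m) →L[ℝ] EuclideanSpace ℝ (Fin n) :=
    mfderiv (𝓡 m) (𝓡 n) (fun g : G ↦ g • x) 1
  let L : EuclideanSpace ℝ (Fin n) →L[ℝ] ℝ := mvfderiv (𝓡 n) r x
  have hL : L ≠ 0 := h.mvfderiv_ne_zero hx
  have hle : A.range ≤ L.ker := by
    rintro _ ⟨w, rfl⟩
    exact hsub (mfderiv_orbitMap_mem_tangentVectors x w)
  have hL' : (L : EuclideanSpace ℝ (Fin n) →ₗ[ℝ] ℝ) ≠ 0 := fun h0 ↦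
    hL (ContinuousLinearMap.coe_injective h0)
  have hker := Module.Dual.finrank_ker_add_one_of_ne_zero hL'
  rw [finrank_euclideanSpace_fin] at hker
  have heq : A.range = L.ker := Submodule.eq_of_le_of_finrank_eq hle (by
    change orbitDim m n G x = Module.finrank ℝ (LinearMap.ker (L : EuclideanSpace ℝ (Fin n) →ₗ[ℝ] ℝ))
    omega)
  have hv' : v ∈ A.range := heq ▸ (show v ∈ L.ker from hv)
  obtain ⟨w, rfl⟩ := hv'
  exact mfderiv_orbitMap_mem_tangentVectors x w

variable [T2Space N] [ConnectedSpace N] [CompactSpace G] [IsContMDiffRiemannianBundle (𝓡 n) ∞ (EuclideanSpace ℝ (Fin n))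
    (fun x : N ↦ TangentSpace (𝓡 n) x)]

/-- A principal orbit is a hypersurface with constant principal curvatures. -/
theorem isHypersurface_and_hasConstantPrincipalCurvatures (hcoh : IsCohomogeneityOne m n G N)
    (hiso : ∀ g : G, PreservesMetric (n := n) (fun y : N ↦ g • y)) {x : N}
    (hx : IsPrincipalPoint G x) : IsHypersurface n (orbit G x) ∧
      HasConstantPrincipalCurvatures n (orbit G x) := by
  have : IsTopologicalGroup G := topologicalGroup_of_lieGroup (𝓡 m) ∞
  rcases exists_coord hcoh hiso x with ⟨U, r, hxU, h⟩ | ⟨hn, -⟩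
  swap
  · exact absurd hx hn
  have hdim : ∀ y ∈ U, orbitDim m n G y + 1 = n := fun y hy ↦
    h.levelSets.orbitDim_eq hcoh.1 h.isOpen h.smul_mem h.contMDiffOn hy (h.mvfderiv_ne_zero hy)
  refine ⟨⟨orbitDim m n G x, hdim x hxU, fun y hy ↦ ?_⟩, ?_⟩
  · have h1 := isSubmanifoldAt_orbit (m := m) (n := n) (G := G) y
    rw [orbit_eq_iff.2 hy] at h1
    have h2 := hdim x hxU
    have h3 := hdim y (h.mem_of_mem_orbit hxU hy)
    rwa [show orbitDim m n G y = orbitDim m n G x by omega] at h1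
  · refine hasConstantPrincipalCurvatures_orbit (contMDiff_smul_left m n) hiso h.isOpen h.smul_mem
      h.contMDiffOn (fun g y hy ↦ h.apply_smul g hy) h.norm_gradient hxU fun y hy ↦ ?_
    rw [← orbit_eq_iff.2 hy]
    have hyU := h.mem_of_mem_orbit hxU hy
    exact h.tangentVectors_orbit hyU (hdim y hyU)

/-- If the orbits that are not principal have codimension at least two, the isoparametric functions
which have the orbits as level sets are proper. -/
theorem hasProperFocalVarieties (hcoh : IsCohomogeneityOne m n G N)
    (hiso : ∀ g : G, PreservesMetric (n := n) (fun y : N ↦ g • y))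
    (hcodim : ∀ x : N, ¬ IsPrincipalPoint G x → orbitDim m n G x + 2 ≤ n) {f : N → ℝ}
    (hU : IsOpen U) (hf : ContinuousOn f U) (hlev : LevelSetsAreOrbits G f U) : HasProperFocalVarieties n f U := by
  have : IsTopologicalGroup G := topologicalGroup_of_lieGroup (𝓡 m) ∞
  rintro p ⟨hp, hext⟩
  have hnp : ¬ IsPrincipalPoint G p := by
    rcases exists_coord hcoh hiso p with ⟨V, s, hpV, h⟩ | ⟨hn, -⟩
    · obtain ⟨⟨y, hy, hyp⟩, z, hz, hpz⟩ := h.exists_lt_and_gt hpV hU hp hf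
        (fun y hy z hz he ↦ (hlev z hz y hy).1 he) (hU.mem_nhds hp)
      rcases hext with hext | hext
      · exact absurd (hext z hz) hpz.not_ge
      · exact absurd (hext y hy) hyp.not_ge
    · exact hn
  refine ⟨orbitDim m n G p, hcodim p hnp, ?_⟩
  have horb : ∀ q ∈ U, f q = f p → q ∈ focalVarieties f U := by
    intro q hq he
    exact ⟨hq, by rwa [he]⟩
  obtain ⟨O, hO, hpO, hOf⟩ : ∃ O, IsOpen O ∧ p ∈ O ∧ ∀ q ∈ O, q ∈ focalVarieties f U →
      f q = f p := by
    by_cases hall : ∀ q ∈ focalVarieties f U, f q = f p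
    · exact ⟨univ, isOpen_univ, mem_univ p, fun q _ hq ↦ hall q hq⟩
    push Not at hall
    obtain ⟨q₀, ⟨hq₀, hext₀⟩, hne⟩ := hall
    refine ⟨U ∩ f ⁻¹' {f q₀}ᶜ, hf.isOpen_inter_preimage hU isOpen_compl_singleton,
      ⟨hp, hne.symm⟩, ?_⟩
    rintro q ⟨hq, hqne⟩ ⟨-, hextq⟩
    have hqne : f q ≠ f q₀ := hqne
    rcases hext with h1 | h1 <;> rcases hext₀ with h2 | h2 <;> rcases hextq with h3 | h3
    · exact le_antisymm (h1 q hq) (h3 p hp)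
    · exact absurd (le_antisymm (h1 q₀ hq₀) (h2 p hp)) hne
    · exact le_antisymm (h1 q hq) (h3 p hp)
    · exact absurd (le_antisymm (h3 q₀ hq₀) (h2 q hq)) hqne
    · exact absurd (le_antisymm (h2 q hq) (h3 q₀ hq₀)) hqne
    · exact le_antisymm (h3 p hp) (h1 q hq)
    · exact absurd (le_antisymm (h2 p hp) (h1 q₀ hq₀)) hne
    · exact le_antisymm (h3 p hp) (h1 q hq)
  refine (isSubmanifoldAt_orbit (m := m) (n := n) (G := G) p).congr (hO.inter hU) ⟨hpO, hp⟩
    fun q hq ↦ ?_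
  rw [← hlev p hp q hq.2]
  exact ⟨fun h ↦ hOf q hq.1 h, horb q hq.2⟩

end Orbits

end

theorem mainTheorem7 (m n : ℕ)
    (N : Type*) [TopologicalSpace N] [ChartedSpace (EuclideanSpace ℝ (Fin n)) N]
    [IsManifold (𝓡 n) ∞ N] [T2Space N] [SecondCountableTopology N] [ConnectedSpace N]
    [RiemannianBundle (fun x : N ↦ TangentSpace (𝓡 n) x)]
    [IsContMDiffRiemannianBundle (𝓡 n) ∞ (EuclideanSpace ℝ (Fin n))
      (fun x : N ↦ TangentSpace (𝓡 n) x)]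
    (G : Type*) [TopologicalSpace G] [ChartedSpace (EuclideanSpace ℝ (Fin m)) G]
    [Group G] [LieGroup (𝓡 m) ∞ G] [T2Space G] [CompactSpace G]
    [MulAction G N] [ContMDiffSMul (𝓡 m) (𝓡 n) ∞ G N]
    (hcoh : IsCohomogeneityOne m n G N) (hinv : IsInvariantMetric n G N) :
    (∀ x : N, IsPrincipalPoint G x →
      IsHypersurface n (MulAction.orbit G x) ∧
      HasConstantPrincipalCurvatures n (MulAction.orbit G x)) ∧
    (¬ Nonempty (MulAction.orbitRel.Quotient G N ≃ₜ Circle) →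
      ∃ f : N → ℝ, IsIsoparametricOn n f univ ∧ LevelSetsAreOrbits G f univ ∧
        ∀ x : N, gradientField n f x ≠ 0 ↔ IsPrincipalPoint G x) ∧
    (Nonempty (MulAction.orbitRel.Quotient G N ≃ₜ Circle) →
      (∀ x : N, IsPrincipalPoint G x) ∧
      ∀ x : N, ∃ f : N → ℝ, IsIsoparametricOn n f (MulAction.orbit G x)ᶜ ∧
        LevelSetsAreOrbits G f (MulAction.orbit G x)ᶜ ∧
        ∀ y ∈ (MulAction.orbit G x)ᶜ, gradientField n f y ≠ 0) ∧
    ((∀ x : N, ¬ IsPrincipalPoint G x → orbitDim m n G x + 2 ≤ n) →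
      ∀ (U : Set N) (f : N → ℝ), IsOpen U → (∀ (g : G), ∀ x ∈ U, g • x ∈ U) →
        IsIsoparametricOn n f U → LevelSetsAreOrbits G f U →
        HasProperFocalVarieties n f U) := by
  have : IsTopologicalGroup G := topologicalGroup_of_lieGroup (𝓡 m) ∞
  have : ContinuousSMul G N := ContMDiffSMul.continuousSMul (I := 𝓡 m) (I' := 𝓡 n) ∞
  have hiso : ∀ g : G, PreservesMetric (n := n) (fun y : N ↦ g • y) := hinv
  have hG : ∀ g : G, ContMDiff (𝓡 n) (𝓡 n) ∞ (fun y : N ↦ g • y) := contMDiff_smul_left m n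
  refine ⟨fun x hx ↦ isHypersurface_and_hasConstantPrincipalCurvatures hcoh hiso hx, fun hQ ↦ ?_,
    ?_, fun hcodim U f hU _ hf hlev ↦
      hasProperFocalVarieties hcoh hiso hcodim hU hf.contMDiffOn.continuousOn hlev⟩
  · obtain ⟨U, r, hr, hdense, hbd⟩ := exists_isRegularCoord_dense hcoh hiso hQ
    obtain ⟨q, hq, hcol⟩ := hr.exists_extend
    obtain ⟨f, hf, hlev, hgrad⟩ := hq.exists_isIsoparametricOn hG hiso hdense.nonempty
      (subset_univ U) isOpen_univ (fun _ _ _ ↦ mem_univ _) (fun p _ ↦ hdense p)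
      fun p _ hp ↦ hcol p (hdense p) (hbd p hp).2
    refine ⟨f, hf, hlev, fun x ↦ (hgrad x (mem_univ x)).trans
      ⟨hq.isPrincipalPoint hG hiso hdense, fun hx ↦ ?_⟩⟩
    by_contra hxU
    exact (hbd x hxU).1 hx
  · rintro ⟨e⟩
    refine ⟨fun x ↦ ?_, fun x ↦ ?_⟩
    · obtain ⟨⟨y, hy⟩, -⟩ := exists_isRegularCoord_compl_orbit hcoh hiso e x
      obtain ⟨-, r, hr⟩ := exists_isRegularCoord_compl_orbit hcoh hiso e y
      refine hr.isPrincipalPoint hG hiso (fun z ↦ mem_closure_iff_nhds.2 fun O hO ↦ ?_)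
        fun hx ↦ hy (MulAction.mem_orbit_symm.1 hx)
      rcases exists_coord hcoh hiso z with ⟨V, s, hzV, h⟩ | ⟨-, W, u, ε, hb⟩
      · obtain ⟨⟨w, ⟨hwO, hwV⟩, hlt⟩, -⟩ := h.exists_lt_and_gt hzV h.isOpen hzV
          h.contMDiffOn.continuousOn (fun y hy z hz he ↦ (h.levelSets z hz y hy).1 he)
          (inter_mem hO (h.isOpen.mem_nhds hzV))
        by_cases hz : z ∈ MulAction.orbit G y
        · refine ⟨w, hwO, fun hw ↦ hlt.ne ((h.levelSets z hzV w hwV).2 ?_)⟩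
          rwa [MulAction.orbit_eq_iff.2 hz]
        · exact ⟨z, mem_of_mem_nhds hO, hz⟩
      · exact (hb.false_of_homeomorph_circle e).elim
    · obtain ⟨hne, r, hr⟩ := exists_isRegularCoord_compl_orbit hcoh hiso e x
      obtain ⟨f, hf, hlev, hgrad⟩ := hr.exists_isIsoparametricOn hG hiso hne subset_rfl
        hr.isOpen hr.smul_mem subset_closure fun p hp hp' ↦ absurd hp hp'
      exact ⟨f, hf, hlev, fun y hy ↦ (hgrad y hy).2 hy⟩
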